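/- Let $N\ge 2$ be an integer and let $R$ be a commutative ring whose characteristic divides $N$. Let $\Gamma$ be an $\mathfrak{sl}(N)$ MOY graph in the plane: an oriented trivalent plane graph (circles without vertices, loops and multiple edges allowed) without sources and sinks, with edge labels in $\{0,\dots,N\}$ such that at each vertex the incoming labels and the outgoing labels have the same sum. Foams $F\colon\emptyset\to\Gamma$ are taken in the piecewise linear category: $F$ is a compact oriented labelled PL $2$-complex embedded in $\mathbb R^2\times(-\infty,0]$ that meets $\mathbb R^2\times 0$ exactly (and transversely) in $\Gamma$. Away from the boundary it is locally a disc, an interval times a trivalent vertex (along the bindings), or the cone on the $1$-skeleton of a tetrahedron (at the singular points). Its facets have labels in $\{0,\dots,N\}$; each binding carries an orientation that agrees with the boundary orientation of exactly two of the three adjacent facets, and the labels of these two add up to the label of the third. A dotted foam $\mathbf F=PF$ has finitely many dots on its facets, a dot on a facet $f$ having a weight $w\in\{1,\dots,\ell(f)\}$. Here $P=\prod_f P_f$, and $P_f$ is the product over the dots on $f$ of the elementary symmetric polynomials $e_w$ in $\ell(f)$ variables $(X_f)_1,\dots,(X_f)_{\ell(f)}$ belonging to $f$. For a closed dotted foam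 $\mathbf F=PF$ the Robert--Wagner evaluation is $$\langle\mathbf F\rangle=\sum_c(-1)^{s(F,c)}\frac{\prod_f P_f(X_{c(f)})}{\prod_{i<j}(X_i-X_j)^{\chi(F_{ij}(c))/2}}\in\mathbb Z[X_1,\dots,X_N],\qquad s(F,c)=\sum_i i\,\frac{\chi(F_i(c))}{2}+\sum_{i<j}\theta^+_{ij}(F,c).$$ The sum is over the colorings $c$, which assign to each facet $f$ a set $c(f)\subset\{1,\dots,N\}$ with $\ell(f)$ elements such that $c(f)\cup c(g)=c(h)$ at each binding with facets $f,g,h$ and $\ell(f)+\ell(g)=\ell(h)$. $F_i(c)$ is the union of the facets $f$ with $i\in c(f)$; $F_{ij}(c)$ is the union of the facets $f$ for which $c(f)$ contains exactly one of $i,j$; and $\theta^+_{ij}(F,c)$ is the number of closed curves formed by the bindings with facets $f,g,h$ such that $i\in c(f)$, $j\in c(g)$, $i,j\in c(h)$ and the cyclic order of the facets around the binding given by the left-hand rule is $f,g,h$. Let $\langle\mathbf F\rangle_R$ be the image of $\langle\mathbf F\rangle$ under $\mathbb Z[X_1,\dots,X_N]\to R$, $X_i\mapsto 0$. Let $\mathscr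 F_N(\Gamma;R)$ be the quotient of the free $R$-module on the dotted foams $\emptyset\to\Gamma$ by the submodule of all $\sum_i a_i\mathbf F_i$ such that $\sum_i a_i\langle\mathbf F_i\cup\overline{\mathbf G}\rangle_R=0$ for every dotted foam $\mathbf G\colon\emptyset\to\Gamma$, where $\overline{\mathbf G}$ is the mirror image of $\mathbf G$ in the plane. For a basepoint on an edge of $\Gamma$ labelled $1$, the weight $1$ basepoint operator on $\mathscr F_N(\Gamma;R)$ adds a dot of weight $1$ to the facet whose boundary contains the basepoint. Let $\nabla$ be the $R$-linear map $PF\mapsto\nabla(P)F$ on the free module on the dotted foams, where $\nabla(P)$ is the sum of all first-order partial derivatives of $P$, and where $QF$ is defined for polynomials $Q$ that are symmetric in the variables of each facet by writing $Q$ as a polynomial in the elementary symmetric polynomials of the facets. Then $\nabla$ descends to an $R$-linear operator $\nabla$ on $\mathscr F_N(\Gamma;R)$. Let $X,Y,Z$ be the weight $1$ basepoint operators of three basepoints lying on edges of $\Gamma$ labelled $1$. Then $Z$ preserves $Y^{N-1}\mathscr F_N(\Gamma;R)$, $Z-Y$ preserves $X^{N-1}\mathscr F_N(\Gamma;R)$,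 and the map $$X^{N-1}\nabla^{N-1}\colon Y^{N-1}\mathscr F_N(\Gamma;R)\to X^{N-1}\mathscr F_N(\Gamma;R)$$ satisfies $$(X^{N-1}\nabla^{N-1})\circ Z=(Z-Y)\circ(X^{N-1}\nabla^{N-1})$$ as maps on $Y^{N-1}\mathscr F_N(\Gamma;R)$. In particular, $(X^{N-1}\nabla^{N-1})\circ X=-Y\circ(X^{N-1}\nabla^{N-1})$ on $Y^{N-1}\mathscr F_N(\Gamma;R)$. -/

import Mathlib

namespace SlFoam

noncomputable section

open scoped Classical

/-! ## Points, oriented labelled triangles, the left-hand rule -/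

/-- Points of `ℝ³`; the plane `ℝ² × 0` is given by the vanishing of the coordinate `2`. -/
abbrev Pt : Type := Fin 3 → ℝ

/-- Mirroring across the plane `ℝ² × 0`. -/
def bar (p : Pt) : Pt := ![p 0, p 1, -p 2]

/-- `triple x y z` is the determinant of three vectors of `ℝ³`, so it is positive exactly when
`(x, y, z)` is a right-handed frame. -/
def triple (x y z : Pt) : ℝ := Matrix.det (Matrix.of ![x, y, z])

/-- Seen from the tip of the arrow `a → b`, the half-planes bounded by the line `ab` through
`u`, `v`, `w` (which have three distinct directions) follow each other counterclockwise in the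
cyclic order `u, v, w`.  Three distinct directions in an oriented plane are in counterclockwise
cyclic order exactly when at least two of the three consecutive determinants are positive. -/
def RightHanded (a b u v w : Pt) : Prop :=
  (0 < triple (b - a) (u - a) (v - a) ∧ 0 < triple (b - a) (v - a) (w - a)) ∨
  (0 < triple (b - a) (v - a) (w - a) ∧ 0 < triple (b - a) (w - a) (u - a)) ∨
  (0 < triple (b - a) (w - a) (u - a) ∧ 0 < triple (b - a) (u - a) (v - a))

/-- The cyclic order of `u, v, w` around the arrow `a → b` given by the left-hand rule is
`u, v, w`. -/
def LeftHanded (a b u v w : Pt) : Prop := RightHanded a b w v u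

/-- An oriented triangle in `ℝ³` with a label.  The orientation is given by the cyclic order of
the vertices `a, b, c`; the edges of the triangle, with the orientation induced on the boundary,
are `a → b`, `b → c`, `c → a`. -/
structure Tri where
  a : Pt
  b : Pt
  c : Pt
  lab : ℕ

/-- The same oriented triangle, written from its second vertex on. -/
def Tri.rot (t : Tri) : Tri := ⟨t.b, t.c, t.a, t.lab⟩

/-- The set of vertices. -/
def Tri.verts (t : Tri) : Set Pt := {t.a, t.b, t.c}

/-- The mirror image of a triangle, with the orientation reversed, so that a triangle with an
edge in `ℝ² × 0` and its mirror image induce opposite orientations on that edge. -/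
def Tri.mirror (t : Tri) : Tri := ⟨bar t.b, bar t.a, bar t.c, t.lab⟩

/-! ## Facets, bindings and the local structure of a triangulated foam

A triangulated, oriented, labelled 2-complex in `ℝ³` is a finite set `K` of oriented labelled
triangles in which every triangle is listed in each of its three rotated forms. -/

/-- The triangles of `K` that have `a → b` as an edge with the induced boundary orientation. -/
def dir (K : Finset Tri) (a b : Pt) : Finset Tri := K.filter fun t => t.a = a ∧ t.b = b

/-- Exactly two triangles meet at the edge `ab`, with coherent orientations: the edge runs
through the inside of a facet. -/
def IsFacetEdge (K : Finset Tri) (a b : Pt) : Prop :=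
  (dir K a b).card = 1 ∧ (dir K b a).card = 1

/-- Exactly three triangles meet at the edge `ab`: the edge lies on a binding. -/
def IsBindingEdge (K : Finset Tri) (a b : Pt) : Prop :=
  (dir K a b).card + (dir K b a).card = 3

/-- The two ways of passing from a triangle to a triangle of the same facet: rewrite it, or cross
an edge at which two triangles meet. -/
def facetRel (K : Finset Tri) (s t : {t : Tri // t ∈ K}) : Prop :=
  t.1 = s.1.rot ∨
  (t.1.a = s.1.b ∧ t.1.b = s.1.a ∧ s.1.lab = t.1.lab ∧ IsFacetEdge K s.1.a s.1.b)

/-- The facets of `K`: the connected components of the complement of the bindings. -/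
def Facet (K : Finset Tri) : Type := Quot (facetRel K)

/-- The facet containing a given triangle. -/
def Facet.of {K : Finset Tri} (t : Tri) (h : t ∈ K) : Facet K := Quot.mk _ ⟨t, h⟩

theorem facetRel.lab_eq {K : Finset Tri} {s t : {t : Tri // t ∈ K}} (h : facetRel K s t) :
    s.1.lab = t.1.lab := by
  rcases h with h | h
  · rw [h]; rfl
  · exact h.2.2.1

/-- The label of a facet. -/
def Facet.lab {K : Finset Tri} : Facet K → ℕ :=
  Quot.lift (fun t => t.1.lab) fun _ _ h => h.lab_eq

instance (K : Finset Tri) : Finite (Facet K) := Quot.finite _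

instance (K : Finset Tri) : Fintype (Facet K) := Fintype.ofFinite _

/-- Passing from one triangle at the vertex `v` to the next one without crossing a binding. -/
def sectorRel (K : Finset Tri) (v : Pt) (s t : {t : Tri // t ∈ K ∧ t.a = v}) : Prop :=
  s.1.c = t.1.b ∧ IsFacetEdge K v s.1.c

/-- The sectors at `v`: the local pieces into which the bindings cut `K` near `v`.  They are the
components of the link of `v` after the removal of its trivalent points. -/
def Sector (K : Finset Tri) (v : Pt) : Type := Quot (sectorRel K v)

/-- A triangle with vertices `v, w, u` belongs to the sector `σ`, so that the sector leaves the
edge `vw` in the direction of `u`. -/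
def Wing (K : Finset Tri) (v w : Pt) (σ : Sector K v) (u : Pt) : Prop :=
  ∃ t : {t : Tri // t ∈ K ∧ t.a = v}, Quot.mk _ t = σ ∧
    ((t.1.b = w ∧ t.1.c = u) ∨ (t.1.c = w ∧ t.1.b = u))

/-- The edge `vw` is an edge of the sector. -/
def Touches (K : Finset Tri) (v : Pt) (σ : Sector K v) (w : Pt) : Prop := ∃ u, Wing K v w σ u

/-- The other endpoints of the binding edges at `v`. -/
def branch (K : Finset Tri) (v : Pt) : Set Pt := {w | IsBindingEdge K v w}

/-- `v` lies inside a facet: its link is a circle. -/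
def IsFacetPoint (K : Finset Tri) (v : Pt) : Prop :=
  branch K v = ∅ ∧ Nat.card (Sector K v) = 1

/-- `v` lies inside a binding, near which `K` looks like an interval times a trivalent vertex of
a planar graph: the link of `v` is a theta graph, and the two branch points of the theta see its
three arcs in opposite cyclic orders. -/
def IsBindingPoint (K : Finset Tri) (v : Pt) : Prop :=
  ∃ w x : Pt, w ≠ x ∧ branch K v = {w, x} ∧ Nat.card (Sector K v) = 3 ∧
    (∀ σ : Sector K v, Touches K v σ w ∧ Touches K v σ x) ∧
    ∀ α β γ : Sector K v, α ≠ β → β ≠ γ → γ ≠ α → ∀ a b c a' b' c' : Pt,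
      Wing K v w α a → Wing K v w β b → Wing K v w γ c →
      Wing K v x α a' → Wing K v x β b' → Wing K v x γ c' →
      (RightHanded v w a b c ↔ RightHanded v x a' c' b')

/-- `v` is a singular point, near which `K` looks like the cone on the 1-skeleton of a
tetrahedron: the link of `v` is a complete graph on four branch points, and the cyclic orders
of the arcs at the branch points are those of the tetrahedron. -/
def IsSingularPoint (K : Finset Tri) (v : Pt) : Prop :=
  (branch K v).ncard = 4 ∧ Nat.card (Sector K v) = 6 ∧
    (∀ w ∈ branch K v, ∀ x ∈ branch K v, w ≠ x →
      ∃ σ : Sector K v, Touches K v σ w ∧ Touches K v σ x) ∧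
    ∀ w ∈ branch K v, ∀ x ∈ branch K v, ∀ y ∈ branch K v, ∀ z ∈ branch K v,
      w ≠ x → w ≠ y → w ≠ z → x ≠ y → x ≠ z → y ≠ z →
      ∀ wx wy wz xz xy : Sector K v, ∀ a b c a' b' c' : Pt,
        Wing K v w wx a → Wing K v w wy b → Touches K v wy y →
        Wing K v w wz c → Touches K v wz z →
        Wing K v x wx a' → Wing K v x xz b' → Touches K v xz z →
        Wing K v x xy c' → Touches K v xy y →
        (RightHanded v w a b c ↔ RightHanded v x a' b' c')

/-! ## MOY graphs -/

/-- An oriented labelled segment. -/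
structure Seg where
  src : Pt
  tgt : Pt
  lab : ℕ

/-- An `sl(N)` MOY graph in the plane `ℝ² × 0`, drawn with polygonal edges.  It is given by its
oriented labelled straight segments, which meet only in common endpoints.  At an endpoint either
two segments meet (a point inside an edge, or on a circle without vertices) or three (a vertex of
the graph).  Labels are in `{0, …, N}`; there are no sources and no sinks, and the labels of the
incoming segments add up to those of the outgoing ones. -/
structure MOYGraph (N : ℕ) where
  seg : Finset Seg
  src_plane : ∀ e ∈ seg, e.src 2 = 0
  tgt_plane : ∀ e ∈ seg, e.tgt 2 = 0
  ne : ∀ e ∈ seg, e.src ≠ e.tgt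
  lab_le : ∀ e ∈ seg, e.lab ≤ N
  embedded : ∀ e ∈ seg, ∀ e' ∈ seg, e ≠ e' →
    segment ℝ e.src e.tgt ∩ segment ℝ e'.src e'.tgt ⊆
      ({e.src, e.tgt} ∩ {e'.src, e'.tgt} : Set Pt)
  no_source : ∀ e ∈ seg, ∃ e' ∈ seg, e'.tgt = e.src
  no_sink : ∀ e ∈ seg, ∃ e' ∈ seg, e'.src = e.tgt
  trivalent : ∀ v : Pt,
    (seg.filter fun e => e.tgt = v).card + (seg.filter fun e => e.src = v).card ≤ 3
  flow : ∀ v : Pt,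
    ∑ e ∈ seg.filter (fun e => e.tgt = v), e.lab = ∑ e ∈ seg.filter (fun e => e.src = v), e.lab

variable {N : ℕ}

/-- The number of segments that meet at a point. -/
def MOYGraph.valence (Γ : MOYGraph N) (v : Pt) : ℕ :=
  (Γ.seg.filter fun e => e.tgt = v).card + (Γ.seg.filter fun e => e.src = v).card

/-- A basepoint: a point inside an edge of the graph, that is, a point on some segment which is
not a trivalent vertex; the segment is recorded. -/
structure Basepoint (Γ : MOYGraph N) where
  pt : Pt
  seg : Seg
  seg_mem : seg ∈ Γ.seg
  pt_mem : pt ∈ segment ℝ seg.src seg.tgt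
  not_vertex : Γ.valence pt ≠ 3

/-- The label of the edge on which the basepoint lies. -/
def Basepoint.lab {Γ : MOYGraph N} (p : Basepoint Γ) : ℕ := p.seg.lab

/-! ## Foams bounding a MOY graph -/

/-- The end of a segment at `v` which is not `v`. -/
def Seg.other (e : Seg) (v : Pt) : Pt := if e.src = v then e.tgt else e.src

/-- Local structure at a point `v` of the boundary graph.  Either two segments meet at `v` and the
link of `v` is an arc (`v` lies on the boundary of one facet), or three segments meet and the link
is a tripod ending in the three segments (`v` is the end of a binding); then the cyclic order of
the three facets around the binding, seen along the binding from `v`, is the cyclic order of the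
segments seen from below the plane. -/
def IsBoundaryPoint (Γ : MOYGraph N) (K : Finset Tri) (v : Pt) : Prop :=
  (Γ.valence v = 2 ∧ branch K v = ∅ ∧ Nat.card (Sector K v) = 1) ∨
  (Γ.valence v = 3 ∧ ∃ w : Pt, branch K v = {w} ∧ Nat.card (Sector K v) = 3 ∧
    (∀ σ : Sector K v, Touches K v σ w) ∧
    ∀ α β γ : Sector K v, α ≠ β → β ≠ γ → γ ≠ α → ∀ a b c : Pt,
      Wing K v w α a → Wing K v w β b → Wing K v w γ c →
      ∀ e ∈ Γ.seg, ∀ f ∈ Γ.seg, ∀ g ∈ Γ.seg,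
        (e.src = v ∨ e.tgt = v) → (f.src = v ∨ f.tgt = v) → (g.src = v ∨ g.tgt = v) →
        Touches K v α (e.other v) → Touches K v β (f.other v) → Touches K v γ (g.other v) →
        (RightHanded v w a b c ↔
          RightHanded v (v - ![0, 0, 1]) (e.other v) (f.other v) (g.other v)))

/-- A (triangulated, piecewise linear) `sl(N)` foam `∅ → Γ`, embedded in the half-space
`ℝ² × (-∞, 0]` and meeting the plane `ℝ² × 0` exactly in `Γ`. -/
structure Foam (Γ : MOYGraph N) where
  /-- the oriented labelled triangles, each in its three rotated forms -/
  tri : Finset Tri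
  rot_mem : ∀ t ∈ tri, t.rot ∈ tri
  lab_le : ∀ t ∈ tri, t.lab ≤ N
  nondegenerate : ∀ t ∈ tri, AffineIndependent ℝ ![t.a, t.b, t.c]
  /-- every triangle has one orientation and one label -/
  oriented : ∀ s ∈ tri, ∀ t ∈ tri, s.verts = t.verts → t = s ∨ t = s.rot ∨ t = s.rot.rot
  /-- two triangles meet at most in a common face -/
  embedded : ∀ s ∈ tri, ∀ t ∈ tri,
    convexHull ℝ s.verts ∩ convexHull ℝ t.verts ⊆ convexHull ℝ (s.verts ∩ t.verts)
  below : ∀ t ∈ tri, t.a 2 ≤ 0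
  /-- the foam meets the plane in `Γ` only: no triangle lies in the plane, -/
  not_flat : ∀ t ∈ tri, ¬ (t.a 2 = 0 ∧ t.b 2 = 0 ∧ t.c 2 = 0)
  /-- an edge that lies in the plane is a segment of `Γ` with the induced orientation, -/
  edge_plane : ∀ t ∈ tri, t.a 2 = 0 → t.b 2 = 0 → ∃ e ∈ Γ.seg, e.src = t.a ∧ e.tgt = t.b
  /-- and a vertex that lies in the plane lies on `Γ` -/
  vertex_plane : ∀ t ∈ tri, t.a 2 = 0 → ∃ e ∈ Γ.seg, e.src = t.a ∨ e.tgt = t.a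
  /-- each segment of `Γ` is an edge of exactly one triangle, which has the same label -/
  boundary : ∀ e ∈ Γ.seg,
    (∃ t ∈ tri, t.lab = e.lab ∧ dir tri e.src e.tgt = {t}) ∧ dir tri e.tgt e.src = ∅
  /-- every other edge is inside a facet, or is a binding edge whose orientation agrees with those
  of two of the three facets; the labels of these two add up to the third -/
  edge : ∀ t ∈ tri, ¬ (t.a 2 = 0 ∧ t.b 2 = 0) →
    (dir tri t.b t.a).Nonempty ∧ (dir tri t.a t.b).card + (dir tri t.b t.a).card ≤ 3 ∧
    ∑ s ∈ dir tri t.a t.b, s.lab = ∑ s ∈ dir tri t.b t.a, s.lab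
  vertex : ∀ t ∈ tri, t.a 2 < 0 →
    IsFacetPoint tri t.a ∨ IsBindingPoint tri t.a ∨ IsSingularPoint tri t.a
  boundary_vertex : ∀ t ∈ tri, t.a 2 = 0 → IsBoundaryPoint Γ tri t.a

/-- The triangle of a foam at a segment of the boundary. -/
def Foam.triAt {Γ : MOYGraph N} (F : Foam Γ) (p : Basepoint Γ) : Tri :=
  (F.boundary p.seg p.seg_mem).1.choose

theorem Foam.triAt_mem {Γ : MOYGraph N} (F : Foam Γ) (p : Basepoint Γ) : F.triAt p ∈ F.tri :=
  (F.boundary p.seg p.seg_mem).1.choose_spec.1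

theorem Foam.triAt_lab {Γ : MOYGraph N} (F : Foam Γ) (p : Basepoint Γ) :
    (F.triAt p).lab = p.lab :=
  (F.boundary p.seg p.seg_mem).1.choose_spec.2.1

theorem Foam.triAt_dir {Γ : MOYGraph N} (F : Foam Γ) (p : Basepoint Γ) :
    dir F.tri p.seg.src p.seg.tgt = {F.triAt p} :=
  (F.boundary p.seg p.seg_mem).1.choose_spec.2.2

/-- The facet whose boundary contains the basepoint. -/
def Foam.facetAt {Γ : MOYGraph N} (F : Foam Γ) (p : Basepoint Γ) : Facet F.tri :=
  Facet.of (F.triAt p) (F.triAt_mem p)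

theorem Foam.facetAt_lab {Γ : MOYGraph N} (F : Foam Γ) (p : Basepoint Γ) :
    (F.facetAt p).lab = p.lab := F.triAt_lab p

/-! ## Dots -/

/-- The kinds of dots on `K`: the pair `⟨f, w⟩` stands for a dot of weight `w + 1` on `f`, so the
weights of the dots on `f` are `1, …, ℓ(f)`. -/
abbrev Dot (K : Finset Tri) : Type := Σ f : Facet K, Fin f.lab

/-- The variables `(X_f)_1, …, (X_f)_{ℓ(f)}` for the facets `f`. -/
abbrev Var (K : Finset Tri) : Type := Σ f : Facet K, Fin f.lab

/-- A set of dots, given by the number of dots of each weight on each facet. -/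
abbrev Dots (K : Finset Tri) : Type := Dot K →₀ ℕ

/-- A dotted foam `∅ → Γ`. -/
abbrev DottedFoam (Γ : MOYGraph N) : Type := Σ F : Foam Γ, Dots F.tri

/-! ## The Robert-Wagner evaluation -/

/-- A coloring, by the pigments `Fin N`, of the facets of a closed foam `K`.  At a binding edge
`s.a → s.b` the triangles `s ≠ t` inducing this orientation belong to the two facets whose labels
add up to the label of the third. -/
structure IsColoring (N : ℕ) (K : Finset Tri) (c : Facet K → Finset (Fin N)) : Prop where
  card : ∀ f, (c f).card = f.lab
  binding : ∀ (s t u : Tri) (hs : s ∈ K) (ht : t ∈ K) (hu : u ∈ K), s ≠ t →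
    t.a = s.a → t.b = s.b → u.a = s.b → u.b = s.a →
    c (.of s hs) ∪ c (.of t ht) = c (.of u hu)

/-- The set of pigments on a triangle. -/
def col {K : Finset Tri} (c : Facet K → Finset (Fin N)) (t : Tri) : Finset (Fin N) :=
  if h : t ∈ K then c (.of t h) else ∅

/-- The Euler characteristic (vertices minus edges plus triangles) of the union of a set of
triangles, each listed in its three rotated forms. -/
def chi (S : Finset Tri) : ℤ :=
  ((S.image Tri.a).card : ℤ) - ((S.image fun t => s(t.a, t.b)).card : ℤ) + (S.card : ℤ) / 3

/-- The monochrome surface `F_i(c)`. -/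
def mono {K : Finset Tri} (c : Facet K → Finset (Fin N)) (i : Fin N) : Finset Tri :=
  K.filter fun t => i ∈ col c t

/-- The bichrome surface `F_ij(c)`. -/
def bichrome {K : Finset Tri} (c : Facet K → Finset (Fin N)) (i j : Fin N) : Finset Tri :=
  K.filter fun t => Xor (i ∈ col c t) (j ∈ col c t)

/-- The oriented edge `e` lies on a binding that is positive with respect to `i < j`. -/
def IsPositive {K : Finset Tri} (c : Facet K → Finset (Fin N)) (i j : Fin N) (e : Pt × Pt) :
    Prop :=
  ∃ f ∈ dir K e.1 e.2, ∃ g ∈ dir K e.1 e.2, ∃ h ∈ dir K e.2 e.1, f ≠ g ∧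
    i ∈ col c f ∧ j ∈ col c g ∧ i ∈ col c h ∧ j ∈ col c h ∧ LeftHanded e.1 e.2 f.c g.c h.c

/-- The number of connected components of the union of the positive bindings, which is the number
of positive simple closed curves. -/
def thetaPos {K : Finset Tri} (c : Facet K → Finset (Fin N)) (i j : Fin N) : ℕ :=
  Nat.card (Quot fun e e' : {e : Pt × Pt // IsPositive c i j e} =>
    e.1.1 = e'.1.1 ∨ e.1.1 = e'.1.2 ∨ e.1.2 = e'.1.1 ∨ e.1.2 = e'.1.2)

/-- The pairs of pigments `i < j`. -/
def pigmentPairs (N : ℕ) : Finset (Fin N × Fin N) := Finset.univ.filter fun p => p.1 < p.2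

/-- The exponent `s(F, c)`; the pigment `i : Fin N` has the number `i + 1`. -/
def signExp {K : Finset Tri} (c : Facet K → Finset (Fin N)) : ℤ :=
  ∑ i : Fin N, ((i : ℤ) + 1) * (chi (mono c i) / 2) +
    ∑ p ∈ pigmentPairs N, (thetaPos c p.1 p.2 : ℤ)

/-- The field `ℚ(X_1, …, X_N)`. -/
abbrev Rat (N : ℕ) : Type := FractionRing (MvPolynomial (Fin N) ℤ)

/-- The indeterminate `X_i` as a rational function. -/
def ratX (i : Fin N) : Rat N := algebraMap (MvPolynomial (Fin N) ℤ) (Rat N) (MvPolynomial.X i)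

/-- The rational function `Q(F, c)`. -/
def qFactor {K : Finset Tri} (c : Facet K → Finset (Fin N)) : Rat N :=
  ∏ p ∈ pigmentPairs N, (ratX p.1 - ratX p.2) ^ (chi (bichrome c p.1 p.2) / 2)

/-- The elementary symmetric polynomial of degree `w` in the variables `X_i`, `i ∈ A`. -/
def esymmOn (A : Finset (Fin N)) (w : ℕ) : MvPolynomial (Fin N) ℤ :=
  ∑ s ∈ A.powersetCard w, ∏ i ∈ s, MvPolynomial.X i

/-- The polynomial `P(F, c)` of a dotted foam. -/
def dotFactor {K : Finset Tri} (d : Dots K) (c : Facet K → Finset (Fin N)) :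
    MvPolynomial (Fin N) ℤ :=
  d.prod fun x k => esymmOn (c x.1) (x.2 + 1) ^ k

/-- The sum over all colorings of `(-1)^{s(F,c)} P(F,c) / Q(F,c)`, a rational function. -/
def evalRat (N : ℕ) (K : Finset Tri) (d : Dots K) : Rat N :=
  ∑ c ∈ Finset.univ.filter (fun c : Facet K → Finset (Fin N) => IsColoring N K c),
    (-1) ^ signExp c * algebraMap (MvPolynomial (Fin N) ℤ) (Rat N) (dotFactor d c) / qFactor c

/-- The Robert-Wagner evaluation of a closed dotted foam: the integral polynomial which equals
the rational function above. -/
def evalPoly (N : ℕ) (K : Finset Tri) (d : Dots K) : MvPolynomial (Fin N) ℤ :=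
  if h : ∃ P : MvPolynomial (Fin N) ℤ,
      algebraMap (MvPolynomial (Fin N) ℤ) (Rat N) P = evalRat N K d
  then h.choose else 0

/-- Its image in `R` under `X_i ↦ 0`. -/
def evalR (R : Type*) [CommRing R] (N : ℕ) (K : Finset Tri) (d : Dots K) : R :=
  MvPolynomial.aeval (fun _ => (0 : R)) (evalPoly N K d)

/-! ## Gluing a foam to the mirror image of another one -/

/-- The closed foam obtained by gluing `F` and the mirror image of `G` along `Γ`. -/
def glue {Γ : MOYGraph N} (F G : Foam Γ) : Finset Tri := F.tri ∪ G.tri.image Tri.mirror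

@[simp] theorem bar_bar (p : Pt) : bar (bar p) = p := by
  ext i; fin_cases i <;> simp [bar]

theorem bar_two (p : Pt) : bar p 2 = -p 2 := by simp [bar]

theorem bar_eq_self {p : Pt} (h : p 2 = 0) : bar p = p := by
  ext i; fin_cases i <;> simp [bar, h]

@[simp] theorem mirror_mirror (t : Tri) : t.mirror.mirror = t := by
  cases t; simp [Tri.mirror]

theorem mem_dir {K : Finset Tri} {a b : Pt} {t : Tri} :
    t ∈ dir K a b ↔ t ∈ K ∧ t.a = a ∧ t.b = b := by simp [dir]

theorem mem_glue {Γ : MOYGraph N} {F G : Foam Γ} {t : Tri} :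
    t ∈ glue F G ↔ t ∈ F.tri ∨ t.mirror ∈ G.tri := by
  simp only [glue, Finset.mem_union, Finset.mem_image]
  refine or_congr Iff.rfl ⟨?_, fun h => ⟨_, h, mirror_mirror t⟩⟩
  rintro ⟨s, hs, rfl⟩
  simpa using hs

theorem Foam.below_b {Γ : MOYGraph N} (F : Foam Γ) {t : Tri} (h : t ∈ F.tri) : t.b 2 ≤ 0 :=
  F.below _ (F.rot_mem _ h)

/-- An edge of a foam at which two of its triangles meet does not lie in the plane. -/
theorem Foam.not_plane {Γ : MOYGraph N} (F : Foam Γ) {a b : Pt} (h : IsFacetEdge F.tri a b) :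
    ¬ (a 2 = 0 ∧ b 2 = 0) := by
  rintro ⟨ha, hb⟩
  obtain ⟨t, ht⟩ := Finset.card_eq_one.1 h.1
  have ht' : t ∈ dir F.tri a b := by simp [ht]
  obtain ⟨htm, rfl, rfl⟩ := mem_dir.1 ht'
  obtain ⟨e, he, h1, h2⟩ := F.edge_plane t htm ha hb
  have := (F.boundary e he).2
  rw [h1, h2] at this
  simp [IsFacetEdge, this] at h

theorem glue_dir_left {Γ : MOYGraph N} (F G : Foam Γ) {a b : Pt} (ha : a 2 ≤ 0) (hb : b 2 ≤ 0)
    (h : ¬ (a 2 = 0 ∧ b 2 = 0)) : dir (glue F G) a b = dir F.tri a b := by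
  ext t
  simp only [mem_dir, mem_glue]
  refine ⟨?_, fun h => ⟨Or.inl h.1, h.2⟩⟩
  rintro ⟨h1 | h1, rfl, rfl⟩
  · exact ⟨h1, rfl, rfl⟩
  · exfalso
    have e1 := G.below _ h1
    have e2 := G.below_b h1
    simp only [Tri.mirror, bar_two] at e1 e2
    exact h ⟨by linarith, by linarith⟩

theorem glue_dir_right {Γ : MOYGraph N} (F G : Foam Γ) {a b : Pt} (ha : a 2 ≤ 0) (hb : b 2 ≤ 0)
    (h : ¬ (a 2 = 0 ∧ b 2 = 0)) :
    dir (glue F G) (bar b) (bar a) = (dir G.tri a b).image Tri.mirror := by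
  ext t
  simp only [mem_dir, mem_glue, Finset.mem_image]
  constructor
  · rintro ⟨h1 | h1, h2, h3⟩
    · exfalso
      have e1 := F.below _ h1
      have e2 := F.below_b h1
      rw [h2, bar_two] at e1
      rw [h3, bar_two] at e2
      exact h ⟨by linarith, by linarith⟩
    · exact ⟨_, ⟨h1, by simp [Tri.mirror, h3], by simp [Tri.mirror, h2]⟩, mirror_mirror t⟩
  · rintro ⟨s, ⟨h1, rfl, rfl⟩, rfl⟩
    exact ⟨Or.inr (by simpa using h1), rfl, rfl⟩

theorem mirror_injective : Function.Injective Tri.mirror :=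
  Function.LeftInverse.injective mirror_mirror

/-- The facet of the glued foam which contains a given facet of `F`. -/
def inclLeft {Γ : MOYGraph N} (F G : Foam Γ) : Facet F.tri → Facet (glue F G) :=
  Quot.map (fun t => ⟨t.1, mem_glue.2 (Or.inl t.2)⟩) <| by
    rintro ⟨s, hs⟩ ⟨t, ht⟩ (h | ⟨h1, h2, h3, h4⟩)
    · exact Or.inl h
    · refine Or.inr ⟨h1, h2, h3, ?_⟩
      have hp := F.not_plane h4
      have ha := F.below _ hs
      have hb := F.below_b hs
      refine ⟨?_, ?_⟩
      · rw [glue_dir_left F G ha hb hp]; exact h4.1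
      · rw [glue_dir_left F G hb ha (fun h => hp h.symm)]; exact h4.2

/-- The facet of the glued foam which contains the mirror image of a given facet of `G`. -/
def inclRight {Γ : MOYGraph N} (F G : Foam Γ) : Facet G.tri → Facet (glue F G) :=
  Quot.lift
    (fun t => Facet.of t.1.mirror (mem_glue.2 (Or.inr (by simp [t.2])))) <| by
    rintro ⟨s, hs⟩ ⟨t, ht⟩ (h | ⟨h1, h2, h3, h4⟩)
    · simp only at h
      subst h
      refine (Quot.sound (r := facetRel (glue F G)) (Or.inl ?_)).symm
      rfl
    · simp only at h1 h2 h3 h4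
      refine Quot.sound (r := facetRel (glue F G))
        (Or.inr ⟨by simp [Tri.mirror, h2], by simp [Tri.mirror, h1], h3, ?_⟩)
      have hp := G.not_plane h4
      have ha := G.below _ hs
      have hb := G.below_b hs
      refine ⟨?_, ?_⟩
      · exact (congrArg Finset.card (glue_dir_right F G ha hb hp)).trans
          ((Finset.card_image_of_injective _ mirror_injective).trans h4.1)
      · exact (congrArg Finset.card (glue_dir_right F G hb ha (fun h => hp h.symm))).trans
          ((Finset.card_image_of_injective _ mirror_injective).trans h4.2)

theorem inclLeft_lab {Γ : MOYGraph N} (F G : Foam Γ) (f : Facet F.tri) :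
    (inclLeft F G f).lab = f.lab := by
  induction f using Quot.ind; rfl

theorem inclRight_lab {Γ : MOYGraph N} (F G : Foam Γ) (f : Facet G.tri) :
    (inclRight F G f).lab = f.lab := by
  induction f using Quot.ind; rfl

/-- Dots of `F` as dots of the glued foam. -/
def dotLeft {Γ : MOYGraph N} (F G : Foam Γ) (x : Dot F.tri) : Dot (glue F G) :=
  ⟨inclLeft F G x.1, Fin.cast (inclLeft_lab F G x.1).symm x.2⟩

/-- Dots of `G` as dots of the glued foam. -/
def dotRight {Γ : MOYGraph N} (F G : Foam Γ) (x : Dot G.tri) : Dot (glue F G) :=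
  ⟨inclRight F G x.1, Fin.cast (inclRight_lab F G x.1).symm x.2⟩

/-- The dots of the glued foam: those of `F` together with those of (the mirror image of) `G`. -/
def glueDots {Γ : MOYGraph N} (F G : DottedFoam Γ) : Dots (glue F.1 G.1) :=
  F.2.mapDomain (dotLeft F.1 G.1) + G.2.mapDomain (dotRight F.1 G.1)

/-! ## The universal construction -/

/-- The free `R`-module on the dotted foams `∅ → Γ`. -/
abbrev FoamModule (Γ : MOYGraph N) (R : Type*) [CommRing R] : Type _ := DottedFoam Γ →₀ R

/-- The pairing with a dotted foam `G`: the linear extension of the evaluation of the closed foam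
`F ∪ mirror G`. -/
def pairing {Γ : MOYGraph N} (R : Type*) [CommRing R] (G : DottedFoam Γ) :
    FoamModule Γ R →ₗ[R] R :=
  Finsupp.linearCombination R fun F : DottedFoam Γ => evalR R N (glue F.1 G.1) (glueDots F G)

/-- The kernel of the pairing. -/
def pairingKer (Γ : MOYGraph N) (R : Type*) [CommRing R] : Submodule R (FoamModule Γ R) :=
  ⨅ G : DottedFoam Γ, LinearMap.ker (pairing R G)

/-- The module `F_N(Γ; R)`. -/
abbrev StateSpace (Γ : MOYGraph N) (R : Type*) [CommRing R] : Type _ :=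
  FoamModule Γ R ⧸ pairingKer Γ R

/-! ## Basepoint operators -/

/-- The dot of weight `w + 1` on the facet at the basepoint. -/
def dotAt {Γ : MOYGraph N} (F : Foam Γ) (p : Basepoint Γ) (w : Fin p.lab) : Dot F.tri :=
  ⟨F.facetAt p, Fin.cast (F.facetAt_lab p).symm w⟩

/-- Adding a dot of weight `w + 1` on the facet whose boundary contains the basepoint. -/
def addDot {Γ : MOYGraph N} (p : Basepoint Γ) (w : Fin p.lab) (F : DottedFoam Γ) :
    DottedFoam Γ :=
  ⟨F.1, F.2 + Finsupp.single (dotAt F.1 p w) 1⟩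

/-- The two facets at a basepoint become one after gluing. -/
theorem incl_facetAt {Γ : MOYGraph N} (F G : Foam Γ) (p : Basepoint Γ) :
    inclLeft F G (F.facetAt p) = inclRight F G (G.facetAt p) := by
  have hs := Γ.src_plane _ p.seg_mem
  have ht := Γ.tgt_plane _ p.seg_mem
  have hF : F.triAt p ∈ dir F.tri p.seg.src p.seg.tgt := by simp [F.triAt_dir]
  have hG : G.triAt p ∈ dir G.tri p.seg.src p.seg.tgt := by simp [G.triAt_dir]
  obtain ⟨hF1, hF2, hF3⟩ := mem_dir.1 hF
  obtain ⟨hG1, hG2, hG3⟩ := mem_dir.1 hG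
  have hF0 := (F.boundary p.seg p.seg_mem).2
  have hG0 := (G.boundary p.seg p.seg_mem).2
  refine Quot.sound (Or.inr ⟨?_, ?_, ?_, ?_, ?_⟩)
  · simp [Tri.mirror, hG3, hF3, bar_eq_self ht]
  · simp [Tri.mirror, hG2, hF2, bar_eq_self hs]
  · simp [Tri.mirror, F.triAt_lab, G.triAt_lab]
  · simp only [hF2, hF3]
    refine Finset.card_eq_one.2 ⟨F.triAt p, ?_⟩
    ext t
    simp only [Finset.mem_singleton]
    constructor
    · intro h
      obtain ⟨h1 | h1, h2, h3⟩ := by simpa only [mem_dir, mem_glue] using h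
      · have : t ∈ dir F.tri p.seg.src p.seg.tgt := mem_dir.2 ⟨h1, h2, h3⟩
        simpa [F.triAt_dir] using this
      · exfalso
        have : t.mirror ∈ dir G.tri p.seg.tgt p.seg.src :=
          mem_dir.2 ⟨h1, by simp [Tri.mirror, h3, bar_eq_self ht],
            by simp [Tri.mirror, h2, bar_eq_self hs]⟩
        simp [hG0] at this
    · rintro rfl
      exact mem_dir.2 ⟨mem_glue.2 (Or.inl hF1), hF2, hF3⟩
  · simp only [hF2, hF3]
    refine Finset.card_eq_one.2 ⟨(G.triAt p).mirror, ?_⟩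
    ext t
    simp only [Finset.mem_singleton]
    constructor
    · intro h
      obtain ⟨h1 | h1, h2, h3⟩ := by simpa only [mem_dir, mem_glue] using h
      · exfalso
        have : t ∈ dir F.tri p.seg.tgt p.seg.src := mem_dir.2 ⟨h1, h2, h3⟩
        simp [hF0] at this
      · have : t.mirror ∈ dir G.tri p.seg.src p.seg.tgt :=
          mem_dir.2 ⟨h1, by simp [Tri.mirror, h3, bar_eq_self hs],
            by simp [Tri.mirror, h2, bar_eq_self ht]⟩
        rw [G.triAt_dir, Finset.mem_singleton] at this
        rw [← this, mirror_mirror]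
    · rintro rfl
      exact mem_dir.2 ⟨mem_glue.2 (Or.inr (by simp [hG1])),
        by simp [Tri.mirror, hG3, bar_eq_self ht], by simp [Tri.mirror, hG2, bar_eq_self hs]⟩

theorem dot_dotAt {Γ : MOYGraph N} (F G : Foam Γ) (p : Basepoint Γ) (w : Fin p.lab) :
    dotLeft F G (dotAt F p w) = dotRight F G (dotAt G p w) := by
  have h := incl_facetAt F G p
  refine Sigma.ext h ?_
  refine (Fin.heq_ext_iff (congrArg Facet.lab h)).2 ?_
  rfl

theorem glueDots_addDot {Γ : MOYGraph N} (F G : DottedFoam Γ) (p : Basepoint Γ)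
    (w : Fin p.lab) : glueDots (addDot p w F) G = glueDots F (addDot p w G) := by
  simp only [glueDots, addDot, Finsupp.mapDomain_add, Finsupp.mapDomain_single, dot_dotAt]
  abel

/-- Adding a dot at the basepoint, on linear combinations of dotted foams. -/
def addDotLin {Γ : MOYGraph N} (R : Type*) [CommRing R] (p : Basepoint Γ) (w : Fin p.lab) :
    FoamModule Γ R →ₗ[R] FoamModule Γ R :=
  Finsupp.lmapDomain R R (addDot p w)

theorem pairing_addDotLin {Γ : MOYGraph N} (R : Type*) [CommRing R] (p : Basepoint Γ)
    (w : Fin p.lab) (G : DottedFoam Γ) (u : FoamModule Γ R) :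
    pairing R G (addDotLin R p w u) = pairing R (addDot p w G) u := by
  have key : ∀ F : DottedFoam Γ, evalR R N (glue (addDot p w F).1 G.1) (glueDots (addDot p w F) G)
      = evalR R N (glue F.1 (addDot p w G).1) (glueDots F (addDot p w G)) := fun F =>
    congrArg (evalR R N (glue F.1 G.1)) (glueDots_addDot F G p w)
  induction u using Finsupp.induction_linear with
  | zero => simp
  | add u v hu hv => rw [map_add, map_add, map_add, hu, hv]
  | single F r =>
    rw [addDotLin, Finsupp.lmapDomain_apply, Finsupp.mapDomain_single, pairing, pairing,
      Finsupp.linearCombination_single, Finsupp.linearCombination_single, key]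

theorem addDotLin_ker {Γ : MOYGraph N} (R : Type*) [CommRing R] (p : Basepoint Γ)
    (w : Fin p.lab) : pairingKer Γ R ≤ (pairingKer Γ R).comap (addDotLin R p w) := by
  intro u hu
  simp only [pairingKer, Submodule.mem_comap, Submodule.mem_iInf, LinearMap.mem_ker] at hu ⊢
  intro G
  rw [pairing_addDotLin]
  exact hu _

/-- The basepoint operator of weight `w + 1` on `F_N(Γ; R)`. -/
def basepointOp {Γ : MOYGraph N} (R : Type*) [CommRing R] (p : Basepoint Γ) (w : Fin p.lab) :
    Module.End R (StateSpace Γ R) :=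
  (pairingKer Γ R).mapQ (pairingKer Γ R) (addDotLin R p w) (addDotLin_ker R p w)

/-- The basepoint operator of weight `1` for a basepoint on an edge labelled `1`. -/
def weightOneOp {Γ : MOYGraph N} (R : Type*) [CommRing R] (p : Basepoint Γ) (hp : p.lab = 1) :
    Module.End R (StateSpace Γ R) :=
  basepointOp R p ⟨0, by omega⟩

/-! ## The operator `∇` -/

/-- The sum of all first-order partial derivatives. -/
def nablaPoly (σ R : Type*) [Fintype σ] [CommRing R] :
    Derivation R (MvPolynomial σ R) (MvPolynomial σ R) :=
  ∑ i : σ, MvPolynomial.pderiv i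

/-- Polynomials in the kinds of dots stand for linear combinations of sets of dots on `K`.  This
map sends a dot of weight `w` on `f` to the elementary symmetric polynomial `e_w` in the
variables `(X_f)_1, …, (X_f)_{ℓ(f)}`; it identifies the polynomials in the dots with the ring
`R[F]` of polynomials that are symmetric in the variables of each facet. -/
def realize (K : Finset Tri) (R : Type*) [CommRing R] :
    MvPolynomial (Dot K) R →ₐ[R] MvPolynomial (Var K) R :=
  MvPolynomial.aeval fun x =>
    MvPolynomial.rename (Sigma.mk x.1) (MvPolynomial.esymm (Fin x.1.lab) R (x.2 + 1))

/-- `∇` on polynomials in the dots: the derivation with `∇ e_w = (ℓ(f) - w + 1) e_{w-1}` for a dot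
of weight `w` on `f`, where `e_0 = 1`.  It is the operator `∇` on `R[F]`, by `realize_nablaDots`
below. -/
def nablaDots (K : Finset Tri) (R : Type*) [CommRing R] :
    Derivation R (MvPolynomial (Dot K) R) (MvPolynomial (Dot K) R) :=
  MvPolynomial.mkDerivation R fun x =>
    if x.2.1 = 0 then (x.1.lab : MvPolynomial (Dot K) R)
    else ((x.1.lab - x.2.1 : ℕ) : MvPolynomial (Dot K) R) *
      MvPolynomial.X ⟨x.1, ⟨x.2.1 - 1, by have := x.2.2; omega⟩⟩

theorem nablaPoly_X {σ R : Type*} [Fintype σ] [CommRing R] (i : σ) :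
    nablaPoly σ R (MvPolynomial.X i) = 1 := by
  have h : nablaPoly σ R (MvPolynomial.X i) =
      ∑ j : σ, MvPolynomial.pderiv j (MvPolynomial.X i : MvPolynomial σ R) := by
    rw [nablaPoly, ← Derivation.coeFnAddMonoidHom_apply, map_sum, Finset.sum_apply]
    rfl
  rw [h, Finset.sum_eq_single i]
  · exact MvPolynomial.pderiv_X_self i
  · intro j _ hj
    exact MvPolynomial.pderiv_X_of_ne hj.symm
  · simp

theorem nablaPoly_rename {σ τ R : Type*} [Fintype σ] [Fintype τ] [CommRing R] (s : σ → τ)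
    (P : MvPolynomial σ R) :
    nablaPoly τ R (MvPolynomial.rename s P) = MvPolynomial.rename s (nablaPoly σ R P) := by
  induction P using MvPolynomial.induction_on with
  | C r => simp [← MvPolynomial.algebraMap_eq]
  | add p q hp hq => simp [hp, hq]
  | mul_X p i hp => simp [hp, nablaPoly_X, Derivation.leibniz]

theorem nablaPoly_esymm (n k : ℕ) (R : Type*) [CommRing R] :
    nablaPoly (Fin n) R (MvPolynomial.esymm (Fin n) R (k + 1)) =
      ((n - k : ℕ) : MvPolynomial (Fin n) R) * MvPolynomial.esymm (Fin n) R k := by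
  have hprod : ∀ s : Finset (Fin n), nablaPoly (Fin n) R (∏ i ∈ s, MvPolynomial.X i) =
      ∑ i ∈ s, ∏ j ∈ s.erase i, MvPolynomial.X j := by
    intro s
    induction s using Finset.induction_on with
    | empty => simp
    | insert a s ha ih =>
      rw [Finset.prod_insert ha, Derivation.leibniz, ih, nablaPoly_X, Finset.sum_insert ha,
        Finset.erase_insert ha, smul_eq_mul, smul_eq_mul, mul_one, add_comm, Finset.mul_sum]
      congr 1
      refine Finset.sum_congr rfl fun i hi => ?_
      have hia : a ≠ i := fun h => ha (h ▸ hi)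
      rw [Finset.erase_insert_of_ne hia, Finset.prod_insert]
      exact fun h => ha (Finset.mem_of_mem_erase h)
  have hr : ((n - k : ℕ) : MvPolynomial (Fin n) R) * MvPolynomial.esymm (Fin n) R k =
      ∑ t ∈ Finset.powersetCard k (Finset.univ : Finset (Fin n)), ∑ _i ∈ tᶜ,
        ∏ j ∈ t, MvPolynomial.X j := by
    rw [MvPolynomial.esymm, Finset.mul_sum]
    refine Finset.sum_congr rfl fun t ht => ?_
    rw [Finset.sum_const, Finset.card_compl, (Finset.mem_powersetCard.1 ht).2, Fintype.card_fin,
      nsmul_eq_mul]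
  rw [hr, MvPolynomial.esymm, map_sum, Finset.sum_congr rfl fun s _ => hprod s,
    Finset.sum_sigma', Finset.sum_sigma']
  refine Finset.sum_bij' (fun x _ => ⟨x.1.erase x.2, x.2⟩) (fun x _ => ⟨insert x.2 x.1, x.2⟩)
    ?_ ?_ ?_ ?_ ?_
  · rintro ⟨s, i⟩ h
    simp only [Finset.mem_sigma, Finset.mem_powersetCard, Finset.subset_univ, true_and,
      Finset.mem_compl] at h ⊢
    exact ⟨by rw [Finset.card_erase_of_mem h.2, h.1]; rfl, Finset.notMem_erase _ _⟩
  · rintro ⟨s, i⟩ h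
    simp only [Finset.mem_sigma, Finset.mem_powersetCard, Finset.subset_univ, true_and,
      Finset.mem_compl] at h ⊢
    exact ⟨by rw [Finset.card_insert_of_notMem h.2, h.1], Finset.mem_insert_self _ _⟩
  · rintro ⟨s, i⟩ h
    simp only [Finset.mem_sigma] at h
    simp [Finset.insert_erase h.2]
  · rintro ⟨s, i⟩ h
    simp only [Finset.mem_sigma, Finset.mem_compl] at h
    simp [Finset.erase_insert h.2]
  · rintro ⟨s, i⟩ _
    rfl

/-- Under the identification of polynomials in the dots with symmetric polynomials, `∇` is the
sum of all first-order partial derivatives. -/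
theorem realize_nablaDots (K : Finset Tri) (R : Type*) [CommRing R]
    (P : MvPolynomial (Dot K) R) :
    realize K R (nablaDots K R P) = nablaPoly (Var K) R (realize K R P) := by
  induction P using MvPolynomial.induction_on with
  | C r => simp [← MvPolynomial.algebraMap_eq]
  | add p q hp hq => simp only [map_add, hp, hq]
  | mul_X p x hp =>
    have hx : realize K R (nablaDots K R (MvPolynomial.X x)) =
        nablaPoly (Var K) R (realize K R (MvPolynomial.X x)) := by
      obtain ⟨f, w, hw⟩ := x
      rw [nablaDots, MvPolynomial.mkDerivation_X]
      simp only [realize, MvPolynomial.aeval_X, nablaPoly_rename, nablaPoly_esymm]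
      split_ifs with h0
      · subst h0
        simp
      · simp only [map_mul, map_natCast, MvPolynomial.aeval_X]
        have e : w - 1 + 1 = w := by omega
        simp only [e]
    simp only [Derivation.leibniz, map_add, map_mul, smul_eq_mul, hp, hx]

/-- `P ↦ P F`: a polynomial in the dots on `F` as a linear combination of dotted foams. -/
def ofDots {Γ : MOYGraph N} (R : Type*) [CommRing R] (F : Foam Γ) :
    MvPolynomial (Dot F.tri) R →ₗ[R] FoamModule Γ R :=
  (MvPolynomial.basisMonomials (Dot F.tri) R).constr R fun d => Finsupp.single ⟨F, d⟩ 1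

theorem ofDots_monomial {Γ : MOYGraph N} (R : Type*) [CommRing R] (F : Foam Γ)
    (d : Dots F.tri) : ofDots R F (MvPolynomial.monomial d 1) = Finsupp.single ⟨F, d⟩ 1 := by
  have h := (MvPolynomial.basisMonomials (Dot F.tri) R).constr_basis R
    (fun d => (Finsupp.single ⟨F, d⟩ 1 : FoamModule Γ R)) d
  rwa [MvPolynomial.coe_basisMonomials] at h

/-- The operator `∇ (P F) = ∇(P) F` on linear combinations of dotted foams. -/
def nabla (Γ : MOYGraph N) (R : Type*) [CommRing R] : FoamModule Γ R →ₗ[R] FoamModule Γ R :=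
  Finsupp.linearCombination R fun F : DottedFoam Γ =>
    ofDots R F.1 (nablaDots F.1.tri R (MvPolynomial.monomial F.2 1))

theorem nabla_ofDots (Γ : MOYGraph N) (R : Type*) [CommRing R] (F : Foam Γ)
    (P : MvPolynomial (Dot F.tri) R) :
    nabla Γ R (ofDots R F P) = ofDots R F (nablaDots F.tri R P) := by
  induction P using MvPolynomial.induction_on' with
  | add p q hp hq => simp only [map_add, hp, hq]
  | monomial d r =>
    have h : (MvPolynomial.monomial d r : MvPolynomial (Dot F.tri) R) =
        r • MvPolynomial.monomial d 1 := by
      rw [MvPolynomial.smul_monomial, smul_eq_mul, mul_one]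
    have h2 : nablaDots F.tri R (r • MvPolynomial.monomial d 1) =
        r • nablaDots F.tri R (MvPolynomial.monomial d 1) := Derivation.map_smul _ _ _
    rw [h, h2, map_smul, map_smul, map_smul, ofDots_monomial, nabla,
      Finsupp.linearCombination_single, one_smul]

end

end SlFoam

/-! ### Parity tools: permutations, closed curves, combinatorial surfaces -/

namespace SlFoam

noncomputable section

open scoped Classical

/-! ## Signs of permutations and numbers of orbits -/

/-! The relation itself is a computation in a Weyl algebra. Write D for ∇. The basepoint operators
commute, each satisfies DZ = ZD + 1 because ∇e₁ = 1 on a facet labelled 1, and Y^N = 0. Hence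
D^(N-1) Z = Z D^(N-1) + (N-1) D^(N-2). The same identity for Y, applied on the image of Y^(N-1), has
left side zero, so (N-1) D^(N-2) acts there as -Y D^(N-1). Thus D^(N-1) Z = (Z - Y) D^(N-1) on that
image, and X^(N-1) commutes with Z - Y (`intertwine`). For Z = X the term X · X^(N-1) vanishes.

The work lies in showing that ∇ descends and that Y^N = 0. Both follow once the evaluation of a
glued foam is known to be a symmetric polynomial with integer coefficients. The weights (-1)^s / Q
involve only the differences X_i - X_j, so ∇ commutes with the evaluation (`nabla_evalForm`). For a
symmetric f the constant term of ∇f is N times a linear coefficient, which is zero in R; so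
derivatives evaluate to zero (`evalFormR_nablaDots`), and by the Leibniz rule ∇ is skew-adjoint for
the pairing (`pairLin_nabla`) and preserves its kernel. For Y^N = 0, a facet labelled 1 with pigment
m carries X_m, a root of ∏ (T - X_l); the lower coefficients of this polynomial have no constant
term, and integrality lets their contributions be discarded (`evalR_add_dots`).

Symmetry and integrality come from exchanging two neighbouring pigments i and j = i + 1 on a union
of components of the bichrome surface F_ij (`Switch`, `recolor`). The contribution of a coloring is
then multiplied by one factor `ratio` for each component, and along X_i = X_j this factor is
(-1)^(χ/2). Exchanging everywhere gives invariance under the transposition of X_i and X_j. Averaging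
over all exchanges produces the factor ∏ (1 + ratio): for a sphere it vanishes along X_i = X_j and
cancels the simple pole, and every other component has χ ≤ 0 and causes no pole (`regular_one_add`).
So there is no pole along X_i = X_j, by symmetry none along any diagonal, and since all denominators
are products of differences the evaluation is a polynomial (`exists_poly`).

The sign rule `IsColoring.sign_recolor` is the topological core. The exchange changes χ(F_i)/2 by
χ(part)/2 minus the Euler characteristic of the surface with pigment i only. The latter has the
parity of the number of its boundary circles, which are the curves where i and j come together, and
θ⁺_ij changes by the same parity; the pairs with a third pigment contribute nothing modulo 2. All
these parities are read off from signs of permutations whose orbits are vertices or curves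
(`sign_eq_of_orbits`), and the bound χ ≤ 2 is linear algebra (`euler_le_two`).

The geometry of the foam enters only through links of vertices: unions of sectors are connected
enough, and the meeting curve of two pigments passes straight through a vertex without changing the
cyclic order of the facets. This is checked for points of facets, bindings and singular points, and
for the points of Γ after gluing (`glue_closedFoam`). -/

theorem card_image_le_of_ker {α β γ : Type*} (s : Finset α) (f : α → β) (g : α → γ)
    (h : ∀ x ∈ s, ∀ y ∈ s, f x = f y → g x = g y) : (s.image g).card ≤ (s.image f).card := by
  have hc : ∀ b : {b // b ∈ s.image g}, ∃ x ∈ s, g x = b := fun b => Finset.mem_image.1 b.2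
  choose k hk hk' using hc
  rw [← Fintype.card_coe, ← Fintype.card_coe]
  refine Fintype.card_le_of_injective
    (fun b => (⟨f (k b), Finset.mem_image_of_mem _ (hk b)⟩ : {b // b ∈ s.image f}))
    fun b b' e => Subtype.ext ?_
  rw [← hk' b, ← hk' b']
  exact h _ (hk b) _ (hk b') (congrArg Subtype.val e)

theorem card_image_eq_of_ker {α β γ : Type*} (s : Finset α) (f : α → β) (g : α → γ)
    (h : ∀ x ∈ s, ∀ y ∈ s, f x = f y ↔ g x = g y) : (s.image f).card = (s.image g).card :=
  le_antisymm (card_image_le_of_ker s g f fun x hx y hy => (h x hx y hy).2)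
    (card_image_le_of_ker s f g fun x hx y hy => (h x hx y hy).1)

/-- The sign of a permutation whose orbits are the fibres of a surjection. -/
theorem sign_eq_of_orbits {S V : Type*} [Fintype S] [DecidableEq S] [Fintype V] (σ : Equiv.Perm S) (a : S → V)
    (ha : Function.Surjective a) (h1 : ∀ t, a (σ t) = a t)
    (h2 : ∀ s t, a s = a t → σ.SameCycle s t) :
    Equiv.Perm.sign σ = (-1) ^ (Fintype.card S + Fintype.card V) := by
  have h3 : ∀ s t, σ.SameCycle s t → a s = a t := by
    have hp : ∀ (n : ℕ) t, a ((σ ^ n) t) = a t := by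
      intro n
      induction n with
      | zero => simp
      | succ n ih => intro t; rw [pow_succ, Equiv.Perm.mul_apply, ih, h1]
    intro s t h
    obtain ⟨n, -, -, hn⟩ := h.exists_pow_eq''
    rw [← hn, hp]
  have hsc : ∀ x ∈ σ.support, ∀ y ∈ σ.support, a x = a y ↔ σ.cycleOf x = σ.cycleOf y := by
    intro x hx y hy
    refine ⟨fun h => (h2 x y h).cycleOf_eq, fun h => h3 x y ?_⟩
    have hxx : y ∈ (σ.cycleOf x).support := by
      rw [h, Equiv.Perm.mem_support, Equiv.Perm.cycleOf_apply_self]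
      exact Equiv.Perm.mem_support.1 hy
    exact ((Equiv.Perm.mem_support_cycleOf_iff).1 hxx).1
  -- Among the points that are moved, the fibres of `a` are the nontrivial cycles; the fixed points
  -- are fibres by themselves. Together this counts the fibres.
  have hcyc : (σ.support.image a).card = Multiset.card σ.cycleType := by
    rw [card_image_eq_of_ker _ _ _ hsc, Equiv.Perm.cycleType_def, Multiset.card_map]
    congr 1
    ext c
    simp only [Finset.mem_image, Equiv.Perm.mem_cycleFactorsFinset_iff]
    constructor
    · rintro ⟨x, hx, rfl⟩
      exact Equiv.Perm.mem_cycleFactorsFinset_iff.1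
        (Equiv.Perm.cycleOf_mem_cycleFactorsFinset_iff.2 hx)
    · rintro ⟨hc, hc'⟩
      obtain ⟨x, hx, -⟩ := id hc
      have hxs : x ∈ c.support := Equiv.Perm.mem_support.2 hx
      refine ⟨x, ?_, ?_⟩
      · rw [Equiv.Perm.mem_support, ← hc' x hxs]; exact hx
      · exact (Equiv.Perm.cycle_is_cycleOf hxs
          (Equiv.Perm.mem_cycleFactorsFinset_iff.2 ⟨hc, hc'⟩)).symm
  have hfix : ((σ.supportᶜ).image a).card = (σ.supportᶜ).card := by
    refine Finset.card_image_of_injOn fun x hx y hy h => ?_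
    have hx' : σ x = x := by simpa using hx
    obtain ⟨n, hn⟩ := h2 x y h
    rw [← hn, Equiv.Perm.zpow_apply_eq_self_of_apply_eq_self hx']
  have hdis : Disjoint (σ.support.image a) ((σ.supportᶜ).image a) := by
    rw [Finset.disjoint_left]
    rintro v hv hv'
    obtain ⟨x, hx, rfl⟩ := Finset.mem_image.1 hv
    obtain ⟨y, hy, hxy⟩ := Finset.mem_image.1 hv'
    have hy' : σ y = y := by simpa using hy
    obtain ⟨n, hn⟩ := h2 y x hxy
    rw [Equiv.Perm.zpow_apply_eq_self_of_apply_eq_self hy'] at hn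
    subst hn
    simp at hx hy
    exact hx hy
  have huniv : (σ.support.image a) ∪ ((σ.supportᶜ).image a) = Finset.univ := by
    rw [← Finset.image_union, Finset.union_compl, Finset.image_univ_of_surjective ha]
  have hcard : Fintype.card V = Multiset.card σ.cycleType + (Fintype.card S - σ.support.card) := by
    rw [← Finset.card_univ, ← huniv, Finset.card_union_of_disjoint hdis, hcyc, hfix,
      Finset.card_compl]
  have hle : σ.support.card ≤ Fintype.card S := Finset.card_le_univ _
  rw [Equiv.Perm.sign_of_cycleType, Equiv.Perm.sum_cycleType]
  obtain ⟨m, hm⟩ := Nat.exists_eq_add_of_le hle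
  rw [hcard, hm, Nat.add_sub_cancel_left]
  have : σ.support.card + m + (Multiset.card σ.cycleType + m)
      = (σ.support.card + Multiset.card σ.cycleType) + 2 * m := by ring
  rw [this, pow_add _ _ (2 * m), pow_mul]
  simp

/-- The sign of an involution. -/
theorem sign_involution {S : Type*} [Fintype S] [DecidableEq S] (σ : Equiv.Perm S) (h : ∀ t, σ (σ t) = t) :
    Equiv.Perm.sign σ = (-1) ^ ((Finset.univ.filter fun t => σ t ≠ t).card / 2) := by
  rw [Equiv.Perm.sign_of_pow_two_eq_one (by ext t; simp [pow_two, h])]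
  have : (Finset.univ.filter fun t => σ t ≠ t) = σ.support := by
    ext t; simp
  rw [this, Equiv.Perm.card_fixedPoints, Equiv.Perm.sum_cycleType]
  have := Finset.card_le_univ σ.support
  congr 2
  omega

theorem sign_eq_one_of_cube {S : Type*} [Fintype S] [DecidableEq S] (σ : Equiv.Perm S) (h : ∀ t, σ (σ (σ t)) = t) :
    Equiv.Perm.sign σ = 1 := by
  have h3 : σ ^ 3 = 1 := by ext t; simp [pow_succ, h]
  have := congrArg Equiv.Perm.sign h3
  rw [map_pow, map_one] at this
  rcases Int.units_eq_one_or (Equiv.Perm.sign σ) with h | h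
  · exact h
  · rw [h] at this; exact absurd this (by decide)

/-! ## Systems of disjoint oriented closed curves -/

/-- A finite set of oriented edges which form disjoint closed curves. -/
structure IsCurve {V : Type*} (C : V × V → Prop) : Prop where
  finite : Finite {e // C e}
  out : ∀ u v, C (u, v) → ∃ w, C (v, w)
  out_unique : ∀ v w w', C (v, w) → C (v, w') → w = w'
  in_unique : ∀ u u' v, C (u, v) → C (u', v) → u = u'

/-- The number of connected components of a set of edges. -/
def numComp {V : Type*} (C : V × V → Prop) : ℕ :=
  Nat.card (Quot fun e e' : {e : V × V // C e} =>
    e.1.1 = e'.1.1 ∨ e.1.1 = e'.1.2 ∨ e.1.2 = e'.1.1 ∨ e.1.2 = e'.1.2)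

namespace IsCurve

variable {V : Type*} {C : V × V → Prop}

theorem exists_next (h : IsCurve C) (e : {e // C e}) : ∃ e' : {e // C e}, e'.1.1 = e.1.2 := by
  obtain ⟨w, hw⟩ := h.out e.1.1 e.1.2 e.2
  exact ⟨⟨_, hw⟩, rfl⟩

/-- The edge after a given one. -/
def nextFun (h : IsCurve C) (e : {e // C e}) : {e // C e} := (h.exists_next e).choose

theorem nextFun_fst (h : IsCurve C) (e : {e // C e}) : (h.nextFun e).1.1 = e.1.2 := (h.exists_next e).choose_spec

theorem ext_fst (h : IsCurve C) {e e' : {e // C e}} (he : e.1.1 = e'.1.1) : e = e' := by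
  obtain ⟨⟨u, v⟩, he1⟩ := e
  obtain ⟨⟨u', v'⟩, he2⟩ := e'
  simp only at he
  subst he
  have := h.out_unique _ _ _ he1 he2
  subst this
  rfl

theorem ext_snd (h : IsCurve C) {e e' : {e // C e}} (he : e.1.2 = e'.1.2) : e = e' := by
  obtain ⟨⟨u, v⟩, he1⟩ := e
  obtain ⟨⟨u', v'⟩, he2⟩ := e'
  simp only at he
  subst he
  have := h.in_unique _ _ _ he1 he2
  subst this
  rfl

theorem nextFun_injective (h : IsCurve C) : Function.Injective h.nextFun := fun e e' he =>
  h.ext_snd (by rw [← h.nextFun_fst, ← h.nextFun_fst, he])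

/-- Passing to the next edge, as a permutation. -/
def next (h : IsCurve C) : Equiv.Perm {e // C e} :=
  Equiv.ofBijective h.nextFun
    (have := h.finite; Finite.injective_iff_bijective.1 h.nextFun_injective)

theorem next_fst (h : IsCurve C) (e : {e // C e}) : (h.next e).1.1 = e.1.2 := h.nextFun_fst e

theorem next_eq_iff (h : IsCurve C) {e e' : {e // C e}} : h.next e = e' ↔ e'.1.1 = e.1.2 :=
  ⟨fun he => he ▸ h.next_fst e, fun he => h.ext_fst ((h.next_fst e).trans he.symm)⟩

/-- The components are the orbits of `next`: two edges of a curve system with a common tail or a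
common head coincide, so the only genuine adjacency is between consecutive edges. The parity then
comes from `sign_eq_of_orbits`. -/
theorem sign_next (h : IsCurve C) [Fintype {e // C e}] [DecidableEq {e // C e}] :
    (-1 : ℤˣ) ^ numComp C = (-1) ^ Fintype.card {e // C e} * Equiv.Perm.sign h.next := by
  let r := fun e e' : {e : V × V // C e} =>
    e.1.1 = e'.1.1 ∨ e.1.1 = e'.1.2 ∨ e.1.2 = e'.1.1 ∨ e.1.2 = e'.1.2
  have : Finite (Quot r) := Quot.finite _
  have := Fintype.ofFinite (Quot r)
  have key := sign_eq_of_orbits h.next (Quot.mk r) Quot.mk_surjective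
    (fun t => Quot.sound (Or.inr (Or.inl (h.next_fst t))))
    (by
      intro s t hst
      have := Quot.eqvGen_exact hst
      induction this with
      | rel x y hxy =>
        rcases hxy with h1 | h1 | h1 | h1
        · rw [h.ext_fst h1]
        · exact (h.next_eq_iff.2 h1 ▸ (Equiv.Perm.SameCycle.refl _ _).apply_right).symm
        · have := h.next_eq_iff.2 h1.symm
          rw [← this]
          exact (Equiv.Perm.SameCycle.refl _ _).apply_right
        · rw [h.ext_snd h1]
      | refl x => exact Equiv.Perm.SameCycle.refl _ _
      | symm x y _ ih => exact (ih (Quot.eqvGen_sound ‹_›)).symm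
      | trans x y z h1 h2 ih1 ih2 =>
        exact (ih1 (Quot.eqvGen_sound h1)).trans (ih2 (Quot.eqvGen_sound h2)))
  have hn : numComp C = Fintype.card (Quot r) := by
    rw [numComp, Nat.card_eq_fintype_card]
  rw [key, hn, ← pow_add, ← add_assoc, pow_add, ← two_mul, pow_mul]
  simp

/-- On a closed curve system, a set of vertices contains as many heads as tails. -/
theorem card_fst_eq_card_snd (h : IsCurve C) [Fintype {e // C e}] (s : V → Prop)
    [DecidablePred s] :
    (Finset.univ.filter fun e : {e // C e} => s e.1.1).card =
      (Finset.univ.filter fun e : {e // C e} => s e.1.2).card := by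
  refine (Finset.card_bij (fun e _ => h.next e) ?_ ?_ ?_).symm
  · intro e he
    simpa [h.next_fst] using he
  · intro e _ e' _ hee
    exact h.next.injective hee
  · intro e he
    refine ⟨h.next.symm e, ?_, by simp⟩
    have := h.next_fst (h.next.symm e)
    rw [Equiv.apply_symm_apply] at this
    simpa [← this] using he

/-- The permutation of the edges of two systems of curves. -/
def next₂ {C : Bool → V × V → Prop} (hC : ∀ b, IsCurve (C b)) :
    Equiv.Perm {x : Bool × V × V // C x.1 x.2} where
  toFun x := ⟨(x.1.1, ((hC x.1.1).next ⟨x.1.2, x.2⟩).1), ((hC x.1.1).next ⟨x.1.2, x.2⟩).2⟩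
  invFun x := ⟨(x.1.1, ((hC x.1.1).next.symm ⟨x.1.2, x.2⟩).1),
    ((hC x.1.1).next.symm ⟨x.1.2, x.2⟩).2⟩
  left_inv := by rintro ⟨⟨b, e⟩, h⟩; simp
  right_inv := by rintro ⟨⟨b, e⟩, h⟩; simp

/-- The edges of two systems of curves, as a sum. -/
def edgesEquiv (C : Bool → V × V → Prop) :
    {x : Bool × V × V // C x.1 x.2} ≃ {e // C true e} ⊕ {e // C false e} where
  toFun x := match x with
    | ⟨(true, e), h⟩ => Sum.inl ⟨e, h⟩
    | ⟨(false, e), h⟩ => Sum.inr ⟨e, h⟩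
  invFun x := match x with
    | Sum.inl e => ⟨(true, e.1), e.2⟩
    | Sum.inr e => ⟨(false, e.1), e.2⟩
  left_inv := by rintro ⟨⟨_ | _, e⟩, h⟩ <;> rfl
  right_inv := by rintro (e | e) <;> rfl

theorem sign_next₂ {C : Bool → V × V → Prop} (hC : ∀ b, IsCurve (C b))
    [Fintype {x : Bool × V × V // C x.1 x.2}] :
    (-1 : ℤˣ) ^ (numComp (C true) + numComp (C false)) =
      (-1) ^ Fintype.card {x : Bool × V × V // C x.1 x.2} * Equiv.Perm.sign (next₂ hC) := by
  have := (hC true).finite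
  have := (hC false).finite
  have := Fintype.ofFinite {e // C true e}
  have := Fintype.ofFinite {e // C false e}
  have hs : Equiv.Perm.sign (next₂ hC) =
      Equiv.Perm.sign (Equiv.Perm.sumCongr (hC true).next (hC false).next) := by
    refine Equiv.Perm.sign_eq_sign_of_equiv _ _ (edgesEquiv C) ?_
    rintro ⟨⟨_ | _, e⟩, h⟩ <;> rfl
  rw [hs, Equiv.Perm.sign_sumCongr, Fintype.card_congr (edgesEquiv C), Fintype.card_sum, pow_add,
    pow_add, (hC true).sign_next, (hC false).sign_next]
  exact mul_mul_mul_comm _ _ _ _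

/-- Two systems of curves `C true`, `C false` on the same vertices are exchanged near the vertices
in `sw`; this does not change the parity of the total number of curves. -/
theorem numComp_exchange {C D : Bool → V × V → Prop} (hC : ∀ b, IsCurve (C b))
    (hD : ∀ b, IsCurve (D b)) (sw : V → Bool)
    (h1 : ∀ b e, D b e ↔ C (b ^^ sw e.1) e) (h2 : ∀ b e, D b e ↔ C (b ^^ sw e.2) e) :
    (-1 : ℤˣ) ^ (numComp (D true) + numComp (D false)) =
      (-1) ^ (numComp (C true) + numComp (C false)) := by
  have := (hC true).finite
  have := (hC false).finite
  have := (hD true).finite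
  have := (hD false).finite
  have := Finite.of_equiv _ (edgesEquiv C).symm
  have := Finite.of_equiv _ (edgesEquiv D).symm
  have := Fintype.ofFinite {e // C true e}
  have := Fintype.ofFinite {e // C false e}
  have := Fintype.ofFinite {x : Bool × V × V // C x.1 x.2}
  have := Fintype.ofFinite {x : Bool × V × V // D x.1 x.2}
  -- `τ1` passes from `C` to `D` by the switch at the tail of an edge, `τ2` by the switch at its
  -- head. They differ exactly on the edges that enter or leave the switched region.
  let τ1 : {x : Bool × V × V // C x.1 x.2} ≃ {x : Bool × V × V // D x.1 x.2} :=
    { toFun := fun x => ⟨(x.1.1 ^^ sw x.1.2.1, x.1.2), (h1 _ _).2 (by simpa using x.2)⟩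
      invFun := fun x => ⟨(x.1.1 ^^ sw x.1.2.1, x.1.2), (h1 _ _).1 x.2⟩
      left_inv := by rintro ⟨⟨b, e⟩, he⟩; simp
      right_inv := by rintro ⟨⟨b, e⟩, he⟩; simp }
  let τ2 : {x : Bool × V × V // C x.1 x.2} ≃ {x : Bool × V × V // D x.1 x.2} :=
    { toFun := fun x => ⟨(x.1.1 ^^ sw x.1.2.2, x.1.2), (h2 _ _).2 (by simpa using x.2)⟩
      invFun := fun x => ⟨(x.1.1 ^^ sw x.1.2.2, x.1.2), (h2 _ _).1 x.2⟩
      left_inv := by rintro ⟨⟨b, e⟩, he⟩; simp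
      right_inv := by rintro ⟨⟨b, e⟩, he⟩; simp }
  have hB : ∀ x y : {x : Bool × V × V // D x.1 x.2}, x.1.1 = y.1.1 → x.1.2.1 = y.1.2.1 → x = y := by
    rintro ⟨⟨b, e⟩, h⟩ ⟨⟨b', e'⟩, h'⟩ he he'
    simp only at he he'
    subst he
    have := (hD b).ext_fst (e := ⟨e, h⟩) (e' := ⟨e', h'⟩) he'
    simp only [Subtype.mk.injEq] at this
    subst this
    rfl
  -- The head of an edge is the tail of the next one, so both sides use the switch at the same
  -- vertex. Hence the two `next₂` are conjugate up to the discrepancy `ω` of `τ1` and `τ2`.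
  have hcomm : ∀ x, next₂ hD (τ2 x) = τ1 (next₂ hC x) := by
    intro x
    have e1 : (next₂ hD (τ2 x)).1.2.1 = x.1.2.2 := (hD _).next_fst _
    have e2 : (next₂ hC x).1.2.1 = x.1.2.2 := (hC _).next_fst _
    refine hB _ _ ?_ (e1.trans e2.symm)
    change (x.1.1 ^^ sw x.1.2.2) = (x.1.1 ^^ sw (next₂ hC x).1.2.1)
    rw [e2]
  let ω : Equiv.Perm {x : Bool × V × V // C x.1 x.2} := τ1.trans τ2.symm
  have hω : ∀ x, (ω x).1 = (x.1.1 ^^ sw x.1.2.1 ^^ sw x.1.2.2, x.1.2) := fun x => rfl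
  have hωω : ∀ x, ω (ω x) = x := by
    intro x
    refine Subtype.ext ?_
    rw [hω, hω]
    refine Prod.ext ?_ rfl
    simp only
    cases x.1.1 <;> cases sw x.1.2.1 <;> cases sw x.1.2.2 <;> rfl
  have hsign : Equiv.Perm.sign (next₂ hD) = Equiv.Perm.sign ω * Equiv.Perm.sign (next₂ hC) := by
    rw [← Equiv.Perm.sign_mul, ← Equiv.Perm.sign_trans_trans_symm (next₂ hD) τ2]
    congr 1
    ext1 x
    simp only [Equiv.trans_apply, Equiv.Perm.mul_apply, ω, hcomm]
  have hcount := (hC true).card_fst_eq_card_snd fun v => sw v = true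
  -- A closed curve enters the switched region as often as it leaves it, so the edges that cross its
  -- border are even in number.
  have hM : (Finset.univ.filter fun e : {e // C true e} => sw e.1.1 ≠ sw e.1.2).card =
      2 * (Finset.univ.filter fun e : {e // C true e} => sw e.1.1 = true ∧ sw e.1.2 = false).card := by
    have hs1 := Finset.card_filter_add_card_filter_not
      (s := Finset.univ.filter fun e : {e // C true e} => sw e.1.1 = true) (fun e => sw e.1.2 = true)
    have hs2 := Finset.card_filter_add_card_filter_not
      (s := Finset.univ.filter fun e : {e // C true e} => sw e.1.2 = true) (fun e => sw e.1.1 = true)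
    have hs3 := Finset.card_filter_add_card_filter_not
      (s := Finset.univ.filter fun e : {e // C true e} => sw e.1.1 ≠ sw e.1.2)
      (fun e => sw e.1.1 = true)
    simp only [Finset.filter_filter] at hs1 hs2 hs3
    have a1 : ∀ e : {e // C true e}, (sw e.1.1 ≠ sw e.1.2 ∧ sw e.1.1 = true) ↔
      (sw e.1.1 = true ∧ ¬ sw e.1.2 = true) := by
      intro e; cases sw e.1.1 <;> cases sw e.1.2 <;> simp
    have a2 : ∀ e : {e // C true e}, (sw e.1.1 ≠ sw e.1.2 ∧ ¬ sw e.1.1 = true) ↔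
      (sw e.1.2 = true ∧ ¬ sw e.1.1 = true) := by
      intro e; cases sw e.1.1 <;> cases sw e.1.2 <;> simp
    have a3 : ∀ e : {e // C true e}, (sw e.1.1 = true ∧ sw e.1.2 = false) ↔
      (sw e.1.1 = true ∧ ¬ sw e.1.2 = true) := by
      intro e; cases sw e.1.1 <;> cases sw e.1.2 <;> simp
    have a4 : ∀ e : {e // C true e}, (sw e.1.1 = true ∧ sw e.1.2 = true) ↔
      (sw e.1.2 = true ∧ sw e.1.1 = true) := fun e => and_comm
    rw [Finset.filter_congr fun e _ => a1 e, Finset.filter_congr fun e _ => a2 e] at hs3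
    rw [Finset.filter_congr fun e _ => a3 e]
    rw [Finset.filter_congr fun e _ => a4 e] at hs1
    omega
  have hN : (Finset.univ.filter fun x => ω x ≠ x).card =
      2 * (Finset.univ.filter fun e : {e // C true e} => sw e.1.1 ≠ sw e.1.2).card := by
    have hne : ∀ x, ω x ≠ x ↔ sw x.1.2.1 ≠ sw x.1.2.2 := by
      intro x
      rw [not_iff_not, Subtype.ext_iff, hω, Prod.ext_iff]
      simp only [and_true]
      cases x.1.1 <;> cases sw x.1.2.1 <;> cases sw x.1.2.2 <;> simp
    -- At an edge whose two ends are switched differently, the two descriptions of `D` force both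
    -- systems to contain the edge. So each such edge counts twice, `ω` moves a multiple of four
    -- points, and it is even.
    have hCC : ∀ e : V × V, sw e.1 ≠ sw e.2 → ∀ b, C b e ↔ C true e := by
      intro e he b
      have e1 := (h1 true e).symm.trans (h2 true e)
      cases b
      · revert e1 he
        cases sw e.1 <;> cases sw e.2 <;> simp
        exact fun h => h.symm
      · rfl
    have : (Finset.univ.filter fun x => ω x ≠ x).card =
        ((Finset.univ : Finset Bool) ×ˢ
          (Finset.univ.filter fun e : {e // C true e} => sw e.1.1 ≠ sw e.1.2)).card := by
      refine Finset.card_bij (fun x hx => (x.1.1, ⟨x.1.2, (hCC x.1.2 ?_ x.1.1).1 x.2⟩)) ?_ ?_ ?_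
      · exact (hne x).1 (Finset.mem_filter.1 hx).2
      · intro x hx
        simpa using (hne x).1 (Finset.mem_filter.1 hx).2
      · rintro ⟨⟨b, e⟩, h⟩ hx ⟨⟨b', e'⟩, h'⟩ hx' h
        simp at h
        obtain ⟨rfl, rfl⟩ := h
        rfl
      · rintro ⟨b, e⟩ he
        have he' : sw e.1.1 ≠ sw e.1.2 := by simpa using he
        exact ⟨⟨(b, e.1), (hCC e.1 he' b).2 e.2⟩, by simpa [hne] using he', rfl⟩
    rw [this, Finset.card_product]
    rfl
  have hω1 : Equiv.Perm.sign ω = 1 := by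
    rw [sign_involution ω hωω]
    have : (Finset.univ.filter fun x => ω x ≠ x).card / 2 =
        2 * (Finset.univ.filter fun e : {e // C true e} =>
          sw e.1.1 = true ∧ sw e.1.2 = false).card := by
      rw [hN, hM]; omega
    have h2 : ∀ m k : ℕ, m = 2 * k → (-1 : ℤˣ) ^ m = 1 := by
      rintro m k rfl; rw [pow_mul]; simp
    refine h2 _ _ (Eq.trans ?_ this)
    congr!
  rw [sign_next₂ hC, sign_next₂ hD, hsign, hω1, one_mul, Fintype.card_congr τ1]

/-- The union of two systems of curves without common vertices. -/
theorem numComp_union {A B : V × V → Prop} (hA : IsCurve A) (hB : IsCurve B)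
    (hAB : IsCurve fun e => A e ∨ B e) (hd : ∀ e, A e → ¬ B e) :
    (-1 : ℤˣ) ^ numComp (fun e => A e ∨ B e) = (-1) ^ numComp A * (-1) ^ numComp B := by
  have := hA.finite
  have := hB.finite
  have := hAB.finite
  have := Fintype.ofFinite {e // A e}
  have := Fintype.ofFinite {e // B e}
  have := Fintype.ofFinite {e // A e ∨ B e}
  let f : {e // A e} ⊕ {e // B e} ≃ {e // A e ∨ B e} :=
    Equiv.ofBijective (Sum.elim (fun e => ⟨e.1, Or.inl e.2⟩) (fun e => ⟨e.1, Or.inr e.2⟩)) (by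
      constructor
      · rintro (⟨e, he⟩ | ⟨e, he⟩) (⟨e', he'⟩ | ⟨e', he'⟩) h <;> simp at h <;> subst h
        · rfl
        · exact absurd he' (hd _ he)
        · exact absurd he (hd _ he')
        · rfl
      · rintro ⟨e, he | he⟩
        · exact ⟨Sum.inl ⟨e, he⟩, rfl⟩
        · exact ⟨Sum.inr ⟨e, he⟩, rfl⟩)
  have hs : Equiv.Perm.sign (Equiv.Perm.sumCongr hA.next hB.next) = Equiv.Perm.sign hAB.next := by
    refine Equiv.Perm.sign_eq_sign_of_equiv _ _ f ?_
    rintro (e | e)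
    · exact (hAB.next_eq_iff.2 (hA.next_fst e)).symm
    · exact (hAB.next_eq_iff.2 (hB.next_fst e)).symm
  rw [hA.sign_next, hB.sign_next, hAB.sign_next, ← hs, Equiv.Perm.sign_sumCongr,
    ← Fintype.card_congr f, Fintype.card_sum, pow_add]
  exact mul_mul_mul_comm _ _ _ _

end IsCurve

end

end SlFoam

namespace SlFoam

noncomputable section

open scoped Classical

/-! ## Combinatorial surfaces -/

/-- Parity of the number of orbits of the rotation at the vertices of a surface with boundary. -/
theorem sign_rotation {S V : Type*} [Fintype S] [DecidableEq S] [Fintype V] (φ α β : Equiv.Perm S)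
    (a : S → V) (ha : Function.Surjective a) (hφ : ∀ t, φ (φ (φ t)) = t) (hα : ∀ t, α (α t) = t)
    (h1 : ∀ t, a (φ (α t)) = a (β t)) (h2 : ∀ s t, a s = a t → (φ * α * β⁻¹).SameCycle s t) :
    (-1 : ℤˣ) ^ (Fintype.card S + Fintype.card V) =
      (-1) ^ ((Finset.univ.filter fun t => α t ≠ t).card / 2) * Equiv.Perm.sign β := by
  -- The orbits of φαβ⁻¹ are the vertices. Since φ³ = 1, φ is even, and the involution α consists of
  -- one transposition for each pair of darts that it exchanges.
  rw [← sign_eq_of_orbits (φ * α * β⁻¹) a ha (fun t => ?_) h2, Equiv.Perm.sign_mul,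
    Equiv.Perm.sign_mul, Equiv.Perm.sign_inv, sign_eq_one_of_cube φ hφ, sign_involution α hα,
    one_mul]
  have := h1 (β⁻¹ t)
  simpa using this

/-- The Euler characteristic of a connected closed oriented surface, given by its darts `S`, is at
most two.  The permutation `φ` rotates the darts of a face, `α` reverses a dart. -/
theorem euler_le_two {S V E F : Type*} [Fintype S] [Fintype V] [Fintype E] [Fintype F]
    (φ α : Equiv.Perm S) (hα : ∀ t, α (α t) = t) (a : S → V) (e : S → E) (f : S → F)
    (ha : Function.Surjective a) (he : Function.Surjective e) (hf : Function.Surjective f)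
    (heα : ∀ t, e (α t) = e t) (hfφ : ∀ t, f (φ t) = f t) (haα : ∀ t, a (α t) = a (φ t))
    (hV : ∀ u : V → ℚ, (∀ t, u (a (φ t)) = u (a t)) → ∀ x y, u x = u y)
    (hF : ∀ w : F → ℚ, (∀ t, w (f (α t)) = w (f t)) → ∀ x y, w x = w y) :
    Fintype.card V + Fintype.card F + Fintype.card E ≤ Fintype.card S + 2 := by
  by_cases hS : Nonempty S
  swap
  · have hS' : IsEmpty S := not_nonempty_iff.1 hS
    have : IsEmpty V := ⟨fun v => (ha v).elim fun x _ => hS'.elim x⟩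
    have : IsEmpty E := ⟨fun v => (he v).elim fun x _ => hS'.elim x⟩
    have : IsEmpty F := ⟨fun v => (hf v).elim fun x _ => hS'.elim x⟩
    simp
  obtain ⟨t0⟩ := hS
  -- A discrete Hodge decomposition: functions u on vertices, w on faces and z on edges are sent to
  -- du + *dw + z on the darts. The rank is at most the number of darts, so the claim is that the
  -- kernel has dimension at most two.
  let T : ((V → ℚ) × (F → ℚ) × (E → ℚ)) →ₗ[ℚ] (S → ℚ) :=
    { toFun := fun x t => (x.1 (a (φ t)) - x.1 (a t)) + (x.2.1 (f t) - x.2.1 (f (α t))) + x.2.2 (e t)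
      map_add' := fun x y => by ext t; simp; ring
      map_smul' := fun r x => by ext t; simp; ring }
  have hT : ∀ x t, T x t =
    (x.1 (a (φ t)) - x.1 (a t)) + (x.2.1 (f t) - x.2.1 (f (α t))) + x.2.2 (e t) := fun _ _ => rfl
  have hker : ∀ x, T x = 0 → (∀ t, x.1 (a (φ t)) = x.1 (a t)) ∧
      (∀ t, x.2.1 (f (α t)) = x.2.1 (f t)) ∧ x.2.2 = 0 := by
    rintro ⟨u, w, z⟩ hx
    have h0 : ∀ t, (u (a (φ t)) - u (a t)) + (w (f t) - w (f (α t))) + z (e t) = 0 := fun t => by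
      rw [← hT ⟨u, w, z⟩ t, hx]; rfl
    -- Reversing a dart changes the sign of du and of *dw but not of z, so the equations at `t` and
    -- `α t` add up to 2z = 0.
    have hz : ∀ t, z (e t) = 0 := by
      intro t
      have h1 := h0 t
      have h2 := h0 (α t)
      rw [← haα (α t), hα, heα, haα] at h2
      linarith
    have h1 : ∀ t, (u (a (φ t)) - u (a t)) = - (w (f t) - w (f (α t))) := fun t => by
      have := h0 t; rw [hz] at this; linarith
    -- Summation by parts along `φ` and `α`: the gradient of a vertex function is orthogonal to the
    -- dual gradient of a face function.
    have horth : ∑ t, (u (a (φ t)) - u (a t)) * (w (f t) - w (f (α t))) = 0 := by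
      have e1 : ∑ t, u (a (φ t)) * w (f t) = ∑ t, u (a t) * w (f t) := by
        rw [← Equiv.sum_comp φ fun t => u (a t) * w (f t)]
        simp only [hfφ]
      have e2 : ∑ t, u (a (φ t)) * w (f (α t)) = ∑ t, u (a t) * w (f t) := by
        rw [← Equiv.sum_comp α fun t => u (a t) * w (f t)]
        simp only [haα]
      have e3 : ∑ t, u (a t) * w (f (α t)) = ∑ t, u (a (φ t)) * w (f t) := by
        rw [← Equiv.sum_comp α fun t => u (a (φ t)) * w (f t)]
        simp only [← haα, hα]
      have : ∀ t, (u (a (φ t)) - u (a t)) * (w (f t) - w (f (α t))) =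
        u (a (φ t)) * w (f t) - u (a (φ t)) * w (f (α t)) - (u (a t) * w (f t)
          - u (a t) * w (f (α t))) := fun t => by ring
      rw [Finset.sum_congr rfl fun t _ => this t, Finset.sum_sub_distrib, Finset.sum_sub_distrib,
        Finset.sum_sub_distrib, e1, e2, e3, e1]
      ring
    -- On the kernel du = -*dw, so orthogonality says that du has norm zero.
    have hsq : ∑ t, (u (a (φ t)) - u (a t)) ^ 2 = 0 := by
      rw [← neg_eq_zero, ← horth, ← Finset.sum_neg_distrib]
      refine Finset.sum_congr rfl fun t _ => ?_
      have := h1 t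
      rw [show w (f t) - w (f (α t)) = -(u (a (φ t)) - u (a t)) by rw [this]; ring]
      ring
    have hd : ∀ t, u (a (φ t)) - u (a t) = 0 := fun t => by
      have := (Finset.sum_eq_zero_iff_of_nonneg (fun t _ => sq_nonneg _)).1 hsq t (Finset.mem_univ t)
      exact pow_eq_zero_iff (two_ne_zero) |>.1 this
    refine ⟨fun t => sub_eq_zero.1 (hd t), fun t => ?_, funext fun x => ?_⟩
    · have := h1 t; rw [hd] at this
      change w (f (α t)) = w (f t)
      linarith
    · obtain ⟨t, rfl⟩ := he x
      exact hz t
  have hrank := LinearMap.finrank_range_add_finrank_ker T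
  have hrange : Module.finrank ℚ (LinearMap.range T) ≤ Fintype.card S :=
    (Submodule.finrank_le _).trans (by simp)
  -- Elements of the kernel are constant on vertices and on faces and vanish on edges, so their
  -- values at one dart determine them.
  have hker2 : Module.finrank ℚ (LinearMap.ker T) ≤ 2 := by
    let P : LinearMap.ker T →ₗ[ℚ] ℚ × ℚ :=
      { toFun := fun x => (x.1.1 (a t0), x.1.2.1 (f t0))
        map_add' := fun x y => rfl
        map_smul' := fun r x => rfl }
    have hP : Function.Injective P := by
      refine (injective_iff_map_eq_zero P).2 ?_
      rintro ⟨⟨u, w, z⟩, hx⟩ h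
      obtain ⟨h1, h2, h3⟩ := hker _ hx
      have h' : (u (a t0), w (f t0)) = (0, 0) := h
      obtain ⟨hu, hw⟩ := Prod.mk.injEq _ _ _ _ ▸ h'
      refine Subtype.ext (Prod.ext (funext fun v => ?_) (Prod.ext (funext fun v => ?_) h3))
      · exact (hV u h1 v (a t0)).trans hu
      · exact (hF w h2 v (f t0)).trans hw
    have := LinearMap.finrank_le_finrank_of_injective hP
    simpa using this
  have hdom : Module.finrank ℚ ((V → ℚ) × (F → ℚ) × (E → ℚ)) =
      Fintype.card V + (Fintype.card F + Fintype.card E) := by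
    simp [Module.finrank_prod]
  omega

end

end SlFoam

/-! ### Local structure of a foam: pigments in the link of a vertex -/

namespace SlFoam

noncomputable section

open scoped Classical

/-! ## The link of a vertex

A triangle with first vertex `v` is an edge of the link of `v`, directed from its second vertex
to its third one. -/

/-- The start (`true`) or the end (`false`) of a triangle, seen as an edge of the link of its first
vertex. -/
def Tri.tip (t : Tri) (ε : Bool) : Pt := if ε then t.b else t.c

@[simp] theorem Tri.tip_true (t : Tri) : t.tip true = t.b := rfl
@[simp] theorem Tri.tip_false (t : Tri) : t.tip false = t.c := rfl
@[simp] theorem Tri.rot_rot_rot (t : Tri) : t.rot.rot.rot = t := rfl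

/-- The edges of the link of `v` that start (or end) at `w`. -/
def stub (K : Finset Tri) (v w : Pt) (ε : Bool) : Finset Tri :=
  K.filter fun t => t.a = v ∧ t.tip ε = w

theorem mem_stub {K : Finset Tri} {v w : Pt} {ε : Bool} {t : Tri} :
    t ∈ stub K v w ε ↔ t ∈ K ∧ t.a = v ∧ t.tip ε = w := by simp [stub]

theorem stub_true (K : Finset Tri) (v w : Pt) : stub K v w true = dir K v w := rfl

theorem card_stub_false {K : Finset Tri} (hK : ∀ t ∈ K, t.rot ∈ K) (v w : Pt) :
    (stub K v w false).card = (dir K w v).card := by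
  refine Finset.card_bij (fun t _ => t.rot.rot) ?_ ?_ ?_
  · intro t ht
    obtain ⟨h1, h2, h3⟩ := mem_stub.1 ht
    exact mem_dir.2 ⟨hK _ (hK _ h1), h3, h2⟩
  · intro s _ t _ h
    exact congrArg Tri.rot h
  · intro t ht
    obtain ⟨h1, h2, h3⟩ := mem_dir.1 ht
    exact ⟨t.rot, mem_stub.2 ⟨hK _ h1, h3, h2⟩, rfl⟩

/-- The hypotheses on the edges at the vertex `v`. -/
structure LinkHyp (K : Finset Tri) (v : Pt) : Prop where
  rot : ∀ t ∈ K, t.rot ∈ K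
  ne : ∀ t ∈ K, t.b ≠ t.c
  le3 : ∀ w, (dir K v w).card + (dir K w v).card ≤ 3
  opp : ∀ w, IsBindingEdge K v w → (dir K v w).Nonempty ∧ (dir K w v).Nonempty

/-- A set of edges of the link of `v` which is a union of sectors. -/
def SectorClosed (K : Finset Tri) (v : Pt) (T : Tri → Prop) : Prop :=
  ∀ s ∈ K, ∀ t ∈ K, s.a = v → t.a = v → s.c = t.b → IsFacetEdge K v s.c → (T s ↔ T t)

/-- A pigment near `v`, given by the set of the triangles that have it. -/
structure LocalPigment (K : Finset Tri) (v : Pt) (p : Tri → Prop) : Prop where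
  closed : SectorClosed K v p
  flow : ∀ w ε, ∀ f ∈ stub K v w ε, ∀ g ∈ stub K v w ε, ∀ h ∈ stub K v w (!ε), f ≠ g →
    (p h ↔ p f ∨ p g) ∧ ¬ (p f ∧ p g)

/-- Two edges of the link in `T` have a common endpoint. -/
def LinkAdj (K : Finset Tri) (v : Pt) (T : Tri → Prop) (s t : Tri) : Prop :=
  (s ∈ K ∧ s.a = v ∧ T s) ∧ (t ∈ K ∧ t.a = v ∧ T t) ∧ ∃ ε δ, s.tip ε = t.tip δ

/-- At the binding edge `vw` the pigments `p` and `q` come together. -/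
structure Meet (K : Finset Tri) (v w : Pt) (ε : Bool) (p q : Tri → Prop) (f g h : Tri) : Prop where
  hf : f ∈ stub K v w ε
  hg : g ∈ stub K v w ε
  hh : h ∈ stub K v w (!ε)
  ne : f ≠ g
  pf : p f
  qg : q g
  ph : p h
  qh : q h

/-- Unions of sectors are connected, unless they have many ends. -/
def LinkConn (K : Finset Tri) (v : Pt) : Prop :=
  ∀ T, SectorClosed K v T → ∀ s ∈ K, ∀ t ∈ K, s.a = v → t.a = v → T s → T t →
    Relation.ReflTransGen (LinkAdj K v T) s t ∨
    ∃ w₁ w₂ w₃ : Pt, w₁ ≠ w₂ ∧ w₁ ≠ w₃ ∧ w₂ ≠ w₃ ∧ ∀ w, w = w₁ ∨ w = w₂ ∨ w = w₃ →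
      IsBindingEdge K v w ∧ ∃! r : Tri, r ∈ K ∧ r.a = v ∧ T r ∧ ∃ ε, r.tip ε = w

/-- The meeting curve of two pigments passes straight through the vertex. -/
def LinkMeet (K : Finset Tri) (v : Pt) : Prop :=
  ∀ p q, LocalPigment K v p → LocalPigment K v q → ∀ w ε f g h, Meet K v w ε p q f g h →
    ∃ x ≠ w, ∃ f' g' h', Meet K v x (!ε) p q f' g' h' ∧
      (RightHanded v w (f.tip !ε) (g.tip !ε) (h.tip ε) ↔
        RightHanded v x (f'.tip ε) (h'.tip !ε) (g'.tip ε)) ∧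
      ∀ y ε' f'' g'' h'', Meet K v y ε' p q f'' g'' h'' → y = w ∨ y = x

theorem rightHanded_cycle {a b u v w : Pt} : RightHanded a b u v w ↔ RightHanded a b v w u := by
  unfold RightHanded; tauto

variable {K : Finset Tri} {v : Pt}

/-- The triangles at `v`. -/
abbrev Lk (K : Finset Tri) (v : Pt) : Type := {t : Tri // t ∈ K ∧ t.a = v}

instance : Finite (Lk K v) :=
  Set.Finite.to_subtype (K.finite_toSet.subset fun _ h => h.1)

/-- The sector of a triangle. -/
def sec (t : Lk K v) : Sector K v := Quot.mk _ t

theorem stub_eq_of_facet (hK : ∀ t ∈ K, t.rot ∈ K) {w : Pt} (hw : IsFacetEdge K v w) {ε : Bool} {s t : Lk K v}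
    (hs : s.1.tip ε = w) (ht : t.1.tip ε = w) : s = t := by
  have h : (stub K v w ε).card = 1 := by
    cases ε
    · rw [card_stub_false hK]; exact hw.2
    · exact hw.1
  obtain ⟨r, hr⟩ := Finset.card_eq_one.1 h
  have e1 : s.1 ∈ stub K v w ε := mem_stub.2 ⟨s.2.1, s.2.2, hs⟩
  have e2 : t.1 ∈ stub K v w ε := mem_stub.2 ⟨t.2.1, t.2.2, ht⟩
  rw [hr, Finset.mem_singleton] at e1 e2
  exact Subtype.ext (e1.trans e2.symm)

theorem exists_stub_of_facet (hK : ∀ t ∈ K, t.rot ∈ K) {w : Pt} (hw : IsFacetEdge K v w) (ε : Bool) :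
    ∃ t : Lk K v, t.1.tip ε = w := by
  have h : (stub K v w ε).card = 1 := by
    cases ε
    · rw [card_stub_false hK]; exact hw.2
    · exact hw.1
  obtain ⟨r, hr⟩ := Finset.card_eq_one.1 h
  have e1 : r ∈ stub K v w ε := by simp [hr]
  obtain ⟨h1, h2, h3⟩ := mem_stub.1 e1
  exact ⟨⟨r, h1, h2⟩, h3⟩

/-- Across a facet edge exactly one triangle follows and exactly one precedes, so `sectorRel` is
deterministic in both directions. The generated equivalence relation is therefore a chain in one of
the two directions. -/
theorem sector_comparable (hK : ∀ t ∈ K, t.rot ∈ K) {s t : Lk K v} (h : sec s = sec t) :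
    Relation.ReflTransGen (sectorRel K v) s t ∨ Relation.ReflTransGen (sectorRel K v) t s := by
  have hr : Relator.RightUnique (sectorRel K v) := fun x y z h1 h2 =>
    stub_eq_of_facet hK (w := x.1.c) (ε := true) h1.2 h1.1.symm h2.1.symm
  have hl : Relator.RightUnique (Function.swap (sectorRel K v)) := fun x y z h1 h2 =>
    stub_eq_of_facet hK (w := x.1.b) (ε := false) (by rw [← h1.1]; exact h1.2) h1.1 h2.1
  have := Quot.eqvGen_exact h
  induction this with
  | rel x y hxy => exact Or.inl (Relation.ReflTransGen.single hxy)
  | refl x => exact Or.inl Relation.ReflTransGen.refl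
  | symm x y _ ih => exact (ih h.symm).symm
  | trans x y z h1 h2 ih1 ih2 =>
    rcases ih1 (Quot.eqvGen_sound h1) with a | a <;> rcases ih2 (Quot.eqvGen_sound h2) with b | b
    · exact Or.inl (a.trans b)
    · have := Relation.ReflTransGen.total_of_right_unique hl
        (Relation.reflTransGen_swap.2 a) (Relation.reflTransGen_swap.2 b)
      exact this.symm.imp Relation.reflTransGen_swap.1 Relation.reflTransGen_swap.1
    · exact Relation.ReflTransGen.total_of_right_unique hr a b
    · exact Or.inr (b.trans a)

/-- A sector has at most one start and at most one end. -/
theorem sector_tip_unique (hK : ∀ t ∈ K, t.rot ∈ K) {s t : Lk K v} (h : sec s = sec t) {ε : Bool}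
    (hs : ¬ IsFacetEdge K v (s.1.tip ε)) (ht : ¬ IsFacetEdge K v (t.1.tip ε)) : s = t := by
  have key : ∀ x y : Lk K v, ¬ IsFacetEdge K v (x.1.tip ε) → ¬ IsFacetEdge K v (y.1.tip ε) →
      Relation.ReflTransGen (sectorRel K v) x y → x = y := by
    intro x y hx hy hxy
    cases ε
    · rcases hxy.cases_head with h | ⟨z, h, -⟩
      · exact h
      · exact absurd h.2 hx
    · rcases hxy.cases_tail with h | ⟨z, -, h⟩
      · exact h.symm
      · have := h.2
        rw [h.1] at this
        exact absurd this hy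
  rcases sector_comparable hK h with h | h
  · exact key _ _ hs ht h
  · exact (key _ _ ht hs h).symm

/-- A sector with one free end has another one. -/
theorem sector_other_tip (hK : ∀ t ∈ K, t.rot ∈ K) {s : Lk K v} {ε : Bool}
    (hs : ¬ IsFacetEdge K v (s.1.tip ε)) :
    ∃ t : Lk K v, sec t = sec s ∧ ¬ IsFacetEdge K v (t.1.tip !ε) := by
  -- Otherwise every triangle of the sector continues across its other end. This gives an injective,
  -- hence surjective, self-map of the finite sector, and then the free end of `s` would also be a
  -- facet edge.
  by_contra! hcon
  have hex : ∀ t : {t : Lk K v // sec t = sec s}, ∃ r : {t : Lk K v // sec t = sec s},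
      r.1.1.tip ε = t.1.1.tip !ε := by
    rintro ⟨t, ht⟩
    have hf := hcon t ht
    obtain ⟨r, hr⟩ := exists_stub_of_facet hK hf ε
    refine ⟨⟨r, ?_⟩, hr⟩
    rw [← ht]
    cases ε
    · refine Quot.sound ⟨hr, ?_⟩
      change IsFacetEdge K v (r.1.tip false)
      rw [hr]; exact hf
    · exact (Quot.sound ⟨hr.symm, hf⟩).symm
  choose n hn using hex
  have hinj : Function.Injective n := by
    intro x y hxy
    refine Subtype.ext (stub_eq_of_facet hK (ε := !ε) (hcon y.1 y.2) ?_ rfl)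
    rw [← hn x, hxy, hn y]
  obtain ⟨r, hr⟩ := (Finite.injective_iff_surjective.1 hinj) ⟨s, rfl⟩
  have := hn r
  rw [hr] at this
  exact hs (this ▸ hcon r.1 r.2)

theorem SectorClosed.iff_of_sec {T : Tri → Prop} (hT : SectorClosed K v T) {s t : Lk K v}
    (h : sec s = sec t) : T s.1 ↔ T t.1 := by
  have := Quot.eqvGen_exact h
  induction this with
  | rel x y hxy => exact hT _ x.2.1 _ y.2.1 x.2.2 y.2.2 hxy.1 hxy.2
  | refl x => rfl
  | symm x y _ ih => exact (ih h.symm).symm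
  | trans x y z h1 h2 ih1 ih2 =>
    exact (ih1 (Quot.eqvGen_sound h1)).trans (ih2 (Quot.eqvGen_sound h2))

theorem LinkAdj.symm {T : Tri → Prop} {s t : Tri} (h : LinkAdj K v T s t) : LinkAdj K v T t s := by
  obtain ⟨h1, h2, ε, δ, h3⟩ := h
  exact ⟨h2, h1, δ, ε, h3.symm⟩

theorem linkConn_symm {T : Tri → Prop} {s t : Tri}
    (h : Relation.ReflTransGen (LinkAdj K v T) s t) : Relation.ReflTransGen (LinkAdj K v T) t s := by
  induction h with
  | refl => exact Relation.ReflTransGen.refl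
  | tail _ h ih => exact Relation.ReflTransGen.head h.symm ih

theorem SectorClosed.conn {T : Tri → Prop} (hT : SectorClosed K v T) {s t : Lk K v}
    (h : sec s = sec t) (hs : T s.1) : Relation.ReflTransGen (LinkAdj K v T) s.1 t.1 := by
  have := Quot.eqvGen_exact h
  induction this with
  | rel x y hxy =>
    have hy := (hT _ x.2.1 _ y.2.1 x.2.2 y.2.2 hxy.1 hxy.2).1 hs
    exact Relation.ReflTransGen.single ⟨⟨x.2.1, x.2.2, hs⟩, ⟨y.2.1, y.2.2, hy⟩, false, true, hxy.1⟩
  | refl x => exact Relation.ReflTransGen.refl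
  | symm x y _ ih =>
    exact linkConn_symm (ih h.symm ((hT.iff_of_sec h).1 hs))
  | trans x y z h1 h2 ih1 ih2 =>
    have h' := Quot.eqvGen_sound h1
    exact (ih1 h' hs).trans (ih2 (Quot.eqvGen_sound h2) ((hT.iff_of_sec h').1 hs))

theorem touches_iff {σ : Sector K v} {w : Pt} :
    Touches K v σ w ↔ ∃ t : Lk K v, sec t = σ ∧ ∃ ε, t.1.tip ε = w := by
  constructor
  · rintro ⟨u, t, ht, ⟨h, -⟩ | ⟨h, -⟩⟩
    · exact ⟨t, ht, true, h⟩
    · exact ⟨t, ht, false, h⟩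
  · rintro ⟨t, ht, _ | _, h⟩
    · exact ⟨t.1.b, t, ht, Or.inr ⟨h, rfl⟩⟩
    · exact ⟨t.1.c, t, ht, Or.inl ⟨h, rfl⟩⟩

theorem wing_of_tip {t : Lk K v} {w : Pt} {ε : Bool} (h : t.1.tip ε = w) :
    Wing K v w (sec t) (t.1.tip !ε) := by
  refine ⟨t, rfl, ?_⟩
  cases ε
  · exact Or.inr ⟨h, rfl⟩
  · exact Or.inl ⟨h, rfl⟩

theorem IsBindingEdge.not_facet {w : Pt} (h : IsBindingEdge K v w) : ¬ IsFacetEdge K v w := by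
  rintro ⟨h1, h2⟩
  unfold IsBindingEdge at h
  omega

/-- A sector that leaves `w` and touches `x` arrives at `x`. -/
theorem sector_arrive (hK : ∀ t ∈ K, t.rot ∈ K) {w x : Pt} (hw : ¬ IsFacetEdge K v w)
    (hx : ¬ IsFacetEdge K v x) (hwx : w ≠ x) {s : Lk K v} {ε : Bool} (hs : s.1.tip ε = w)
    (ht : Touches K v (sec s) x) : ∃ t : Lk K v, sec t = sec s ∧ t.1.tip (!ε) = x := by
  obtain ⟨t, ht, δ, hδ⟩ := touches_iff.1 ht
  refine ⟨t, ht, ?_⟩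
  by_cases h : δ = ε
  · subst h
    have := sector_tip_unique hK ht (ε := δ) (by rwa [hδ]) (by rwa [hs])
    rw [this, hs] at hδ
    exact absurd hδ hwx
  · have : δ = !ε := by cases δ <;> cases ε <;> simp_all
    rw [← this, hδ]

theorem Meet.binding (H : LinkHyp K v) {w : Pt} {ε : Bool} {p q : Tri → Prop} {f g h : Tri}
    (hm : Meet K v w ε p q f g h) : IsBindingEdge K v w := by
  have h1 : 1 < (stub K v w ε).card := Finset.one_lt_card.2 ⟨f, hm.hf, g, hm.hg, hm.ne⟩
  have h2 : 0 < (stub K v w !ε).card := Finset.card_pos.2 ⟨h, hm.hh⟩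
  have h3 := H.le3 w
  unfold IsBindingEdge
  rw [← card_stub_false H.rot v w, ← stub_true K v w] at h3 ⊢
  cases ε <;> simp only [Bool.not_true, Bool.not_false] at h2 <;> omega

theorem Meet.not_qf {w : Pt} {ε : Bool} {p q : Tri → Prop} {f g h : Tri}
    (hm : Meet K v w ε p q f g h) (hq : LocalPigment K v q) : ¬ q f := fun hf =>
  (hq.flow w ε f hm.hf g hm.hg h hm.hh hm.ne).2 ⟨hf, hm.qg⟩

theorem Meet.not_pg {w : Pt} {ε : Bool} {p q : Tri → Prop} {f g h : Tri}
    (hm : Meet K v w ε p q f g h) (hp : LocalPigment K v p) : ¬ p g := fun hg =>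
  (hp.flow w ε f hm.hf g hm.hg h hm.hh hm.ne).2 ⟨hm.pf, hg⟩

/-! ### Vertices inside facets and bindings -/

theorem linkConn_of_facetPoint (h : IsFacetPoint K v) : LinkConn K v := by
  intro T hT s hs t ht hsv htv hTs hTt
  left
  have := (Nat.card_eq_one_iff_unique.1 h.2).1
  exact hT.conn (s := ⟨s, hs, hsv⟩) (t := ⟨t, ht, htv⟩) (Subsingleton.elim _ _) hTs

theorem linkMeet_of_branch_empty (H : LinkHyp K v) (h : branch K v = ∅) : LinkMeet K v := by
  intro p q hp hq w ε f g h' hm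
  have : w ∈ branch K v := hm.binding H
  rw [h] at this
  exact absurd this (Set.notMem_empty _)

/-- All sectors share the point `w` of the link, so any two triangles of `T` are joined through
their own sectors and `w`. -/
theorem linkConn_of_touch {w : Pt} (h : ∀ σ : Sector K v, Touches K v σ w) : LinkConn K v := by
  intro T hT s hs t ht hsv htv hTs hTt
  left
  obtain ⟨s', hs', ε, hε⟩ := touches_iff.1 (h (sec ⟨s, hs, hsv⟩))
  obtain ⟨t', ht', δ, hδ⟩ := touches_iff.1 (h (sec ⟨t, ht, htv⟩))
  have h1 : T s'.1 := (hT.iff_of_sec hs').2 hTs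
  have h2 : T t'.1 := (hT.iff_of_sec ht').2 hTt
  exact (hT.conn hs'.symm hTs).trans ((Relation.ReflTransGen.single
    ⟨⟨s'.2.1, s'.2.2, h1⟩, ⟨t'.2.1, t'.2.2, h2⟩, ε, δ, hε.trans hδ.symm⟩).trans (hT.conn ht' h2))

/-- The three sectors at `w` all arrive at `x`. -/
theorem linkMeet_step (H : LinkHyp K v) {w x : Pt} (hwx : w ≠ x)
    (hw : IsBindingEdge K v w) (hx : IsBindingEdge K v x)
    (ht : ∀ σ : Sector K v, Touches K v σ x) (hB : branch K v = {w, x})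
    (hR : ∀ α β γ : Sector K v, α ≠ β → β ≠ γ → γ ≠ α → ∀ a b c a' b' c' : Pt,
      Wing K v w α a → Wing K v w β b → Wing K v w γ c →
      Wing K v x α a' → Wing K v x β b' → Wing K v x γ c' →
      (RightHanded v w a b c ↔ RightHanded v x a' c' b'))
    {p q : Tri → Prop} (hp : LocalPigment K v p) (hq : LocalPigment K v q) {ε : Bool} {f g h : Tri}
    (hm : Meet K v w ε p q f g h) :
    ∃ x ≠ w, ∃ f' g' h', Meet K v x (!ε) p q f' g' h' ∧
      (RightHanded v w (f.tip !ε) (g.tip !ε) (h.tip ε) ↔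
        RightHanded v x (f'.tip ε) (h'.tip !ε) (g'.tip ε)) ∧
      ∀ y ε' f'' g'' h'', Meet K v y ε' p q f'' g'' h'' → y = w ∨ y = x := by
  obtain ⟨f1, f2, f3⟩ := mem_stub.1 hm.hf
  obtain ⟨g1, g2, g3⟩ := mem_stub.1 hm.hg
  obtain ⟨h1, h2, h3⟩ := mem_stub.1 hm.hh
  have hqf := hm.not_qf hq
  have hpg := hm.not_pg hp
  obtain ⟨f', f4, f5⟩ := sector_arrive H.rot hw.not_facet hx.not_facet hwx (s := ⟨f, f1, f2⟩) f3
    (ht _)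
  obtain ⟨g', g4, g5⟩ := sector_arrive H.rot hw.not_facet hx.not_facet hwx (s := ⟨g, g1, g2⟩) g3
    (ht _)
  obtain ⟨h', h4, h5⟩ := sector_arrive H.rot hw.not_facet hx.not_facet hwx (s := ⟨h, h1, h2⟩) h3
    (ht _)
  rw [Bool.not_not] at h5
  have pf := (hp.closed.iff_of_sec f4).2 hm.pf
  have qf := mt (hq.closed.iff_of_sec f4).1 hqf
  have pg := mt (hp.closed.iff_of_sec g4).1 hpg
  have qg := (hq.closed.iff_of_sec g4).2 hm.qg
  have ph := (hp.closed.iff_of_sec h4).2 hm.ph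
  have qh := (hq.closed.iff_of_sec h4).2 hm.qh
  refine ⟨x, hwx.symm, f'.1, g'.1, h'.1, ⟨mem_stub.2 ⟨f'.2.1, f'.2.2, f5⟩,
    mem_stub.2 ⟨g'.2.1, g'.2.2, g5⟩, mem_stub.2 ⟨h'.2.1, h'.2.2, by rwa [Bool.not_not]⟩, ?_,
    pf, qg, ph, qh⟩, ?_, ?_⟩
  · intro he; rw [he] at pf; exact pg pf
  · have e1 := wing_of_tip (t := ⟨f, f1, f2⟩) f3
    have e2 := wing_of_tip (t := ⟨g, g1, g2⟩) g3
    have e3 := wing_of_tip (t := ⟨h, h1, h2⟩) h3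
    have e4 := wing_of_tip f5
    have e5 := wing_of_tip g5
    have e6 := wing_of_tip h5
    rw [f4] at e4
    rw [g4] at e5
    rw [h4] at e6
    rw [Bool.not_not] at e3 e4 e5
    -- The three sectors are different because the pigments tell them apart: `f` has only `p`, `g`
    -- has only `q`, and `h` has both.
    refine hR _ _ _ ?_ ?_ ?_ _ _ _ _ _ _ e1 e2 e3 e4 e5 e6
    · intro he; exact hpg ((hp.closed.iff_of_sec he).1 hm.pf)
    · intro he; exact hpg ((hp.closed.iff_of_sec he).2 hm.ph)
    · intro he; exact hqf ((hq.closed.iff_of_sec he).1 hm.qh)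
  · intro y ε' f'' g'' h'' hy
    have : y ∈ branch K v := hy.binding H
    rw [hB] at this
    exact this

theorem linkMeet_of_bindingPoint (H : LinkHyp K v) (h : IsBindingPoint K v) :
    LinkConn K v ∧ LinkMeet K v := by
  obtain ⟨w, x, hwx, hB, -, ht, hR⟩ := h
  have hw : IsBindingEdge K v w := by
    have : w ∈ branch K v := by simp [hB]
    exact this
  have hx : IsBindingEdge K v x := by
    have : x ∈ branch K v := by simp [hB]
    exact this
  refine ⟨linkConn_of_touch fun σ => (ht σ).1, ?_⟩
  intro p q hp hq y ε f g h hm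
  have hy : y ∈ branch K v := hm.binding H
  rw [hB] at hy
  rcases hy with rfl | rfl
  · exact linkMeet_step H hwx hw hx (fun σ => (ht σ).2) hB hR hp hq hm
  · refine linkMeet_step H hwx.symm hx hw (fun σ => (ht σ).1) (by rw [hB, Set.pair_comm]) ?_ hp hq hm
    -- The condition on the cyclic orders is symmetric in the two ends of the binding once `β` and
    -- `γ` are interchanged.
    intro α β γ h1 h2 h3 a b c a' b' c' e1 e2 e3 e4 e5 e6
    exact (hR α γ β h3.symm h2.symm h1.symm a' c' b' a c b e4 e6 e5 e1 e3 e2).symm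

end

end SlFoam

namespace SlFoam

/-- Conservation of a pigment at a branch point with three directed edges. -/
def node (e₁ e₂ e₃ p₁ p₂ p₃ : Bool) : Bool :=
  if e₁ = e₂ then (e₃ != e₁) && (p₃ == (p₁ || p₂)) && !(p₁ && p₂)
  else if e₁ = e₃ then p₂ == (p₁ || p₃) && !(p₁ && p₃)
  else p₁ == (p₂ || p₃) && !(p₂ && p₃)

/-- A finite check on the complete graph with vertices w, x, y, z, where the arcs wx, wy, wz carry
`p` only, `q` only and both. The variables `d₁ d₂ d₃` are the directions and `pᵢ`, `qᵢ` the pigments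
of the arcs xy, xz, yz. Conservation at x, y, z leaves three cases, in which the pigments part again
at x, at y and at z respectively. -/
theorem node_complete_bool : ∀ ε d₁ d₂ d₃ p₁ q₁ p₂ q₂ p₃ q₃ : Bool,
    (!(node (!ε) d₁ d₂ true p₁ p₂ && node (!ε) d₁ d₂ false q₁ q₂ &&
      node (!ε) (!d₁) d₃ false p₁ p₃ && node (!ε) (!d₁) d₃ true q₁ q₃ &&
      node ε (!d₂) (!d₃) true p₂ p₃ && node ε (!d₂) (!d₃) true q₂ q₃) ||
    (!p₁ && q₁ && (d₁ == !ε) && p₂ && q₂ && (d₂ == ε) && !p₃ && !q₃) ||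
    (p₁ && !q₁ && (d₁ == ε) && p₃ && q₃ && (d₃ == ε) && !p₂ && !q₂) ||
    (p₂ && !q₂ && (d₂ == ε) && !p₃ && q₃ && (d₃ == ε) && !p₁ && !q₁)) = true := by
  rintro (_ | _) (_ | _) (_ | _) (_ | _) <;> decide

theorem node_complete (ε d₁ d₂ d₃ p₁ q₁ p₂ q₂ p₃ q₃ : Bool)
    (h₁ : node (!ε) d₁ d₂ true p₁ p₂) (h₂ : node (!ε) d₁ d₂ false q₁ q₂)
    (h₃ : node (!ε) (!d₁) d₃ false p₁ p₃) (h₄ : node (!ε) (!d₁) d₃ true q₁ q₃)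
    (h₅ : node ε (!d₂) (!d₃) true p₂ p₃) (h₆ : node ε (!d₂) (!d₃) true q₂ q₃) :
    (p₁ = false ∧ q₁ = true ∧ d₁ = !ε ∧ p₂ = true ∧ q₂ = true ∧ d₂ = ε ∧ p₃ = false ∧ q₃ = false) ∨
    (p₁ = true ∧ q₁ = false ∧ d₁ = ε ∧ p₃ = true ∧ q₃ = true ∧ d₃ = ε ∧ p₂ = false ∧ q₂ = false) ∨
    (p₂ = true ∧ q₂ = false ∧ d₂ = ε ∧ p₃ = false ∧ q₃ = true ∧ d₃ = ε ∧ p₁ = false ∧ q₁ = false)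
    := by
  have h := node_complete_bool ε d₁ d₂ d₃ p₁ q₁ p₂ q₂ p₃ q₃
  simp only [h₁, h₂, h₃, h₄, h₅, h₆, Bool.and_self, Bool.not_true, Bool.false_or, Bool.or_eq_true,
    Bool.and_eq_true, Bool.not_eq_true', beq_iff_eq] at h
  rcases h with (h | h) | h
  · exact Or.inl (by tauto)
  · exact Or.inr (Or.inl (by tauto))
  · exact Or.inr (Or.inr (by tauto))

noncomputable section

open scoped Classical

variable {K : Finset Tri} {v : Pt}

/-! ### Singular points -/

theorem bool_pigeonhole (a b c : Bool) : a = b ∨ a = c ∨ b = c := by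
  revert a b c; decide

/-- Among three ends of triangles two point in the same direction, and a sector has at most one free
end in each direction. -/
theorem touches_le_two (hK : ∀ t ∈ K, t.rot ∈ K) {σ : Sector K v} {w x y : Pt}
    (hw : ¬ IsFacetEdge K v w) (hx : ¬ IsFacetEdge K v x) (hy : ¬ IsFacetEdge K v y)
    (tw : Touches K v σ w) (tx : Touches K v σ x) (ty : Touches K v σ y) :
    w = x ∨ w = y ∨ x = y := by
  obtain ⟨r, hr, a, ha⟩ := touches_iff.1 tw
  obtain ⟨s, hs, b, hb⟩ := touches_iff.1 tx
  obtain ⟨t, ht, c, hc⟩ := touches_iff.1 ty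
  rcases bool_pigeonhole a b c with h | h | h
  · left
    subst h
    rw [← ha, ← hb, sector_tip_unique hK (hr.trans hs.symm) (by rwa [ha]) (by rwa [hb])]
  · right; left
    subst h
    rw [← ha, ← hc, sector_tip_unique hK (hr.trans ht.symm) (by rwa [ha]) (by rwa [hc])]
  · right; right
    subst h
    rw [← hb, ← hc, sector_tip_unique hK (hs.trans ht.symm) (by rwa [hb]) (by rwa [hc])]

/-- The sectors at a singular point are the edges of a complete graph on the branch points. -/
theorem singular_sectors (hK : ∀ t ∈ K, t.rot ∈ K) (h : IsSingularPoint K v) :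
    (∀ σ : Sector K v, ∃ w ∈ branch K v, ∃ x ∈ branch K v, w ≠ x ∧ Touches K v σ w ∧
      Touches K v σ x) ∧
    ∀ σ τ : Sector K v, ∀ w ∈ branch K v, ∀ x ∈ branch K v, w ≠ x → Touches K v σ w →
      Touches K v σ x → Touches K v τ w → Touches K v τ x → σ = τ := by
  obtain ⟨h4, h6, hpair, -⟩ := h
  have hfin : (branch K v).Finite := Set.finite_of_ncard_ne_zero (by omega)
  have hB : hfin.toFinset.card = 4 := by rw [← h4, Set.ncard_eq_toFinset_card _ hfin]
  have hnf : ∀ w ∈ branch K v, ¬ IsFacetEdge K v w := fun w hw => IsBindingEdge.not_facet hw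
  have hex : ∀ P : {P // P ∈ hfin.toFinset.powersetCard 2}, ∃ σ : Sector K v,
      ∀ w ∈ P.1, Touches K v σ w := by
    rintro ⟨P, hP⟩
    obtain ⟨hP1, hP2⟩ := Finset.mem_powersetCard.1 hP
    obtain ⟨w, x, hwx, rfl⟩ := Finset.card_eq_two.1 hP2
    obtain ⟨σ, h1, h2⟩ := hpair w (by simpa using hP1 (by simp)) x (by simpa using hP1 (by simp)) hwx
    exact ⟨σ, by simp [h1, h2]⟩
  choose c hc using hex
  have hmem : ∀ P : {P // P ∈ hfin.toFinset.powersetCard 2}, ∀ w ∈ P.1, w ∈ branch K v :=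
    fun P w hw => by simpa using (Finset.mem_powersetCard.1 P.2).1 hw
  have hall : ∀ P : {P // P ∈ hfin.toFinset.powersetCard 2}, ∀ w ∈ branch K v,
      Touches K v (c P) w → w ∈ P.1 := by
    intro P w hw ht
    obtain ⟨y, z, hyz, hP⟩ := Finset.card_eq_two.1 (Finset.mem_powersetCard.1 P.2).2
    have hy : y ∈ P.1 := by simp [hP]
    have hz : z ∈ P.1 := by simp [hP]
    rcases touches_le_two hK (hnf w hw) (hnf y (hmem P y hy)) (hnf z (hmem P z hz)) ht (hc P y hy)
      (hc P z hz) with e | e | e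
    · rwa [e]
    · rwa [e]
    · exact absurd e hyz
  have hinj : Function.Injective c := by
    intro P P' hPP
    refine Subtype.ext (Finset.eq_of_subset_of_card_le (fun w hw => ?_) ?_)
    · exact hall P' w (hmem P w hw) (hPP ▸ hc P w hw)
    · rw [(Finset.mem_powersetCard.1 P.2).2, (Finset.mem_powersetCard.1 P'.2).2]
  have hcard : Nat.card {P // P ∈ hfin.toFinset.powersetCard 2} = 6 := by
    rw [Nat.card_eq_fintype_card, Fintype.card_coe, Finset.card_powersetCard, hB]
    rfl
  have : Finite (Sector K v) := Quot.finite _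
  -- A sector touches at most two branch points, so the six pairs of branch points have different
  -- sectors. As there are six sectors in all, pairs and sectors correspond.
  have hbij := hinj.bijective_of_nat_card_le (by rw [h6, hcard])
  constructor
  · intro σ
    obtain ⟨P, rfl⟩ := hbij.2 σ
    obtain ⟨w, x, hwx, hP⟩ := Finset.card_eq_two.1 (Finset.mem_powersetCard.1 P.2).2
    have hw : w ∈ P.1 := by simp [hP]
    have hx : x ∈ P.1 := by simp [hP]
    exact ⟨w, hmem P w hw, x, hmem P x hx, hwx, hc P w hw, hc P x hx⟩
  · intro σ τ w hw x hx hwx h1 h2 h3 h4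
    obtain ⟨P, rfl⟩ := hbij.2 σ
    obtain ⟨P', rfl⟩ := hbij.2 τ
    have key : ∀ P : {P // P ∈ hfin.toFinset.powersetCard 2}, Touches K v (c P) w →
        Touches K v (c P) x → P.1 = {w, x} := by
      intro P hw' hx'
      refine (Finset.eq_of_subset_of_card_le (fun u hu => ?_) ?_).symm
      · rcases Finset.mem_insert.1 hu with rfl | hu
        · exact hall P u hw hw'
        · rw [Finset.mem_singleton.1 hu]
          exact hall P x hx hx'
      · rw [(Finset.mem_powersetCard.1 P.2).2, Finset.card_pair hwx]
    have : P = P' := Subtype.ext ((key P h1 h2).trans (key P' h3 h4).symm)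
    rw [this]

/-- If the two triangles met `w` in opposite directions, the sector would have to arrive at `x` and
at `w` by the same free end. -/
theorem sector_touch_unique (hK : ∀ t ∈ K, t.rot ∈ K) {w x : Pt} (hw : ¬ IsFacetEdge K v w)
    (hx : ¬ IsFacetEdge K v x) (hwx : w ≠ x) {s t : Lk K v} (hst : sec s = sec t)
    (hs : ∃ ε, s.1.tip ε = w) (ht : ∃ ε, t.1.tip ε = w) (h : Touches K v (sec s) x) : s = t := by
  obtain ⟨a, ha⟩ := hs
  obtain ⟨b, hb⟩ := ht
  obtain ⟨r, hr, hr'⟩ := sector_arrive hK hw hx hwx ha h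
  by_cases hab : a = b
  · subst hab
    exact sector_tip_unique hK hst (by rwa [ha]) (by rwa [hb])
  · have hab' : b = !a := by cases a <;> cases b <;> simp_all
    subst hab'
    have := sector_tip_unique hK (hr.trans hst) (by rwa [hr']) (by rwa [hb])
    rw [this, hb] at hr'
    exact absurd hr' hwx

/-- Two arcs of a complete graph on four points that cannot be joined inside `T` are opposite arcs
wx and yz, and `T` contains none of the other four arcs. Then each branch point is the end of
exactly one triangle of `T`, which is the second alternative of `LinkConn`. -/
theorem linkConn_of_singularPoint (H : LinkHyp K v) (h : IsSingularPoint K v) : LinkConn K v := by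
  obtain ⟨h1, h2⟩ := singular_sectors H.rot h
  obtain ⟨h4, -, -, -⟩ := h
  have hnf : ∀ w ∈ branch K v, ¬ IsFacetEdge K v w := fun w hw => IsBindingEdge.not_facet hw
  intro T hT s hs t ht hsv htv hTs hTt
  obtain ⟨w, hw, x, hx, hwx, tw, tx⟩ := h1 (sec ⟨s, hs, hsv⟩)
  obtain ⟨y, hy, z, hz, hyz, ty, tz⟩ := h1 (sec ⟨t, ht, htv⟩)
  have join : ∀ r r' : Lk K v, T r.1 → T r'.1 → ∀ u, Touches K v (sec r) u →
      Touches K v (sec r') u → Relation.ReflTransGen (LinkAdj K v T) r.1 r'.1 := by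
    intro r r' hr hr' u hu hu'
    obtain ⟨a, ha, ε, hε⟩ := touches_iff.1 hu
    obtain ⟨b, hb, δ, hδ⟩ := touches_iff.1 hu'
    have e1 := (hT.iff_of_sec ha).2 hr
    have e2 := (hT.iff_of_sec hb).2 hr'
    exact (hT.conn ha.symm hr).trans ((Relation.ReflTransGen.single
      ⟨⟨a.2.1, a.2.2, e1⟩, ⟨b.2.1, b.2.2, e2⟩, ε, δ, hε.trans hδ.symm⟩).trans (hT.conn hb e2))
  by_cases hcon : Relation.ReflTransGen (LinkAdj K v T) s t
  · exact Or.inl hcon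
  right
  have bridge : ∀ r : Lk K v, T r.1 → ∀ u u', Touches K v (sec ⟨s, hs, hsv⟩) u →
      Touches K v (sec ⟨t, ht, htv⟩) u' → Touches K v (sec r) u → ¬ Touches K v (sec r) u' := by
    intro r hr u u' h3 h4 h5 h6
    exact hcon ((join ⟨s, hs, hsv⟩ r hTs hr u h3 h5).trans (join r ⟨t, ht, htv⟩ hr hTt u' h6 h4))
  have hne : ∀ u, Touches K v (sec ⟨s, hs, hsv⟩) u → ¬ Touches K v (sec ⟨t, ht, htv⟩) u :=
    fun u h3 h5 => hcon (join ⟨s, hs, hsv⟩ ⟨t, ht, htv⟩ hTs hTt u h3 h5)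
  have hwy : w ≠ y := fun e => hne w tw (e ▸ ty)
  have hwz : w ≠ z := fun e => hne w tw (e ▸ tz)
  have hxy : x ≠ y := fun e => hne x tx (e ▸ ty)
  have hxz : x ≠ z := fun e => hne x tx (e ▸ tz)
  have hB : ∀ u ∈ branch K v, u = w ∨ u = x ∨ u = y ∨ u = z := by
    intro u hu
    by_contra! hcon'
    obtain ⟨a1, a2, a3, a4⟩ := hcon'
    have hfin : (branch K v).Finite := Set.finite_of_ncard_ne_zero (by omega)
    have hsub : ({u, w, x, y, z} : Set Pt) ⊆ branch K v := by
      intro i hi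
      simp only [Set.mem_insert_iff, Set.mem_singleton_iff] at hi
      rcases hi with rfl | rfl | rfl | rfl | rfl <;> assumption
    have hc := Set.ncard_le_ncard hsub hfin
    have h5 : ({u, w, x, y, z} : Set Pt).ncard = 5 := by
      have : ({u, w, x, y, z} : Set Pt) = (({u, w, x, y, z} : Finset Pt) : Set Pt) := by simp
      rw [this, Set.ncard_coe_finset]
      simp [Finset.card_insert_of_notMem, *]
    omega
  -- at an end of a sector in `T` there is no other sector in `T`
  have uniq : ∀ (s t : Lk K v) (w x y z : Pt), T s.1 → w ∈ branch K v → x ∈ branch K v →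
      w ≠ x → Touches K v (sec s) w → Touches K v (sec s) x →
      (∀ u ∈ branch K v, u = w ∨ u = x ∨ u = y ∨ u = z) →
      (∀ r : Lk K v, T r.1 → Touches K v (sec r) w → ¬ Touches K v (sec r) y) →
      (∀ r : Lk K v, T r.1 → Touches K v (sec r) w → ¬ Touches K v (sec r) z) →
      IsBindingEdge K v w ∧ ∃! r : Tri, r ∈ K ∧ r.a = v ∧ T r ∧ ∃ ε, r.tip ε = w := by
    intro s t w x y z hs hw hx hwx tw tx hB hy hz
    refine ⟨hw, ?_⟩
    obtain ⟨r, hr, ε, hε⟩ := touches_iff.1 tw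
    refine ⟨r.1, ⟨r.2.1, r.2.2, (hT.iff_of_sec hr).2 hs, ε, hε⟩, ?_⟩
    rintro r' ⟨b1, b2, b3, b4⟩
    have hr'w : Touches K v (sec ⟨r', b1, b2⟩) w := touches_iff.2 ⟨_, rfl, b4⟩
    obtain ⟨i, hi, j, hj, hij, ti, tj⟩ := h1 (sec ⟨r', b1, b2⟩)
    have hx' : Touches K v (sec ⟨r', b1, b2⟩) x := by
      rcases hB i hi with rfl | rfl | rfl | rfl
      · rcases hB j hj with rfl | rfl | rfl | rfl
        · exact absurd rfl hij
        · exact tj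
        · exact absurd tj (hy ⟨r', b1, b2⟩ b3 hr'w)
        · exact absurd tj (hz ⟨r', b1, b2⟩ b3 hr'w)
      · exact ti
      · exact absurd ti (hy ⟨r', b1, b2⟩ b3 hr'w)
      · exact absurd ti (hz ⟨r', b1, b2⟩ b3 hr'w)
    have hsec : sec ⟨r', b1, b2⟩ = sec s := h2 _ _ w hw x hx hwx hr'w hx' tw tx
    exact congrArg Subtype.val (sector_touch_unique H.rot (hnf w hw) (hnf x hx) hwx
      (hsec.trans hr.symm) b4 ⟨ε, hε⟩ hx')
  refine ⟨w, x, y, hwx, hwy, hxy, ?_⟩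
  rintro u (rfl | rfl | rfl)
  · exact uniq ⟨s, hs, hsv⟩ ⟨t, ht, htv⟩ u x y z hTs hw hx hwx tw tx hB
      (fun r hr h3 => bridge r hr _ _ tw ty h3) (fun r hr h3 => bridge r hr _ _ tw tz h3)
  · exact uniq ⟨s, hs, hsv⟩ ⟨t, ht, htv⟩ u w y z hTs hx hw hwx.symm tx tw
      (fun i hi => by rcases hB i hi with h | h | h | h <;> simp [h])
      (fun r hr h3 => bridge r hr _ _ tx ty h3) (fun r hr h3 => bridge r hr _ _ tx tz h3)
  · exact uniq ⟨t, ht, htv⟩ ⟨s, hs, hsv⟩ u z w x hTt hy hz hyz ty tz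
      (fun i hi => by rcases hB i hi with h | h | h | h <;> simp [h])
      (fun r hr h3 h4 => bridge r hr _ _ tw ty h4 h3) (fun r hr h3 h4 => bridge r hr _ _ tx ty h4 h3)

/-- Of three edges of the link at a branch point, two are directed alike and the third is opposite;
the cases of `node` record which one it is. -/
theorem node_of_flow (H : LinkHyp K v) {w : Pt} (hw : IsBindingEdge K v w) {p : Tri → Prop}
    (hp : LocalPigment K v p) {r₁ r₂ r₃ : Lk K v} (h12 : r₁ ≠ r₂) (h13 : r₁ ≠ r₃) (h23 : r₂ ≠ r₃)
    {e₁ e₂ e₃ : Bool} (h1 : r₁.1.tip e₁ = w) (h2 : r₂.1.tip e₂ = w) (h3 : r₃.1.tip e₃ = w) :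
    node e₁ e₂ e₃ (decide (p r₁.1)) (decide (p r₂.1)) (decide (p r₃.1)) := by
  have hm : ∀ {r : Lk K v} {e : Bool}, r.1.tip e = w → r.1 ∈ stub K v w e := fun {r e} h =>
    mem_stub.2 ⟨r.2.1, r.2.2, h⟩
  have hc : ∀ e, (stub K v w e).card ≤ 2 := by
    intro e
    have h1 := H.le3 w
    have h2 := (H.opp w hw)
    have h3 := Finset.card_pos.2 h2.1
    have h4 := Finset.card_pos.2 h2.2
    rw [← card_stub_false H.rot v w, ← stub_true K v w] at *
    cases e <;> omega
  have n12 : r₁.1 ≠ r₂.1 := fun h => h12 (Subtype.ext h)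
  have n13 : r₁.1 ≠ r₃.1 := fun h => h13 (Subtype.ext h)
  have n23 : r₂.1 ≠ r₃.1 := fun h => h23 (Subtype.ext h)
  have hb : ∀ a b : Bool, a ≠ b → b = !a := by decide
  unfold node
  split_ifs with c1 c2
  · subst c1
    have c3 : e₁ ≠ e₃ := by
      intro h
      subst h
      have : 2 < (stub K v w e₁).card :=
        Finset.two_lt_card.2 ⟨_, hm h1, _, hm h2, _, hm h3, n12, n13, n23⟩
      exact absurd (hc e₁) (by omega)
    have h4 := hb _ _ c3
    subst h4
    obtain ⟨f1, f2⟩ := hp.flow w e₁ _ (hm h1) _ (hm h2) _ (hm h3) n12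
    simp [f1]
    tauto
  · subst c2
    have h4 := hb _ _ c1
    subst h4
    obtain ⟨f1, f2⟩ := hp.flow w e₁ _ (hm h1) _ (hm h3) _ (hm h2) n13
    simp [f1]
    tauto
  · have h4 := hb _ _ c1
    have h5 := hb _ _ c2
    subst h4
    subst h5
    obtain ⟨f1, f2⟩ := hp.flow w (!e₁) _ (hm h2) _ (hm h3) r₁.1 (by rw [Bool.not_not]; exact hm h1) n23
    simp [f1]
    tauto

end

end SlFoam

/-! ### Meeting curves at singular points -/

namespace SlFoam

noncomputable section

open scoped Classical

variable {K : Finset Tri} {v : Pt}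

theorem mem_branch_four (h : (branch K v).ncard = 4) {w x y z : Pt} (hw : w ∈ branch K v)
    (hx : x ∈ branch K v) (hy : y ∈ branch K v) (hz : z ∈ branch K v) (hwx : w ≠ x) (hwy : w ≠ y)
    (hwz : w ≠ z) (hxy : x ≠ y) (hxz : x ≠ z) (hyz : y ≠ z) :
    ∀ u ∈ branch K v, u = w ∨ u = x ∨ u = y ∨ u = z := by
  intro u hu
  by_contra! hcon'
  obtain ⟨a1, a2, a3, a4⟩ := hcon'
  have hfin : (branch K v).Finite := Set.finite_of_ncard_ne_zero (by omega)
  have hsub : ({u, w, x, y, z} : Set Pt) ⊆ branch K v := by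
    intro i hi
    simp only [Set.mem_insert_iff, Set.mem_singleton_iff] at hi
    rcases hi with rfl | rfl | rfl | rfl | rfl <;> assumption
  have hc := Set.ncard_le_ncard hsub hfin
  have h5 : ({u, w, x, y, z} : Set Pt).ncard = 5 := by
    have : ({u, w, x, y, z} : Set Pt) = (({u, w, x, y, z} : Finset Pt) : Set Pt) := by simp
    rw [this, Set.ncard_coe_finset]
    simp [Finset.card_insert_of_notMem, *]
  omega

/-- The arcs from w that carry `p` only, `q` only and both run to three other branch points x, y, z.
Conservation of the two pigments there determines the opposite triangle up to the cases of
`node_complete`, and in each of them the pigments separate again at exactly one of x, y, z. The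
tetrahedral cyclic orders compare the two ends. -/
theorem linkMeet_of_singularPoint (H : LinkHyp K v) (hsing : IsSingularPoint K v) :
    LinkMeet K v := by
  obtain ⟨I1, I3⟩ := singular_sectors H.rot hsing
  obtain ⟨h4, -, hpair, hR⟩ := hsing
  have hnf : ∀ w ∈ branch K v, ¬ IsFacetEdge K v w := fun w hw => IsBindingEdge.not_facet hw
  have other : ∀ r : Lk K v, ∀ w, (∃ x ∈ branch K v, x ≠ w ∧ Touches K v (sec r) x) := by
    intro r w
    obtain ⟨i, hi, j, hj, hij, ti, tj⟩ := I1 (sec r)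
    by_cases h : i = w
    · exact ⟨j, hj, fun e => hij (h.trans e.symm), tj⟩
    · exact ⟨i, hi, h, ti⟩
  have tch : ∀ (r s : Lk K v) (w : Pt) (ε : Bool), sec s = sec r → s.1.tip ε = w →
    Touches K v (sec r) w := fun r s w ε h h' => touches_iff.2 ⟨s, h, ε, h'⟩
  have diff : ∀ (r s : Lk K v), ∀ u ∈ branch K v, ∀ u' ∈ branch K v, ∀ u'' ∈ branch K v,
      u ≠ u' → u ≠ u'' → u' ≠ u'' → Touches K v (sec r) u → Touches K v (sec r) u' →
      Touches K v (sec s) u'' → r ≠ s := by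
    intro r s u hu u' hu' u'' hu'' n1 n2 n3 t1 t2 t3 h
    subst h
    rcases touches_le_two H.rot (hnf u hu) (hnf u' hu') (hnf u'' hu'') t1 t2 t3 with e | e | e
    · exact n1 e
    · exact n2 e
    · exact n3 e
  intro p q hp hq w ε f g h hm
  have hw : w ∈ branch K v := hm.binding H
  have hqf := hm.not_qf hq
  have hpg := hm.not_pg hp
  obtain ⟨f1, f2, f3⟩ := mem_stub.1 hm.hf
  obtain ⟨g1, g2, g3⟩ := mem_stub.1 hm.hg
  obtain ⟨h1, h2, h3⟩ := mem_stub.1 hm.hh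
  obtain ⟨F, rfl⟩ : ∃ F : Lk K v, F.1 = f := ⟨⟨f, f1, f2⟩, rfl⟩
  obtain ⟨G, rfl⟩ : ∃ G : Lk K v, G.1 = g := ⟨⟨g, g1, g2⟩, rfl⟩
  obtain ⟨E, rfl⟩ : ∃ E : Lk K v, E.1 = h := ⟨⟨h, h1, h2⟩, rfl⟩
  have pF := hm.pf
  have qG := hm.qg
  have pE := hm.ph
  have qE := hm.qh
  have Fw := tch F F w _ rfl f3
  have Gw := tch G G w _ rfl g3
  have Ew := tch E E w _ rfl h3
  obtain ⟨x, hx, hxw, Fx⟩ := other F w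
  obtain ⟨y, hy, hyw, Gy⟩ := other G w
  obtain ⟨z, hz, hzw, Ez⟩ := other E w
  -- An arc is determined by its two ends, and the pigments distinguish the three arcs at w; so
  -- their far ends differ.
  have hxy : x ≠ y := by
    rintro rfl
    have := I3 _ _ w hw x hx hxw.symm Fw Fx Gw Gy
    exact hpg ((hp.closed.iff_of_sec this).1 pF)
  have hxz : x ≠ z := by
    rintro rfl
    have := I3 _ _ w hw x hx hxw.symm Fw Fx Ew Ez
    exact hqf ((hq.closed.iff_of_sec this).2 qE)
  have hyz : y ≠ z := by
    rintro rfl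
    have := I3 _ _ w hw y hy hyw.symm Gw Gy Ew Ez
    exact hpg ((hp.closed.iff_of_sec this).2 pE)
  have hB := mem_branch_four h4 hw hx hy hz hxw.symm hyw.symm hzw.symm hxy hxz hyz
  obtain ⟨F', sF, tF⟩ := sector_arrive H.rot (hnf w hw) (hnf x hx) hxw.symm f3 Fx
  obtain ⟨G', sG, tG⟩ := sector_arrive H.rot (hnf w hw) (hnf y hy) hyw.symm g3 Gy
  obtain ⟨E', sE, tE⟩ := sector_arrive H.rot (hnf w hw) (hnf z hz) hzw.symm h3 Ez
  rw [Bool.not_not] at tE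
  have getSec : ∀ a ∈ branch K v, ∀ b ∈ branch K v, a ≠ b → ∃ r r' : Lk K v, ∃ δ, sec r' = sec r ∧
      r.1.tip δ = a ∧ r'.1.tip (!δ) = b ∧ Touches K v (sec r) a ∧ Touches K v (sec r) b := by
    intro a ha b hb hab
    obtain ⟨σ, ta, tb⟩ := hpair a ha b hb hab
    obtain ⟨r, hr, δ, hδ⟩ := touches_iff.1 ta
    subst hr
    obtain ⟨r', hr', hδ'⟩ := sector_arrive H.rot (hnf a ha) (hnf b hb) hab hδ tb
    exact ⟨r, r', δ, hr', hδ, hδ', ta, tb⟩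
  obtain ⟨a, a', δ₁, sa, ta, ta', ax, ay⟩ := getSec x hx y hy hxy
  obtain ⟨b, b', δ₂, sb, tb, tb', bx, bz⟩ := getSec x hx z hz hxz
  obtain ⟨c, c', δ₃, sc, tc, tc', cy, cz⟩ := getSec y hy z hz hyz
  have P : ∀ {r s : Lk K v}, sec r = sec s → (p r.1 ↔ p s.1) := fun h => hp.closed.iff_of_sec h
  have Q : ∀ {r s : Lk K v}, sec r = sec s → (q r.1 ↔ q s.1) := fun h => hq.closed.iff_of_sec h
  have Fw' := sF ▸ Fw
  have Fx' := sF ▸ Fx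
  have Gw' := sG ▸ Gw
  have Gy' := sG ▸ Gy
  have Ew' := sE ▸ Ew
  have Ez' := sE ▸ Ez
  have ax' := sa ▸ ax
  have ay' := sa ▸ ay
  have bx' := sb ▸ bx
  have bz' := sb ▸ bz
  have cy' := sc ▸ cy
  have cz' := sc ▸ cz
  -- Conservation at x, y and z. An arc that leaves one end with direction δ arrives at the other
  -- with `!δ`.
  have nx : ∀ {p}, LocalPigment K v p → node (!ε) δ₁ δ₂ (decide (p F'.1)) (decide (p a.1))
      (decide (p b.1)) := fun hp => node_of_flow H hx hp
    (diff _ _ w hw x hx y hy hxw.symm hyw.symm hxy Fw' Fx' ay)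
    (diff _ _ w hw x hx z hz hxw.symm hzw.symm hxz Fw' Fx' bz)
    (diff _ _ x hx y hy z hz hxy hxz hyz ax ay bz) tF ta tb
  have ny : ∀ {p}, LocalPigment K v p → node (!ε) (!δ₁) δ₃ (decide (p G'.1)) (decide (p a'.1))
      (decide (p c.1)) := fun hp => node_of_flow H hy hp
    (diff _ _ w hw y hy x hx hyw.symm hxw.symm hxy.symm Gw' Gy' ax')
    (diff _ _ w hw y hy z hz hyw.symm hzw.symm hyz Gw' Gy' cz)
    (diff _ _ x hx y hy z hz hxy hxz hyz ax' ay' cz) tG ta' tc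
  have nz : ∀ {p}, LocalPigment K v p → node ε (!δ₂) (!δ₃) (decide (p E'.1)) (decide (p b'.1))
      (decide (p c'.1)) := fun hp => node_of_flow H hz hp
    (diff _ _ w hw z hz x hx hzw.symm hxw.symm hxz.symm Ew' Ez' bx')
    (diff _ _ w hw z hz y hy hzw.symm hyw.symm hyz.symm Ew' Ez' cy')
    (diff _ _ x hx z hz y hy hxz hxy hyz.symm bx' bz' cy') tE tb' tc'
  have pF' : p F'.1 := (P sF).2 pF
  have qF' : ¬ q F'.1 := mt (Q sF).1 hqf
  have pG' : ¬ p G'.1 := mt (P sG).1 hpg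
  have qG' : q G'.1 := (Q sG).2 qG
  have pE' : p E'.1 := (P sE).2 pE
  have qE' : q E'.1 := (Q sE).2 qE
  have n1 := nx hp
  have n2 := nx hq
  have n3 := ny hp
  have n4 := ny hq
  have n5 := nz hp
  have n6 := nz hq
  simp only [P sa, P sb, P sc, Q sa, Q sb, Q sc, pF', qF', pG', qG', pE', qE', decide_true,
    decide_false] at n1 n2 n3 n4 n5 n6
  have key := node_complete ε δ₁ δ₂ δ₃ _ _ _ _ _ _ n1 n2 n3 n4 n5 n6
  simp only [decide_eq_true_eq, decide_eq_false_iff_not] at key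
  -- the only points where the pigments may meet
  have meets : ∀ (u : Pt) (r₁ r₂ r₃ : Lk K v),
      (∀ r : Lk K v, Touches K v (sec r) u → sec r = sec r₁ ∨ sec r = sec r₂ ∨ sec r = sec r₃) →
      ∀ ε' f'' g'' h'', Meet K v u ε' p q f'' g'' h'' →
      ((p r₁.1 ∧ ¬ q r₁.1) ∨ (p r₂.1 ∧ ¬ q r₂.1) ∨ (p r₃.1 ∧ ¬ q r₃.1)) ∧
      ((p r₁.1 ∧ q r₁.1) ∨ (p r₂.1 ∧ q r₂.1) ∨ (p r₃.1 ∧ q r₃.1)) := by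
    intro u r₁ r₂ r₃ hr ε' f'' g'' h'' hm'
    obtain ⟨i1, i2, i3⟩ := mem_stub.1 hm'.hf
    obtain ⟨j1, j2, j3⟩ := mem_stub.1 hm'.hh
    have k1 := hm'.not_qf hq
    constructor
    · rcases hr ⟨f'', i1, i2⟩ (tch _ _ u _ rfl i3) with e | e | e
      · exact Or.inl ⟨(P e).1 hm'.pf, mt (Q e).2 k1⟩
      · exact Or.inr (Or.inl ⟨(P e).1 hm'.pf, mt (Q e).2 k1⟩)
      · exact Or.inr (Or.inr ⟨(P e).1 hm'.pf, mt (Q e).2 k1⟩)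
    · rcases hr ⟨h'', j1, j2⟩ (tch _ _ u _ rfl j3) with e | e | e
      · exact Or.inl ⟨(P e).1 hm'.ph, (Q e).1 hm'.qh⟩
      · exact Or.inr (Or.inl ⟨(P e).1 hm'.ph, (Q e).1 hm'.qh⟩)
      · exact Or.inr (Or.inr ⟨(P e).1 hm'.ph, (Q e).1 hm'.qh⟩)
  have mx := meets x F a b fun r hr => by
    obtain ⟨u, hu, hux, tu⟩ := other r x
    rcases hB u hu with rfl | rfl | rfl | rfl
    · exact Or.inl (I3 _ _ u hu x hx hux tu hr Fw Fx)
    · exact absurd rfl hux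
    · exact Or.inr (Or.inl (I3 _ _ u hu x hx hux tu hr ay ax))
    · exact Or.inr (Or.inr (I3 _ _ u hu x hx hux tu hr bz bx))
  have my := meets y G a c fun r hr => by
    obtain ⟨u, hu, huy, tu⟩ := other r y
    rcases hB u hu with rfl | rfl | rfl | rfl
    · exact Or.inl (I3 _ _ u hu y hy huy tu hr Gw Gy)
    · exact Or.inr (Or.inl (I3 _ _ u hu y hy huy tu hr ax ay))
    · exact absurd rfl huy
    · exact Or.inr (Or.inr (I3 _ _ u hu y hy huy tu hr cz cy))
  have mz := meets z E b c fun r hr => by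
    obtain ⟨u, hu, huz, tu⟩ := other r z
    rcases hB u hu with rfl | rfl | rfl | rfl
    · exact Or.inl (I3 _ _ u hu z hz huz tu hr Ew Ez)
    · exact Or.inr (Or.inl (I3 _ _ u hu z hz huz tu hr bx bz))
    · exact Or.inr (Or.inr (I3 _ _ u hu z hz huz tu hr cy cz))
    · exact absurd rfl huz
  have st : ∀ {r : Lk K v} {u e}, r.1.tip e = u → r.1 ∈ stub K v u e := fun {r u e} h =>
    mem_stub.2 ⟨r.2.1, r.2.2, h⟩
  have wF := wing_of_tip f3
  have wG := wing_of_tip g3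
  have wE := wing_of_tip h3
  have wF' := wing_of_tip tF
  have wG' := wing_of_tip tG
  have wE' := wing_of_tip tE
  rw [sF] at wF'
  rw [sG] at wG'
  rw [sE] at wE'
  rw [Bool.not_not] at wE wF' wG'
  -- The curve leaves through x, y or z. At each of the two remaining points either no arc with `p`
  -- alone or no arc with both pigments is present, so `meets` excludes a meeting there.
  rcases key with ⟨k1, k2, k3, k4, k5, k6, k7, k8⟩ | ⟨k1, k2, k3, k4, k5, k6, k7, k8⟩ |
    ⟨k1, k2, k3, k4, k5, k6, k7, k8⟩
  · subst k3; subst k6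
    have wa := wing_of_tip ta
    have wb := wing_of_tip tb
    rw [Bool.not_not] at wa
    refine ⟨x, hxw, F'.1, a.1, b.1, ⟨st tF, st ta, st (by rw [Bool.not_not]; exact tb),
      fun e => k1 (e ▸ pF'), pF', k2, k4, k5⟩, ?_, ?_⟩
    · exact hR w hw x hx y hy z hz hxw.symm hyw.symm hzw.symm hxy hxz hyz _ _ _ _ _ _ _ _ _ _ _
        wF wG Gy wE Ez wF' wb bz wa ay
    · intro u ε' f'' g'' h'' hm'
      rcases hB u (hm'.binding H) with rfl | rfl | rfl | rfl
      · exact Or.inl rfl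
      · exact Or.inr rfl
      · have := my _ _ _ _ hm'; tauto
      · have := mz _ _ _ _ hm'; tauto
  · subst k3; subst k6
    have wa := wing_of_tip ta'
    have wc := wing_of_tip tc
    rw [sa, Bool.not_not] at wa
    refine ⟨y, hyw, a'.1, G'.1, c.1, ⟨st ta', st tG, st (by rw [Bool.not_not]; exact tc),
      fun e => pG' (e ▸ (P sa).2 k1), (P sa).2 k1, qG', k4, k5⟩, ?_, ?_⟩
    · have := hR w hw y hy z hz x hx hyw.symm hzw.symm hxw.symm hyz hxy.symm hxz.symm
        _ _ _ _ _ _ _ _ _ _ _ wG wE Ez wF Fx wG' wa ax wc cz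
      rw [rightHanded_cycle, this, rightHanded_cycle]
    · intro u ε' f'' g'' h'' hm'
      rcases hB u (hm'.binding H) with rfl | rfl | rfl | rfl
      · exact Or.inl rfl
      · have := mx _ _ _ _ hm'; tauto
      · exact Or.inr rfl
      · have := mz _ _ _ _ hm'; tauto
  · subst k3; subst k6
    have wb := wing_of_tip tb'
    have wc := wing_of_tip tc'
    rw [sb, Bool.not_not] at wb
    rw [sc, Bool.not_not] at wc
    refine ⟨z, hzw, b'.1, c'.1, E'.1, ⟨st tb', st tc', st (by rw [Bool.not_not]; exact tE),
      fun e => k4 ((P sc).1 (e ▸ (P sb).2 k1)), (P sb).2 k1, (Q sc).2 k5, pE', qE'⟩, ?_, ?_⟩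
    · have := hR w hw z hz x hx y hy hzw.symm hxw.symm hyw.symm hxz.symm hyz.symm hxy
        _ _ _ _ _ _ _ _ _ _ _ wE wF Fx wG Gy wE' wc cy wb bx
      rw [← rightHanded_cycle, this, rightHanded_cycle, rightHanded_cycle]
    · intro u ε' f'' g'' h'' hm'
      rcases hB u (hm'.binding H) with rfl | rfl | rfl | rfl
      · exact Or.inl rfl
      · have := mx _ _ _ _ hm'; tauto
      · have := my _ _ _ _ hm'; tauto
      · exact Or.inr rfl

end

end SlFoam

namespace SlFoam

noncomputable section

open scoped Classical

/-! ## Cyclic orders around an edge -/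

theorem triple_eq (x y z : Pt) : triple x y z =
    x 0 * y 1 * z 2 - x 0 * y 2 * z 1 - x 1 * y 0 * z 2 + x 1 * y 2 * z 0 + x 2 * y 0 * z 1
      - x 2 * y 1 * z 0 := by
  simp [triple, Matrix.det_fin_three]

theorem triple_swap (x y z : Pt) : triple x z y = - triple x y z := by
  rw [triple_eq, triple_eq]; ring

theorem triple_comb (x y z : Pt) (s t : ℝ) :
    triple x (s • x + t • y) z = t * triple x y z := by
  simp only [triple_eq, Pi.add_apply, Pi.smul_apply, smul_eq_mul]; ring

theorem triple_bar (a b u w : Pt) : triple (bar b - bar a) (bar u - bar a) (bar w - bar a) =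
    - triple (b - a) (u - a) (w - a) := by
  simp [triple_eq, bar]; ring

theorem triple_reverse (a b u w : Pt) : triple (a - b) (u - b) (w - b) =
    - triple (b - a) (u - a) (w - a) := by
  simp only [triple_eq, Pi.sub_apply]; ring

theorem rightHanded_bar {a b u v w : Pt} :
    RightHanded (bar a) (bar b) (bar u) (bar v) (bar w) ↔ RightHanded a b w v u := by
  simp only [RightHanded, triple_bar, ← triple_swap]
  tauto

theorem rightHanded_reverse {a b u v w : Pt} : RightHanded b a u v w ↔ RightHanded a b w v u := by
  simp only [RightHanded, triple_reverse a b, ← triple_swap]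
  tauto

/-- Two half-planes bounded by a line `ab` are different. -/
def Apart (a b u w : Pt) : Prop :=
  triple (b - a) (u - a) (w - a) = 0 → ∃ s t : ℝ, t < 0 ∧ u - a = s • (b - a) + t • (w - a)

/-- Let p, q, r be the three consecutive determinants. One order asks for two positive ones, the
reversed order for two negative ones. Exactly one holds because a vanishing determinant means
opposite half-planes, and then the other two are nonzero of equal sign. -/
theorem rightHanded_iff_not {a b u v w : Pt} (h1 : Apart a b u v) (h2 : Apart a b v w)
    (h3 : Apart a b w u) (h0 : ∀ c : ℝ, u - a ≠ c • (b - a)) :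
    RightHanded a b u v w ↔ ¬ RightHanded a b w v u := by
  unfold RightHanded
  rw [triple_swap (b - a) (v - a) (w - a), triple_swap (b - a) (u - a) (v - a),
    triple_swap (b - a) (w - a) (u - a)]
  have k1 : triple (b - a) (u - a) (v - a) = 0 → ∃ t : ℝ, t < 0 ∧
      triple (b - a) (w - a) (u - a) = - (t * triple (b - a) (v - a) (w - a)) := by
    intro h
    obtain ⟨s, t, ht, he⟩ := h1 h
    exact ⟨t, ht, by rw [triple_swap, he, triple_comb]⟩
  have k2 : triple (b - a) (v - a) (w - a) = 0 → ∃ t : ℝ, t < 0 ∧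
      triple (b - a) (u - a) (v - a) = - (t * triple (b - a) (w - a) (u - a)) := by
    intro h
    obtain ⟨s, t, ht, he⟩ := h2 h
    exact ⟨t, ht, by rw [triple_swap, he, triple_comb]⟩
  have k3 : triple (b - a) (w - a) (u - a) = 0 → ∃ t : ℝ, t < 0 ∧
      triple (b - a) (v - a) (w - a) = - (t * triple (b - a) (u - a) (v - a)) := by
    intro h
    obtain ⟨s, t, ht, he⟩ := h3 h
    exact ⟨t, ht, by rw [triple_swap, he, triple_comb]⟩
  -- If two determinants vanish, so does the third, and each half-plane is opposite to the next one.
  -- Going round once multiplies u - a, modulo the direction of the edge, by a product of three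
  -- negative numbers; this puts u on the line ab, against `h0`.
  have k4 : ¬ (triple (b - a) (u - a) (v - a) = 0 ∧ triple (b - a) (v - a) (w - a) = 0) := by
    rintro ⟨z1, z2⟩
    obtain ⟨s, t, ht, he⟩ := h1 z1
    obtain ⟨s', t', ht', he'⟩ := h2 z2
    have z3 : triple (b - a) (w - a) (u - a) = 0 := by
      obtain ⟨t, -, h⟩ := k1 z1
      rw [h, z2]; ring
    obtain ⟨s'', t'', ht'', he''⟩ := h3 z3
    have e : (1 - t * t' * t'') • (u - a) = (s + t * s' + t * t' * s'') • (b - a) := by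
      have e1 : u - a = s • (b - a) + t • (s' • (b - a) + t' • (s'' • (b - a) + t'' • (u - a))) := by
        rw [← he'', ← he', ← he]
      have e2 : (1 - t * t' * t'') • (u - a) = (u - a) - (t * t' * t'') • (u - a) := by
        rw [sub_smul, one_smul]
      rw [e2]
      nth_rewrite 1 [e1]
      ext i
      simp only [Pi.add_apply, Pi.sub_apply, Pi.smul_apply, smul_eq_mul]
      ring
    have hpos : 0 < 1 - t * t' * t'' := by
      have := mul_pos_of_neg_of_neg ht ht'
      nlinarith [mul_neg_of_pos_of_neg this ht'']
    refine h0 ((1 - t * t' * t'')⁻¹ * (s + t * s' + t * t' * s'')) ?_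
    rw [mul_smul, ← e, smul_smul, inv_mul_cancel₀ hpos.ne', one_smul]
  generalize triple (b - a) (u - a) (v - a) = p at *
  generalize triple (b - a) (v - a) (w - a) = q at *
  generalize triple (b - a) (w - a) (u - a) = r at *
  have sgn : ∀ t x : ℝ, t < 0 → x ≠ 0 → (0 < x ∧ 0 < -(t * x)) ∨ (x < 0 ∧ -(t * x) < 0) := by
    intro t x ht hx
    rcases lt_or_gt_of_ne hx with h | h
    · right; exact ⟨h, by have := mul_pos_of_neg_of_neg ht h; linarith⟩
    · left; exact ⟨h, by have := mul_neg_of_neg_of_pos ht h; linarith⟩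
  have m1 : p = 0 → (0 < q ∧ 0 < r) ∨ (q < 0 ∧ r < 0) := by
    intro h
    obtain ⟨t, ht, rfl⟩ := k1 h
    exact sgn t q ht fun hq => k4 ⟨h, hq⟩
  have m2 : q = 0 → (0 < r ∧ 0 < p) ∨ (r < 0 ∧ p < 0) := by
    intro h
    obtain ⟨t, ht, hp⟩ := k2 h
    rw [hp]
    exact sgn t r ht fun hr => k4 ⟨by rw [hp, hr]; ring, h⟩
  have m3 : r = 0 → (0 < p ∧ 0 < q) ∨ (p < 0 ∧ q < 0) := by
    intro h
    obtain ⟨t, ht, hq⟩ := k3 h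
    rw [hq]
    exact sgn t p ht fun hp => k4 ⟨hp, by rw [hq, hp]; ring⟩
  simp only [Left.neg_pos_iff]
  clear k1 k2 k3 k4 h1 h2 h3
  rcases lt_trichotomy p 0 with hp | hp | hp <;> rcases lt_trichotomy q 0 with hq | hq | hq <;>
    rcases lt_trichotomy r 0 with hr | hr | hr <;> grind

theorem triple_eq_zero_dep {x y z : Pt} (h : triple x y z = 0) :
    ∃ c₀ c₁ c₂ : ℝ, (c₀ ≠ 0 ∨ c₁ ≠ 0 ∨ c₂ ≠ 0) ∧ c₀ • x + c₁ • y + c₂ • z = 0 := by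
  obtain ⟨c, hc, hc0⟩ := Matrix.exists_vecMul_eq_zero_iff.2 h
  refine ⟨c 0, c 1, c 2, ?_, ?_⟩
  · by_contra! hcon
    exact hc (funext fun i => by fin_cases i; exacts [hcon.1, hcon.2.1, hcon.2.2])
  · ext i
    have := congrFun hc0 i
    simp [Matrix.vecMul, dotProduct, Fin.sum_univ_three] at this
    simp only [Pi.add_apply, Pi.smul_apply, smul_eq_mul, Pi.zero_apply]
    linarith

/-- Two nondegenerate triangles that meet only in their common edge lie in different
half-planes. -/
theorem apart_of_hulls {a b u w : Pt} (hu : LinearIndependent ℝ ![b - a, u - a])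
    (hw : LinearIndependent ℝ ![b - a, w - a])
    (h : convexHull ℝ {a, b, u} ∩ convexHull ℝ {a, b, w} ⊆ convexHull ℝ ({a, b} : Set Pt)) :
    Apart a b u w := by
  intro h0
  rw [LinearIndependent.pair_iff] at hu hw
  obtain ⟨c₀, c₁, c₂, hc, he⟩ := triple_eq_zero_dep h0
  have hc1 : c₁ ≠ 0 := by
    rintro rfl
    have := hw c₀ c₂ (by rw [← he]; simp)
    simp [this] at hc
  have hc2 : c₂ ≠ 0 := by
    rintro rfl
    have := hu c₀ c₁ (by rw [← he]; simp)
    exact hc1 this.2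
  refine ⟨-c₀ / c₁, -c₂ / c₁, ?_, ?_⟩
  swap
  · ext i
    have := congrFun he i
    simp only [Pi.add_apply, Pi.smul_apply, smul_eq_mul, Pi.zero_apply] at this ⊢
    field_simp
    linarith
  by_contra! ht
  obtain ⟨s, hs⟩ : ∃ s, s = -c₀ / c₁ := ⟨_, rfl⟩
  obtain ⟨t, htt⟩ : ∃ t, t = -c₂ / c₁ := ⟨_, rfl⟩
  have hu' : u - a = s • (b - a) + t • (w - a) := by
    ext i
    have := congrFun he i
    simp only [Pi.add_apply, Pi.smul_apply, smul_eq_mul, Pi.zero_apply] at this ⊢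
    rw [hs, htt]
    field_simp
    linarith
  rw [← htt] at ht
  -- With t ≥ 0 both triangles lie on the same side of ab. For β this small the point a + (b - a)/2
  -- + β(u - a) has nonnegative barycentric coordinates in both of them.
  obtain ⟨β, hβ, hβ1, hβ2⟩ : ∃ β : ℝ, 0 < β ∧ β ≤ 1 / 2 ∧ β * (|s| + t) ≤ 1 / 2 := by
    refine ⟨1 / (2 * (1 + |s| + t)), by positivity, ?_, ?_⟩
    · rw [div_le_div_iff₀ (by positivity) (by norm_num)]
      have := abs_nonneg s
      linarith
    · rw [div_mul_eq_mul_div, one_mul, div_le_div_iff₀ (by positivity) (by norm_num)]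
      have := abs_nonneg s
      linarith
  have hx1 : a + (1 / 2 : ℝ) • (b - a) + β • (u - a) ∈ convexHull ℝ ({a, b, u} : Set Pt) := by
    have : a + (1 / 2 : ℝ) • (b - a) + β • (u - a) = (1 / 2 - β) • a + (1 / 2 : ℝ) • b + β • u := by
      ext i; simp; ring
    rw [this]
    exact (by
      have hm := (convex_convexHull ℝ ({a, b, u} : Set Pt)).sum_mem (t := (Finset.univ : Finset (Fin 3))) (w := ![1 / 2 - β, 1 / 2, β])
        (z := ![a, b, u]) (by intro i _; fin_cases i <;> simp <;> linarith)
        (by simp [Fin.sum_univ_three]; ring)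
        (by intro i _; fin_cases i <;> exact subset_convexHull ℝ _ (by simp))
      simpa [Fin.sum_univ_three] using hm)
  have hsl : -|s| ≤ s := neg_abs_le s
  have hsu : s ≤ |s| := le_abs_self s
  have hβs : β * s ≤ β * |s| := by gcongr
  have hβs' : -(β * |s|) ≤ β * s := by
    have := mul_le_mul_of_nonneg_left hsl hβ.le
    linarith
  have hβt : 0 ≤ β * t := by positivity
  have hx2 : a + (1 / 2 : ℝ) • (b - a) + β • (u - a) ∈ convexHull ℝ ({a, b, w} : Set Pt) := by
    have : a + (1 / 2 : ℝ) • (b - a) + β • (u - a) =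
        (1 - (1 / 2 + β * s) - β * t) • a + (1 / 2 + β * s) • b + (β * t) • w := by
      rw [hu']; ext i; simp; ring
    rw [this]
    exact (by
      have hm := (convex_convexHull ℝ ({a, b, w} : Set Pt)).sum_mem (t := (Finset.univ : Finset (Fin 3)))
        (w := ![1 - (1 / 2 + β * s) - β * t, 1 / 2 + β * s, β * t])
        (z := ![a, b, w]) (by intro i _; fin_cases i <;> simp <;> nlinarith)
        (by simp [Fin.sum_univ_three]; ring)
        (by intro i _; fin_cases i <;> exact subset_convexHull ℝ _ (by simp))
      simpa [Fin.sum_univ_three] using hm)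
  have hx := h ⟨hx1, hx2⟩
  rw [convexHull_pair, segment_eq_image'] at hx
  obtain ⟨θ, -, hθ⟩ := hx
  -- Since the common point lies on the segment ab, independence of b - a and u - a forces β = 0.
  have := hu (1 / 2 - θ) β (by
    have e : (1 / 2 : ℝ) • (b - a) + β • (u - a) = θ • (b - a) := by
      rw [add_assoc] at hθ
      exact (add_left_cancel hθ).symm
    rw [sub_smul, ← e]
    abel)
  exact hβ.ne' this.2

end

end SlFoam

namespace SlFoam

noncomputable section

open scoped Classical

variable {K L : Finset Tri} {v : Pt}

/-! ## Links and changes of the complex -/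

/-- Two complexes have the same triangles at `v`. -/
structure SameAt (K L : Finset Tri) (v : Pt) : Prop where
  fst : ∀ w, dir K v w = dir L v w
  snd : ∀ w, dir K w v = dir L w v

theorem SameAt.mem (h : SameAt K L v) {t : Tri} (ht : t.a = v) : t ∈ K ↔ t ∈ L := by
  have := Finset.ext_iff.1 (h.fst t.b) t
  simpa [mem_dir, ht] using this

theorem SameAt.mem' (h : SameAt K L v) {t : Tri} : t ∈ K ∧ t.a = v ↔ t ∈ L ∧ t.a = v :=
  ⟨fun ht => ⟨(h.mem ht.2).1 ht.1, ht.2⟩, fun ht => ⟨(h.mem ht.2).2 ht.1, ht.2⟩⟩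

theorem SameAt.facet (h : SameAt K L v) (w : Pt) : IsFacetEdge K v w ↔ IsFacetEdge L v w := by
  rw [IsFacetEdge, IsFacetEdge, h.fst, h.snd]

theorem SameAt.binding (h : SameAt K L v) (w : Pt) : IsBindingEdge K v w ↔ IsBindingEdge L v w := by
  rw [IsBindingEdge, IsBindingEdge, h.fst, h.snd]

theorem SameAt.stub_eq (h : SameAt K L v) (w : Pt) (ε : Bool) : stub K v w ε = stub L v w ε := by
  ext t
  rw [mem_stub, mem_stub, ← and_assoc, ← and_assoc, h.mem']

theorem SameAt.sectorClosed (h : SameAt K L v) {T : Tri → Prop} (hT : SectorClosed L v T) :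
    SectorClosed K v T := fun s hs t ht hsv htv hst hf =>
  hT s ((h.mem hsv).1 hs) t ((h.mem htv).1 ht) hsv htv hst ((h.facet _).1 hf)

theorem SameAt.localPigment (h : SameAt K L v) {p : Tri → Prop} (hp : LocalPigment L v p) :
    LocalPigment K v p :=
  ⟨h.sectorClosed hp.closed, by simpa only [h.stub_eq] using hp.flow⟩

theorem SameAt.symm (h : SameAt K L v) : SameAt L K v := ⟨fun w => (h.fst w).symm, fun w => (h.snd w).symm⟩

theorem SameAt.meet (h : SameAt K L v) {w : Pt} {ε : Bool} {p q : Tri → Prop} {f g k : Tri}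
    (m : Meet K v w ε p q f g k) : Meet L v w ε p q f g k :=
  ⟨h.stub_eq w ε ▸ m.hf, h.stub_eq w ε ▸ m.hg, h.stub_eq w _ ▸ m.hh, m.ne, m.pf, m.qg, m.ph, m.qh⟩

theorem SameAt.linkConn (h : SameAt K L v) (hK : LinkConn K v) : LinkConn L v := by
  intro T hT s hs t ht hsv htv hTs hTt
  rcases hK T (h.sectorClosed hT) s ((h.mem hsv).2 hs) t ((h.mem htv).2 ht) hsv htv hTs hTt with
    h1 | ⟨w₁, w₂, w₃, h1, h2, h3, h4⟩
  · refine Or.inl (Relation.ReflTransGen.mono ?_ _ _ h1)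
    rintro x y ⟨⟨x1, x2, x3⟩, ⟨y1, y2, y3⟩, e⟩
    exact ⟨⟨(h.mem x2).1 x1, x2, x3⟩, ⟨(h.mem y2).1 y1, y2, y3⟩, e⟩
  · refine Or.inr ⟨w₁, w₂, w₃, h1, h2, h3, fun w hw => ?_⟩
    obtain ⟨h5, r, ⟨r1, r2, r3⟩, r4⟩ := h4 w hw
    refine ⟨(h.binding w).1 h5, r, ⟨(h.mem r2).1 r1, r2, r3⟩, ?_⟩
    rintro r' ⟨r5, r6, r7⟩
    exact r4 r' ⟨(h.mem r6).2 r5, r6, r7⟩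

theorem SameAt.linkMeet (h : SameAt K L v) (hK : LinkMeet K v) : LinkMeet L v := by
  intro p q hp hq w ε f g k m
  obtain ⟨x, hx, f', g', h', m', hR, hu⟩ :=
    hK p q (h.localPigment hp) (h.localPigment hq) w ε f g k (h.symm.meet m)
  exact ⟨x, hx, f', g', h', h.meet m', hR, fun y ε' f'' g'' h'' m'' =>
    hu y ε' f'' g'' h'' (h.symm.meet m'')⟩

/-! ## Links and mirror images -/

/-- The mirror image of a triangle, written from the image of the first vertex on. -/
def Tri.flip (t : Tri) : Tri := ⟨bar t.a, bar t.c, bar t.b, t.lab⟩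

@[simp] theorem Tri.flip_flip (t : Tri) : t.flip.flip = t := by
  cases t; simp [Tri.flip]


@[simp] theorem Tri.flip_tip (t : Tri) (ε : Bool) : t.flip.tip ε = bar (t.tip !ε) := by
  cases ε <;> rfl

theorem bar_eq_iff {a b : Pt} : bar a = b ↔ a = bar b :=
  ⟨fun h => by rw [← h, bar_bar], fun h => by rw [h, bar_bar]⟩

/-- Two complexes are mirror images of each other. -/
structure Mirrored (K L : Finset Tri) : Prop where
  mem : ∀ t, t ∈ L ↔ t.mirror ∈ K
  rotK : ∀ t ∈ K, t.rot ∈ K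
  rotL : ∀ t ∈ L, t.rot ∈ L

theorem Mirrored.symm (h : Mirrored K L) : Mirrored L K :=
  ⟨fun t => by rw [h.mem, mirror_mirror], h.rotL, h.rotK⟩

theorem Mirrored.flip_mem (h : Mirrored K L) {t : Tri} (ht : t ∈ K) : t.flip ∈ L :=
  h.rotL t.mirror ((h.mem _).2 (by simpa using ht))

theorem Mirrored.dir_eq (h : Mirrored K L) (a b : Pt) :
    dir L (bar b) (bar a) = (dir K a b).image Tri.mirror := by
  ext t
  simp only [mem_dir, Finset.mem_image]
  constructor
  · rintro ⟨h1, h2, h3⟩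
    exact ⟨t.mirror, ⟨(h.mem t).1 h1, by simp [Tri.mirror, h3], by simp [Tri.mirror, h2]⟩,
      mirror_mirror t⟩
  · rintro ⟨s, ⟨h1, rfl, rfl⟩, rfl⟩
    exact ⟨(h.mem _).2 (by simpa using h1), rfl, rfl⟩

theorem Mirrored.card_dir (h : Mirrored K L) (a b : Pt) :
    (dir L (bar b) (bar a)).card = (dir K a b).card := by
  rw [h.dir_eq, Finset.card_image_of_injective _ mirror_injective]

theorem Mirrored.facet (h : Mirrored K L) {a b : Pt} (hf : IsFacetEdge K a b) :
    IsFacetEdge L (bar a) (bar b) :=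
  ⟨(h.card_dir b a).trans hf.2, (h.card_dir a b).trans hf.1⟩

theorem Mirrored.binding (h : Mirrored K L) {a b : Pt} (hf : IsBindingEdge K a b) :
    IsBindingEdge L (bar a) (bar b) := by
  unfold IsBindingEdge at *
  rw [h.card_dir b a, h.card_dir a b]; omega

theorem Mirrored.flip_mem_stub (h : Mirrored K L) {w : Pt} {ε : Bool} {t : Tri}
    (ht : t ∈ stub K v w ε) : t.flip ∈ stub L (bar v) (bar w) !ε := by
  obtain ⟨h1, rfl, rfl⟩ := mem_stub.1 ht
  exact mem_stub.2 ⟨h.flip_mem h1, rfl, by simp⟩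

theorem Mirrored.sectorClosed (h : Mirrored K L) {T : Tri → Prop}
    (hT : SectorClosed L (bar v) T) : SectorClosed K v fun t => T t.flip := by
  rintro s hs t ht rfl htv hst hf
  refine (hT t.flip (h.flip_mem ht) s.flip (h.flip_mem hs) (congrArg bar htv) rfl
    (congrArg bar hst.symm) ?_).symm
  change IsFacetEdge L _ (bar t.b)
  rw [← hst]
  exact h.facet hf

theorem Mirrored.localPigment (h : Mirrored K L) {p : Tri → Prop}
    (hp : LocalPigment L (bar v) p) : LocalPigment K v fun t => p t.flip := by
  refine ⟨h.sectorClosed hp.closed, ?_⟩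
  intro w ε f hf g hg k hk hne
  refine hp.flow (bar w) (!ε) _ (h.flip_mem_stub hf) _ (h.flip_mem_stub hg) _ ?_ fun e => hne ?_
  · have := h.flip_mem_stub hk
    simpa using this
  · rw [← f.flip_flip, e, g.flip_flip]

theorem Mirrored.meet (h : Mirrored K L) {w : Pt} {ε : Bool} {p q : Tri → Prop} {f g k : Tri}
    (m : Meet K v w ε (fun t => p t.flip) (fun t => q t.flip) f g k) :
    Meet L (bar v) (bar w) (!ε) p q f.flip g.flip k.flip :=
  ⟨h.flip_mem_stub m.hf, h.flip_mem_stub m.hg, h.flip_mem_stub m.hh,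
    fun e => m.ne (by rw [← f.flip_flip, e, g.flip_flip]), m.pf, m.qg, m.ph, m.qh⟩

theorem Mirrored.meet' (h : Mirrored K L) {w : Pt} {ε : Bool} {p q : Tri → Prop} {f g k : Tri}
    (m : Meet L (bar v) w ε p q f g k) :
    Meet K v (bar w) (!ε) (fun t => p t.flip) (fun t => q t.flip) f.flip g.flip k.flip := by
  have := h.symm.meet (v := bar v) (w := w) (ε := ε) (p := fun t => p t.flip)
    (q := fun t => q t.flip) (f := f) (g := g) (k := k) (by simpa using m)
  simpa using this

theorem Mirrored.linkAdj (h : Mirrored K L) {T : Tri → Prop} {s t : Tri}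
    (hst : LinkAdj K v (fun t => T t.flip) s t) : LinkAdj L (bar v) T s.flip t.flip := by
  obtain ⟨⟨h1, h2, h3⟩, ⟨h4, h5, h6⟩, ε, δ, h7⟩ := hst
  exact ⟨⟨h.flip_mem h1, congrArg bar h2, h3⟩, ⟨h.flip_mem h4, congrArg bar h5, h6⟩, !ε, !δ,
    by simp [h7]⟩

theorem Mirrored.linkConn (h : Mirrored K L) (hK : LinkConn K v) : LinkConn L (bar v) := by
  intro T hT s hs t ht hsv htv hTs hTt
  rcases hK _ (h.sectorClosed hT) s.flip (h.symm.flip_mem hs) t.flip (h.symm.flip_mem ht)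
    (bar_eq_iff.2 hsv) (bar_eq_iff.2 htv) (by simpa using hTs) (by simpa using hTt) with
    h1 | ⟨w₁, w₂, w₃, h1, h2, h3, h4⟩
  · left
    have := h1.lift (p := LinkAdj L (bar v) T) Tri.flip fun a b hab => h.linkAdj hab
    simpa [Function.onFun] using this
  · have hb : Function.Injective bar := Function.LeftInverse.injective bar_bar
    refine Or.inr ⟨bar w₁, bar w₂, bar w₃, hb.ne h1, hb.ne h2, hb.ne h3, fun w hw => ?_⟩
    obtain ⟨h5, r, ⟨r1, r2, r3, ε, r5⟩, r4⟩ := h4 (bar w) (by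
      rcases hw with rfl | rfl | rfl <;> simp)
    refine ⟨by simpa using h.binding h5, r.flip, ⟨h.flip_mem r1, congrArg bar r2, r3, !ε,
      by simp [r5]⟩, ?_⟩
    rintro r' ⟨r6, r7, r8, δ, r9⟩
    rw [← r4 r'.flip ⟨h.symm.flip_mem r6, bar_eq_iff.2 r7, by simpa using r8, !δ, by simp [r9]⟩,
      Tri.flip_flip]

/-- The meeting curve of two pigments that passes through the edge `vw` passes straight through
`v`. -/
def LinkMeetAt (K : Finset Tri) (v w : Pt) : Prop :=
  ∀ p q, LocalPigment K v p → LocalPigment K v q → ∀ ε f g h, Meet K v w ε p q f g h →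
    ∃ x ≠ w, ∃ f' g' h', Meet K v x (!ε) p q f' g' h' ∧
      (RightHanded v w (f.tip !ε) (g.tip !ε) (h.tip ε) ↔
        RightHanded v x (f'.tip ε) (h'.tip !ε) (g'.tip ε)) ∧
      ∀ y ε' f'' g'' h'', Meet K v y ε' p q f'' g'' h'' → y = w ∨ y = x

theorem Meet.swap {w : Pt} {ε : Bool} {p q : Tri → Prop} {f g h : Tri}
    (m : Meet K v w ε p q f g h) : Meet K v w ε q p g f h :=
  ⟨m.hg, m.hf, m.hh, m.ne.symm, m.qg, m.pf, m.qh, m.ph⟩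

/-- Reflection reverses cyclic orders, and so does exchanging the two pigments. The property of `K`
is therefore applied to the pair (q, p), and the two reversals cancel. -/
theorem Mirrored.linkMeetAt (h : Mirrored K L) {w : Pt} (hK : LinkMeetAt K v (bar w)) :
    LinkMeetAt L (bar v) w := by
  intro p q hp hq ε f g k m
  obtain ⟨x, hx, f', g', h', m', hR, hu⟩ :=
    hK _ _ (h.localPigment hq) (h.localPigment hp) _ _ _ _ (h.meet' m.swap)
  refine ⟨bar x, fun e => hx (bar_eq_iff.1 e), g'.flip, f'.flip, h'.flip, ?_, ?_, ?_⟩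
  · have := h.meet m'.swap
    simpa using this
  · simp only [Tri.flip_tip, Bool.not_not] at hR ⊢
    rw [rightHanded_bar]
    have e := rightHanded_bar (a := bar v) (b := w) (u := g.tip !ε) (v := f.tip !ε) (w := k.tip ε)
    rw [bar_bar] at e
    rw [← rightHanded_cycle, ← e, hR]
  · intro y ε' f'' g'' h'' m''
    rcases hu _ _ _ _ _ (h.meet' m''.swap) with e | e
    · exact Or.inl (by rw [← bar_bar y, e, bar_bar])
    · exact Or.inr (by rw [← bar_bar y, e])

end

end SlFoam

namespace SlFoam

noncomputable section

open scoped Classical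

/-! ## Gluing two foams -/

/-- The conditions on the edges of a closed foam. -/
structure EdgeHyp (K : Finset Tri) : Prop where
  rot : ∀ t ∈ K, t.rot ∈ K
  ne : ∀ t ∈ K, t.a ≠ t.b
  opp : ∀ t ∈ K, (dir K t.b t.a).Nonempty
  le3 : ∀ a b, (dir K a b).card + (dir K b a).card ≤ 3
  lab : ∀ a b, ∑ s ∈ dir K a b, s.lab = ∑ s ∈ dir K b a, s.lab

/-- A triangulated closed foam. -/
structure ClosedFoam (K : Finset Tri) : Prop extends EdgeHyp K where
  hand : ∀ a b, ∀ f ∈ dir K a b, ∀ g ∈ dir K a b, ∀ h ∈ dir K b a, f ≠ g →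
    (LeftHanded a b f.c g.c h.c ↔ ¬ LeftHanded a b g.c f.c h.c)
  conn : ∀ t ∈ K, LinkConn K t.a
  meet : ∀ t ∈ K, LinkMeet K t.a

theorem EdgeHyp.link {K : Finset Tri} (H : EdgeHyp K) (v : Pt) : LinkHyp K v := by
  refine ⟨H.rot, fun t ht => H.ne _ (H.rot t ht), H.le3 v, fun w hw => ?_⟩
  have key : ∀ a b, (dir K a b).Nonempty → (dir K b a).Nonempty := by
    rintro a b ⟨t, ht⟩
    obtain ⟨h1, rfl, rfl⟩ := mem_dir.1 ht
    exact H.opp t h1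
  by_cases h : (dir K v w).Nonempty
  · exact ⟨h, key _ _ h⟩
  · have h' : (dir K w v).Nonempty := by
      rw [Finset.not_nonempty_iff_eq_empty] at h
      unfold IsBindingEdge at hw
      rw [h, Finset.card_empty, zero_add] at hw
      exact Finset.card_pos.1 (by omega)
    exact ⟨key _ _ h', h'⟩

theorem SameAt.linkHyp {K L : Finset Tri} {v : Pt} (h : SameAt K L v) (H : LinkHyp K v)
    (hr : ∀ t ∈ L, t.rot ∈ L) (hne : ∀ t ∈ L, t.b ≠ t.c) : LinkHyp L v := by
  refine ⟨hr, hne, fun w => ?_, fun w hw => ?_⟩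
  · rw [← h.fst, ← h.snd]; exact H.le3 w
  · rw [← h.fst, ← h.snd]; exact H.opp w ((h.binding w).2 hw)

variable {N : ℕ} {Γ : MOYGraph N}

theorem Foam.ne (F : Foam Γ) {t : Tri} (ht : t ∈ F.tri) : t.a ≠ t.b := fun h => by
  have := (F.nondegenerate t ht).injective (a₁ := 0) (a₂ := 1) h
  simp at this

theorem glue_mirrored (F G : Foam Γ) : Mirrored (glue G F) (glue F G) := by
  have hr : ∀ F G : Foam Γ, ∀ t ∈ glue F G, t.rot ∈ glue F G := by
    intro F G t ht
    rcases mem_glue.1 ht with h | h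
    · exact mem_glue.2 (Or.inl (F.rot_mem t h))
    · exact mem_glue.2 (Or.inr (G.rot_mem _ (G.rot_mem _ h)))
  refine ⟨fun t => ?_, hr G F, hr F G⟩
  rw [mem_glue, mem_glue, mirror_mirror, or_comm]

theorem mem_dir_glue {F G : Foam Γ} {a b : Pt} {t : Tri} :
    t ∈ dir (glue F G) a b ↔ t ∈ dir F.tri a b ∨ t.mirror ∈ dir G.tri (bar b) (bar a) := by
  simp only [mem_dir, mem_glue, Tri.mirror]
  constructor
  · rintro ⟨h1 | h1, rfl, rfl⟩
    · exact Or.inl ⟨h1, rfl, rfl⟩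
    · exact Or.inr ⟨h1, rfl, rfl⟩
  · rintro (⟨h1, h2, h3⟩ | ⟨h1, h2, h3⟩)
    · exact ⟨Or.inl h1, h2, h3⟩
    · exact ⟨Or.inr h1, by rw [← bar_bar t.a, h3, bar_bar], by rw [← bar_bar t.b, h2, bar_bar]⟩

/-- At a segment of the graph the two foams are joined. -/
theorem glue_dir_seg (F G : Foam Γ) {e : Seg} (he : e ∈ Γ.seg) :
    ∃ s ∈ F.tri, ∃ t ∈ G.tri, s.lab = e.lab ∧ t.lab = e.lab ∧
      dir F.tri e.src e.tgt = {s} ∧ dir G.tri e.src e.tgt = {t} ∧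
      dir (glue F G) e.src e.tgt = {s} ∧ dir (glue F G) e.tgt e.src = {t.mirror} := by
  obtain ⟨⟨s, h1, h2, h3⟩, h4⟩ := F.boundary e he
  obtain ⟨⟨t, h5, h6, h7⟩, h8⟩ := G.boundary e he
  refine ⟨s, h1, t, h5, h2, h6, h3, h7, ?_, ?_⟩ <;> ext r <;>
    rw [mem_dir_glue, bar_eq_self (Γ.src_plane e he), bar_eq_self (Γ.tgt_plane e he)]
  · simp [h3, h8]
  · rw [h7, h4, Finset.mem_singleton, Finset.mem_singleton]
    simp only [Finset.notMem_empty, false_or]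
    exact ⟨fun h => by rw [← h, mirror_mirror], fun h => by rw [h, mirror_mirror]⟩

/-- An edge in the plane is a segment of Γ, where one triangle of each half meets the other with the
same label; any other edge of `F` sees only triangles of `F`. -/
theorem glue_edge (F G : Foam Γ) {t : Tri} (ht : t ∈ F.tri) :
    (dir (glue F G) t.b t.a).Nonempty ∧
      (dir (glue F G) t.a t.b).card + (dir (glue F G) t.b t.a).card ≤ 3 ∧
      ∑ s ∈ dir (glue F G) t.a t.b, s.lab = ∑ s ∈ dir (glue F G) t.b t.a, s.lab := by
  by_cases hp : t.a 2 = 0 ∧ t.b 2 = 0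
  · obtain ⟨e, he, h1, h2⟩ := F.edge_plane t ht hp.1 hp.2
    obtain ⟨s, -, t', -, h3, h4, -, -, h5, h6⟩ := glue_dir_seg F G he
    rw [← h1, ← h2, h5, h6]
    simp [h3, Tri.mirror, h4]
  · rw [glue_dir_left F G (F.below t ht) (F.below_b ht) hp,
      glue_dir_left F G (F.below_b ht) (F.below t ht) fun h => hp h.symm]
    exact F.edge t ht hp

theorem glue_edgeHyp (F G : Foam Γ) : EdgeHyp (glue F G) := by
  have hm := glue_mirrored F G
  have key : ∀ t ∈ glue F G, (dir (glue F G) t.b t.a).Nonempty ∧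
      (dir (glue F G) t.a t.b).card + (dir (glue F G) t.b t.a).card ≤ 3 ∧
      ∑ s ∈ dir (glue F G) t.a t.b, s.lab = ∑ s ∈ dir (glue F G) t.b t.a, s.lab := by
    intro t ht
    rcases mem_glue.1 ht with h | h
    · exact glue_edge F G h
    · have := glue_edge G F h
      simp only [Tri.mirror] at this
      rw [hm.symm.dir_eq, hm.symm.dir_eq, Finset.image_nonempty,
        Finset.card_image_of_injective _ mirror_injective,
        Finset.card_image_of_injective _ mirror_injective,
        Finset.sum_image fun _ _ _ _ h => mirror_injective h,
        Finset.sum_image fun _ _ _ _ h => mirror_injective h] at this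
      exact this
  have key2 : ∀ a b, ((dir (glue F G) a b).card + (dir (glue F G) b a).card ≤ 3 ∧
      ∑ s ∈ dir (glue F G) a b, s.lab = ∑ s ∈ dir (glue F G) b a, s.lab) := by
    intro a b
    rcases (dir (glue F G) a b).eq_empty_or_nonempty with h | ⟨t, ht⟩
    · rcases (dir (glue F G) b a).eq_empty_or_nonempty with h' | ⟨t, ht⟩
      · rw [h, h']; simp
      · obtain ⟨h1, rfl, rfl⟩ := mem_dir.1 ht
        have := (key t h1).2
        exact ⟨by rw [add_comm]; exact this.1, this.2.symm⟩
    · obtain ⟨h1, rfl, rfl⟩ := mem_dir.1 ht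
      exact (key t h1).2
  refine ⟨hm.rotL, fun t ht => ?_, fun t ht => (key t ht).1, fun a b => (key2 a b).1,
    fun a b => (key2 a b).2⟩
  rcases mem_glue.1 ht with h | h
  · exact F.ne h
  · intro e
    exact G.ne h (by simp [Tri.mirror, e])

/-! ### Orientations around the bindings -/

theorem Foam.linearIndependent (F : Foam Γ) {t : Tri} (ht : t ∈ F.tri) :
    LinearIndependent ℝ ![t.b - t.a, t.c - t.a] := by
  have h := (affineIndependent_iff_linearIndependent_vsub ℝ _ (0 : Fin 3)).1 (F.nondegenerate t ht)
  have := h.comp ![⟨1, by decide⟩, ⟨2, by decide⟩] (by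
    intro i j hij
    fin_cases i <;> fin_cases j <;> simp_all)
  have e : ![t.b - t.a, t.c - t.a] = ((fun i : {i : Fin 3 // i ≠ 0} =>
      ![t.a, t.b, t.c] i -ᵥ ![t.a, t.b, t.c] 0) ∘ ![⟨1, by decide⟩, ⟨2, by decide⟩]) := by
    ext i j
    fin_cases i <;> rfl
  rw [e]
  exact this

theorem Foam.apart (F : Foam Γ) {s t : Tri} {a b u w : Pt} (hs : s ∈ F.tri) (ht : t ∈ F.tri)
    (hst : u ≠ w) (h1 : s.verts = {a, b, u}) (h2 : t.verts = {a, b, w})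
    (hu : LinearIndependent ℝ ![b - a, u - a]) (hw : LinearIndependent ℝ ![b - a, w - a]) :
    Apart a b u w := by
  refine apart_of_hulls hu hw ?_
  have := F.embedded s hs t ht
  rw [h1, h2] at this
  refine this.trans (convexHull_mono ?_)
  have hub : u ≠ a ∧ u ≠ b := by
    refine ⟨?_, ?_⟩
    · rintro rfl
      have := LinearIndependent.ne_zero 1 hu
      simp at this
    · rintro rfl
      have := LinearIndependent.pair_iff.1 hu 1 (-1) (by simp)
      simp at this
  rintro x ⟨h1, h2⟩
  simp only [Set.mem_insert_iff, Set.mem_singleton_iff] at h1 h2 ⊢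
  rcases h1 with h1 | h1 | h1
  · exact Or.inl h1
  · exact Or.inr h1
  · rcases h2 with h2 | h2 | h2
    · exact Or.inl h2
    · exact Or.inr h2
    · exact absurd (h1.symm.trans h2) hst

/-- The three triangles at a binding edge have different third vertices: otherwise `oriented` would
identify two of them up to rotation, against their directions along the edge or against `f ≠ g`. As
they meet only in that edge, they span different half-planes, and `rightHanded_iff_not` applies. -/
theorem Foam.hand (F : Foam Γ) {a b : Pt} {f g h : Tri} (hf : f ∈ dir F.tri a b)
    (hg : g ∈ dir F.tri a b) (hh : h ∈ dir F.tri b a) (hne : f ≠ g) :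
    LeftHanded a b f.c g.c h.c ↔ ¬ LeftHanded a b g.c f.c h.c := by
  obtain ⟨f1, rfl, rfl⟩ := mem_dir.1 hf
  obtain ⟨g1, g2, g3⟩ := mem_dir.1 hg
  obtain ⟨h1, h2, h3⟩ := mem_dir.1 hh
  have lf := F.linearIndependent f1
  have lg := F.linearIndependent g1
  rw [g2, g3] at lg
  have lh := F.linearIndependent (F.rot_mem _ (F.rot_mem _ h1))
  have lh' : LinearIndependent ℝ ![f.b - f.a, h.c - f.a] := by
    have e := F.linearIndependent h1
    rw [h2, h3] at e
    rw [LinearIndependent.pair_iff] at e ⊢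
    intro s t hst
    have := e (-(s + t)) t (by rw [← hst]; ext i; simp; ring)
    refine ⟨?_, this.2⟩
    have h := this.1
    rw [this.2] at h
    linarith
  have vf : f.verts = {f.a, f.b, f.c} := rfl
  have vg : g.verts = {f.a, f.b, g.c} := by rw [← g2, ← g3]; rfl
  have vh : h.verts = {f.a, f.b, h.c} := by rw [← h2, ← h3, Set.insert_comm]; rfl
  have nfc : f.a ≠ f.b := F.ne f1
  have nfb : f.b ≠ f.c := F.ne (F.rot_mem _ f1)
  have nfa : f.c ≠ f.a := F.ne (F.rot_mem _ (F.rot_mem _ f1))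
  have ngb : g.b ≠ g.c := F.ne (F.rot_mem _ g1)
  have nga : g.c ≠ g.a := F.ne (F.rot_mem _ (F.rot_mem _ g1))
  have d1 : f.c ≠ g.c := by
    intro e
    rcases F.oriented f f1 g g1 (by rw [vf, vg, e]) with e' | e' | e'
    · exact hne e'.symm
    · exact nfc (by rw [← g2, e']; rfl)
    · exact nfa (by rw [← g2, e']; rfl)
  have d2 : f.c ≠ h.c := by
    intro e
    rcases F.oriented f f1 h h1 (by rw [vf, vh, e]) with e' | e' | e'
    · exact nfc (by rw [← h2, e'])
    · exact nfa (by rw [← h3, e']; rfl)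
    · exact nfb (by rw [← h2, e']; rfl)
  have d3 : g.c ≠ h.c := by
    intro e
    rcases F.oriented g g1 h h1 (by rw [vg, vh, e]) with e' | e' | e'
    · exact nfc (by rw [← h2, e', g2])
    · exact nga (by rw [g2, ← h3, e']; rfl)
    · exact ngb (by rw [g3, ← h2, e']; rfl)
  have k := rightHanded_iff_not (F.apart h1 g1 d3.symm vh vg lh' lg)
    (F.apart g1 f1 d1.symm vg vf lg lf) (F.apart f1 h1 d2 vf vh lf lh') (fun c hc => by
      have := (LinearIndependent.pair_iff.1 lh') (-c) 1 (by rw [one_smul, hc, neg_smul]; simp)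
      exact one_ne_zero this.2)
  unfold LeftHanded
  rw [k, rightHanded_cycle (u := h.c) (v := f.c)]

/-- Reflection and reversal of the edge each turn the cyclic order around, and mirror images of
triangles undergo both. -/
theorem leftHanded_bar {a b u v w : Pt} :
    LeftHanded (bar b) (bar a) (bar u) (bar v) (bar w) ↔ LeftHanded a b u v w := by
  unfold LeftHanded
  rw [rightHanded_bar, rightHanded_reverse]

theorem glue_hand (F G : Foam Γ) {a b : Pt} {f g h : Tri} (hf : f ∈ dir (glue F G) a b)
    (hg : g ∈ dir (glue F G) a b) (hh : h ∈ dir (glue F G) b a) (hne : f ≠ g) :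
    LeftHanded a b f.c g.c h.c ↔ ¬ LeftHanded a b g.c f.c h.c := by
  have side : ∀ F G : Foam Γ, ∀ a b : Pt, ∀ f g h : Tri, f ∈ dir (glue F G) a b →
      g ∈ dir (glue F G) a b → h ∈ dir (glue F G) b a → f ≠ g → f ∈ F.tri →
      (LeftHanded a b f.c g.c h.c ↔ ¬ LeftHanded a b g.c f.c h.c) := by
    intro F G a b f g h hf hg hh hne hF
    obtain ⟨-, rfl, rfl⟩ := mem_dir.1 hf
    -- At an edge in the plane each direction has a single triangle, so `f ≠ g` rules this out and
    -- the whole configuration lies in `F`.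
    have hp : ¬ (f.a 2 = 0 ∧ f.b 2 = 0) := by
      intro hp
      obtain ⟨e, he, e1, e2⟩ := F.edge_plane f hF hp.1 hp.2
      obtain ⟨s, -, t', -, -, -, -, -, h5, -⟩ := glue_dir_seg F G he
      rw [e1, e2] at h5
      rw [h5, Finset.mem_singleton] at hf hg
      exact hne (hf.trans hg.symm)
    rw [glue_dir_left F G (F.below f hF) (F.below_b hF) hp] at hf hg
    rw [glue_dir_left F G (F.below_b hF) (F.below f hF) fun h => hp h.symm] at hh
    exact F.hand hf hg hh hne
  rcases mem_dir_glue.1 hf with h1 | h1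
  · exact side F G a b f g h hf hg hh hne (mem_dir.1 h1).1
  · have hm := glue_mirrored F G
    have k : ∀ {a b : Pt} {t : Tri}, t ∈ dir (glue F G) a b →
        t.mirror ∈ dir (glue G F) (bar b) (bar a) := fun ht => by
      rw [hm.symm.dir_eq]; exact Finset.mem_image_of_mem _ ht
    have := side G F _ _ _ _ _ (k hf) (k hg) (k hh) (mirror_injective.ne hne) (mem_dir.1 h1).1
    simp only [Tri.mirror, leftHanded_bar] at this
    exact this

end

end SlFoam

namespace SlFoam

noncomputable section

open scoped Classical

variable {N : ℕ} {Γ : MOYGraph N} {v : Pt}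

/-! ### Links in the glued foam -/

theorem glue_sameAt (F G : Foam Γ) (hv : v 2 < 0) : SameAt F.tri (glue F G) v := by
  constructor <;> intro w <;> ext t <;> rw [mem_dir_glue] <;>
    refine ⟨Or.inl, fun h => h.resolve_right fun h' => ?_⟩ <;> obtain ⟨h1, h2, h3⟩ := mem_dir.1 h'
  · have := G.below_b h1
    rw [h3, bar_two] at this
    linarith
  · have := G.below _ h1
    rw [h2, bar_two] at this
    linarith

theorem glue_link_of_neg (F G : Foam Γ) {t : Tri} (ht : t ∈ F.tri) (hv : t.a 2 < 0) :
    LinkConn (glue F G) t.a ∧ LinkMeet (glue F G) t.a := by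
  have hs := glue_sameAt F G hv
  have H : LinkHyp F.tri t.a := hs.symm.linkHyp ((glue_edgeHyp F G).link t.a) F.rot_mem
    fun t ht => F.ne (F.rot_mem t ht)
  suffices h : LinkConn F.tri t.a ∧ LinkMeet F.tri t.a from ⟨hs.linkConn h.1, hs.linkMeet h.2⟩
  rcases F.vertex t ht hv with h | h | h
  · exact ⟨linkConn_of_facetPoint h, linkMeet_of_branch_empty H h.1⟩
  · exact linkMeet_of_bindingPoint H h
  · exact ⟨linkConn_of_singularPoint H h, linkMeet_of_singularPoint H h⟩

/-- A triangle with an edge in the plane is continued across a segment of the graph. -/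
theorem Foam.cross (F G : Foam Γ) {t : Tri} (ht : t ∈ F.tri) (hv : t.a 2 = 0) {ε : Bool}
    (hε : (t.tip ε) 2 = 0) : (∃ e ∈ Γ.seg, (e.src = t.a ∨ e.tgt = t.a) ∧ e.other t.a = t.tip ε) ∧
      (∃ u ∈ G.tri, u.a = t.a ∧ u.tip ε = t.tip ε) ∧ IsFacetEdge (glue F G) t.a (t.tip ε) := by
  cases ε
  · obtain ⟨e, he, e1, e2⟩ := F.edge_plane _ (F.rot_mem _ (F.rot_mem _ ht)) hε hv
    obtain ⟨s, -, u, hu, -, -, -, h4, h5, h6⟩ := glue_dir_seg F G he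
    refine ⟨⟨e, he, Or.inr e2, ?_⟩, ⟨u.rot, G.rot_mem _ hu, ?_⟩, ?_⟩
    · have := F.ne (F.rot_mem _ (F.rot_mem _ ht))
      rw [Seg.other, if_neg (by rw [e1]; exact this), e1]; rfl
    · have : u ∈ dir G.tri e.src e.tgt := by simp [h4]
      exact ⟨(mem_dir.1 this).2.2.trans e2, (mem_dir.1 this).2.1.trans e1⟩
    · rw [e1, e2] at h5 h6
      exact ⟨Finset.card_eq_one.2 ⟨_, h6⟩, Finset.card_eq_one.2 ⟨_, h5⟩⟩
  · obtain ⟨e, he, e1, e2⟩ := F.edge_plane _ ht hv hε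
    obtain ⟨s, -, u, hu, -, -, -, h4, h5, h6⟩ := glue_dir_seg F G he
    refine ⟨⟨e, he, Or.inl e1, ?_⟩, ⟨u, hu, ?_⟩, ?_⟩
    · rw [Seg.other, if_pos e1, e2]; rfl
    · have : u ∈ dir G.tri e.src e.tgt := by simp [h4]
      exact ⟨(mem_dir.1 this).2.1.trans e1, (mem_dir.1 this).2.2.trans e2⟩
    · rw [e1, e2] at h5 h6
      exact ⟨Finset.card_eq_one.2 ⟨_, h5⟩, Finset.card_eq_one.2 ⟨_, h6⟩⟩

theorem Foam.plane_not_facet (F : Foam Γ) (hv : v 2 = 0) {w : Pt} (hw : w 2 = 0) :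
    ¬ IsFacetEdge F.tri v w := fun h => F.not_plane h ⟨hv, hw⟩

theorem Foam.exists_at (F : Foam Γ) {e : Seg} (he : e ∈ Γ.seg) (h : e.src = v ∨ e.tgt = v) :
    ∃ t : Lk F.tri v, ∃ ε, (t.1.tip ε) 2 = 0 := by
  obtain ⟨⟨s, h1, h2, h3⟩, h4⟩ := F.boundary e he
  have : s ∈ dir F.tri e.src e.tgt := by simp [h3]
  obtain ⟨-, h5, h6⟩ := mem_dir.1 this
  rcases h with h | h
  · refine ⟨⟨s, h1, h5.trans h⟩, true, ?_⟩
    change s.b 2 = 0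
    rw [h6]; exact Γ.tgt_plane e he
  · refine ⟨⟨s.rot, F.rot_mem _ h1, h6.trans h⟩, false, ?_⟩
    change s.a 2 = 0
    rw [h5]; exact Γ.src_plane e he

/-- Three sectors all reach `w`, but only three ends of triangles lie there. So each sector uses
exactly one of them and cannot both start and end at `w`. -/
theorem branch_two_ends {K : Finset Tri} (hK : ∀ t ∈ K, t.rot ∈ K) {w : Pt}
    (hw : IsBindingEdge K v w) (hc : Nat.card (Sector K v) = 3)
    (ht : ∀ σ : Sector K v, Touches K v σ w) {s t : Lk K v} {ε δ : Bool} (hst : sec s = sec t)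
    (hs : s.1.tip ε = w) (ht' : t.1.tip δ = w) : ε = δ := by
  let D := {x : Lk K v × Bool // x.1.1.tip x.2 = w}
  let f : D → Sector K v := fun x => sec x.1.1
  have hf : Function.Surjective f := by
    intro σ
    obtain ⟨t, h1, ε, h2⟩ := touches_iff.1 (ht σ)
    exact ⟨⟨(t, ε), h2⟩, h1⟩
  let e : D → {t // t ∈ stub K v w true} ⊕ {t // t ∈ stub K v w false} := fun x =>
    if h : x.1.2 = true then Sum.inl ⟨x.1.1.1, mem_stub.2 ⟨x.1.1.2.1, x.1.1.2.2, h ▸ x.2⟩⟩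
    else Sum.inr ⟨x.1.1.1, mem_stub.2 ⟨x.1.1.2.1, x.1.1.2.2, Bool.eq_false_of_not_eq_true h ▸ x.2⟩⟩
  have he : Function.Injective e := by
    rintro ⟨⟨⟨x, hx⟩, ε⟩, h⟩ ⟨⟨⟨y, hy⟩, δ⟩, h'⟩ hxy
    cases ε <;> cases δ <;> simp_all [e]
  have hD : Nat.card D ≤ Nat.card (Sector K v) := by
    refine (Nat.card_le_card_of_injective e he).trans ?_
    rw [Nat.card_sum, Nat.card_eq_fintype_card, Nat.card_eq_fintype_card, Fintype.card_coe,
      Fintype.card_coe, card_stub_false hK, hc]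
    exact hw.le
  have : Finite D := Subtype.finite
  have hb := hf.bijective_of_nat_card_le hD
  have := hb.1 (a₁ := ⟨(s, ε), hs⟩) (a₂ := ⟨(t, δ), ht'⟩) hst
  exact congrArg (fun x : D => x.1.2) this

/-- Every sector at a plane vertex ends at the graph. -/
theorem Foam.sector_plane (F : Foam Γ) (hv : v 2 = 0) (s : Lk F.tri v) :
    ∃ t : Lk F.tri v, sec t = sec s ∧ ∃ ε, (t.1.tip ε) 2 = 0 := by
  have hv' : s.1.a 2 = 0 := by rw [s.2.2]; exact hv
  have hb := F.boundary_vertex s.1 s.2.1 hv'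
  rw [s.2.2] at hb
  rcases hb with ⟨-, -, h⟩ | ⟨-, w, h1, h2, h3, -⟩
  · obtain ⟨e, he, he'⟩ := F.vertex_plane s.1 s.2.1 hv'
    rw [s.2.2] at he'
    obtain ⟨t, ht⟩ := F.exists_at he he'
    have := (Nat.card_eq_one_iff_unique.1 h).1
    exact ⟨t, Subsingleton.elim _ _, ht⟩
  · have hw : IsBindingEdge F.tri v w := by
      have : w ∈ branch F.tri v := by simp [h1]
      exact this
    obtain ⟨s', hs', ε, hε⟩ := touches_iff.1 (h3 (sec s))
    obtain ⟨t, ht, hf⟩ := sector_other_tip F.rot_mem (s := s') (ε := ε)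
      (by rw [hε]; exact hw.not_facet)
    refine ⟨t, ht.trans hs', !ε, ?_⟩
    -- A free end outside the plane is a binding edge, hence the only one, `w`; then the sector
    -- would have both its ends at `w`.
    by_contra hp
    have hbe : IsBindingEdge F.tri v (t.1.tip !ε) := by
      have key : ∀ t : Tri, t ∈ F.tri → ¬ (t.a 2 = 0 ∧ t.b 2 = 0) →
          0 < (dir F.tri t.a t.b).card ∧ 0 < (dir F.tri t.b t.a).card ∧
          (dir F.tri t.a t.b).card + (dir F.tri t.b t.a).card ≤ 3 := by
        intro t ht hp
        obtain ⟨h1, h2, -⟩ := F.edge t ht hp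
        exact ⟨Finset.card_pos.2 ⟨t, mem_dir.2 ⟨ht, rfl, rfl⟩⟩, Finset.card_pos.2 h1, h2⟩
      have k2 : 0 < (dir F.tri v (t.1.tip !ε)).card ∧ 0 < (dir F.tri (t.1.tip !ε) v).card ∧
          (dir F.tri v (t.1.tip !ε)).card + (dir F.tri (t.1.tip !ε) v).card ≤ 3 := by
        have t2 := t.2.2
        generalize hδ : (!ε) = δ at hp ⊢
        cases δ
        · have := key t.1.rot.rot (F.rot_mem _ (F.rot_mem _ t.2.1)) fun h => hp h.1
          change 0 < (dir F.tri t.1.c t.1.a).card ∧ 0 < (dir F.tri t.1.a t.1.c).card ∧ _ at this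
          rw [t2] at this
          exact ⟨this.2.1, this.1, by rw [add_comm]; simpa [Tri.rot, t2] using this.2.2⟩
        · have := key t.1 t.2.1 fun h => hp h.2
          rw [t2] at this
          exact this
      unfold IsFacetEdge at hf
      unfold IsBindingEdge
      omega
    have hw' : t.1.tip (!ε) ∈ branch F.tri v := hbe
    rw [h1] at hw'
    have := branch_two_ends F.rot_mem hw h2 h3 ht.symm hε hw'
    cases ε <;> simp at this

theorem Foam.linkConn_plane (F : Foam Γ) (hv : v 2 = 0) {T : Tri → Prop}
    (hT : SectorClosed F.tri v T) {s t : Tri} (hs : s ∈ F.tri) (ht : t ∈ F.tri) (hsv : s.a = v)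
    (htv : t.a = v) (hTs : T s) (hTt : T t) : Relation.ReflTransGen (LinkAdj F.tri v T) s t := by
  have hb := F.boundary_vertex s hs (by rw [hsv]; exact hv)
  rw [hsv] at hb
  rcases hb with ⟨-, -, h⟩ | ⟨-, w, -, -, h3, -⟩
  · have := (Nat.card_eq_one_iff_unique.1 h).1
    exact hT.conn (s := ⟨s, hs, hsv⟩) (t := ⟨t, ht, htv⟩) (Subsingleton.elim _ _) hTs
  · obtain ⟨s', hs', ε, hε⟩ := touches_iff.1 (h3 (sec ⟨s, hs, hsv⟩))
    obtain ⟨t', ht', δ, hδ⟩ := touches_iff.1 (h3 (sec ⟨t, ht, htv⟩))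
    have h1 : T s'.1 := (hT.iff_of_sec hs').2 hTs
    have h2 : T t'.1 := (hT.iff_of_sec ht').2 hTt
    exact (hT.conn hs'.symm hTs).trans ((Relation.ReflTransGen.single
      ⟨⟨s'.2.1, s'.2.2, h1⟩, ⟨t'.2.1, t'.2.2, h2⟩, ε, δ, hε.trans hδ.symm⟩).trans (hT.conn ht' h2))

theorem glue_facet_left (F G : Foam Γ) {w : Pt} (h : IsFacetEdge F.tri v w) :
    IsFacetEdge (glue F G) v w := by
  have hp := F.not_plane h
  obtain ⟨t, ht⟩ := Finset.card_eq_one.1 h.1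
  have : t ∈ dir F.tri v w := by simp [ht]
  obtain ⟨h1, h2, h3⟩ := mem_dir.1 this
  have hv := F.below _ h1
  have hw := F.below_b h1
  rw [h2] at hv
  rw [h3] at hw
  unfold IsFacetEdge at *
  rwa [glue_dir_left F G hv hw hp, glue_dir_left F G hw hv fun h => hp h.symm]

theorem glue_sectorClosed_left (F G : Foam Γ) {T : Tri → Prop}
    (hT : SectorClosed (glue F G) v T) : SectorClosed F.tri v T :=
  fun s hs t ht hsv htv hst hf => hT s (mem_glue.2 (Or.inl hs)) t (mem_glue.2 (Or.inl ht)) hsv htv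
    hst (glue_facet_left F G hf)

theorem glue_sectorClosed_right (F G : Foam Γ) (hv : v 2 = 0) {T : Tri → Prop}
    (hT : SectorClosed (glue F G) v T) : SectorClosed G.tri v fun t => T t.flip := by
  refine glue_sectorClosed_left G F ((glue_mirrored F G).sectorClosed ?_)
  rwa [bar_eq_self hv]

theorem linkAdj_glue_left (F G : Foam Γ) {T : Tri → Prop} {s t : Tri}
    (h : LinkAdj F.tri v T s t) : LinkAdj (glue F G) v T s t := by
  obtain ⟨⟨h1, h2, h3⟩, ⟨h4, h5, h6⟩, h7⟩ := h
  exact ⟨⟨mem_glue.2 (Or.inl h1), h2, h3⟩, ⟨mem_glue.2 (Or.inl h4), h5, h6⟩, h7⟩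

theorem linkAdj_glue_right (F G : Foam Γ) (hv : v 2 = 0) {T : Tri → Prop} {s t : Tri}
    (h : LinkAdj G.tri v (fun t => T t.flip) s t) : LinkAdj (glue F G) v T s.flip t.flip := by
  have := (glue_mirrored F G).linkAdj (linkAdj_glue_left G F h)
  rwa [bar_eq_self hv] at this

/-- Crossing the plane inside a facet of the glued foam. -/
theorem glue_cross (F G : Foam Γ) (hv : v 2 = 0) {t : Tri} (ht : t ∈ F.tri) (htv : t.a = v)
    {ε : Bool} (hε : (t.tip ε) 2 = 0) : ∃ u ∈ G.tri, u.a = v ∧ u.tip ε = t.tip ε ∧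
      ∀ T, SectorClosed (glue F G) v T → (T t ↔ T u.flip) := by
  obtain ⟨-, ⟨u, hu, h1, h2⟩, h3⟩ := F.cross G ht (by rw [htv]; exact hv) hε
  rw [htv] at h1 h3
  refine ⟨u, hu, h1, h2, fun T hT => ?_⟩
  have hu' : u.flip ∈ glue F G := (glue_mirrored F G).flip_mem (mem_glue.2 (Or.inl hu))
  have ht' : t ∈ glue F G := mem_glue.2 (Or.inl ht)
  have huv : u.flip.a = v := by
    change bar u.a = v
    rw [h1, bar_eq_self hv]
  have e : u.flip.tip (!ε) = t.tip ε := by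
    rw [Tri.flip_tip, Bool.not_not, h2, bar_eq_self hε]
  cases ε
  · exact hT _ ht' _ hu' htv huv e.symm h3
  · refine (hT _ hu' _ ht' huv htv e ?_).symm
    change IsFacetEdge _ _ (u.flip.tip false)
    rw [show u.flip.tip false = _ from e]
    exact h3

/-- Each half of the link is connected within `T`, and every sector of a half reaches the plane,
where a segment of Γ leads to the other half. -/
theorem glue_linkConn_plane (F G : Foam Γ) (hv : v 2 = 0) : LinkConn (glue F G) v := by
  intro T hT s hs t ht hsv htv hTs hTt
  left
  have left : ∀ s t, s ∈ F.tri → t ∈ F.tri → s.a = v → t.a = v → T s → T t →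
      Relation.ReflTransGen (LinkAdj (glue F G) v T) s t := fun s t hs ht hsv htv hTs hTt =>
    Relation.ReflTransGen.mono (fun _ _ h => linkAdj_glue_left F G h) _ _
      (F.linkConn_plane hv (glue_sectorClosed_left F G hT) hs ht hsv htv hTs hTt)
  have right : ∀ s t, s.flip ∈ G.tri → t.flip ∈ G.tri → s.a = v → t.a = v → T s → T t →
      Relation.ReflTransGen (LinkAdj (glue F G) v T) s t := by
    intro s t hs ht hsv htv hTs hTt
    have := Relation.ReflTransGen.lift (p := LinkAdj (glue F G) v T) Tri.flip
      (fun _ _ h => linkAdj_glue_right F G hv h) _ _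
      (G.linkConn_plane hv (glue_sectorClosed_right F G hv hT) hs ht
      (show bar s.a = v by rw [hsv, bar_eq_self hv]) (show bar t.a = v by rw [htv, bar_eq_self hv])
      (by simpa using hTs) (by simpa using hTt))
    simpa [Function.onFun] using this
  have across : ∀ s t, s ∈ F.tri → t.flip ∈ G.tri → s.a = v → t.a = v → T s → T t →
      Relation.ReflTransGen (LinkAdj (glue F G) v T) s t := by
    intro s t hs ht hsv htv hTs hTt
    obtain ⟨s', hs', ε, hε⟩ := F.sector_plane hv ⟨s, hs, hsv⟩
    have hTs' : T s'.1 := ((glue_sectorClosed_left F G hT).iff_of_sec hs').2 hTs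
    obtain ⟨u, hu, h1, h2, h3⟩ := glue_cross F G hv s'.2.1 s'.2.2 hε
    have hTu := (h3 T hT).1 hTs'
    have huv : u.flip.a = v := by
      change bar u.a = v
      rw [h1, bar_eq_self hv]
    refine (left s s'.1 hs s'.2.1 hsv s'.2.2 hTs hTs').trans ((Relation.ReflTransGen.single
      ⟨⟨mem_glue.2 (Or.inl s'.2.1), s'.2.2, hTs'⟩,
        ⟨(glue_mirrored F G).flip_mem (mem_glue.2 (Or.inl hu)), huv, hTu⟩, ε, !ε, ?_⟩).trans
      (right _ _ (by simpa using hu) ht huv htv hTu hTt))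
    rw [Tri.flip_tip, Bool.not_not, h2, bar_eq_self hε]
  have side : ∀ s, s ∈ glue F G → s ∈ F.tri ∨ s.flip ∈ G.tri := fun s hs =>
    (mem_glue.1 hs).imp id fun h => G.rot_mem s.mirror h
  rcases side s hs with h1 | h1 <;> rcases side t ht with h2 | h2
  · exact left s t h1 h2 hsv htv hTs hTt
  · exact across s t h1 h2 hsv htv hTs hTt
  · exact linkConn_symm (across t s h2 h1 htv hsv hTt hTs)
  · exact right s t h1 h2 hsv htv hTs hTt

end

end SlFoam

/-! ### Meeting curves at points of the plane -/

namespace SlFoam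

noncomputable section

open scoped Classical

variable {N : ℕ} {Γ : MOYGraph N} {v : Pt}

/-- At an edge in the plane one triangle of each half meets the other, so it is a facet edge. Edges
off the plane belong to one half, and the upper half is treated by reflection. -/
theorem glue_branch (F G : Foam Γ) (hv : v 2 = 0) {w : Pt} (hw : IsBindingEdge (glue F G) v w) :
    (w 2 < 0 ∧ IsBindingEdge F.tri v w) ∨ (0 < w 2 ∧ IsBindingEdge G.tri v (bar w)) := by
  have left : ∀ F G : Foam Γ, ∀ w : Pt, w 2 < 0 → IsBindingEdge (glue F G) v w →
      IsBindingEdge F.tri v w := by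
    intro F G w h hw
    unfold IsBindingEdge at *
    rwa [glue_dir_left F G hv.le h.le fun e => h.ne e.2,
      glue_dir_left F G h.le hv.le fun e => h.ne e.1] at hw
  rcases lt_trichotomy (w 2) 0 with h | h | h
  · exact Or.inl ⟨h, left F G w h hw⟩
  · exfalso
    have key : ∀ F G : Foam Γ, ∀ ε, ∀ t ∈ F.tri, t.a = v → t.tip ε = w → ¬ IsBindingEdge (glue F G) v w := by
      intro F G ε t ht htv hε hb
      obtain ⟨-, -, hf⟩ := F.cross G ht (by rw [htv]; exact hv) (ε := ε) (by rw [hε]; exact h)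
      rw [htv, hε] at hf
      exact hb.not_facet hf
    obtain ⟨t, ht⟩ := (((glue_edgeHyp F G).link v).opp w hw).1
    obtain ⟨h1, h2, h3⟩ := mem_dir.1 ht
    rcases mem_glue.1 h1 with h4 | h4
    · exact key F G true t h4 h2 h3 hw
    · refine key G F false t.flip (G.rot_mem t.mirror h4) ?_ ?_ ?_
      · change bar t.a = v
        rw [h2, bar_eq_self hv]
      · change bar t.b = w
        rw [h3, bar_eq_self h]
      · have := (glue_mirrored F G).symm.binding hw
        rwa [bar_eq_self hv, bar_eq_self h] at this
  · right
    refine ⟨h, ?_⟩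
    refine left G F (bar w) (by rw [bar_two]; linarith) ?_
    have := (glue_mirrored F G).symm.binding hw
    rwa [bar_eq_self hv] at this

/-- At a vertex of Γ the three sectors leaving `w` run to the three segments, cross into `G` and
arrive at its only binding edge; so the curve leaves through the mirror image of that edge. The
cyclic orders at both ends are compared with that of the segments seen from below. -/
theorem glue_linkMeetAt_plane (F G : Foam Γ) (hv : v 2 = 0) {w : Pt} (hw : w 2 < 0) :
    LinkMeetAt (glue F G) v w := by
  intro p q hp hq ε f g h m
  have hbw : IsBindingEdge (glue F G) v w := m.binding ((glue_edgeHyp F G).link v)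
  have hbF : IsBindingEdge F.tri v w := by
    rcases glue_branch F G hv hbw with h | h
    · exact h.2
    · linarith [h.1]
  have hstub : ∀ δ, ∀ t ∈ stub (glue F G) v w δ, t ∈ F.tri := by
    intro δ t ht
    obtain ⟨h1, h2, h3⟩ := mem_stub.1 ht
    refine (mem_glue.1 h1).resolve_right fun h4 => ?_
    cases δ
    · have := G.below _ (G.rot_mem _ (G.rot_mem _ h4))
      change (bar t.c) 2 ≤ 0 at this
      change t.c = w at h3
      rw [h3, bar_two] at this
      linarith
    · have := G.below _ h4
      change (bar t.b) 2 ≤ 0 at this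
      change t.b = w at h3
      rw [h3, bar_two] at this
      linarith
  have hf := hstub _ _ m.hf
  have hg := hstub _ _ m.hg
  have hh := hstub _ _ m.hh
  obtain ⟨-, fv, fw⟩ := mem_stub.1 m.hf
  obtain ⟨-, gv, gw⟩ := mem_stub.1 m.hg
  obtain ⟨-, hv', hw'⟩ := mem_stub.1 m.hh
  have bF := F.boundary_vertex f hf (by rw [fv]; exact hv)
  rw [fv] at bF
  obtain ⟨-, hB, -⟩ | ⟨hval, w₀, hB, -, hT, hR⟩ := bF
  · have : w ∈ branch F.tri v := hbF
    rw [hB] at this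
    exact absurd this (Set.notMem_empty _)
  obtain rfl : w = w₀ := by
    have : w ∈ branch F.tri v := hbF
    rwa [hB] at this
  -- the continuation of a triangle at `vw` in `F` to a triangle at `vw'` in `G`
  have cont : ∀ t (ht : t ∈ F.tri) (htv : t.a = v) (δ : Bool), t.tip δ = w →
      ∃ t' : Lk F.tri v, sec t' = sec ⟨t, ht, htv⟩ ∧ (t'.1.tip !δ) 2 = 0 := by
    intro t ht htv δ hδ
    obtain ⟨t', ht', δ', hδ'⟩ := F.sector_plane hv ⟨t, ht, htv⟩
    refine ⟨t', ht', ?_⟩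
    by_cases e : δ' = δ
    · subst e
      have := sector_tip_unique F.rot_mem ht' (ε := δ') (F.plane_not_facet hv hδ')
        (by rw [hδ]; exact hbF.not_facet)
      rw [this, hδ] at hδ'
      exact absurd hδ' hw.ne
    · have : δ' = !δ := by cases δ <;> cases δ' <;> simp_all
      rwa [← this]
  obtain ⟨f1, sf, ff⟩ := cont f hf fv ε fw
  obtain ⟨g1, sg, gf⟩ := cont g hg gv ε gw
  obtain ⟨h1, sh, hhf⟩ := cont h hh hv' (!ε) hw'
  rw [Bool.not_not] at hhf
  obtain ⟨f2, f2G, f2v, f2t, f2T⟩ := glue_cross F G hv f1.2.1 f1.2.2 ff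
  obtain ⟨g2, g2G, g2v, g2t, g2T⟩ := glue_cross F G hv g1.2.1 g1.2.2 gf
  obtain ⟨h2, h2G, h2v, h2t, h2T⟩ := glue_cross F G hv h1.2.1 h1.2.2 hhf
  have bG := G.boundary_vertex f2 f2G (by rw [f2v]; exact hv)
  rw [f2v] at bG
  -- The valence belongs to Γ and is already known to be 3, so the first case cannot occur.
  obtain ⟨hval', -⟩ | ⟨-, w', hB', -, hT', hR'⟩ := bG
  · omega
  have hbG : IsBindingEdge G.tri v w' := by
    have : w' ∈ branch G.tri v := by simp [hB']
    exact this
  -- An edge in the plane lies on one triangle of `G` only and is not a binding edge.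
  have hw'0 : w' 2 ≠ 0 := by
    intro h0
    obtain ⟨t', h1, h2⟩ := touches_iff.1 (hT' (sec ⟨f2, f2G, f2v⟩))
    obtain ⟨δ, hδ⟩ := h2
    obtain ⟨⟨e, he, he1, he2⟩, -, hf⟩ :=
      G.cross F t'.2.1 (by rw [t'.2.2]; exact hv) (ε := δ) (by rw [hδ]; exact h0)
    have key : ∀ e ∈ Γ.seg, ¬ IsBindingEdge G.tri e.src e.tgt := by
      intro e he hb
      obtain ⟨s, -, t, -, -, -, -, h4, -⟩ := glue_dir_seg G G he
      unfold IsBindingEdge at hb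
      rw [h4, (G.boundary e he).2] at hb
      simp at hb
    rw [t'.2.2, hδ] at he2
    rw [t'.2.2] at he1
    by_cases h : e.src = v
    · rw [Seg.other, if_pos h] at he2
      exact key e he (by rw [h, he2]; exact hbG)
    · rw [Seg.other, if_neg h] at he2
      refine key e he ?_
      rw [he2, he1.resolve_left h]
      unfold IsBindingEdge at *
      omega
  have arr : ∀ t (ht : t ∈ G.tri) (htv : t.a = v) (δ : Bool), (t.tip δ) 2 = 0 →
      ∃ t' : Lk G.tri v, sec t' = sec ⟨t, ht, htv⟩ ∧ t'.1.tip (!δ) = w' := by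
    intro t ht htv δ hδ
    exact sector_arrive G.rot_mem (w := t.tip δ) (G.plane_not_facet hv hδ) hbG.not_facet
      (fun e => hw'0 (by rw [← e]; exact hδ)) (s := ⟨t, ht, htv⟩) rfl (hT' _)
  obtain ⟨f3, sf3, f3w⟩ := arr f2 f2G f2v (!ε) (by rw [f2t]; exact ff)
  obtain ⟨g3, sg3, g3w⟩ := arr g2 g2G g2v (!ε) (by rw [g2t]; exact gf)
  obtain ⟨h3, sh3, h3w⟩ := arr h2 h2G h2v ε (by rw [h2t]; exact hhf)
  rw [Bool.not_not] at f3w g3w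
  -- A set that respects sectors is constant along each path: through a sector of `F`, across the
  -- plane, and through a sector of `G`.
  have through : ∀ T, SectorClosed (glue F G) v T → (T f ↔ T f3.1.flip) ∧ (T g ↔ T g3.1.flip) ∧
      (T h ↔ T h3.1.flip) := by
    intro T hT
    have a := glue_sectorClosed_left F G hT
    have b := glue_sectorClosed_right F G hv hT
    exact ⟨((a.iff_of_sec sf).symm.trans (f2T T hT)).trans (b.iff_of_sec sf3).symm,
      ((a.iff_of_sec sg).symm.trans (g2T T hT)).trans (b.iff_of_sec sg3).symm,
      ((a.iff_of_sec sh).symm.trans (h2T T hT)).trans (b.iff_of_sec sh3).symm⟩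
  obtain ⟨pf, pg, ph⟩ := through p hp.closed
  obtain ⟨qf, qg, qh⟩ := through q hq.closed
  have nqf := m.not_qf hq
  have npg := m.not_pg hp
  have hstub' : ∀ (t : Lk G.tri v) (δ : Bool), t.1.tip δ = w' →
      t.1.flip ∈ stub (glue F G) v (bar w') !δ := by
    intro t δ hδ
    refine mem_stub.2 ⟨(glue_mirrored F G).flip_mem (mem_glue.2 (Or.inl t.2.1)), ?_, ?_⟩
    · change bar t.1.a = v
      rw [t.2.2, bar_eq_self hv]
    · rw [Tri.flip_tip, Bool.not_not, hδ]
  have hw'neg : w' 2 < 0 := by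
    refine lt_of_le_of_ne ?_ hw'0
    cases ε
    · rw [← f3w]; exact G.below _ (G.rot_mem _ (G.rot_mem _ f3.2.1))
    · rw [← f3w]; exact G.below_b f3.2.1
  refine ⟨bar w', ?_, f3.1.flip, g3.1.flip, h3.1.flip, ⟨hstub' f3 ε f3w, hstub' g3 ε g3w,
    hstub' h3 _ h3w, fun e => ?_, pf.1 m.pf, qg.1 m.qg, ph.1 m.ph, qh.1 m.qh⟩, ?_, ?_⟩
  · intro e
    rw [← e, bar_two] at hw
    linarith
  · exact npg (pg.2 (e ▸ pf.1 m.pf))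
  · have dist : ∀ {H : Foam Γ} {s t : Lk H.tri v} {T : Tri → Prop}, SectorClosed H.tri v T →
        T s.1 → ¬ T t.1 → sec s ≠ sec t := fun hT hs ht e => ht ((hT.iff_of_sec e).1 hs)
    have pL := glue_sectorClosed_left F G hp.closed
    have qL := glue_sectorClosed_left F G hq.closed
    have pR := glue_sectorClosed_right F G hv hp.closed
    have qR := glue_sectorClosed_right F G hv hq.closed
    obtain ⟨⟨e₁, he₁, i₁, o₁⟩, -⟩ := F.cross G f1.2.1 (by rw [f1.2.2]; exact hv) ff
    obtain ⟨⟨e₂, he₂, i₂, o₂⟩, -⟩ := F.cross G g1.2.1 (by rw [g1.2.2]; exact hv) gf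
    obtain ⟨⟨e₃, he₃, i₃, o₃⟩, -⟩ := F.cross G h1.2.1 (by rw [h1.2.2]; exact hv) hhf
    rw [f1.2.2] at i₁ o₁
    rw [g1.2.2] at i₂ o₂
    rw [h1.2.2] at i₃ o₃
    have RF := hR (sec ⟨f, hf, fv⟩) (sec ⟨g, hg, gv⟩) (sec ⟨h, hh, hv'⟩)
      (dist pL m.pf npg) (dist pL m.ph npg).symm (dist qL m.qh nqf) _ _ _
      (wing_of_tip fw) (wing_of_tip gw) (wing_of_tip hw') e₁ he₁ e₂ he₂ e₃ he₃ i₁ i₂ i₃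
      (by rw [o₁]; exact touches_iff.2 ⟨f1, sf, _, rfl⟩)
      (by rw [o₂]; exact touches_iff.2 ⟨g1, sg, _, rfl⟩)
      (by rw [o₃]; exact touches_iff.2 ⟨h1, sh, _, rfl⟩)
    have RG := hR' (sec f3) (sec g3) (sec h3)
      (dist pR (pf.1 m.pf) (mt pg.2 npg)) (dist pR (ph.1 m.ph) (mt pg.2 npg)).symm
      (dist qR (qh.1 m.qh) (mt qf.2 nqf)) _ _ _
      (wing_of_tip f3w) (wing_of_tip g3w) (wing_of_tip h3w) e₁ he₁ e₂ he₂ e₃ he₃ i₁ i₂ i₃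
      (by rw [o₁, ← f2t]; exact touches_iff.2 ⟨⟨f2, f2G, f2v⟩, sf3.symm, _, rfl⟩)
      (by rw [o₂, ← g2t]; exact touches_iff.2 ⟨⟨g2, g2G, g2v⟩, sg3.symm, _, rfl⟩)
      (by rw [o₃, ← h2t]; exact touches_iff.2 ⟨⟨h2, h2G, h2v⟩, sh3.symm, _, rfl⟩)
    rw [Bool.not_not] at RF RG
    -- Both orders agree with the order of the segments. What remains is the reversal caused by
    -- reflecting `G`, which matches the reversed triple in the claim up to rotation.
    rw [RF, ← RG]
    simp only [Tri.flip_tip, Bool.not_not]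
    have e := rightHanded_bar (a := v) (b := w') (u := f3.1.tip !ε) (v := h3.1.tip ε)
      (w := g3.1.tip !ε)
    rw [bar_eq_self hv] at e
    rw [e, ← rightHanded_cycle, rightHanded_cycle, rightHanded_cycle]
  · intro y ε' f'' g'' h'' m''
    rcases glue_branch F G hv (m''.binding ((glue_edgeHyp F G).link v)) with h | h
    · have : y ∈ branch F.tri v := h.2
      rw [hB] at this
      exact Or.inl this
    · have : bar y ∈ branch G.tri v := h.2
      rw [hB'] at this
      exact Or.inr (by rw [← bar_bar y]; exact congrArg bar this)

theorem glue_linkMeet_plane (F G : Foam Γ) (hv : v 2 = 0) : LinkMeet (glue F G) v := by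
  intro p q hp hq w ε f g h m
  rcases glue_branch F G hv (m.binding ((glue_edgeHyp F G).link v)) with hw | hw
  · exact glue_linkMeetAt_plane F G hv hw.1 p q hp hq ε f g h m
  · have := (glue_mirrored F G).linkMeetAt (v := v) (w := w)
      (glue_linkMeetAt_plane G F hv (by rw [bar_two]; linarith [hw.1]))
    rw [bar_eq_self hv] at this
    exact this p q hp hq ε f g h m

theorem glue_link (F G : Foam Γ) {t : Tri} (ht : t ∈ glue F G) :
    LinkConn (glue F G) t.a ∧ LinkMeet (glue F G) t.a := by
  have hm := glue_mirrored F G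
  rcases lt_trichotomy (t.a 2) 0 with h | h | h
  · rcases mem_glue.1 ht with h1 | h1
    · exact glue_link_of_neg F G h1 h
    · have := G.below_b h1
      change (bar t.a) 2 ≤ 0 at this
      rw [bar_two] at this
      linarith
  · exact ⟨glue_linkConn_plane F G h, glue_linkMeet_plane F G h⟩
  · rcases mem_glue.1 ht with h1 | h1
    · linarith [F.below _ h1]
    · have := glue_link_of_neg G F (t := t.flip) (G.rot_mem t.mirror h1)
        (by change (bar t.a) 2 < 0; rw [bar_two]; linarith)
      have h2 := hm.linkConn this.1
      change LinkConn _ (bar (bar t.a)) at h2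
      rw [bar_bar] at h2
      refine ⟨h2, fun p q hp hq w => ?_⟩
      have h3 : LinkMeetAt (glue F G) (bar t.flip.a) w :=
        hm.linkMeetAt fun p q hp hq => this.2 p q hp hq _
      change LinkMeetAt _ (bar (bar t.a)) w at h3
      rw [bar_bar] at h3
      exact h3 p q hp hq

theorem glue_closedFoam (F G : Foam Γ) : ClosedFoam (glue F G) where
  toEdgeHyp := glue_edgeHyp F G
  hand _ _ _ hf _ hg _ hh hne := glue_hand F G hf hg hh hne
  conn _ ht := (glue_link F G ht).1
  meet _ ht := (glue_link F G ht).2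

end

end SlFoam

/-! ### Global structure: surfaces, pigments and exchanges -/

namespace SlFoam

noncomputable section

open scoped Classical

/-! ## Surfaces

A set of oriented triangles, some of which are given the opposite orientation. -/

/-- The next rotated form of a triangle, for the orientation recorded by `o`. -/
def Tri.fwd (o : Tri → Prop) (t : Tri) : Tri := if o t then t.rot else t.rot.rot

/-- The triangle is an edge from its first vertex to its head. -/
def Tri.head (o : Tri → Prop) (t : Tri) : Pt := (t.fwd o).a

/-- A surface, possibly with boundary and with singular vertices. -/
structure PreSurf (S : Finset Tri) (o : Tri → Prop) : Prop where
  rot : ∀ t ∈ S, t.rot ∈ S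
  o_rot : ∀ t ∈ S, (o t.rot ↔ o t)
  ne : ∀ t ∈ S, t.a ≠ t.b
  unique : ∀ s ∈ S, ∀ t ∈ S, s.a = t.a → s.head o = t.head o → s = t

/-- A surface, possibly with boundary. -/
structure Surf (S : Finset Tri) (o : Tri → Prop) : Prop extends PreSurf S o where
  conn : ∀ s ∈ S, ∀ t ∈ S, s.a = t.a → Relation.ReflTransGen (LinkAdj S s.a fun _ => True) s t

/-- Some triangle of the surface lies on the other side of the edge. -/
def HasPartner (S : Finset Tri) (o : Tri → Prop) (t : Tri) : Prop :=
  ∃ u ∈ S, u.a = t.head o ∧ u.head o = t.a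

namespace PreSurf

variable {S : Finset Tri} {o : Tri → Prop}

theorem fwd_mem (h : PreSurf S o) {t : Tri} (ht : t ∈ S) : t.fwd o ∈ S := by
  unfold Tri.fwd
  split_ifs
  · exact h.rot _ ht
  · exact h.rot _ (h.rot _ ht)

theorem o_fwd (h : PreSurf S o) {t : Tri} (ht : t ∈ S) : o (t.fwd o) ↔ o t := by
  unfold Tri.fwd
  split_ifs with h'
  · exact h.o_rot _ ht
  · exact (h.o_rot _ (h.rot _ ht)).trans (h.o_rot _ ht)

theorem fwd_fwd_fwd (h : PreSurf S o) {t : Tri} (ht : t ∈ S) :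
    ((t.fwd o).fwd o).fwd o = t := by
  have h1 := h.o_fwd ht
  have h2 := h.o_fwd (h.fwd_mem ht)
  by_cases ho : o t
  · have h3 := h1.2 ho
    have h4 := h2.2 h3
    rw [Tri.fwd, if_pos h4, Tri.fwd, if_pos h3, Tri.fwd, if_pos ho]
    rfl
  · have h3 := mt h1.1 ho
    have h4 := mt h2.1 h3
    rw [Tri.fwd, if_neg h4, Tri.fwd, if_neg h3, Tri.fwd, if_neg ho]
    rfl

theorem head_fwd_fwd (h : PreSurf S o) {t : Tri} (ht : t ∈ S) :
    ((t.fwd o).fwd o).head o = t.a := by rw [Tri.head, h.fwd_fwd_fwd ht]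

theorem head_ne (h : PreSurf S o) {t : Tri} (ht : t ∈ S) : t.a ≠ t.head o := by
  unfold Tri.head Tri.fwd
  split_ifs
  · exact h.ne t ht
  · exact (h.ne _ (h.rot _ (h.rot _ ht))).symm

/-- The two other vertices of a triangle are its head and its tail. -/
theorem tip_eq (t : Tri) (ho : o (t.fwd o) ↔ o t) (ε : Bool) :
    t.tip ε = t.head o ∨ t.tip ε = ((t.fwd o).fwd o).a := by
  have e : ∀ s, s.fwd o = if o s then s.rot else s.rot.rot := fun _ => rfl
  by_cases h : o t
  · rw [Tri.head, e (t.fwd o), if_pos (ho.2 h), e t, if_pos h]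
    cases ε
    · exact Or.inr rfl
    · exact Or.inl rfl
  · rw [Tri.head, e (t.fwd o), if_neg (mt ho.1 h), e t, if_neg h]
    cases ε
    · exact Or.inl rfl
    · exact Or.inr rfl

end PreSurf

theorem neg_one_pow_parity {a b : ℕ} (h : (-1 : ℤˣ) ^ a = (-1) ^ b) : a % 2 = b % 2 := by
  rcases Nat.even_or_odd a with ha | ha <;> rcases Nat.even_or_odd b with hb | hb
  · rw [Nat.even_iff.1 ha, Nat.even_iff.1 hb]
  · rw [ha.neg_one_pow, hb.neg_one_pow] at h
    exact absurd h (by decide)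
  · rw [ha.neg_one_pow, hb.neg_one_pow] at h
    exact absurd h (by decide)
  · rw [Nat.odd_iff.1 ha, Nat.odd_iff.1 hb]

namespace Surf

open PreSurf

variable {S : Finset Tri} {o : Tri → Prop}

/-- Rotation of the triangles. -/
def turn (h : Surf S o) : Equiv.Perm {t // t ∈ S} where
  toFun t := ⟨t.1.fwd o, h.fwd_mem t.2⟩
  invFun t := ⟨(t.1.fwd o).fwd o, h.fwd_mem (h.fwd_mem t.2)⟩
  left_inv t := Subtype.ext (h.fwd_fwd_fwd t.2)
  right_inv t := Subtype.ext (h.fwd_fwd_fwd t.2)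

theorem turn_cube (h : Surf S o) (t : {t // t ∈ S}) : h.turn (h.turn (h.turn t)) = t :=
  Subtype.ext (h.fwd_fwd_fwd t.2)

/-- Crossing of the edges inside the surface. -/
def crossFun (S : Finset Tri) (o : Tri → Prop) (t : {t // t ∈ S}) : {t // t ∈ S} :=
  if h : HasPartner S o t.1 then ⟨h.choose, h.choose_spec.1⟩ else t

theorem crossFun_eq (h : Surf S o) {t u : {t // t ∈ S}} (h1 : u.1.a = t.1.head o)
    (h2 : u.1.head o = t.1.a) : crossFun S o t = u := by
  have hp : HasPartner S o t.1 := ⟨u.1, u.2, h1, h2⟩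
  have := hp.choose_spec
  rw [crossFun, dif_pos hp]
  exact Subtype.ext (h.unique _ this.1 _ u.2 (this.2.1.trans h1.symm) (this.2.2.trans h2.symm))

theorem crossFun_spec {t : {t // t ∈ S}} (hp : HasPartner S o t.1) :
    (crossFun S o t).1.a = t.1.head o ∧ (crossFun S o t).1.head o = t.1.a := by
  have := hp.choose_spec
  rw [crossFun, dif_pos hp]
  exact this.2

theorem crossFun_invol (h : Surf S o) (t : {t // t ∈ S}) : crossFun S o (crossFun S o t) = t := by
  by_cases hp : HasPartner S o t.1
  · have := crossFun_spec hp
    exact h.crossFun_eq this.2.symm this.1.symm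
  · have : crossFun S o t = t := by rw [crossFun, dif_neg hp]
    rw [this, this]

/-- Crossing of the edges inside the surface, as a permutation. -/
def cross (h : Surf S o) : Equiv.Perm {t // t ∈ S} where
  toFun := crossFun S o
  invFun := crossFun S o
  left_inv := h.crossFun_invol
  right_inv := h.crossFun_invol

theorem cross_spec (h : Surf S o) {t : {t // t ∈ S}} (hp : HasPartner S o t.1) :
    (h.cross t).1.a = t.1.head o ∧ (h.cross t).1.head o = t.1.a := crossFun_spec hp

theorem cross_eq_self (h : Surf S o) {t : {t // t ∈ S}} (hp : ¬ HasPartner S o t.1) :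
    h.cross t = t := dif_neg hp

theorem cross_ne (h : Surf S o) (t : {t // t ∈ S}) : h.cross t ≠ t ↔ HasPartner S o t.1 := by
  by_cases hp : HasPartner S o t.1
  · refine ⟨fun _ => hp, fun _ e => h.head_ne t.2 ?_⟩
    rw [← (h.cross_spec hp).1, e]
  · simp [hp, h.cross_eq_self hp]

/-- Going around a vertex. -/
theorem turn_cross (h : Surf S o) {s t : {t // t ∈ S}} (h1 : s.1.a = t.1.a)
    (h2 : ((s.1.fwd o).fwd o).a = t.1.head o) :
    HasPartner S o t.1 ∧ h.turn (h.cross t) = s := by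
  have e : h.cross t = h.turn (h.turn s) :=
    h.crossFun_eq h2 ((h.head_fwd_fwd s.2).trans h1)
  refine ⟨⟨_, h.fwd_mem (h.fwd_mem s.2), h2, (h.head_fwd_fwd s.2).trans h1⟩, ?_⟩
  rw [e, h.turn_cube]

/-- If both triangles have their head, or both their tail, at the common point of the link, they
coincide by uniqueness; otherwise they are neighbours in the rotation around `v`. -/
theorem adj_cases (h : Surf S o) {v : Pt} {s t : Tri} (hst : LinkAdj S v (fun _ => True) s t) :
    s = t ∨ ((s.fwd o).fwd o).a = t.head o ∨ ((t.fwd o).fwd o).a = s.head o := by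
  obtain ⟨⟨h1, h2, -⟩, ⟨h3, h4, -⟩, ε, δ, h5⟩ := hst
  rcases tip_eq s (h.o_fwd h1) ε with e | e <;> rcases tip_eq t (h.o_fwd h3) δ with e' | e'
  · exact Or.inl (h.unique s h1 t h3 (h2.trans h4.symm) (e.symm.trans (h5.trans e')))
  · exact Or.inr (Or.inr (e'.symm.trans (h5.symm.trans e)))
  · exact Or.inr (Or.inl (e.symm.trans (h5.trans e')))
  · left
    have := h.unique _ (h.fwd_mem (h.fwd_mem h1)) _ (h.fwd_mem (h.fwd_mem h3))
      (e.symm.trans (h5.trans e'))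
      ((h.head_fwd_fwd h1).trans ((h2.trans h4.symm).trans (h.head_fwd_fwd h3).symm))
    rw [← h.fwd_fwd_fwd h1, this, h.fwd_fwd_fwd h3]

/-- Local connectivity gives a path in the link, and every step between different triangles crosses
an edge with a partner, where `β` is trivial; so it is a step of the rotation or its inverse. On the
boundary `β` only closes up the fan of triangles. -/
theorem sameCycle (h : Surf S o) {β : Equiv.Perm {t // t ∈ S}}
    (hβ : ∀ t, HasPartner S o t.1 → β t = t) (s t : {t // t ∈ S}) (hst : s.1.a = t.1.a) :
    (h.turn * h.cross * β⁻¹).SameCycle s t := by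
  have key : ∀ s t : {t // t ∈ S}, s.1.a = t.1.a → ((s.1.fwd o).fwd o).a = t.1.head o →
      (h.turn * h.cross * β⁻¹).SameCycle t s := by
    intro s t h1 h2
    obtain ⟨hp, he⟩ := h.turn_cross h1 h2
    refine ⟨1, ?_⟩
    have : β⁻¹ t = t := by rw [Equiv.Perm.inv_eq_iff_eq, hβ t hp]
    simp only [zpow_one, Equiv.Perm.mul_apply, this, he]
  have path : ∀ x, Relation.ReflTransGen (LinkAdj S s.1.a fun _ => True) s.1 x →
      ∃ hx : x ∈ S, x.a = s.1.a ∧ (h.turn * h.cross * β⁻¹).SameCycle s ⟨x, hx⟩ := by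
    intro x hx
    induction hx with
    | refl => exact ⟨s.2, rfl, Equiv.Perm.SameCycle.refl _ _⟩
    | tail _ hxy ih =>
      obtain ⟨hx, hxs, hc⟩ := ih
      have hy := hxy.2.1
      refine ⟨hy.1, hy.2.1, hc.trans ?_⟩
      rcases h.adj_cases hxy with e | e | e
      · exact e ▸ Equiv.Perm.SameCycle.refl _ _
      · exact (key ⟨_, hx⟩ ⟨_, hy.1⟩ (hxs.trans hy.2.1.symm) e).symm
      · exact key ⟨_, hy.1⟩ ⟨_, hx⟩ (hy.2.1.trans hxs.symm) e
  obtain ⟨_, -, h2⟩ := path _ (h.conn s.1 s.2 t.1 t.2 hst)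
  exact h2

/-- The parity of the number of vertices of a surface whose boundary is traversed by `β`. -/
theorem parity (h : Surf S o) (β : Equiv.Perm {t // t ∈ S})
    (hβ : ∀ t, HasPartner S o t.1 → β t = t)
    (hβ' : ∀ t, ¬ HasPartner S o t.1 → (β t).1.a = t.1.head o) :
    (-1 : ℤˣ) ^ (S.card + (S.image Tri.a).card) =
      (-1) ^ ((S.filter fun t => HasPartner S o t).card / 2) * Equiv.Perm.sign β := by
  have := sign_rotation h.turn h.cross β
    (fun t => (⟨t.1.a, Finset.mem_image_of_mem _ t.2⟩ : {v // v ∈ S.image Tri.a})) ?_ h.turn_cube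
    h.crossFun_invol ?_ ?_
  · rw [Fintype.card_coe, Fintype.card_coe] at this
    rw [this]
    congr 3
    simp_rw [h.cross_ne]
    rw [← Finset.card_map (Function.Embedding.subtype fun t => t ∈ S)]
    congr 1
    ext t
    simp
    tauto
  · rintro ⟨v, hv⟩
    obtain ⟨t, ht, rfl⟩ := Finset.mem_image.1 hv
    exact ⟨⟨t, ht⟩, rfl⟩
  · intro t
    refine Subtype.ext ?_
    change ((h.cross t).1.head o) = (β t).1.a
    by_cases hp : HasPartner S o t.1
    · rw [hβ t hp, (h.cross_spec hp).2]
    · rw [h.cross_eq_self hp, hβ' t hp]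
  · intro s t hst
    exact h.sameCycle hβ s t (congrArg Subtype.val hst)

/-- The rotation has order three and no fixed point, because a triangle has different first vertex
and head. -/
theorem three_dvd (h : Surf S o) : 3 ∣ S.card := by
  have : Fact (Nat.Prime 3) := ⟨Nat.prime_three⟩
  have h2 := Equiv.Perm.card_fixedPoints_modEq (α := {t // t ∈ S}) (f := @DFunLike.coe _ _ _ _ h.turn) (p := 3) (n := 1)
    (funext fun t => h.turn_cube t)
  rw [Fintype.card_coe] at h2
  have h3 : Fintype.card (Function.fixedPoints h.turn) = 0 := by
    rw [Fintype.card_eq_zero_iff]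
    refine ⟨fun x => h.head_ne x.1.2 ?_⟩
    have := congrArg (fun t => Tri.a (Subtype.val t)) x.2
    exact this.symm
  rw [h3] at h2
  exact (Nat.modEq_zero_iff_dvd).1 h2

/-- The surface has no boundary. -/
def Closed (S : Finset Tri) (o : Tri → Prop) : Prop := ∀ t ∈ S, HasPartner S o t

theorem edge_image (h : Surf S o) :
    S.image (fun t => s(t.a, t.b)) = S.image (fun t => s(t.a, t.head o)) := by
  have e : ∀ t ∈ S, s(t.a, t.head o) = s(t.a, t.b) ∨
      s(t.a, t.head o) = s(t.rot.rot.a, t.rot.rot.b) := by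
    intro t ht
    by_cases ho : o t
    · left
      rw [Tri.head, Tri.fwd, if_pos ho]; rfl
    · right
      rw [Tri.head, Tri.fwd, if_neg ho]; exact Sym2.eq_swap
  ext x
  simp only [Finset.mem_image]
  constructor
  · rintro ⟨t, ht, rfl⟩
    by_cases ho : o t
    · refine ⟨t, ht, ?_⟩
      rw [Tri.head, Tri.fwd, if_pos ho]; rfl
    · refine ⟨t.rot, h.rot t ht, ?_⟩
      rw [Tri.head, Tri.fwd, if_neg (mt (h.o_rot t ht).1 ho)]; exact Sym2.eq_swap
  · rintro ⟨t, ht, rfl⟩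
    rcases e t ht with e | e
    · exact ⟨t, ht, e.symm⟩
    · exact ⟨_, h.rot _ (h.rot _ ht), e.symm⟩

theorem edge_eq_iff (h : Surf S o) (hc : Closed S o) (s t : {t // t ∈ S}) :
    s(s.1.a, s.1.head o) = s(t.1.a, t.1.head o) ↔ s = t ∨ s = h.cross t := by
  have hs := h.cross_spec (hc t.1 t.2)
  rw [Sym2.eq_iff]
  constructor
  · rintro (⟨h1, h2⟩ | ⟨h1, h2⟩)
    · exact Or.inl (Subtype.ext (h.unique _ s.2 _ t.2 h1 h2))
    · exact Or.inr (h.crossFun_eq h1 h2).symm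
  · rintro (rfl | rfl)
    · exact Or.inl ⟨rfl, rfl⟩
    · exact Or.inr hs

theorem card_edges (h : Surf S o) (hc : Closed S o) :
    S.card = 2 * (S.image fun t => s(t.a, t.b)).card := by
  rw [h.edge_image, Finset.card_eq_sum_card_image (fun t => s(t.a, t.head o)) S,
    Finset.sum_const_nat (m := 2), mul_comm]
  intro x hx
  obtain ⟨t, ht, rfl⟩ := Finset.mem_image.1 hx
  have hn : (h.cross ⟨t, ht⟩).1 ≠ t := fun e =>
    (h.cross_ne ⟨t, ht⟩).2 (hc t ht) (Subtype.ext e)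
  have : (S.filter fun s => s(s.a, s.head o) = s(t.a, t.head o)) = {t, (h.cross ⟨t, ht⟩).1} := by
    ext s
    simp only [Finset.mem_filter, Finset.mem_insert, Finset.mem_singleton]
    constructor
    · rintro ⟨hs, e⟩
      rcases (h.edge_eq_iff hc ⟨s, hs⟩ ⟨t, ht⟩).1 e with e | e
      · exact Or.inl (congrArg Subtype.val e)
      · exact Or.inr (congrArg Subtype.val e)
    · rintro (rfl | rfl)
      · exact ⟨ht, rfl⟩
      · exact ⟨(h.cross ⟨t, ht⟩).2, (h.edge_eq_iff hc _ ⟨t, ht⟩).2 (Or.inr rfl)⟩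
  rw [this, Finset.card_pair hn.symm]

/-- Each edge carries two triangles and each face three, so with S darts E = S/2 and F = S/3. For
evenness, `parity` with trivial boundary gives S + V ≡ E modulo 2, and S = 3F, so V - E + F ≡ 4F. -/
theorem six_chi (h : Surf S o) (hc : Closed S o) :
    6 * chi S = 6 * (S.image Tri.a).card - S.card ∧ 2 ∣ chi S := by
  have h2 := h.card_edges hc
  obtain ⟨k, hk⟩ := h.three_dvd
  have hp := h.parity 1 (fun _ _ => rfl) (fun t ht => absurd (hc t.1 t.2) ht)
  have hf : (S.filter fun t => HasPartner S o t) = S :=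
    Finset.filter_true_of_mem fun t ht => hc t ht
  rw [hf, Equiv.Perm.sign_one, mul_one] at hp
  have hchi : chi S = ((S.image Tri.a).card : ℤ) - (S.image fun t => s(t.a, t.b)).card + k := by
    unfold chi
    have : (S.card : ℤ) = 3 * k := by exact_mod_cast hk
    rw [this]
    simp
  have h3 : (S.card : ℤ) = 3 * k := by exact_mod_cast hk
  have h4 : (S.card : ℤ) = 2 * (S.image fun t => s(t.a, t.b)).card := by exact_mod_cast h2
  refine ⟨by rw [hchi]; linarith, ?_⟩
  have hp := neg_one_pow_parity hp
  rw [hchi]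
  omega

/-- A connected closed surface has Euler characteristic at most two. -/
theorem chi_le_two (h : Surf S o) (hc : Closed S o)
    (hcon : ∀ x ∈ S, ∀ y ∈ S, Relation.ReflTransGen
      (fun s t => s ∈ S ∧ t ∈ S ∧ (t = s.rot ∨ s.a = t.a)) x y) : chi S ≤ 2 := by
  have h2 := h.card_edges hc
  obtain ⟨k, hk⟩ := h.three_dvd
  let a : {t // t ∈ S} → {v // v ∈ S.image Tri.a} :=
    fun t => ⟨t.1.a, Finset.mem_image_of_mem _ t.2⟩
  let e : {t // t ∈ S} → {x // x ∈ S.image fun t => s(t.a, t.b)} :=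
    fun t => ⟨s(t.1.a, t.1.head o), by rw [h.edge_image]; exact Finset.mem_image_of_mem _ t.2⟩
  -- Unoriented faces, represented as orbits of the rotation, each with three elements.
  let f₀ : {t // t ∈ S} → Finset {t // t ∈ S} := fun t => {t, h.turn t, h.turn (h.turn t)}
  let f : {t // t ∈ S} → {x // x ∈ Finset.univ.image f₀} :=
    fun t => ⟨f₀ t, Finset.mem_image_of_mem _ (Finset.mem_univ t)⟩
  have hturn : ∀ t : {t // t ∈ S}, (h.turn t).1 = t.1.rot ∨ (h.turn (h.turn t)).1 = t.1.rot := by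
    intro t
    by_cases ho : o t.1
    · left
      exact if_pos ho
    · right
      have e1 : (h.turn t).1 = t.1.rot.rot := if_neg ho
      have e2 : ¬ o (h.turn t).1 := mt (h.o_fwd t.2).1 ho
      have e3 : (h.turn (h.turn t)).1 = (h.turn t).1.rot.rot := if_neg e2
      rw [e3, e1]; rfl
  have hft : ∀ t, f (h.turn t) = f t := by
    intro t
    refine Subtype.ext ?_
    change ({h.turn t, h.turn (h.turn t), h.turn (h.turn (h.turn t))} : Finset _) = {t, _, _}
    rw [h.turn_cube]
    ext x; simp only [Finset.mem_insert, Finset.mem_singleton]; tauto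
  have hcardF : S.card = 3 * (Finset.univ.image f₀).card := by
    rw [← Fintype.card_coe S, ← Finset.card_univ, Finset.card_eq_sum_card_image f₀ Finset.univ,
      Finset.sum_const_nat (m := 3), mul_comm]
    intro x hx
    obtain ⟨t, -, rfl⟩ := Finset.mem_image.1 hx
    have : (Finset.univ.filter fun s => f₀ s = f₀ t) = f₀ t := by
      ext s
      simp only [Finset.mem_filter, Finset.mem_univ, true_and]
      constructor
      · intro e
        rw [← e]
        exact Finset.mem_insert_self _ _
      · intro hs
        have h1 := congrArg Subtype.val (hft t)
        have h2 := congrArg Subtype.val (hft (h.turn t))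
        change f₀ _ = f₀ _ at h1 h2
        simp only [f₀, Finset.mem_insert, Finset.mem_singleton] at hs
        rcases hs with rfl | rfl | rfl
        · rfl
        · exact h1
        · exact h2.trans h1
    rw [this]
    have n1 : ∀ t, h.turn t ≠ t := fun t e =>
      h.head_ne t.2 (congrArg (fun t => Tri.a (Subtype.val t)) e).symm
    have n2 : t ≠ h.turn (h.turn t) := fun e => n1 t (by
      have := congrArg h.turn e
      rw [h.turn_cube] at this
      exact this)
    exact Finset.card_eq_three.2 ⟨_, _, _, (n1 t).symm, n2, (n1 _).symm, rfl⟩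
  -- A face function that does not change across edges is constant around a vertex, because the
  -- triangles there form one orbit.
  have hstar : ∀ w : {x // x ∈ Finset.univ.image f₀} → ℚ, (∀ t, w (f (h.cross t)) = w (f t)) →
      ∀ s t : {t // t ∈ S}, s.1.a = t.1.a → w (f s) = w (f t) := by
    intro w hw s t hst
    obtain ⟨n, hn⟩ := h.sameCycle (β := 1) (fun _ _ => rfl) s t hst
    have inv : ∀ x, w (f ((h.turn * h.cross * 1⁻¹) x)) = w (f x) := by
      intro x
      rw [inv_one, mul_one, Equiv.Perm.mul_apply, hft, hw]
    have inv' : ∀ n : ℤ, ∀ x, w (f (((h.turn * h.cross * 1⁻¹) ^ n) x)) = w (f x) := by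
      intro n
      induction n using Int.induction_on with
      | zero => intro x; rfl
      | succ n ih => intro x; rw [zpow_add_one, Equiv.Perm.mul_apply, ih, inv]
      | pred n ih =>
        intro x
        rw [zpow_sub_one, Equiv.Perm.mul_apply, ih, ← inv]
        congr 2
        rw [← Equiv.Perm.mul_apply, mul_inv_cancel, Equiv.Perm.one_apply]
    rw [← hn, inv']
  have key := euler_le_two h.turn h.cross h.crossFun_invol a e f ?_ ?_ ?_ ?_ hft ?_ ?_ ?_
  · rw [Fintype.card_coe, Fintype.card_coe, Fintype.card_coe, Fintype.card_coe] at key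
    have h6 := (h.six_chi hc).1
    have : (S.card : ℤ) = 2 * (S.image fun t => s(t.a, t.b)).card := by exact_mod_cast h2
    have h3 : (S.card : ℤ) = 3 * (Finset.univ.image f₀).card := by exact_mod_cast hcardF
    have : ((S.image Tri.a).card : ℤ) + (Finset.univ.image f₀).card +
      (S.image fun t => s(t.a, t.b)).card ≤ S.card + 2 := by exact_mod_cast key
    linarith
  · rintro ⟨v, hv⟩
    obtain ⟨t, ht, rfl⟩ := Finset.mem_image.1 hv
    exact ⟨⟨t, ht⟩, rfl⟩
  · rintro ⟨x, hx⟩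
    have hx' := hx
    rw [h.edge_image] at hx'
    obtain ⟨t, ht, rfl⟩ := Finset.mem_image.1 hx'
    exact ⟨⟨t, ht⟩, rfl⟩
  · rintro ⟨x, hx⟩
    obtain ⟨t, -, rfl⟩ := Finset.mem_image.1 hx
    exact ⟨t, rfl⟩
  · intro t
    exact Subtype.ext ((h.edge_eq_iff hc _ t).2 (Or.inr rfl))
  · intro t
    exact Subtype.ext (h.cross_spec (hc t.1 t.2)).1
  · intro u hu
    have hu2 : ∀ t : {t // t ∈ S}, u (a ⟨t.1.rot, h.rot _ t.2⟩) = u (a t) := by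
      intro t
      rcases hturn t with e | e
      · rw [← hu t]; congr 2; exact Subtype.ext e.symm
      · rw [← hu t, ← hu (h.turn t)]; congr 2; exact Subtype.ext e.symm
    have path : ∀ x y, Relation.ReflTransGen
        (fun s t => s ∈ S ∧ t ∈ S ∧ (t = s.rot ∨ s.a = t.a)) x y → ∀ hx : x ∈ S,
        ∃ hy : y ∈ S, u (a ⟨x, hx⟩) = u (a ⟨y, hy⟩) := by
      intro x y hxy hx
      induction hxy with
      | refl => exact ⟨hx, rfl⟩
      | tail _ hst ih =>
        obtain ⟨hs, e⟩ := ih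
        refine ⟨hst.2.1, e.trans ?_⟩
        rcases hst.2.2 with rfl | h'
        · exact (hu2 ⟨_, hs⟩).symm
        · exact congrArg u (Subtype.ext h')
    rintro ⟨x, hx⟩ ⟨y, hy⟩
    obtain ⟨s, hs, rfl⟩ := Finset.mem_image.1 hx
    obtain ⟨t, ht, rfl⟩ := Finset.mem_image.1 hy
    exact (path s t (hcon s hs t ht) hs).2
  · intro w hw
    have hw2 : ∀ t : {t // t ∈ S}, f ⟨t.1.rot, h.rot _ t.2⟩ = f t := by
      intro t
      rcases hturn t with e | e
      · rw [← hft t]; congr 1; exact Subtype.ext e.symm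
      · rw [← hft t, ← hft (h.turn t)]; congr 1; exact Subtype.ext e.symm
    have path : ∀ x y, Relation.ReflTransGen
        (fun s t => s ∈ S ∧ t ∈ S ∧ (t = s.rot ∨ s.a = t.a)) x y → ∀ hx : x ∈ S,
        ∃ hy : y ∈ S, w (f ⟨x, hx⟩) = w (f ⟨y, hy⟩) := by
      intro x y hxy hx
      induction hxy with
      | refl => exact ⟨hx, rfl⟩
      | tail _ hst ih =>
        obtain ⟨hs, e⟩ := ih
        refine ⟨hst.2.1, e.trans ?_⟩
        rcases hst.2.2 with rfl | h'
        · exact (congrArg w (hw2 ⟨_, hs⟩)).symm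
        · exact hstar w hw ⟨_, hs⟩ ⟨_, hst.2.1⟩ h'
    rintro ⟨x, hx⟩ ⟨y, hy⟩
    obtain ⟨s, -, rfl⟩ := Finset.mem_image.1 hx
    obtain ⟨t, -, rfl⟩ := Finset.mem_image.1 hy
    exact (path s.1 t.1 (hcon s.1 s.2 t.1 t.2) s.2).2

end Surf

end

end SlFoam

namespace SlFoam

noncomputable section

open scoped Classical

/-! ## Pigments on a closed foam -/

/-- A pigment, given by the set of the triangles that have it. -/
structure Pigment (K : Finset Tri) (p : Tri → Prop) : Prop where
  rot : ∀ t ∈ K, (p t.rot ↔ p t)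
  facet : ∀ s ∈ K, ∀ t ∈ K, t.a = s.b → t.b = s.a → IsFacetEdge K s.a s.b → (p s ↔ p t)
  flow : ∀ a b, ∀ f ∈ dir K a b, ∀ g ∈ dir K a b, ∀ h ∈ dir K b a, f ≠ g →
    (p h ↔ p f ∨ p g) ∧ ¬ (p f ∧ p g)

variable {K : Finset Tri} {p q : Tri → Prop} {v : Pt}

theorem rot_mem_stub_false (hK : ∀ t ∈ K, t.rot ∈ K) {w : Pt} {t : Tri} (ht : t ∈ dir K w v) :
    t.rot ∈ stub K v w false := by
  obtain ⟨h1, h2, h3⟩ := mem_dir.1 ht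
  exact mem_stub.2 ⟨hK _ h1, h3, h2⟩

theorem rot_rot_mem_dir (hK : ∀ t ∈ K, t.rot ∈ K) {w : Pt} {t : Tri} (ht : t ∈ stub K v w false) :
    t.rot.rot ∈ dir K w v := by
  obtain ⟨h1, h2, h3⟩ := mem_stub.1 ht
  exact mem_dir.2 ⟨hK _ (hK _ h1), h3, h2⟩

theorem rot_injective : Function.Injective Tri.rot := fun s t h => by
  rw [← s.rot_rot_rot, h, t.rot_rot_rot]

namespace Pigment

theorem rot_rot (hp : Pigment K p) (hK : ∀ t ∈ K, t.rot ∈ K) {t : Tri} (ht : t ∈ K) :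
    p t.rot.rot ↔ p t := (hp.rot _ (hK _ ht)).trans (hp.rot _ ht)

theorem sectorClosed (hp : Pigment K p) (hK : ∀ t ∈ K, t.rot ∈ K) (v : Pt) :
    SectorClosed K v p := by
  rintro s hs t ht rfl htv hst hf
  rw [← hp.rot_rot hK hs]
  refine (hp.facet t ht _ (hK _ (hK _ hs)) hst htv.symm ?_).symm
  rwa [htv, ← hst]

theorem toLocal (hp : Pigment K p) (hK : ∀ t ∈ K, t.rot ∈ K) (v : Pt) : LocalPigment K v p := by
  refine ⟨hp.sectorClosed hK v, ?_⟩
  intro w ε f hf g hg h hh hne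
  cases ε
  · have := hp.flow w v _ (rot_rot_mem_dir hK hf) _ (rot_rot_mem_dir hK hg) h hh fun e =>
      hne (rot_injective (rot_injective e))
    rwa [hp.rot_rot hK (mem_stub.1 hf).1, hp.rot_rot hK (mem_stub.1 hg).1] at this
  · have := hp.flow v w _ hf _ hg _ (rot_rot_mem_dir hK hh) hne
    rwa [hp.rot_rot hK (mem_stub.1 hh).1] at this

theorem unique (hp : Pigment K p) (H : EdgeHyp K) {a b : Pt} {f g : Tri} (hf : f ∈ dir K a b)
    (hg : g ∈ dir K a b) (pf : p f) (pg : p g) : f = g := by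
  obtain ⟨f1, rfl, rfl⟩ := mem_dir.1 hf
  obtain ⟨h, hh⟩ := H.opp f f1
  by_contra hne
  exact (hp.flow _ _ f hf g hg h hh hne).2 ⟨pf, pg⟩

/-- Three cases: another triangle on the same side of the edge, two triangles on the other side, or
one on each side. The first two are the flow condition at a binding, the last is constancy on a
facet. -/
theorem exists_opp (hp : Pigment K p) (H : EdgeHyp K) {a b : Pt} {t : Tri} (ht : t ∈ dir K a b)
    (pt : p t) : ∃ u ∈ dir K b a, p u := by
  obtain ⟨t1, rfl, rfl⟩ := mem_dir.1 ht
  obtain ⟨u, hu⟩ := H.opp t t1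
  by_cases h1 : ∃ g ∈ dir K t.a t.b, g ≠ t
  · obtain ⟨g, hg, hne⟩ := h1
    exact ⟨u, hu, (hp.flow _ _ t ht g hg u hu hne.symm).1.2 (Or.inl pt)⟩
  by_cases h2 : ∃ u' ∈ dir K t.b t.a, u' ≠ u
  · obtain ⟨u', hu', hne⟩ := h2
    rcases (hp.flow _ _ u hu u' hu' t ht hne.symm).1.1 pt with h | h
    · exact ⟨u, hu, h⟩
    · exact ⟨u', hu', h⟩
  push Not at h1 h2
  obtain ⟨u1, u2, u3⟩ := mem_dir.1 hu
  refine ⟨u, hu, (hp.facet t t1 u u1 u2 u3 ⟨?_, ?_⟩).1 pt⟩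
  · exact Finset.card_eq_one.2 ⟨t, Finset.eq_singleton_iff_unique_mem.2 ⟨ht, h1⟩⟩
  · exact Finset.card_eq_one.2 ⟨u, Finset.eq_singleton_iff_unique_mem.2 ⟨hu, h2⟩⟩

end Pigment

theorem EdgeHyp.not_four (H : EdgeHyp K) {a b : Pt} {f g h k : Tri} (hf : f ∈ dir K a b)
    (hg : g ∈ dir K a b) (hfg : f ≠ g) (hh : h ∈ dir K b a) (hk : k ∈ dir K b a) : h = k := by
  by_contra hne
  have h1 : 1 < (dir K a b).card := Finset.one_lt_card.2 ⟨f, hf, g, hg, hfg⟩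
  have h2 : 1 < (dir K b a).card := Finset.one_lt_card.2 ⟨h, hh, k, hk, hne⟩
  have := H.le3 a b
  omega

/-! ### Closed surfaces -/

/-- A closed surface which is locally a union of sectors is locally connected. -/
theorem PreSurf.surf_of_closed {S : Finset Tri} {o T : Tri → Prop} (h : PreSurf S o)
    (hc : Surf.Closed S o) (hS : ∀ t, t ∈ S ↔ t ∈ K ∧ T t) (hT : ∀ v, SectorClosed K v T)
    (hL : ∀ t ∈ K, LinkConn K t.a) : Surf S o := by
  refine ⟨h, fun s hs t ht hst => ?_⟩
  have hs' := (hS s).1 hs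
  have ht' := (hS t).1 ht
  rcases hL s hs'.1 T (hT _) s hs'.1 t ht'.1 rfl hst.symm hs'.2 ht'.2 with h1 | ⟨w, _, _, -, -, -, h1⟩
  · refine Relation.ReflTransGen.mono ?_ _ _ h1
    rintro x y ⟨⟨x1, x2, x3⟩, ⟨y1, y2, y3⟩, e⟩
    exact ⟨⟨(hS x).2 ⟨x1, x3⟩, x2, trivial⟩, ⟨(hS y).2 ⟨y1, y3⟩, y2, trivial⟩, e⟩
  -- Here `w` is the end of exactly one triangle `r` of the surface. Closedness gives a partner
  -- across that edge, which also ends at `w`; it would have to be `r` itself, although head and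
  -- tail of `r` differ.
  · exfalso
    obtain ⟨-, r, ⟨r1, r2, r3, ε, r4⟩, hu⟩ := h1 w (Or.inl rfl)
    have hr : r ∈ S := (hS r).2 ⟨r1, r3⟩
    have hne : r.head o ≠ ((r.fwd o).fwd o).a := by
      have := h.head_ne (h.fwd_mem hr)
      exact this
    have tip : ∀ x ∈ S, ∀ y, x.head o = y ∨ ((x.fwd o).fwd o).a = y → ∃ ε, x.tip ε = y := by
      rintro x hx y (hy | hy) <;> rw [← hy]
      · by_cases ho : o x
        · exact ⟨true, by rw [Tri.head, Tri.fwd, if_pos ho]; rfl⟩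
        · exact ⟨false, by rw [Tri.head, Tri.fwd, if_neg ho]; rfl⟩
      · have e : ∀ s, s.fwd o = if o s then s.rot else s.rot.rot := fun _ => rfl
        by_cases ho : o x
        · exact ⟨false, by rw [e (x.fwd o), if_pos ((h.o_fwd hx).2 ho), e, if_pos ho]; rfl⟩
        · exact ⟨true, by rw [e (x.fwd o), if_neg (mt (h.o_fwd hx).1 ho), e, if_neg ho]; rfl⟩
    have uniq : ∀ x ∈ S, x.a = s.a → x.head o = w ∨ ((x.fwd o).fwd o).a = w → x = r :=
      fun x hx hxv hxw => hu x ⟨((hS x).1 hx).1, hxv, ((hS x).1 hx).2, tip x hx w hxw⟩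
    rcases PreSurf.tip_eq r (h.o_fwd hr) ε with e | e <;> rw [r4] at e
    · obtain ⟨u, hu1, hu2, hu3⟩ := hc r hr
      have := uniq _ (h.fwd_mem hu1) (hu3.trans r2)
        (Or.inr (by rw [h.fwd_fwd_fwd hu1, hu2, e]))
      refine hne ?_
      rw [← this, h.fwd_fwd_fwd hu1, this, hu2]
    · obtain ⟨u, hu1, hu2, hu3⟩ := hc _ (h.fwd_mem (h.fwd_mem hr))
      rw [h.head_fwd_fwd hr] at hu2
      have := uniq u hu1 (hu2.trans r2) (Or.inl (hu3.trans e.symm))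
      refine hne ?_
      rw [← e, ← this, hu3, e]

theorem Tri.head_true (t : Tri) : t.head (fun _ => True) = t.b := by
  rw [Tri.head, Tri.fwd, if_pos trivial]; rfl

/-- The triangles with the pigment `p` form a closed surface. -/
theorem Pigment.surf (hp : Pigment K p) (H : ClosedFoam K) :
    Surf (K.filter p) (fun _ => True) ∧ Surf.Closed (K.filter p) fun _ => True := by
  have hc : Surf.Closed (K.filter p) fun _ => True := by
    intro t ht
    rw [Finset.mem_filter] at ht
    obtain ⟨u, hu, pu⟩ := hp.exists_opp H.toEdgeHyp (mem_dir.2 ⟨ht.1, rfl, rfl⟩) ht.2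
    obtain ⟨u1, u2, u3⟩ := mem_dir.1 hu
    exact ⟨u, Finset.mem_filter.2 ⟨u1, pu⟩, by rwa [Tri.head_true], by rwa [Tri.head_true]⟩
  refine ⟨PreSurf.surf_of_closed ⟨?_, fun _ _ => Iff.rfl, ?_, ?_⟩ hc (T := p)
    (fun t => Finset.mem_filter) (hp.sectorClosed H.rot) H.conn, hc⟩
  · intro t ht
    rw [Finset.mem_filter] at ht ⊢
    exact ⟨H.rot t ht.1, (hp.rot t ht.1).2 ht.2⟩
  · exact fun t ht => H.ne t (Finset.mem_filter.1 ht).1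
  · intro s hs t ht h1 h2
    rw [Finset.mem_filter] at hs ht
    rw [Tri.head_true, Tri.head_true] at h2
    exact hp.unique H.toEdgeHyp (mem_dir.2 ⟨hs.1, rfl, rfl⟩) (mem_dir.2 ⟨ht.1, h1.symm, h2.symm⟩)
      hs.2 ht.2

/-- Continuing `p` and `q` across the edge would give two triangles in each direction, unless the
continuation of `p` is `t`. So the orientation of a bichrome surface that reverses the triangles
having `q` alone is coherent. -/
theorem xor_edge (hp : Pigment K p) (hq : Pigment K q) (H : EdgeHyp K) {a b : Pt} {s t : Tri}
    (hs : s ∈ dir K a b) (ps : p s) (qs : ¬ q s) (ht : t ∈ dir K b a) (qt : q t) (pt : ¬ p t) :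
    False := by
  obtain ⟨u, hu, pu⟩ := hp.exists_opp H hs ps
  obtain ⟨g, hg, qg⟩ := hq.exists_opp H ht qt
  have := H.not_four hs hg (fun e => qs (e ▸ qg)) hu ht
  exact pt (this ▸ pu)

theorem Tri.head_pos {o : Tri → Prop} {t : Tri} (h : o t) : t.head o = t.b := by
  rw [Tri.head, Tri.fwd, if_pos h]; rfl

theorem Tri.head_neg {o : Tri → Prop} {t : Tri} (h : ¬ o t) : t.head o = t.c := by
  rw [Tri.head, Tri.fwd, if_neg h]; rfl

/-- The triangles with exactly one of two pigments form a closed surface. -/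
theorem Pigment.xor_surf (hp : Pigment K p) (hq : Pigment K q) (H : ClosedFoam K) :
    Surf (K.filter fun t => Xor (p t) (q t)) p ∧
      Surf.Closed (K.filter fun t => Xor (p t) (q t)) p := by
  have E := H.toEdgeHyp
  have rr : ∀ {t}, t ∈ K → t.rot.rot ∈ K := fun ht => H.rot _ (H.rot _ ht)
  have hc : Surf.Closed (K.filter fun t => Xor (p t) (q t)) p := by
    intro t ht
    rw [Finset.mem_filter] at ht
    obtain ⟨ht, ⟨pt, qt⟩ | ⟨qt, pt⟩⟩ := ht
    · have htd : t ∈ dir K t.a t.b := mem_dir.2 ⟨ht, rfl, rfl⟩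
      obtain ⟨u, hu, pu⟩ := hp.exists_opp E htd pt
      obtain ⟨u1, u2, u3⟩ := mem_dir.1 hu
      by_cases qu : q u
      -- The pigments come together along this edge. The bichrome surface then passes from the facet
      -- with `p` alone to the one with `q` alone on the same side, which is read with reversed
      -- orientation.
      · obtain ⟨g, hg, qg⟩ := hq.exists_opp E hu qu
        obtain ⟨g1, g2, g3⟩ := mem_dir.1 hg
        have pg : ¬ p g := fun pg => qt (hp.unique E htd hg pt pg ▸ qg)
        have pg' : ¬ p g.rot := mt (hp.rot g g1).1 pg
        refine ⟨g.rot, Finset.mem_filter.2 ⟨H.rot _ g1, Or.inr ⟨(hq.rot g g1).2 qg, pg'⟩⟩, ?_, ?_⟩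
        · rw [Tri.head_pos pt]; exact g3
        · rw [Tri.head_neg pg']; exact g2
      · exact ⟨u, Finset.mem_filter.2 ⟨u1, Or.inl ⟨pu, qu⟩⟩, by rwa [Tri.head_pos pt],
          by rwa [Tri.head_pos pu]⟩
    · have htd : t.rot.rot ∈ dir K t.c t.a := mem_dir.2 ⟨rr ht, rfl, rfl⟩
      have qt' := (hq.rot_rot H.rot ht).2 qt
      obtain ⟨u, hu, qu⟩ := hq.exists_opp E htd qt'
      obtain ⟨u1, u2, u3⟩ := mem_dir.1 hu
      by_cases pu : p u
      · obtain ⟨g, hg, pg⟩ := hp.exists_opp E hu pu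
        obtain ⟨g1, g2, g3⟩ := mem_dir.1 hg
        have qg : ¬ q g := fun qg => pt ((hp.rot_rot H.rot ht).1 (hq.unique E htd hg qt' qg ▸ pg))
        refine ⟨g, Finset.mem_filter.2 ⟨g1, Or.inl ⟨pg, qg⟩⟩, ?_, ?_⟩
        · rw [Tri.head_neg pt]; exact g2
        · rw [Tri.head_pos pg]; exact g3
      · have pu' : ¬ p u.rot := mt (hp.rot u u1).1 pu
        refine ⟨u.rot, Finset.mem_filter.2 ⟨H.rot _ u1, Or.inr ⟨(hq.rot u u1).2 qu, pu'⟩⟩, ?_, ?_⟩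
        · rw [Tri.head_neg pt]; exact u3
        · rw [Tri.head_neg pu']; exact u2
  refine ⟨PreSurf.surf_of_closed ⟨?_, ?_, ?_, ?_⟩ hc (T := fun t => Xor (p t) (q t))
    (fun t => Finset.mem_filter) ?_ H.conn, hc⟩
  · intro t ht
    rw [Finset.mem_filter] at ht ⊢
    rw [hp.rot t ht.1, hq.rot t ht.1]
    exact ⟨H.rot t ht.1, ht.2⟩
  · exact fun t ht => hp.rot t (Finset.mem_filter.1 ht).1
  · exact fun t ht => H.ne t (Finset.mem_filter.1 ht).1
  · intro s hs t ht h1 h2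
    rw [Finset.mem_filter] at hs ht
    obtain ⟨hs, ⟨ps, qs⟩ | ⟨qs, ps⟩⟩ := hs <;> obtain ⟨ht, ⟨pt, qt⟩ | ⟨qt, pt⟩⟩ := ht
    · rw [Tri.head_pos ps, Tri.head_pos pt] at h2
      exact hp.unique E (mem_dir.2 ⟨hs, rfl, rfl⟩) (mem_dir.2 ⟨ht, h1.symm, h2.symm⟩) ps pt
    · rw [Tri.head_pos ps, Tri.head_neg pt] at h2
      exact (xor_edge hp hq E (mem_dir.2 ⟨hs, h1, h2⟩) ps qs (t := t.rot.rot)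
        (mem_dir.2 ⟨rr ht, rfl, rfl⟩) ((hq.rot_rot H.rot ht).2 qt)
        (mt (hp.rot_rot H.rot ht).1 pt)).elim
    · rw [Tri.head_neg ps, Tri.head_pos pt] at h2
      exact (xor_edge hp hq E (mem_dir.2 ⟨ht, h1.symm, h2.symm⟩) pt qt (t := s.rot.rot)
        (mem_dir.2 ⟨rr hs, rfl, rfl⟩) ((hq.rot_rot H.rot hs).2 qs)
        (mt (hp.rot_rot H.rot hs).1 ps)).elim
    · rw [Tri.head_neg ps, Tri.head_neg pt] at h2
      exact rot_injective (rot_injective (hq.unique E (mem_dir.2 ⟨rr hs, rfl, rfl⟩)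
        (mem_dir.2 ⟨rr ht, h2.symm, h1.symm⟩) ((hq.rot_rot H.rot hs).2 qs)
        ((hq.rot_rot H.rot ht).2 qt)))
  · intro v s hs t ht hsv htv hst hf
    change Xor (p s) (q s) ↔ Xor (p t) (q t)
    rw [hp.sectorClosed H.rot v s hs t ht hsv htv hst hf,
      hq.sectorClosed H.rot v s hs t ht hsv htv hst hf]

/-! ### The meeting curves of two pigments -/

/-- Along the edge, oriented as the binding, two pigments come together. -/
def MeetEdge (K : Finset Tri) (p q : Tri → Prop) (e : Pt × Pt) : Prop :=
  ∃ f ∈ dir K e.1 e.2, ∃ g ∈ dir K e.1 e.2, ∃ h ∈ dir K e.2 e.1, f ≠ g ∧ p f ∧ q g ∧ p h ∧ q h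

/-- Along the edge, oriented as the binding, two pigments come together in the positive order. -/
def PosEdge (K : Finset Tri) (p q : Tri → Prop) (e : Pt × Pt) : Prop :=
  ∃ f ∈ dir K e.1 e.2, ∃ g ∈ dir K e.1 e.2, ∃ h ∈ dir K e.2 e.1, f ≠ g ∧ p f ∧ q g ∧ p h ∧ q h ∧
    LeftHanded e.1 e.2 f.c g.c h.c

theorem meet_true_of_edge (hp : Pigment K p) (hq : Pigment K q) (hK : ∀ t ∈ K, t.rot ∈ K)
    {w : Pt} {f g h : Tri} (hf : f ∈ dir K v w) (hg : g ∈ dir K v w) (hh : h ∈ dir K w v)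
    (hne : f ≠ g) (pf : p f) (qg : q g) (ph : p h) (qh : q h) : Meet K v w true p q f g h.rot :=
  ⟨hf, hg, rot_mem_stub_false hK hh, hne, pf, qg, (hp.rot h (mem_dir.1 hh).1).2 ph,
    (hq.rot h (mem_dir.1 hh).1).2 qh⟩

theorem meet_false_of_edge (hp : Pigment K p) (hq : Pigment K q) (hK : ∀ t ∈ K, t.rot ∈ K)
    {w : Pt} {f g h : Tri} (hf : f ∈ dir K w v) (hg : g ∈ dir K w v) (hh : h ∈ dir K v w)
    (hne : f ≠ g) (pf : p f) (qg : q g) (ph : p h) (qh : q h) :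
    Meet K v w false p q f.rot g.rot h :=
  ⟨rot_mem_stub_false hK hf, rot_mem_stub_false hK hg, hh, rot_injective.ne hne,
    (hp.rot f (mem_dir.1 hf).1).2 pf, (hq.rot g (mem_dir.1 hg).1).2 qg, ph, qh⟩

theorem meetEdge_of_false (hp : Pigment K p) (hq : Pigment K q) (hK : ∀ t ∈ K, t.rot ∈ K)
    {w : Pt} {f g h : Tri} (m : Meet K v w false p q f g h) : MeetEdge K p q (w, v) :=
  ⟨_, rot_rot_mem_dir hK m.hf, _, rot_rot_mem_dir hK m.hg, h, m.hh,
    (rot_injective.comp rot_injective).ne m.ne, (hp.rot_rot hK (mem_stub.1 m.hf).1).2 m.pf,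
    (hq.rot_rot hK (mem_stub.1 m.hg).1).2 m.qg, m.ph, m.qh⟩

theorem MeetEdge.not_reverse (H : EdgeHyp K) {a b : Pt} (h : MeetEdge K p q (a, b))
    (h' : MeetEdge K p q (b, a)) : False := by
  obtain ⟨f, hf, g, hg, -, -, hne, -⟩ := h
  obtain ⟨f', hf', g', hg', -, -, hne', -⟩ := h'
  exact hne' (H.not_four hf hg hne hf' hg')

/-- The meeting curve continues at the end of an edge. -/
theorem meet_step (hp : Pigment K p) (hq : Pigment K q) (H : ClosedFoam K) {a b : Pt}
    {f g h : Tri} (hf : f ∈ dir K a b) (hg : g ∈ dir K a b) (hh : h ∈ dir K b a) (hne : f ≠ g)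
    (pf : p f) (qg : q g) (ph : p h) (qh : q h) :
    ∃ x, ∃ f' ∈ dir K b x, ∃ g' ∈ dir K b x, ∃ h' ∈ dir K x b, f' ≠ g' ∧ p f' ∧ q g' ∧ p h' ∧
      q h' ∧ (LeftHanded a b f.c g.c h.c ↔ LeftHanded b x f'.c g'.c h'.c) ∧
      ∀ y, (MeetEdge K p q (b, y) → y = x) ∧ (MeetEdge K p q (y, b) → y = a) := by
  have lp := hp.toLocal H.rot b
  have lq := hq.toLocal H.rot b
  obtain ⟨h1, h2, h3⟩ := mem_dir.1 hh
  have hM := H.meet h h1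
  rw [h2] at hM
  have m := meet_false_of_edge hp hq H.rot hf hg hh hne pf qg ph qh
  obtain ⟨x, hx, f', g', h', m', hR, hu⟩ := hM p q lp lq a false _ _ _ m
  have e : MeetEdge K p q (a, b) := ⟨f, hf, g, hg, h, hh, hne, pf, qg, ph, qh⟩
  have e' : MeetEdge K p q (b, x) := ⟨f', m'.hf, g', m'.hg, _, rot_rot_mem_dir H.rot m'.hh, m'.ne,
    m'.pf, m'.qg, (hp.rot_rot H.rot (mem_stub.1 m'.hh).1).2 m'.ph,
    (hq.rot_rot H.rot (mem_stub.1 m'.hh).1).2 m'.qh⟩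
  refine ⟨x, f', m'.hf, g', m'.hg, _, rot_rot_mem_dir H.rot m'.hh, m'.ne, m'.pf, m'.qg,
    (hp.rot_rot H.rot (mem_stub.1 m'.hh).1).2 m'.ph,
    (hq.rot_rot H.rot (mem_stub.1 m'.hh).1).2 m'.qh, ?_, fun y => ⟨fun hy => ?_, fun hy => ?_⟩⟩
  -- The link at `b` looks at the edge from its end point, and reversing an edge turns right-handed
  -- order into left-handed order.
  · unfold LeftHanded
    rw [← rightHanded_reverse]
    refine Iff.trans hR ?_
    rw [rightHanded_cycle (u := f'.tip false)]
    rfl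
  · obtain ⟨f2, hf2, g2, hg2, k2, hk2, n2, pf2, qg2, pk2, qk2⟩ := id hy
    rcases hu _ _ _ _ _ (meet_true_of_edge hp hq H.rot hf2 hg2 hk2 n2 pf2 qg2 pk2 qk2) with r | r
    · subst r
      exact (e.not_reverse H.toEdgeHyp hy).elim
    · exact r
  · obtain ⟨f2, hf2, g2, hg2, k2, hk2, n2, pf2, qg2, pk2, qk2⟩ := id hy
    rcases hu _ _ _ _ _ (meet_false_of_edge hp hq H.rot hf2 hg2 hk2 n2 pf2 qg2 pk2 qk2) with r | r
    · exact r
    · subst r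
      exact (e'.not_reverse H.toEdgeHyp hy).elim

theorem PosEdge.meetEdge {e : Pt × Pt} (h : PosEdge K p q e) : MeetEdge K p q e := by
  obtain ⟨f, hf, g, hg, k, hk, n, pf, qg, pk, qk, -⟩ := h
  exact ⟨f, hf, g, hg, k, hk, n, pf, qg, pk, qk⟩

/-- By `meet_step` the neighbours of an edge at its end are unique. Uniqueness of the outgoing edge
is obtained from an incoming one, which the same passage through the vertex provides. -/
theorem MeetEdge.isCurve (hp : Pigment K p) (hq : Pigment K q) (H : ClosedFoam K) :
    IsCurve (MeetEdge K p q) := by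
  have hin : ∀ v w, MeetEdge K p q (v, w) → ∃ u, MeetEdge K p q (u, v) := by
    rintro v w ⟨f, hf, g, hg, h, hh, hne, pf, qg, ph, qh⟩
    obtain ⟨f1, f2, f3⟩ := mem_dir.1 hf
    have hM := H.meet f f1
    rw [f2] at hM
    obtain ⟨x, -, f', g', h', m', -⟩ := hM p q (hp.toLocal H.rot v) (hq.toLocal H.rot v) w true _ _ _
      (meet_true_of_edge hp hq H.rot hf hg hh hne pf qg ph qh)
    exact ⟨x, meetEdge_of_false hp hq H.rot m'⟩
  refine ⟨?_, ?_, ?_, ?_⟩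
  · refine Set.Finite.to_subtype (((K.image fun t => (t.a, t.b)).finite_toSet).subset ?_)
    rintro ⟨a, b⟩ ⟨f, hf, -⟩
    obtain ⟨f1, f2, f3⟩ := mem_dir.1 hf
    exact Finset.mem_coe.2 (Finset.mem_image.2 ⟨f, f1, by simp [f2, f3]⟩)
  · rintro u v ⟨f, hf, g, hg, h, hh, hne, pf, qg, ph, qh⟩
    obtain ⟨x, f', hf', g', hg', h', hh', n, pf', qg', ph', qh', -⟩ :=
      meet_step hp hq H hf hg hh hne pf qg ph qh
    exact ⟨x, f', hf', g', hg', h', hh', n, pf', qg', ph', qh'⟩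
  · intro v w w' h1 h2
    obtain ⟨u, f, hf, g, hg, h, hh, hne, pf, qg, ph, qh⟩ := hin v w h1
    obtain ⟨x, -, -, -, -, -, -, -, -, -, -, -, -, hu⟩ :=
      meet_step hp hq H hf hg hh hne pf qg ph qh
    exact ((hu w).1 h1).trans ((hu w').1 h2).symm
  · rintro u u' v ⟨f, hf, g, hg, h, hh, hne, pf, qg, ph, qh⟩ h2
    obtain ⟨x, -, -, -, -, -, -, -, -, -, -, -, -, hu⟩ :=
      meet_step hp hq H hf hg hh hne pf qg ph qh
    exact ((hu u').2 h2).symm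

/-- A set of edges of a curve that is closed under going forward is a curve. -/
theorem IsCurve.subset {V : Type*} {C D : V × V → Prop} (hC : IsCurve C) (hD : ∀ e, D e → C e)
    (h : ∀ u v w, D (u, v) → C (v, w) → D (v, w)) : IsCurve D := by
  refine ⟨?_, ?_, fun v w w' h1 h2 => hC.out_unique v w w' (hD _ h1) (hD _ h2),
    fun u u' v h1 h2 => hC.in_unique u u' v (hD _ h1) (hD _ h2)⟩
  · have := hC.finite
    exact Finite.of_injective (fun e : {e // D e} => (⟨e.1, hD _ e.2⟩ : {e // C e}))
      fun e e' he => Subtype.ext (congrArg (fun x : {e // C e} => x.1) he)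
  · intro u v huv
    obtain ⟨w, hw⟩ := hC.out u v (hD _ huv)
    exact ⟨w, h u v w huv hw⟩

/-- Positivity is carried along the curve by `meet_step`, so it is a property of whole components.
-/
theorem PosEdge.next (hp : Pigment K p) (hq : Pigment K q) (H : ClosedFoam K) {u v w : Pt}
    (h1 : PosEdge K p q (u, v)) (h2 : MeetEdge K p q (v, w)) : PosEdge K p q (v, w) := by
  obtain ⟨f, hf, g, hg, h, hh, hne, pf, qg, ph, qh, hL⟩ := h1
  obtain ⟨x, f', hf', g', hg', h', hh', n, pf', qg', ph', qh', hL', hu⟩ :=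
    meet_step hp hq H hf hg hh hne pf qg ph qh
  obtain rfl := (hu w).1 h2
  exact ⟨f', hf', g', hg', h', hh', n, pf', qg', ph', qh', hL'.1 hL⟩

theorem PosEdge.isCurve (hp : Pigment K p) (hq : Pigment K q) (H : ClosedFoam K) :
    IsCurve (PosEdge K p q) :=
  (MeetEdge.isCurve hp hq H).subset (fun _ h => h.meetEdge) fun _ _ _ h1 h2 => h1.next hp hq H h2

theorem MeetEdge.swap {e : Pt × Pt} (h : MeetEdge K p q e) : MeetEdge K q p e := by
  obtain ⟨f, hf, g, hg, k, hk, n, pf, qg, pk, qk⟩ := h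
  exact ⟨g, hg, f, hf, k, hk, n.symm, qg, pf, qk, pk⟩

/-- Interchanging the two pigments reverses the order of the three facets, and `hand` says that one
of the two orders is left-handed. -/
theorem meetEdge_iff (H : ClosedFoam K) {e : Pt × Pt} :
    MeetEdge K p q e ↔ PosEdge K p q e ∨ PosEdge K q p e := by
  constructor
  · rintro ⟨f, hf, g, hg, k, hk, n, pf, qg, pk, qk⟩
    by_cases h : LeftHanded e.1 e.2 f.c g.c k.c
    · exact Or.inl ⟨f, hf, g, hg, k, hk, n, pf, qg, pk, qk, h⟩
    · exact Or.inr ⟨g, hg, f, hf, k, hk, n.symm, qg, pf, qk, pk,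
        (H.hand _ _ g hg f hf k hk n.symm).2 h⟩
  · rintro (h | h)
    · exact h.meetEdge
    · exact h.meetEdge.swap

theorem PosEdge.not_swap (hp : Pigment K p) (hq : Pigment K q) (H : ClosedFoam K) {e : Pt × Pt}
    (h : PosEdge K p q e) : ¬ PosEdge K q p e := by
  rintro ⟨g', hg', f', hf', k', hk', -, qg', pf', pk', -, hL'⟩
  obtain ⟨f, hf, g, hg, k, hk, n, pf, qg, pk, qk, hL⟩ := h
  obtain rfl := hp.unique H.toEdgeHyp hf hf' pf pf'
  obtain rfl := hq.unique H.toEdgeHyp hg hg' qg qg'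
  obtain rfl := H.not_four hf hg n hk hk'
  exact (H.hand _ _ f hf g hg k hk n).1 hL hL'

end

end SlFoam

namespace SlFoam

noncomputable section

open scoped Classical

variable {K : Finset Tri} {p q r : Tri → Prop} {v : Pt} {sw : Pt → Prop}

/-! ## Exchanging two pigments on a part of their bichrome surface -/

/-- A set of vertices of the bichrome surface of two pigments that is a union of components. -/
structure Switch (K : Finset Tri) (p q : Tri → Prop) (sw : Pt → Prop) : Prop where
  const : ∀ t ∈ K, Xor (p t) (q t) → (sw t.a ↔ sw t.b)
  sub : ∀ v, sw v → ∃ t ∈ K, t.a = v ∧ Xor (p t) (q t)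

/-- The pigment `p` after the exchange with `q` on `sw`. -/
def exch (p q : Tri → Prop) (sw : Pt → Prop) (t : Tri) : Prop := if sw t.a then q t else p t

theorem Switch.symm (h : Switch K p q sw) : Switch K q p sw :=
  ⟨fun t ht hx => h.const t ht (xor_comm _ _ ▸ hx), fun v hv => by
    obtain ⟨t, ht, e, hx⟩ := h.sub v hv
    exact ⟨t, ht, e, xor_comm _ _ ▸ hx⟩⟩

/-- The exchange may be read at any vertex of a triangle: either the triangle is bichrome, and `sw`
is constant on it, or the two pigments agree there and nothing changes. -/
theorem Switch.exch_b (h : Switch K p q sw) {t : Tri} (ht : t ∈ K) :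
    exch p q sw t ↔ if sw t.b then q t else p t := by
  by_cases hx : Xor (p t) (q t)
  · have := h.const t ht hx
    simp only [exch, this]
  · have : p t ↔ q t := by unfold Xor at hx; tauto
    simp [exch, this]

theorem exch_rot (hp : Pigment K p) (hq : Pigment K q) (h : Switch K p q sw) {t : Tri}
    (ht : t ∈ K) : exch p q sw t.rot ↔ exch p q sw t := by
  rw [h.exch_b ht, exch, hp.rot t ht, hq.rot t ht]
  rfl

/-- All triangles at an edge can be read at the same end of it, so the conditions at that edge are
those of `p` or those of `q`. -/
theorem Switch.pigment (h : Switch K p q sw) (hp : Pigment K p) (hq : Pigment K q) :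
    Pigment K (exch p q sw) := by
  refine ⟨fun t ht => exch_rot hp hq h ht, ?_, ?_⟩
  · intro s hs t ht h1 h2 hf
    rw [h.exch_b ht, exch, hp.facet s hs t ht h1 h2 hf, hq.facet s hs t ht h1 h2 hf, h2]
  · intro a b f hf g hg k hk hne
    obtain ⟨f1, f2, f3⟩ := mem_dir.1 hf
    obtain ⟨g1, g2, g3⟩ := mem_dir.1 hg
    obtain ⟨k1, k2, k3⟩ := mem_dir.1 hk
    rw [h.exch_b k1, exch, exch, f2, g2, k3]
    split_ifs
    · exact hq.flow a b f hf g hg k hk hne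
    · exact hp.flow a b f hf g hg k hk hne

theorem exch_xor (t : Tri) : Xor (exch p q sw t) (exch q p sw t) ↔ Xor (p t) (q t) := by
  unfold exch
  split_ifs
  · rw [xor_comm]
  · rfl

/-- The triangle on the other side of an edge of the surface. -/
theorem partner_or_meet (hp : Pigment K p) (hq : Pigment K q) (H : EdgeHyp K) {a b : Pt} {t : Tri}
    (ht : t ∈ dir K a b) (pt : p t) (qt : ¬ q t) :
    (∃ u ∈ dir K b a, p u ∧ ¬ q u) ∨ MeetEdge K p q (a, b) := by
  obtain ⟨u, hu, pu⟩ := hp.exists_opp H ht pt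
  by_cases qu : q u
  · obtain ⟨g, hg, qg⟩ := hq.exists_opp H hu qu
    exact Or.inr ⟨t, ht, g, hg, u, hu, fun e => qt (e ▸ qg), pt, qg, pu, qu⟩
  · exact Or.inl ⟨u, hu, pu, qu⟩

theorem MeetEdge.no_partner (hp : Pigment K p) (H : EdgeHyp K) {a b : Pt}
    (h : MeetEdge K p q (a, b)) {u : Tri} (hu : u ∈ dir K b a) (pu : p u) : q u := by
  obtain ⟨f, hf, g, hg, k, hk, hne, pf, qg, pk, qk⟩ := h
  exact hp.unique H hk hu pk pu ▸ qk

/-- The triangles with `p` but not `q` at the vertices in `sw`. -/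
def onlyPart (K : Finset Tri) (p q : Tri → Prop) (sw : Pt → Prop) : Finset Tri :=
  K.filter fun t => p t ∧ ¬ q t ∧ sw t.a

theorem mem_onlyPart {t : Tri} : t ∈ onlyPart K p q sw ↔ t ∈ K ∧ p t ∧ ¬ q t ∧ sw t.a :=
  Finset.mem_filter

/-- Only local connectivity needs an argument. The alternative in `LinkConn` gives three points of
the link at which the surface ends, and the surface with `p` alone ends only at the meeting curve.
-/
theorem Switch.onlyPart_surf (h : Switch K p q sw) (hp : Pigment K p) (hq : Pigment K q)
    (H : ClosedFoam K) : Surf (onlyPart K p q sw) fun _ => True := by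
  have E := H.toEdgeHyp
  refine ⟨⟨?_, fun _ _ => Iff.rfl, ?_, ?_⟩, ?_⟩
  · intro t ht
    rw [mem_onlyPart] at ht ⊢
    rw [hp.rot t ht.1, hq.rot t ht.1]
    exact ⟨H.rot t ht.1, ht.2.1, ht.2.2.1,
      (h.const t ht.1 (Or.inl ⟨ht.2.1, ht.2.2.1⟩)).1 ht.2.2.2⟩
  · exact fun t ht => H.ne t (mem_onlyPart.1 ht).1
  · intro s hs t ht h1 h2
    rw [mem_onlyPart] at hs ht
    rw [Tri.head_true, Tri.head_true] at h2
    exact hp.unique E (mem_dir.2 ⟨hs.1, rfl, rfl⟩) (mem_dir.2 ⟨ht.1, h1.symm, h2.symm⟩)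
      hs.2.1 ht.2.1
  · intro s hs t ht hst
    rw [mem_onlyPart] at hs ht
    have hT : SectorClosed K s.a fun t => p t ∧ ¬ q t := by
      intro x hx y hy hxv hyv hxy hf
      change p x ∧ ¬ q x ↔ p y ∧ ¬ q y
      rw [hp.sectorClosed H.rot _ x hx y hy hxv hyv hxy hf,
        hq.sectorClosed H.rot _ x hx y hy hxv hyv hxy hf]
    rcases H.conn s hs.1 _ hT s hs.1 t ht.1 rfl hst.symm ⟨hs.2.1, hs.2.2.1⟩
      ⟨ht.2.1, ht.2.2.1⟩ with h1 | ⟨w₁, w₂, w₃, n1, n2, n3, h1⟩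
    · refine Relation.ReflTransGen.mono ?_ _ _ h1
      rintro x y ⟨⟨x1, x2, x3⟩, ⟨y1, y2, y3⟩, e⟩
      exact ⟨⟨mem_onlyPart.2 ⟨x1, x3.1, x3.2, by rw [x2]; exact hs.2.2.2⟩, x2, trivial⟩,
        ⟨mem_onlyPart.2 ⟨y1, y3.1, y3.2, by rw [y2]; exact hs.2.2.2⟩, y2, trivial⟩, e⟩
    -- Each of the three points is the other end of an edge of the meeting curve at this vertex, but
    -- a curve has just one incoming and one outgoing edge.
    · exfalso
      have hm : ∀ w, w = w₁ ∨ w = w₂ ∨ w = w₃ →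
          MeetEdge K p q (s.a, w) ∨ MeetEdge K p q (w, s.a) := by
        intro w hw
        obtain ⟨-, r, ⟨r1, r2, ⟨r3, r4⟩, ε, r5⟩, hu⟩ := h1 w hw
        have hbc : r.b ≠ r.c := H.ne _ (H.rot _ r1)
        cases ε
        · rcases partner_or_meet hp hq E (t := r.rot.rot) (mem_dir.2 ⟨H.rot _ (H.rot _ r1), r5, r2⟩)
            ((hp.rot_rot H.rot r1).2 r3) (mt (hq.rot_rot H.rot r1).1 r4) with ⟨u, hu1, hu2⟩ | hm
          · obtain ⟨u1, u2, u3⟩ := mem_dir.1 hu1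
            have := hu u ⟨u1, u2, hu2, true, u3⟩
            subst this
            exact (hbc (u3.trans r5.symm)).elim
          · exact Or.inr hm
        · rcases partner_or_meet hp hq E (t := r) (mem_dir.2 ⟨r1, r2, r5⟩) r3 r4 with
            ⟨u, hu1, hu2⟩ | hm
          · obtain ⟨u1, u2, u3⟩ := mem_dir.1 hu1
            have := hu u.rot ⟨H.rot _ u1, u3, ⟨(hp.rot u u1).2 hu2.1, mt (hq.rot u u1).1 hu2.2⟩,
              false, u2⟩
            subst this
            exact (hbc (r5.trans u2.symm)).elim
          · exact Or.inl hm
      have hC := MeetEdge.isCurve hp hq H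
      have ho := fun w w' => hC.out_unique s.a w w'
      have hi := fun w w' => hC.in_unique w w' s.a
      rcases hm w₁ (Or.inl rfl) with m1 | m1 <;> rcases hm w₂ (Or.inr (Or.inl rfl)) with m2 | m2
      · exact n1 (ho _ _ m1 m2)
      · rcases hm w₃ (Or.inr (Or.inr rfl)) with m3 | m3
        · exact n2 (ho _ _ m1 m3)
        · exact n3 (hi _ _ m2 m3)
      · rcases hm w₃ (Or.inr (Or.inr rfl)) with m3 | m3
        · exact n3 (ho _ _ m2 m3)
        · exact n2 (hi _ _ m1 m3)
      · exact n1 (hi _ _ m1 m2)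

/-- The part of the meeting curve in `sw`. -/
def meetPart (K : Finset Tri) (p q : Tri → Prop) (sw : Pt → Prop) (e : Pt × Pt) : Prop :=
  MeetEdge K p q e ∧ sw e.1

theorem MeetEdge.sw_iff (h : Switch K p q sw) (hq : Pigment K q) (H : EdgeHyp K)
    {e : Pt × Pt} (m : MeetEdge K p q e) : sw e.1 ↔ sw e.2 := by
  obtain ⟨f, hf, g, hg, k, hk, hne, pf, qg, pk, qk⟩ := m
  obtain ⟨f1, f2, f3⟩ := mem_dir.1 hf
  rw [← f2, ← f3]
  exact h.const f f1 (Or.inl ⟨pf, fun qf => hne (hq.unique H hf hg qf qg)⟩)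

theorem Switch.meetPart_isCurve (h : Switch K p q sw) (hp : Pigment K p) (hq : Pigment K q)
    (H : ClosedFoam K) : IsCurve (meetPart K p q sw) :=
  (MeetEdge.isCurve hp hq H).subset (fun _ he => he.1) fun _ _ _ h1 h2 =>
    ⟨h2, (h1.1.sw_iff h hq H.toEdgeHyp).1 h1.2⟩

theorem Surf.even_partner {S : Finset Tri} {o : Tri → Prop} (h : Surf S o) :
    Even (S.filter fun t => HasPartner S o t).card := by
  have h2 := Equiv.Perm.card_fixedPoints_modEq (α := {t // t ∈ S})
    (f := @DFunLike.coe _ _ _ _ h.cross) (p := 2) (n := 1) (funext fun t => h.crossFun_invol t)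
  have e : Fintype.card (Function.fixedPoints (@DFunLike.coe _ _ _ _ h.cross)) =
      (S.filter fun t => ¬ HasPartner S o t).card := by
    rw [← Fintype.card_coe]
    refine Fintype.card_congr ⟨fun x => ⟨x.1.1, Finset.mem_filter.2 ⟨x.1.2, fun hp =>
      (h.cross_ne x.1).2 hp x.2⟩⟩, fun x => ⟨⟨x.1, (Finset.mem_filter.1 x.2).1⟩,
      h.cross_eq_self (Finset.mem_filter.1 x.2).2⟩, fun _ => rfl, fun _ => rfl⟩
  have h3 := Finset.card_filter_add_card_filter_not (s := S) (fun t => HasPartner S o t)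
  rw [Fintype.card_coe] at h2
  erw [e] at h2
  rw [← h3] at h2
  have := (Nat.modEq_iff_dvd.1 h2)
  push_cast at this
  rw [Nat.even_iff]
  omega

/-- The parity of the number of components of the meeting curve in `sw`. -/
theorem Switch.parity (h : Switch K p q sw) (hp : Pigment K p) (hq : Pigment K q)
    (H : ClosedFoam K) [Fintype {e // meetPart K p q sw e}] :
    ∃ k m : ℕ, (onlyPart K p q sw).card = 3 * k ∧
      (onlyPart K p q sw).card = 2 * m + Fintype.card {e // meetPart K p q sw e} ∧
      (((onlyPart K p q sw).image Tri.a).card + m) % 2 = numComp (meetPart K p q sw) % 2 := by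
  have E := H.toEdgeHyp
  have hS := h.onlyPart_surf hp hq H
  have hC := h.meetPart_isCurve hp hq H
  -- The boundary of the surface with `p` alone is the meeting curve: where `p` continues into a
  -- triangle that also has `q`, the pigment `q` joins from the other side.
  have hb : ∀ t ∈ onlyPart K p q sw,
      (¬ HasPartner (onlyPart K p q sw) (fun _ => True) t ↔ MeetEdge K p q (t.a, t.b)) := by
    intro t ht
    have ht' := mem_onlyPart.1 ht
    constructor
    · intro hn
      refine (partner_or_meet hp hq E (mem_dir.2 ⟨ht'.1, rfl, rfl⟩) ht'.2.1
        ht'.2.2.1).resolve_left ?_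
      rintro ⟨u, hu, pu, qu⟩
      obtain ⟨u1, u2, u3⟩ := mem_dir.1 hu
      refine hn ⟨u, mem_onlyPart.2 ⟨u1, pu, qu, ?_⟩, by rwa [Tri.head_true], by rwa [Tri.head_true]⟩
      rw [u2]
      exact (h.const t ht'.1 (Or.inl ⟨ht'.2.1, ht'.2.2.1⟩)).1 ht'.2.2.2
    · rintro hm ⟨u, hu, u2, u3⟩
      have hu' := mem_onlyPart.1 hu
      rw [Tri.head_true] at u2 u3
      exact hu'.2.2.1 (hm.no_partner hp E (mem_dir.2 ⟨hu'.1, u2, u3⟩) hu'.2.1)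
  have htri : ∀ e : {e // meetPart K p q sw e}, ∃ t : {t : {t // t ∈ onlyPart K p q sw} //
      ¬ HasPartner (onlyPart K p q sw) (fun _ => True) t.1}, t.1.1.a = e.1.1 ∧ t.1.1.b = e.1.2 := by
    rintro ⟨⟨a, b⟩, hm, hs⟩
    obtain ⟨f, hf, g, hg, k, hk, hne, pf, qg, pk, qk⟩ := id hm
    obtain ⟨f1, f2, f3⟩ := mem_dir.1 hf
    have hfS : f ∈ onlyPart K p q sw := mem_onlyPart.2 ⟨f1, pf,
      fun qf => hne (hq.unique E hf hg qf qg), by rw [f2]; exact hs⟩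
    refine ⟨⟨⟨f, hfS⟩, (hb f hfS).2 ?_⟩, f2, f3⟩
    rw [f2, f3]
    exact hm
  choose F hF1 hF2 using htri
  have hFb : Function.Bijective F := by
    constructor
    · intro e e' he
      refine Subtype.ext (Prod.ext ?_ ?_)
      · rw [← hF1, ← hF1, he]
      · rw [← hF2, ← hF2, he]
    · rintro ⟨⟨t, ht⟩, hn⟩
      refine ⟨⟨(t.a, t.b), (hb t ht).1 hn, (mem_onlyPart.1 ht).2.2.2⟩, ?_⟩
      refine Subtype.ext (Subtype.ext (hS.unique _ (F _).1.2 _ ht (hF1 _) ?_))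
      rw [Tri.head_true, Tri.head_true]
      exact hF2 _
  let f := Equiv.ofBijective F hFb
  have hf : ∀ e, f e = F e := fun _ => rfl
  -- The boundary is traversed by the permutation `next` of the meeting curve, transported to the
  -- boundary triangles, so its sign counts the curves.
  have hpar := hS.parity (hC.next.extendDomain f) ?_ ?_
  · rw [Equiv.Perm.sign_extendDomain] at hpar
    have hsn := hC.sign_next
    obtain ⟨k, hk⟩ := hS.three_dvd
    obtain ⟨m, hm⟩ := hS.even_partner
    have hcard : ((onlyPart K p q sw).filter fun t =>
        ¬ HasPartner (onlyPart K p q sw) (fun _ => True) t).card =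
        Fintype.card {e // meetPart K p q sw e} := by
      rw [Fintype.card_congr f, ← Fintype.card_coe]
      refine Fintype.card_congr ⟨fun x => ⟨⟨x.1, (Finset.mem_filter.1 x.2).1⟩,
        (Finset.mem_filter.1 x.2).2⟩, fun x => ⟨x.1.1, Finset.mem_filter.2 ⟨x.1.2, x.2⟩⟩,
        fun _ => rfl, fun _ => rfl⟩
    have h3 := Finset.card_filter_add_card_filter_not (s := onlyPart K p q sw)
      (fun t => HasPartner (onlyPart K p q sw) (fun _ => True) t)
    rw [hcard] at h3
    refine ⟨k, m, hk, by rw [← h3, hm]; ring, ?_⟩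
    have hsg : Equiv.Perm.sign hC.next = (-1) ^ (Fintype.card {e // meetPart K p q sw e} +
        numComp (meetPart K p q sw)) := by
      rw [pow_add, hsn, ← mul_assoc, ← pow_add, Even.neg_one_pow ⟨_, rfl⟩, one_mul]
    rw [hsg, ← pow_add] at hpar
    -- With S = 3k = 2m + M for M boundary edges, S and M cancel modulo 2 and the number of vertices
    -- plus m remains.
    have := neg_one_pow_parity hpar
    omega
  · intro t ht
    exact Equiv.Perm.extendDomain_apply_not_subtype _ _ (not_not.2 ht)
  · intro t ht
    obtain ⟨e, he⟩ := f.surjective ⟨t, ht⟩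
    have e1 : t = (f e).1 := by rw [he]
    rw [e1, Equiv.Perm.extendDomain_apply_image, hf, hf, hF1, hC.next_fst, Tri.head_true, hF2]

end

end SlFoam

namespace SlFoam

noncomputable section

open scoped Classical

variable {K : Finset Tri} {p q r : Tri → Prop} {v : Pt} {sw : Pt → Prop}

/-! ### Euler characteristics after an exchange -/

/-- Six times the Euler characteristic of a closed surface, as a sum over the vertices. -/
def sixChi (S : Finset Tri) : ℤ := 6 * (S.image Tri.a).card - S.card

/-- The triangles with a property at the vertices in `sw`. -/
def part (K : Finset Tri) (P : Tri → Prop) (sw : Pt → Prop) : Finset Tri :=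
  K.filter fun t => P t ∧ sw t.a

theorem mem_part {P : Tri → Prop} {t : Tri} : t ∈ part K P sw ↔ t ∈ K ∧ P t ∧ sw t.a :=
  Finset.mem_filter

theorem sixChi_union {S T : Finset Tri} (h : ∀ s ∈ S, ∀ t ∈ T, s.a ≠ t.a) :
    sixChi (S ∪ T) = sixChi S + sixChi T := by
  have h1 : Disjoint S T := Finset.disjoint_left.2 fun s hs ht => h s hs s ht rfl
  have h2 : Disjoint (S.image Tri.a) (T.image Tri.a) := by
    rw [Finset.disjoint_left]
    intro v hs ht
    obtain ⟨s, hs', rfl⟩ := Finset.mem_image.1 hs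
    obtain ⟨t, ht', e⟩ := Finset.mem_image.1 ht
    exact h s hs' t ht' e.symm
  rw [sixChi, Finset.image_union, Finset.card_union_of_disjoint h1, Finset.card_union_of_disjoint h2]
  unfold sixChi
  push_cast
  ring

theorem sixChi_part_or {P : Tri → Prop} {sw sw' : Pt → Prop} (h : ∀ v, sw v → ¬ sw' v) :
    sixChi (part K P fun v => sw v ∨ sw' v) = sixChi (part K P sw) + sixChi (part K P sw') := by
  rw [← sixChi_union]
  · congr 1
    ext t
    simp only [mem_part, Finset.mem_union]
    tauto
  · intro s hs t ht e
    exact h _ (mem_part.1 hs).2.2 (e ▸ (mem_part.1 ht).2.2)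

theorem sixChi_filter (P : Tri → Prop) (sw : Pt → Prop) :
    sixChi (K.filter P) = sixChi (part K P sw) + sixChi (part K P fun v => ¬ sw v) := by
  rw [← sixChi_part_or fun v h => not_not.2 h]
  congr 1
  ext t
  simp only [mem_part, Finset.mem_filter]
  tauto

/-- This count is a sum over vertices, and the parts of a complex over `sw` and over its complement
have no vertex in common. -/
theorem sixChi_exch (P Q : Tri → Prop) (sw : Pt → Prop) :
    sixChi (K.filter (exch P Q sw)) =
      sixChi (K.filter P) + (sixChi (part K Q sw) - sixChi (part K P sw)) := by
  rw [sixChi_filter (exch P Q sw) sw, sixChi_filter P sw]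
  have h1 : part K (exch P Q sw) sw = part K Q sw := by
    ext t
    simp only [mem_part, exch]
    constructor
    · rintro ⟨h1, h2, h3⟩
      exact ⟨h1, by rwa [if_pos h3] at h2, h3⟩
    · rintro ⟨h1, h2, h3⟩
      exact ⟨h1, by rwa [if_pos h3], h3⟩
  have h2 : part K (exch P Q sw) (fun v => ¬ sw v) = part K P fun v => ¬ sw v := by
    ext t
    simp only [mem_part, exch]
    constructor
    · rintro ⟨h1, h2, h3⟩
      exact ⟨h1, by rwa [if_neg h3] at h2, h3⟩
    · rintro ⟨h1, h2, h3⟩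
      exact ⟨h1, by rwa [if_neg h3], h3⟩
  rw [h1, h2]
  ring

theorem Surf.sixChi_eq {S : Finset Tri} {o : Tri → Prop} (h : Surf S o) (hc : Surf.Closed S o) :
    6 * chi S = sixChi S := (h.six_chi hc).1

/-- A union of components of a closed surface is a closed surface. -/
theorem Surf.restrict {S : Finset Tri} {o : Tri → Prop} (h : Surf S o) (hc : Surf.Closed S o)
    (hsw : ∀ t ∈ S, (sw t.a ↔ sw t.b)) :
    Surf (S.filter fun t => sw t.a) o ∧ Surf.Closed (S.filter fun t => sw t.a) o := by
  have hh : ∀ t ∈ S, (sw t.a ↔ sw (t.head o)) := by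
    intro t ht
    by_cases ho : o t
    · rw [Tri.head_pos ho]; exact hsw t ht
    · rw [Tri.head_neg ho]; exact (hsw _ (h.rot _ (h.rot _ ht))).symm
  refine ⟨⟨⟨?_, ?_, ?_, ?_⟩, ?_⟩, ?_⟩
  · intro t ht
    rw [Finset.mem_filter] at ht ⊢
    exact ⟨h.rot t ht.1, (hsw t ht.1).1 ht.2⟩
  · exact fun t ht => h.o_rot t (Finset.mem_filter.1 ht).1
  · exact fun t ht => h.ne t (Finset.mem_filter.1 ht).1
  · exact fun s hs t ht => h.unique s (Finset.mem_filter.1 hs).1 t (Finset.mem_filter.1 ht).1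
  · intro s hs t ht hst
    rw [Finset.mem_filter] at hs ht
    refine Relation.ReflTransGen.mono ?_ _ _ (h.conn s hs.1 t ht.1 hst)
    rintro x y ⟨⟨x1, x2, -⟩, ⟨y1, y2, -⟩, e⟩
    exact ⟨⟨Finset.mem_filter.2 ⟨x1, by rw [x2]; exact hs.2⟩, x2, trivial⟩,
      ⟨Finset.mem_filter.2 ⟨y1, by rw [y2]; exact hs.2⟩, y2, trivial⟩, e⟩
  · intro t ht
    rw [Finset.mem_filter] at ht
    obtain ⟨u, hu, h1, h2⟩ := hc t ht.1
    exact ⟨u, Finset.mem_filter.2 ⟨hu, by rw [h1]; exact (hh t ht.1).1 ht.2⟩, h1, h2⟩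

theorem part_xor_eq : part K (fun t => Xor (p t) (q t)) sw =
    (K.filter fun t => Xor (p t) (q t)).filter fun t => sw t.a := by
  ext t
  simp only [mem_part, Finset.mem_filter, and_assoc]

theorem Switch.part_surf (h : Switch K p q sw) (hp : Pigment K p) (hq : Pigment K q)
    (H : ClosedFoam K) : Surf (part K (fun t => Xor (p t) (q t)) sw) p ∧
      Surf.Closed (part K (fun t => Xor (p t) (q t)) sw) p := by
  rw [part_xor_eq]
  exact (hp.xor_surf hq H).1.restrict (hp.xor_surf hq H).2 fun t ht =>
    h.const t (Finset.mem_filter.1 ht).1 (Finset.mem_filter.1 ht).2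

/-- A path from outside to inside has a step from outside to inside. -/
theorem reflTransGen_exit {α : Type*} {R : α → α → Prop} {P : α → Prop} {x y : α}
    (h : Relation.ReflTransGen R x y) (hx : P x) (hy : ¬ P y) : ∃ u w, R u w ∧ P u ∧ ¬ P w := by
  induction h with
  | refl => exact absurd hx hy
  | @tail b c h1 h2 ih =>
    by_cases hb : P b
    · exact ⟨b, c, h2, hb, hy⟩
    · exact ih hb

/-- On the way from the first triangle to the second inside the link of the bichrome surface there
is a step from `p` alone to `q` alone. By `xor_edge` the two triangles have the same direction at
the shared edge, so the pigments meet there. -/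
theorem meet_of_both (hp : Pigment K p) (hq : Pigment K q) (H : ClosedFoam K) {s t : Tri}
    (hs : s ∈ K) (ht : t ∈ K) (hst : s.a = t.a) (ps : p s) (qs : ¬ q s) (qt : q t) (pt : ¬ p t) :
    ∃ w, MeetEdge K p q (s.a, w) := by
  have E := H.toEdgeHyp
  have hp1 := (hp.xor_surf hq H).1.conn s (Finset.mem_filter.2 ⟨hs, Or.inl ⟨ps, qs⟩⟩) t
    (Finset.mem_filter.2 ⟨ht, Or.inr ⟨qt, pt⟩⟩) hst
  obtain ⟨x, y, ⟨⟨x1, x2, -⟩, ⟨y1, y2, -⟩, ε, δ, e⟩, px, py⟩ := reflTransGen_exit (P := p) hp1 ps pt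
  obtain ⟨x1, x3⟩ := Finset.mem_filter.1 x1
  obtain ⟨y1, y3⟩ := Finset.mem_filter.1 y1
  have qx : ¬ q x := by unfold Xor at x3; tauto
  have qy : q y := by unfold Xor at y3; tauto
  have key : ∀ a b : Pt, ∀ x y : Tri, x ∈ dir K a b → y ∈ dir K a b → p x → ¬ q x → q y →
      MeetEdge K p q (a, b) := by
    intro a b x y hx hy px qx qy
    have hne : x ≠ y := fun h => qx (h ▸ qy)
    obtain ⟨u, hu, pu⟩ := hp.exists_opp E hx px
    obtain ⟨u', hu', qu⟩ := hq.exists_opp E hy qy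
    obtain rfl := E.not_four hx hy hne hu hu'
    exact ⟨x, hx, y, hy, u, hu, hne, px, qy, pu, qu⟩
  have rr : ∀ {t : Tri}, t ∈ K → t.a = s.a → t.rot.rot ∈ dir K t.c s.a := fun ht h =>
    mem_dir.2 ⟨H.rot _ (H.rot _ ht), rfl, h⟩
  cases ε <;> cases δ
  · change x.c = y.c at e
    have m := key _ _ _ _ (rr x1 x2) (e ▸ rr y1 y2) ((hp.rot_rot H.rot x1).2 px)
      (mt (hq.rot_rot H.rot x1).1 qx) ((hq.rot_rot H.rot y1).2 qy)
    obtain ⟨w, hw⟩ := (MeetEdge.isCurve hp hq H).out _ _ m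
    exact ⟨w, hw⟩
  · exact (xor_edge hp hq E (rr x1 x2) ((hp.rot_rot H.rot x1).2 px)
      (mt (hq.rot_rot H.rot x1).1 qx) (mem_dir.2 ⟨y1, y2, e.symm⟩) qy py).elim
  · exact (xor_edge hp hq E (mem_dir.2 ⟨x1, x2, e⟩) px qx (rr y1 y2)
      ((hq.rot_rot H.rot y1).2 qy) (mt (hp.rot_rot H.rot y1).1 py)).elim
  · exact ⟨_, key _ _ _ _ (mem_dir.2 ⟨x1, x2, rfl⟩) (mem_dir.2 ⟨y1, y2, e.symm⟩) px qx qy⟩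

/-- A triangle with both pigments is joined to one with `q` alone inside the surface of `q`. At the
step where `p` is lost, the surface of `p` continues without `q`. -/
theorem exists_only (hp : Pigment K p) (hq : Pigment K q) (H : ClosedFoam K) {t y : Tri}
    (ht : t ∈ K) (hy : y ∈ K) (hty : t.a = y.a) (pt : p t) (hx : Xor (p y) (q y)) :
    ∃ u ∈ K, u.a = t.a ∧ p u ∧ ¬ q u := by
  have E := H.toEdgeHyp
  by_cases qt : q t
  swap
  · exact ⟨t, ht, rfl, pt, qt⟩
  rcases hx with ⟨py, qy⟩ | ⟨qy, py⟩
  · exact ⟨y, hy, hty.symm, py, qy⟩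
  have hp1 := (hq.surf H).1.conn t (Finset.mem_filter.2 ⟨ht, qt⟩) y
    (Finset.mem_filter.2 ⟨hy, qy⟩) hty
  obtain ⟨x, z, ⟨⟨x1, x2, -⟩, ⟨z1, z2, -⟩, ε, δ, e⟩, px, pz⟩ := reflTransGen_exit (P := p) hp1 pt py
  obtain ⟨x1, qx⟩ := Finset.mem_filter.1 x1
  obtain ⟨z1, qz⟩ := Finset.mem_filter.1 z1
  have key : ∀ a b : Pt, ∀ x z : Tri, x ∈ dir K a b → z ∈ dir K b a → p x → q z → ¬ p z →
      ∃ u ∈ dir K b a, p u ∧ ¬ q u := by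
    intro a b x z hx hz px qz pz
    obtain ⟨u, hu, pu⟩ := hp.exists_opp E hx px
    refine ⟨u, hu, pu, fun qu => pz ?_⟩
    rw [hq.unique E hz hu qz qu]; exact pu
  have rr : ∀ {y : Tri}, y ∈ K → y.a = t.a → y.rot.rot ∈ dir K y.c t.a := fun ht h =>
    mem_dir.2 ⟨H.rot _ (H.rot _ ht), rfl, h⟩
  cases ε <;> cases δ
  · exfalso
    change x.c = z.c at e
    have := hq.unique E (rr x1 x2) (e ▸ rr z1 z2) ((hq.rot_rot H.rot x1).2 qx)
      ((hq.rot_rot H.rot z1).2 qz)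
    exact pz (rot_injective (rot_injective this) ▸ px)
  · obtain ⟨u, hu, pu, qu⟩ := key _ _ _ _ (rr x1 x2) (mem_dir.2 ⟨z1, z2, e.symm⟩)
      ((hp.rot_rot H.rot x1).2 px) qz pz
    obtain ⟨u1, u2, u3⟩ := mem_dir.1 hu
    exact ⟨u, u1, u2, pu, qu⟩
  · obtain ⟨u, hu, pu, qu⟩ := key _ _ _ _ (mem_dir.2 ⟨x1, x2, e⟩) (rr z1 z2) px
      ((hq.rot_rot H.rot z1).2 qz) (mt (hp.rot_rot H.rot z1).1 pz)
    obtain ⟨u1, u2, u3⟩ := mem_dir.1 hu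
    exact ⟨u.rot, H.rot _ u1, u3, (hp.rot u u1).2 pu, mt (hq.rot u u1).1 qu⟩
  · exfalso
    have := hq.unique E (mem_dir.2 ⟨x1, x2, rfl⟩) (mem_dir.2 ⟨z1, z2, e.symm⟩) qx qz
    exact pz (this ▸ px)

theorem Switch.image_part (h : Switch K p q sw) (hp : Pigment K p) (hq : Pigment K q)
    (H : ClosedFoam K) : (part K p sw).image Tri.a = (onlyPart K p q sw).image Tri.a := by
  ext v
  simp only [Finset.mem_image, mem_part, mem_onlyPart]
  constructor
  · rintro ⟨t, ⟨h1, h2, h3⟩, rfl⟩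
    obtain ⟨y, y1, y2, y3⟩ := h.sub _ h3
    obtain ⟨u, u1, u2, u3, u4⟩ := exists_only hp hq H h1 y1 y2.symm h2 y3
    exact ⟨u, ⟨u1, u3, u4, by rwa [u2]⟩, u2⟩
  · rintro ⟨t, ⟨h1, h2, -, h3⟩, rfl⟩
    exact ⟨t, ⟨h1, h2, h3⟩, rfl⟩

/-- Over `sw` every vertex of the surface of `p` already lies on a triangle with `p` alone, so the
common triangles contribute to the number of triangles but not of vertices. -/
theorem Switch.sixChi_part (h : Switch K p q sw) (hp : Pigment K p) (hq : Pigment K q)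
    (H : ClosedFoam K) : sixChi (part K p sw) = sixChi (onlyPart K p q sw) -
      (part K (fun t => p t ∧ q t) sw).card := by
  have : part K p sw = onlyPart K p q sw ∪ part K (fun t => p t ∧ q t) sw := by
    ext t
    simp only [mem_part, mem_onlyPart, Finset.mem_union]
    tauto
  have hd : Disjoint (onlyPart K p q sw) (part K (fun t => p t ∧ q t) sw) := by
    rw [Finset.disjoint_left]
    intro t h1 h2
    exact (mem_onlyPart.1 h1).2.2.1 (mem_part.1 h2).2.1.2
  have hc := congrArg Finset.card this
  rw [Finset.card_union_of_disjoint hd] at hc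
  unfold sixChi
  rw [h.image_part hp hq H, hc]
  push_cast
  ring

/-- The vertices shared by the surfaces with `p` alone and `q` alone are those of the meeting curve,
and one edge of it starts at each. -/
theorem Switch.card_inter (h : Switch K p q sw) (hp : Pigment K p) (hq : Pigment K q)
    (H : ClosedFoam K) [Fintype {e // meetPart K p q sw e}] :
    ((onlyPart K p q sw).image Tri.a ∩ (onlyPart K q p sw).image Tri.a).card =
      Fintype.card {e // meetPart K p q sw e} := by
  have hC := h.meetPart_isCurve hp hq H
  rw [← Finset.card_univ]
  symm
  refine Finset.card_bij (fun e _ => e.1.1) ?_ (fun e _ e' _ he => hC.ext_fst he) ?_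
  · rintro ⟨⟨a, b⟩, ⟨f, hf, g, hg, k, hk, hne, pf, qg, pk, qk⟩, hs⟩ -
    obtain ⟨f1, f2, f3⟩ := mem_dir.1 hf
    obtain ⟨g1, g2, g3⟩ := mem_dir.1 hg
    change sw a at hs
    refine Finset.mem_inter.2 ⟨Finset.mem_image.2 ⟨f, mem_onlyPart.2 ⟨f1, pf, fun qf => hne
      (hq.unique H.toEdgeHyp hf hg qf qg), ?_⟩, f2⟩, Finset.mem_image.2 ⟨g, mem_onlyPart.2
      ⟨g1, qg, fun pg => hne (hp.unique H.toEdgeHyp hf hg pf pg), ?_⟩, g2⟩⟩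
    · rw [f2]; exact hs
    · rw [g2]; exact hs
  · intro v hv
    obtain ⟨h1, h2⟩ := Finset.mem_inter.1 hv
    obtain ⟨s, hs, rfl⟩ := Finset.mem_image.1 h1
    obtain ⟨t, ht, e⟩ := Finset.mem_image.1 h2
    have hs' := mem_onlyPart.1 hs
    have ht' := mem_onlyPart.1 ht
    obtain ⟨w, hw⟩ := meet_of_both hp hq H hs'.1 ht'.1 e.symm hs'.2.1 hs'.2.2.1 ht'.2.1 ht'.2.2.1
    exact ⟨⟨(s.a, w), hw, hs'.2.2.2⟩, Finset.mem_univ _, rfl⟩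

theorem Switch.sixChi_xor (h : Switch K p q sw) (hp : Pigment K p) (hq : Pigment K q)
    (H : ClosedFoam K) [Fintype {e // meetPart K p q sw e}] :
    sixChi (part K (fun t => Xor (p t) (q t)) sw) + 6 * Fintype.card {e // meetPart K p q sw e} =
      sixChi (onlyPart K p q sw) + sixChi (onlyPart K q p sw) := by
  have e1 : part K (fun t => Xor (p t) (q t)) sw = onlyPart K p q sw ∪ onlyPart K q p sw := by
    ext t
    simp only [mem_part, mem_onlyPart, Finset.mem_union, Xor]
    tauto
  have hd : Disjoint (onlyPart K p q sw) (onlyPart K q p sw) := by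
    rw [Finset.disjoint_left]
    intro t h1 h2
    exact (mem_onlyPart.1 h1).2.2.1 (mem_onlyPart.1 h2).2.1
  rw [e1]
  have h2 := Finset.card_union_add_card_inter ((onlyPart K p q sw).image Tri.a)
    ((onlyPart K q p sw).image Tri.a)
  rw [h.card_inter hp hq H] at h2
  unfold sixChi
  rw [Finset.image_union, Finset.card_union_of_disjoint hd]
  have h3 : (((onlyPart K p q sw).image Tri.a ∪ (onlyPart K q p sw).image Tri.a).card : ℤ) +
      Fintype.card {e // meetPart K p q sw e} = ((onlyPart K p q sw).image Tri.a).card +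
      ((onlyPart K q p sw).image Tri.a).card := by exact_mod_cast h2
  push_cast
  linarith

/-- The change of the Euler characteristics of the monochrome surfaces in an exchange. -/
theorem Switch.chi_mono (h : Switch K p q sw) (hp : Pigment K p) (hq : Pigment K q)
    (H : ClosedFoam K) : ∃ x : ℤ, chi (part K (fun t => Xor (p t) (q t)) sw) =
      chi (K.filter (exch p q sw)) - chi (K.filter p) + 2 * x ∧
      x % 2 = numComp (meetPart K p q sw) % 2 := by
  have hfin := (h.meetPart_isCurve hp hq H).finite
  have hft : Fintype {e // meetPart K p q sw e} := Fintype.ofFinite _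
  have c1 := (h.part_surf hp hq H).1.sixChi_eq (h.part_surf hp hq H).2
  have c2 := ((h.pigment hp hq).surf H).1.sixChi_eq ((h.pigment hp hq).surf H).2
  have c3 := (hp.surf H).1.sixChi_eq (hp.surf H).2
  have c4 := h.sixChi_xor hp hq H
  have c5 := h.sixChi_part hp hq H
  have c6 := h.symm.sixChi_part hq hp H
  rw [sixChi_exch] at c2
  have e1 : part K (fun t => q t ∧ p t) sw = part K (fun t => p t ∧ q t) sw := by
    ext t; simp only [mem_part]; tauto
  rw [e1] at c6
  obtain ⟨k, m, h1, h2, h3⟩ := h.parity hp hq H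
  have d1 : sixChi (onlyPart K p q sw) = 6 * ((onlyPart K p q sw).image Tri.a).card -
    (onlyPart K p q sw).card := rfl
  have h1' : ((onlyPart K p q sw).card : ℤ) = 3 * k := by exact_mod_cast h1
  have h2' : ((onlyPart K p q sw).card : ℤ) = 2 * m + Fintype.card {e // meetPart K p q sw e} := by
    exact_mod_cast h2
  -- This is the Euler characteristic of the surface with `p` alone, boundary included: it has k
  -- faces, m inner edges and 3k - 2m boundary edges. Its parity is that of the number of boundary
  -- circles.
  refine ⟨((onlyPart K p q sw).image Tri.a).card - 2 * k + m, ?_, ?_⟩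
  · linarith
  · omega

/-- What one pigment gains over `sw` the other loses. -/
theorem Switch.chi_mono_add (h : Switch K p q sw) (hp : Pigment K p) (hq : Pigment K q)
    (H : ClosedFoam K) : chi (K.filter (exch p q sw)) + chi (K.filter (exch q p sw)) =
      chi (K.filter p) + chi (K.filter q) := by
  have c1 := ((h.pigment hp hq).surf H).1.sixChi_eq ((h.pigment hp hq).surf H).2
  have c2 := ((h.symm.pigment hq hp).surf H).1.sixChi_eq ((h.symm.pigment hq hp).surf H).2
  have c3 := (hp.surf H).1.sixChi_eq (hp.surf H).2
  have c4 := (hq.surf H).1.sixChi_eq (hq.surf H).2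
  rw [sixChi_exch] at c1 c2
  linarith

/-! ### Meeting curves after an exchange -/

theorem PosEdge.exch_self (h : Switch K p q sw) {e : Pt × Pt} :
    PosEdge K (exch p q sw) (exch q p sw) e ↔
      (PosEdge K q p e ∧ sw e.1) ∨ (PosEdge K p q e ∧ ¬ sw e.1) := by
  have key : PosEdge K (exch p q sw) (exch q p sw) e ↔
      if sw e.1 then PosEdge K q p e else PosEdge K p q e := by
    have e1 : ∀ p q : Tri → Prop, ∀ t ∈ dir K e.1 e.2, exch p q sw t ↔ if sw e.1 then q t else p t := by
      intro p q t ht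
      rw [exch, (mem_dir.1 ht).2.1]
    have e2 : ∀ p q : Tri → Prop, Switch K p q sw → ∀ t ∈ dir K e.2 e.1,
        (exch p q sw t ↔ if sw e.1 then q t else p t) := by
      intro p q h t ht
      rw [h.exch_b (mem_dir.1 ht).1, (mem_dir.1 ht).2.2]
    by_cases hs : sw e.1
    · simp only [hs, if_true] at e1 e2 ⊢
      constructor
      · rintro ⟨f, hf, g, hg, k, hk, n, pf, qg, pk, qk, hL⟩
        exact ⟨f, hf, g, hg, k, hk, n, (e1 _ _ f hf).1 pf, (e1 _ _ g hg).1 qg,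
          (e2 _ _ h k hk).1 pk, (e2 _ _ h.symm k hk).1 qk, hL⟩
      · rintro ⟨f, hf, g, hg, k, hk, n, pf, qg, pk, qk, hL⟩
        exact ⟨f, hf, g, hg, k, hk, n, (e1 _ _ f hf).2 pf, (e1 _ _ g hg).2 qg,
          (e2 _ _ h k hk).2 pk, (e2 _ _ h.symm k hk).2 qk, hL⟩
    · simp only [hs, if_false] at e1 e2 ⊢
      constructor
      · rintro ⟨f, hf, g, hg, k, hk, n, pf, qg, pk, qk, hL⟩
        exact ⟨f, hf, g, hg, k, hk, n, (e1 _ _ f hf).1 pf, (e1 _ _ g hg).1 qg,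
          (e2 _ _ h k hk).1 pk, (e2 _ _ h.symm k hk).1 qk, hL⟩
      · rintro ⟨f, hf, g, hg, k, hk, n, pf, qg, pk, qk, hL⟩
        exact ⟨f, hf, g, hg, k, hk, n, (e1 _ _ f hf).2 pf, (e1 _ _ g hg).2 qg,
          (e2 _ _ h k hk).2 pk, (e2 _ _ h.symm k hk).2 qk, hL⟩
  rw [key]
  split_ifs <;> tauto

theorem Switch.posPart_isCurve (h : Switch K p q sw) (hp : Pigment K p) (hq : Pigment K q)
    (H : ClosedFoam K) : IsCurve fun e => PosEdge K p q e ∧ sw e.1 :=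
  (PosEdge.isCurve hp hq H).subset (fun _ he => he.1) fun _ _ _ h1 h2 =>
    ⟨h2, (h1.1.meetEdge.sw_iff h hq H.toEdgeHyp).1 h1.2⟩

theorem Switch.posPart_isCurve' (h : Switch K p q sw) (hp : Pigment K p) (hq : Pigment K q)
    (H : ClosedFoam K) : IsCurve fun e => PosEdge K p q e ∧ ¬ sw e.1 :=
  (PosEdge.isCurve hp hq H).subset (fun _ he => he.1) fun _ _ _ h1 h2 =>
    ⟨h2, mt (h1.1.meetEdge.sw_iff h hq H.toEdgeHyp).2 h1.2⟩

/-- The change of the number of positive curves of the exchanged pigments. -/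
theorem Switch.numComp_self (h : Switch K p q sw) (hp : Pigment K p) (hq : Pigment K q)
    (H : ClosedFoam K) : (-1 : ℤˣ) ^ numComp (PosEdge K (exch p q sw) (exch q p sw)) =
      (-1) ^ numComp (PosEdge K p q) * (-1) ^ numComp (meetPart K p q sw) := by
  have a1 := h.posPart_isCurve hp hq H
  have a2 := h.posPart_isCurve' hp hq H
  have a3 := h.symm.posPart_isCurve hq hp H
  have t1 : PosEdge K p q = fun e => (PosEdge K p q e ∧ sw e.1) ∨ (PosEdge K p q e ∧ ¬ sw e.1) := by
    funext e; apply propext; tauto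
  have t2 : PosEdge K (exch p q sw) (exch q p sw) =
      fun e => (PosEdge K q p e ∧ sw e.1) ∨ (PosEdge K p q e ∧ ¬ sw e.1) :=
    funext fun e => propext (PosEdge.exch_self h)
  -- Over `sw` the meeting curves are those positive for (p, q) together with those positive for (q,
  -- p). The exchange replaces the first kind by the second, so the parity changes by the total
  -- number.
  have t3 : meetPart K p q sw =
      fun e => (PosEdge K p q e ∧ sw e.1) ∨ (PosEdge K q p e ∧ sw e.1) := by
    funext e; apply propext; rw [meetPart, meetEdge_iff H]; tauto
  have n1 := IsCurve.numComp_union a1 a2 (t1 ▸ PosEdge.isCurve hp hq H) fun e h1 h2 => h2.2 h1.2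
  have n2 := IsCurve.numComp_union a3 a2
    (t2 ▸ PosEdge.isCurve (h.pigment hp hq) (h.symm.pigment hq hp) H) fun e h1 h2 => h2.2 h1.2
  have n3 := IsCurve.numComp_union a1 a3 (t3 ▸ h.meetPart_isCurve hp hq H) fun e h1 h2 =>
    h1.1.not_swap hp hq H h2.1
  rw [← t1] at n1
  rw [← t2] at n2
  rw [← t3] at n3
  rw [n1, n2, n3]
  generalize (-1 : ℤˣ) ^ numComp (fun e => PosEdge K p q e ∧ sw e.1) = x
  generalize (-1 : ℤˣ) ^ numComp (fun e => PosEdge K q p e ∧ sw e.1) = y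
  generalize (-1 : ℤˣ) ^ numComp (fun e => PosEdge K p q e ∧ ¬ sw e.1) = z
  rw [show x * z * (x * y) = x * x * (y * z) by
    rw [mul_assoc, mul_assoc, mul_comm z, mul_assoc], Int.units_mul_self, one_mul]

/-- The number of positive curves with a third pigment. -/
theorem Switch.numComp_other (h : Switch K p q sw) (hp : Pigment K p) (hq : Pigment K q)
    (hr : Pigment K r) (H : ClosedFoam K) :
    (-1 : ℤˣ) ^ (numComp (PosEdge K (exch p q sw) r) + numComp (PosEdge K (exch q p sw) r)) =
      (-1) ^ (numComp (PosEdge K p r) + numComp (PosEdge K q r)) ∧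
    (-1 : ℤˣ) ^ (numComp (PosEdge K r (exch p q sw)) + numComp (PosEdge K r (exch q p sw))) =
      (-1) ^ (numComp (PosEdge K r p) + numComp (PosEdge K r q)) := by
  have hp' := h.pigment hp hq
  have hq' := h.symm.pigment hq hp
  have a1 : ∀ p q : Tri → Prop, Switch K p q sw → ∀ a b : Pt, ∀ t, t ∈ dir K a b →
      (exch p q sw t ↔ if sw a then q t else p t) := by
    intro p q _ a b t ht
    rw [exch, (mem_dir.1 ht).2.1]
  have a2 : ∀ p q : Tri → Prop, Switch K p q sw → ∀ a b : Pt, ∀ t, t ∈ dir K a b →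
      (exch p q sw t ↔ if sw b then q t else p t) := by
    intro p q h a b t ht
    rw [h.exch_b (mem_dir.1 ht).1, (mem_dir.1 ht).2.2]
  have pos : ∀ {p p' q q' : Tri → Prop} {e : Pt × Pt},
      (∀ t, t ∈ dir K e.1 e.2 ∨ t ∈ dir K e.2 e.1 → ((p t ↔ p' t) ∧ (q t ↔ q' t))) →
      (PosEdge K p q e ↔ PosEdge K p' q' e) := by
    intro p p' q q' e hpq
    constructor
    · rintro ⟨f, hf, g, hg, k, hk, n, pf, qg, pk, qk, hL⟩
      exact ⟨f, hf, g, hg, k, hk, n, (hpq f (Or.inl hf)).1.1 pf, (hpq g (Or.inl hg)).2.1 qg,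
        (hpq k (Or.inr hk)).1.1 pk, (hpq k (Or.inr hk)).2.1 qk, hL⟩
    · rintro ⟨f, hf, g, hg, k, hk, n, pf, qg, pk, qk, hL⟩
      exact ⟨f, hf, g, hg, k, hk, n, (hpq f (Or.inl hf)).1.2 pf, (hpq g (Or.inl hg)).2.2 qg,
        (hpq k (Or.inr hk)).1.2 pk, (hpq k (Or.inr hk)).2.2 qk, hL⟩
  -- At a given edge the exchange may be read at either end; these are the two descriptions that
  -- `IsCurve.numComp_exchange` asks for.
  have at1 : ∀ b : Bool, ∀ e : Pt × Pt, ∀ t, t ∈ dir K e.1 e.2 ∨ t ∈ dir K e.2 e.1 →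
      ((if b then exch p q sw else exch q p sw) t ↔
        (if (b ^^ decide (sw e.1)) then p else q) t) ∧
      ((if b then exch p q sw else exch q p sw) t ↔
        (if (b ^^ decide (sw e.2)) then p else q) t) := by
    intro b e t ht
    have k1 : ∀ p q : Tri → Prop, Switch K p q sw → (exch p q sw t ↔ if sw e.1 then q t else p t) ∧
        (exch p q sw t ↔ if sw e.2 then q t else p t) := by
      intro p q h
      rcases ht with ht | ht
      · exact ⟨a1 p q h _ _ t ht, a2 p q h _ _ t ht⟩
      · exact ⟨a2 p q h _ _ t ht, a1 p q h _ _ t ht⟩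
    have k2 := k1 p q h
    have k3 := k1 q p h.symm
    cases b <;> by_cases s1 : sw e.1 <;> by_cases s2 : sw e.2 <;> simp_all
  refine ⟨?_, ?_⟩
  · exact IsCurve.numComp_exchange (C := fun b => PosEdge K (if b then p else q) r)
      (D := fun b => PosEdge K (if b then exch p q sw else exch q p sw) r)
      (fun b => by cases b; exacts [PosEdge.isCurve hq hr H, PosEdge.isCurve hp hr H])
      (fun b => by cases b; exacts [PosEdge.isCurve hq' hr H, PosEdge.isCurve hp' hr H])
      (fun v => decide (sw v)) (fun b e => pos fun t ht => ⟨(at1 b e t ht).1, Iff.rfl⟩)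
      (fun b e => pos fun t ht => ⟨(at1 b e t ht).2, Iff.rfl⟩)
  · exact IsCurve.numComp_exchange (C := fun b => PosEdge K r (if b then p else q))
      (D := fun b => PosEdge K r (if b then exch p q sw else exch q p sw))
      (fun b => by cases b; exacts [PosEdge.isCurve hr hq H, PosEdge.isCurve hr hp H])
      (fun b => by cases b; exacts [PosEdge.isCurve hr hq' H, PosEdge.isCurve hr hp' H])
      (fun v => decide (sw v)) (fun b e => pos fun t ht => ⟨Iff.rfl, (at1 b e t ht).1⟩)
      (fun b e => pos fun t ht => ⟨Iff.rfl, (at1 b e t ht).2⟩)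

end

end SlFoam

/-! ### The evaluation: exchange of pigments, poles, symmetry and integrality -/

namespace SlFoam

noncomputable section

open scoped Classical

variable {N : ℕ} {K : Finset Tri} {c : Facet K → Finset (Fin N)} {i j k : Fin N} {sw : Pt → Prop}

/-! ## Colorings -/

/-- The triangles with the pigment `i`. -/
def pig (c : Facet K → Finset (Fin N)) (i : Fin N) (t : Tri) : Prop := i ∈ col c t

theorem pig_iff {t : Tri} (h : t ∈ K) : pig c i t ↔ i ∈ c (.of t h) := by
  rw [pig, col, dif_pos h]

theorem pig_of_not_mem {t : Tri} (h : t ∉ K) : ¬ pig c i t := by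
  rw [pig, col, dif_neg h]; exact Finset.notMem_empty i

theorem facet_rot {t : Tri} (h : t ∈ K) (h' : t.rot ∈ K) : Facet.of t.rot h' = Facet.of t h :=
  (Quot.sound (r := facetRel K) (Or.inl rfl)).symm

/-- The relation that generates facets also demands equal labels; at a facet edge this is the flow
of the labels. -/
theorem facet_cross (H : EdgeHyp K) {s t : Tri} (hs : s ∈ K) (ht : t ∈ K) (h1 : t.a = s.b)
    (h2 : t.b = s.a) (hf : IsFacetEdge K s.a s.b) : Facet.of s hs = Facet.of t ht := by
  refine Quot.sound (r := facetRel K) (Or.inr ⟨h1, h2, ?_, hf⟩)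
  have hl := H.lab s.a s.b
  obtain ⟨x, hx⟩ := Finset.card_eq_one.1 hf.1
  obtain ⟨y, hy⟩ := Finset.card_eq_one.1 hf.2
  have e1 : s ∈ dir K s.a s.b := mem_dir.2 ⟨hs, rfl, rfl⟩
  have e2 : t ∈ dir K s.b s.a := mem_dir.2 ⟨ht, h1, h2⟩
  rw [hx, hy, Finset.sum_singleton, Finset.sum_singleton] at hl
  rw [hx, Finset.mem_singleton] at e1
  rw [hy, Finset.mem_singleton] at e2
  change s.lab = t.lab
  rw [← e1, ← e2] at hl
  exact hl

theorem lab_add (H : EdgeHyp K) {a b : Pt} {s t u : Tri} (hs : s ∈ dir K a b) (ht : t ∈ dir K a b)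
    (hu : u ∈ dir K b a) (hst : s ≠ t) : s.lab + t.lab = u.lab := by
  have h2 : ({s, t} : Finset Tri) ⊆ dir K a b := by
    intro x hx
    rcases Finset.mem_insert.1 hx with rfl | hx
    · exact hs
    · rw [Finset.mem_singleton.1 hx]; exact ht
  have h1 : ({u} : Finset Tri) ⊆ dir K b a := Finset.singleton_subset_iff.2 hu
  have l3 := H.le3 a b
  have c1 := Finset.card_le_card h2
  have c2 := Finset.card_le_card h1
  rw [Finset.card_pair hst] at c1
  rw [Finset.card_singleton] at c2
  have e1 := Finset.eq_of_subset_of_card_le h1 (by rw [Finset.card_singleton]; omega)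
  have e2 := Finset.eq_of_subset_of_card_le h2 (by rw [Finset.card_pair hst]; omega)
  have := H.lab a b
  rwa [← e1, ← e2, Finset.sum_pair hst, Finset.sum_singleton] at this

/-- The union at a binding is disjoint by counting, because the labels of the two smaller facets add
up to the label of the third. -/
theorem IsColoring.pigment (hc : IsColoring N K c) (H : EdgeHyp K) (i : Fin N) :
    Pigment K (pig c i) := by
  refine ⟨?_, ?_, ?_⟩
  · intro t ht
    rw [pig_iff ht, pig_iff (H.rot t ht), facet_rot ht]
  · intro s hs t ht h1 h2 hf
    rw [pig_iff hs, pig_iff ht, facet_cross H hs ht h1 h2 hf]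
  · intro a b f hf g hg h hh hne
    have hl := lab_add H hf hg hh hne
    obtain ⟨f1, f2, f3⟩ := mem_dir.1 hf
    obtain ⟨g1, g2, g3⟩ := mem_dir.1 hg
    obtain ⟨h1, h2, h3⟩ := mem_dir.1 hh
    have hb := hc.binding f g h f1 g1 h1 hne (g2.trans f2.symm) (g3.trans f3.symm)
      (h2.trans f3.symm) (h3.trans f2.symm)
    rw [pig_iff f1, pig_iff g1, pig_iff h1, ← hb, Finset.mem_union]
    refine ⟨Iff.rfl, fun hfg => ?_⟩
    have hcard := Finset.card_union_add_card_inter (c (.of f f1)) (c (.of g g1))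
    rw [hb, hc.card, hc.card, hc.card] at hcard
    change h.lab + _ = f.lab + g.lab at hcard
    have : (c (.of f f1) ∩ c (.of g g1)).card = 0 := by omega
    rw [Finset.card_eq_zero] at this
    exact absurd (Finset.mem_inter.2 hfg) (this ▸ Finset.notMem_empty i)

/-- The triangles at which the exchange of two pigments on `sw` makes a difference. -/
def Moved (c : Facet K → Finset (Fin N)) (i j : Fin N) (sw : Pt → Prop) (t : Tri) : Prop :=
  Xor (pig c i t) (pig c j t) ∧ sw t.a

/-- The coloring after the exchange of `i` and `j` on `sw`. -/
def recolor (c : Facet K → Finset (Fin N)) (i j : Fin N) (sw : Pt → Prop) :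
    Facet K → Finset (Fin N) := fun f =>
  if ∃ t h, Facet.of t h = f ∧ Moved c i j sw t then (c f).map (Equiv.swap i j).toEmbedding
  else c f

/-- Being moved is invariant under both steps that generate a facet, since `sw` is constant on
bichrome triangles; so it is a property of facets. -/
theorem moved_iff (h : Switch K (pig c i) (pig c j) sw) {t : Tri} (ht : t ∈ K) :
    (∃ s hs, Facet.of s hs = Facet.of t ht ∧ Moved c i j sw s) ↔ Moved c i j sw t := by
  refine ⟨?_, fun hm => ⟨t, ht, rfl, hm⟩⟩
  have resp : ∀ x y : {t : Tri // t ∈ K}, facetRel K x y →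
      Moved c i j sw x.1 = Moved c i j sw y.1 := by
    rintro ⟨x, hx⟩ ⟨y, hy⟩ hxy
    have hf : Facet.of x hx = Facet.of y hy := Quot.sound hxy
    have hX : Xor (pig c i x) (pig c j x) ↔ Xor (pig c i y) (pig c j y) := by
      rw [pig_iff hx, pig_iff hx, pig_iff hy, pig_iff hy, hf]
    refine propext ⟨fun ⟨m1, m2⟩ => ⟨hX.1 m1, ?_⟩, fun ⟨m1, m2⟩ => ⟨hX.2 m1, ?_⟩⟩
    · have hs := (h.const x hx m1).1 m2
      rcases hxy with e | ⟨e, -⟩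
      · change y = x.rot at e
        change sw y.a
        rw [e]; exact hs
      · change y.a = x.b at e
        change sw y.a
        rwa [e]
    · have hs := h.const x hx (hX.2 m1)
      rcases hxy with e | ⟨e, -⟩
      · change y = x.rot at e
        change sw y.a at m2
        rw [e] at m2; exact hs.2 m2
      · change y.a = x.b at e
        change sw y.a at m2
        rw [e] at m2; exact hs.2 m2
  rintro ⟨s, hs, e, hm⟩
  have := congrArg (Quot.lift (fun x : {t : Tri // t ∈ K} => Moved c i j sw x.1) resp) e
  change Moved c i j sw s = Moved c i j sw t at this
  rwa [← this]

theorem mem_swap_map {A : Finset (Fin N)} {k : Fin N} :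
    k ∈ A.map (Equiv.swap i j).toEmbedding ↔ Equiv.swap i j k ∈ A := by
  rw [Finset.mem_map_equiv, Equiv.symm_swap]

theorem pig_recolor (h : Switch K (pig c i) (pig c j) sw) (k : Fin N) {t : Tri}
    (ht : t ∈ K) : pig (recolor c i j sw) k t ↔
      if Moved c i j sw t then pig c (Equiv.swap i j k) t else pig c k t := by
  rw [pig_iff ht, recolor]
  simp only [moved_iff h ht]
  split_ifs
  · rw [mem_swap_map, pig_iff ht]
  · rw [pig_iff ht]

theorem pig_recolor_left (h : Switch K (pig c i) (pig c j) sw) :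
    pig (recolor c i j sw) i = exch (pig c i) (pig c j) sw := by
  funext t
  apply propext
  by_cases ht : t ∈ K
  · rw [pig_recolor h i ht, Equiv.swap_apply_left, exch, Moved, Xor]
    split_ifs <;> tauto
  · have h1 := pig_of_not_mem (c := recolor c i j sw) (i := i) ht
    have h2 := pig_of_not_mem (c := c) (i := i) ht
    have h3 := pig_of_not_mem (c := c) (i := j) ht
    unfold exch
    split_ifs <;> tauto

theorem pig_recolor_right (h : Switch K (pig c i) (pig c j) sw) :
    pig (recolor c i j sw) j = exch (pig c j) (pig c i) sw := by
  funext t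
  apply propext
  by_cases ht : t ∈ K
  · rw [pig_recolor h j ht, Equiv.swap_apply_right, exch, Moved, Xor]
    split_ifs <;> tauto
  · have h1 := pig_of_not_mem (c := recolor c i j sw) (i := j) ht
    have h2 := pig_of_not_mem (c := c) (i := i) ht
    have h3 := pig_of_not_mem (c := c) (i := j) ht
    unfold exch
    split_ifs <;> tauto

theorem pig_recolor_other (h : Switch K (pig c i) (pig c j) sw) (hi : k ≠ i)
    (hj : k ≠ j) : pig (recolor c i j sw) k = pig c k := by
  funext t
  apply propext
  by_cases ht : t ∈ K
  · rw [pig_recolor h k ht, Equiv.swap_apply_of_ne_of_ne hi hj, ite_self]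
  · exact iff_of_false (pig_of_not_mem ht) (pig_of_not_mem ht)

theorem IsColoring.switch (hc : IsColoring N K c) (H : EdgeHyp K)
    (h : Switch K (pig c i) (pig c j) sw) : IsColoring N K (recolor c i j sw) := by
  refine ⟨fun f => ?_, ?_⟩
  · unfold recolor
    split_ifs
    · rw [Finset.card_map, hc.card]
    · exact hc.card f
  · intro s t u hs ht hu hne h1 h2 h3 h4
    have hp : ∀ k, Pigment K (pig (recolor c i j sw) k) := by
      intro k
      by_cases hi : k = i
      · rw [hi, pig_recolor_left h]; exact h.pigment (hc.pigment H i) (hc.pigment H j)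
      by_cases hj : k = j
      · rw [hj, pig_recolor_right h]; exact h.symm.pigment (hc.pigment H j) (hc.pigment H i)
      rw [pig_recolor_other h hi hj]; exact hc.pigment H k
    ext k
    have := ((hp k).flow s.a s.b s (mem_dir.2 ⟨hs, rfl, rfl⟩) t (mem_dir.2 ⟨ht, h1, h2⟩) u
      (mem_dir.2 ⟨hu, h3, h4⟩) hne).1
    rw [pig_iff hs, pig_iff ht, pig_iff hu] at this
    rw [Finset.mem_union, this]

theorem pig_recolor_xor (h : Switch K (pig c i) (pig c j) sw) (t : Tri) :
    Xor (pig (recolor c i j sw) i t) (pig (recolor c i j sw) j t) ↔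
      Xor (pig c i t) (pig c j t) := by
  rw [pig_recolor_left h, pig_recolor_right h, exch_xor]

theorem moved_recolor (h : Switch K (pig c i) (pig c j) sw) (sw' : Pt → Prop) (t : Tri) :
    Moved (recolor c i j sw) i j sw' t ↔ Moved c i j sw' t := by
  rw [Moved, Moved, pig_recolor_xor h]

theorem recolor_recolor (h : Switch K (pig c i) (pig c j) sw) :
    recolor (recolor c i j sw) i j sw = c := by
  funext f
  have e : (∃ t ht, Facet.of t ht = f ∧ Moved (recolor c i j sw) i j sw t) ↔
      ∃ t ht, Facet.of t ht = f ∧ Moved c i j sw t := by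
    simp only [moved_recolor h]
  by_cases hm : ∃ t ht, Facet.of t ht = f ∧ Moved c i j sw t
  · rw [recolor, if_pos (e.2 hm), recolor, if_pos hm]
    ext k
    rw [mem_swap_map, mem_swap_map, Equiv.swap_apply_self]
  · rw [recolor, if_neg (mt e.1 hm), recolor, if_neg hm]

/-! ### Products over pairs of pigments -/

/-- A product over the pairs of pigments, arranged with respect to the pair `i < j`. -/
theorem prod_pairs {M : Type*} [CommMonoid M] (g : Fin N × Fin N → M) (hij : i < j) :
    ∏ p ∈ pigmentPairs N, g p = g (i, j) *
      (∏ k ∈ (Finset.univ.erase i).erase j, (if i < k then g (i, k) else g (k, i)) *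
        (if j < k then g (j, k) else g (k, j))) *
      ∏ a ∈ (Finset.univ.erase i).erase j, ∏ b ∈ (Finset.univ.erase i).erase j,
        if a < b then g (a, b) else 1 := by
  have split : ∀ f : Fin N → M, ∏ a, f a = f i * f j * ∏ a ∈ (Finset.univ.erase i).erase j, f a := by
    intro f
    rw [← Finset.mul_prod_erase Finset.univ f (Finset.mem_univ i),
      ← Finset.mul_prod_erase (Finset.univ.erase i) f
        (Finset.mem_erase.2 ⟨hij.ne', Finset.mem_univ j⟩), mul_assoc]
  rw [pigmentPairs, Finset.prod_filter, ← Finset.univ_product_univ, Finset.prod_product]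
  simp only
  rw [split, split, split]
  simp only [lt_irrefl, hij, hij.not_gt, if_true, if_false, one_mul]
  simp_rw [split fun b => if (_ : Fin N) < b then g (_, b) else (1 : M)]
  have e : ∏ k ∈ (Finset.univ.erase i).erase j, (if i < k then g (i, k) else g (k, i)) *
        (if j < k then g (j, k) else g (k, j)) =
      (∏ k ∈ (Finset.univ.erase i).erase j, if i < k then g (i, k) else 1) *
      (∏ k ∈ (Finset.univ.erase i).erase j, if j < k then g (j, k) else 1) *
      ((∏ k ∈ (Finset.univ.erase i).erase j, if k < i then g (k, i) else 1) *
      (∏ k ∈ (Finset.univ.erase i).erase j, if k < j then g (k, j) else 1)) := by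
    rw [← Finset.prod_mul_distrib, ← Finset.prod_mul_distrib, ← Finset.prod_mul_distrib]
    refine Finset.prod_congr rfl fun k hk => ?_
    rw [Finset.mem_erase, Finset.mem_erase] at hk
    rcases lt_or_gt_of_ne hk.2.1 with h1 | h1 <;> rcases lt_or_gt_of_ne hk.1 with h2 | h2 <;>
      simp [h1, h2, h1.not_gt, h2.not_gt, mul_comm]
  rw [Finset.prod_mul_distrib, Finset.prod_mul_distrib, e]
  ac_rfl

end

end SlFoam

namespace SlFoam

noncomputable section

open scoped Classical

variable {N : ℕ} {K : Finset Tri} {c : Facet K → Finset (Fin N)} {i j k : Fin N} {sw : Pt → Prop}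

/-! ## The sign -/

theorem mono_eq (c : Facet K → Finset (Fin N)) (i : Fin N) : mono c i = K.filter (pig c i) := by
  ext t
  simp only [mono, pig, Finset.mem_filter]

theorem bichrome_eq (c : Facet K → Finset (Fin N)) (i j : Fin N) :
    bichrome c i j = K.filter fun t => Xor (pig c i t) (pig c j t) := by
  ext t
  rw [bichrome, Finset.mem_filter, Finset.mem_filter]
  rfl

theorem thetaPos_eq (c : Facet K → Finset (Fin N)) (i j : Fin N) :
    thetaPos c i j = numComp (PosEdge K (pig c i) (pig c j)) := rfl

/-- The part of a bichrome surface over `sw`. -/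
def bipart (c : Facet K → Finset (Fin N)) (i j : Fin N) (sw : Pt → Prop) : Finset Tri :=
  part K (fun t => Xor (pig c i t) (pig c j t)) sw

theorem IsColoring.even_mono (hc : IsColoring N K c) (H : ClosedFoam K) (i : Fin N) :
    2 ∣ chi (mono c i) := by
  rw [mono_eq]
  have := (hc.pigment H.toEdgeHyp i).surf H
  exact (this.1.six_chi this.2).2

theorem IsColoring.six_bichrome (hc : IsColoring N K c) (H : ClosedFoam K) (i j : Fin N) :
    6 * chi (bichrome c i j) = sixChi (bichrome c i j) ∧ 2 ∣ chi (bichrome c i j) := by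
  rw [bichrome_eq]
  have := (hc.pigment H.toEdgeHyp i).xor_surf (hc.pigment H.toEdgeHyp j) H
  exact this.1.six_chi this.2

theorem IsColoring.six_bipart (hc : IsColoring N K c) (H : ClosedFoam K)
    (h : Switch K (pig c i) (pig c j) sw) :
    6 * chi (bipart c i j sw) = sixChi (bipart c i j sw) ∧ 2 ∣ chi (bipart c i j sw) := by
  have := h.part_surf (hc.pigment H.toEdgeHyp i) (hc.pigment H.toEdgeHyp j) H
  exact this.1.six_chi this.2

theorem sum_split (hij : i ≠ j) (f : Fin N → ℤ) :
    ∑ a, f a = f i + f j + ∑ a ∈ (Finset.univ.erase i).erase j, f a := by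
  rw [← Finset.add_sum_erase Finset.univ f (Finset.mem_univ i),
    ← Finset.add_sum_erase (Finset.univ.erase i) f
      (Finset.mem_erase.2 ⟨hij.symm, Finset.mem_univ j⟩), add_assoc]

theorem neg_one_pow_congr {x : ℤ} {m : ℕ} (h : x % 2 = m % 2) : (-1 : ℤˣ) ^ x = (-1) ^ m := by
  obtain ⟨y, hy⟩ : ∃ y, x = m + 2 * y := ⟨(x - m) / 2, by omega⟩
  rw [hy, zpow_add, zpow_mul, zpow_natCast, show ((-1 : ℤˣ) ^ (2 : ℤ)) = 1 from rfl, one_zpow,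
    mul_one]

/-- This is why only neighbouring pigments are exchanged: their order relative to a third pigment is
the same, so θ⁺ and Q do not change roles in the pairs with it. -/
theorem lt_iff_of_adjacent (hij : i.val + 1 = j.val) (hi : k ≠ i) (hj : k ≠ j) : i < k ↔ j < k := by
  have h1 := Fin.val_ne_of_ne hi
  have h2 := Fin.val_ne_of_ne hj
  rw [Fin.lt_def, Fin.lt_def]
  omega

/-- For the exchanged pair the parity changes by the number of meeting curves over `sw`. For a third
pigment the two pairs are taken together, and the total parity is unchanged by
`Switch.numComp_other`. -/
theorem IsColoring.prod_theta (hc : IsColoring N K c) (H : ClosedFoam K)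
    (hij : i.val + 1 = j.val) (h : Switch K (pig c i) (pig c j) sw) :
    ∏ p ∈ pigmentPairs N, (-1 : ℤˣ) ^ thetaPos (recolor c i j sw) p.1 p.2 =
      (∏ p ∈ pigmentPairs N, (-1 : ℤˣ) ^ thetaPos c p.1 p.2) *
        (-1) ^ numComp (meetPart K (pig c i) (pig c j) sw) := by
  have hlt : i < j := by rw [Fin.lt_def]; omega
  have P := hc.pigment H.toEdgeHyp
  rw [prod_pairs _ hlt, prod_pairs _ hlt]
  have e1 : (-1 : ℤˣ) ^ thetaPos (recolor c i j sw) i j = (-1) ^ thetaPos c i j *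
      (-1) ^ numComp (meetPart K (pig c i) (pig c j) sw) := by
    rw [thetaPos_eq, thetaPos_eq, pig_recolor_left h, pig_recolor_right h]
    exact h.numComp_self (P i) (P j) H
  have e2 : ∀ k ∈ (Finset.univ.erase i).erase j,
      (if i < k then (-1 : ℤˣ) ^ thetaPos (recolor c i j sw) i k
        else (-1) ^ thetaPos (recolor c i j sw) k i) *
      (if j < k then (-1) ^ thetaPos (recolor c i j sw) j k
        else (-1) ^ thetaPos (recolor c i j sw) k j) =
      (if i < k then (-1 : ℤˣ) ^ thetaPos c i k else (-1) ^ thetaPos c k i) *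
      (if j < k then (-1) ^ thetaPos c j k else (-1) ^ thetaPos c k j) := by
    intro k hk
    rw [Finset.mem_erase, Finset.mem_erase] at hk
    have hh := h.numComp_other (P i) (P j) (P k) H
    simp only [thetaPos_eq, pig_recolor_left h, pig_recolor_right h,
      pig_recolor_other h hk.2.1 hk.1, ← lt_iff_of_adjacent hij hk.2.1 hk.1]
    split_ifs
    · rw [← pow_add, ← pow_add]; exact hh.1
    · rw [← pow_add, ← pow_add]; exact hh.2
  have e3 : ∀ a ∈ (Finset.univ.erase i).erase j, ∀ b ∈ (Finset.univ.erase i).erase j,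
      (if a < b then (-1 : ℤˣ) ^ thetaPos (recolor c i j sw) a b else 1) =
      if a < b then (-1 : ℤˣ) ^ thetaPos c a b else 1 := by
    intro a ha b hb
    rw [Finset.mem_erase, Finset.mem_erase] at ha hb
    rw [thetaPos_eq, thetaPos_eq, pig_recolor_other h ha.2.1 ha.1, pig_recolor_other h hb.2.1 hb.1]
  simp only
  rw [Finset.prod_congr rfl e2, e1,
    Finset.prod_congr rfl fun a ha => Finset.prod_congr rfl fun b hb => e3 a ha b hb]
  ac_rfl

/-- Since j = i + 1 and χ(F_i) + χ(F_j) is preserved, the weighted sum of the χ/2 decreases by the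
change of χ(F_i)/2, that is, by χ(part)/2 - x. Here x has the parity of the number of meeting curves
over `sw`, which is also the change of the θ⁺ sum; so only χ(part)/2 survives. -/
theorem IsColoring.sign_recolor (hc : IsColoring N K c) (H : ClosedFoam K)
    (hij : i.val + 1 = j.val) (h : Switch K (pig c i) (pig c j) sw) :
    (-1 : ℤˣ) ^ signExp (recolor c i j sw) =
      (-1) ^ signExp c * (-1) ^ (chi (bipart c i j sw) / 2) := by
  have hne : i ≠ j := fun e => by rw [e] at hij; omega
  have P := hc.pigment H.toEdgeHyp
  have th : ∀ c : Facet K → Finset (Fin N),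
      (-1 : ℤˣ) ^ (∑ p ∈ pigmentPairs N, (thetaPos c p.1 p.2 : ℤ)) =
        ∏ p ∈ pigmentPairs N, (-1 : ℤˣ) ^ thetaPos c p.1 p.2 := by
    intro c
    rw [← Nat.cast_sum, zpow_natCast, Finset.prod_pow_eq_pow_sum]
  have hc' := hc.switch H.toEdgeHyp h
  obtain ⟨x, hx, hm⟩ := h.chi_mono (P i) (P j) H
  have ha := h.chi_mono_add (P i) (P j) H
  rw [← pig_recolor_left h, ← pig_recolor_right h] at ha
  rw [← pig_recolor_left h] at hx
  rw [← mono_eq, ← mono_eq] at hx ha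
  rw [← mono_eq, ← mono_eq] at ha
  change chi (bipart c i j sw) = _ at hx
  have hr : ∀ k ∈ (Finset.univ.erase i).erase j,
      ((k : ℤ) + 1) * (chi (mono (recolor c i j sw) k) / 2) =
        ((k : ℤ) + 1) * (chi (mono c k) / 2) := by
    intro k hk
    rw [Finset.mem_erase, Finset.mem_erase] at hk
    rw [mono_eq, mono_eq, pig_recolor_other h hk.2.1 hk.1]
  have key : ∑ k : Fin N, ((k : ℤ) + 1) * (chi (mono (recolor c i j sw) k) / 2) =
      ∑ k : Fin N, ((k : ℤ) + 1) * (chi (mono c k) / 2) -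
        (chi (bipart c i j sw) / 2 - x) := by
    rw [sum_split hne, sum_split hne, Finset.sum_congr rfl hr]
    obtain ⟨a, ha1⟩ := hc.even_mono H i
    obtain ⟨b, hb⟩ := hc.even_mono H j
    obtain ⟨a', ha'⟩ := hc'.even_mono H i
    obtain ⟨b', hb'⟩ := hc'.even_mono H j
    have hjz : (j : ℤ) = i + 1 := by exact_mod_cast hij.symm
    rw [ha', hb', ha1, hb] at ha
    rw [ha', ha1] at hx
    have e : b' = a + b - a' := by omega
    rw [hx, ha', hb', ha1, hb, hjz, show 2 * a' - 2 * a + 2 * x = 2 * (a' - a + x) by ring]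
    simp only [Int.mul_ediv_cancel_left _ (two_ne_zero : (2 : ℤ) ≠ 0)]
    rw [e]
    ring
  rw [signExp, signExp, zpow_add, zpow_add, th, th, hc.prod_theta H hij h, key,
    ← neg_one_pow_congr hm]
  have e : ∀ a b x : ℤ, (-1 : ℤˣ) ^ (a - (b - x)) = (-1) ^ a * (-1) ^ b * (-1) ^ x := by
    intro a b x
    rw [← zpow_add, ← zpow_add, show a + b + x = a - (b - x) + 2 * b by ring, zpow_add,
      zpow_mul _ 2, show ((-1 : ℤˣ) ^ (2 : ℤ)) = 1 from rfl, one_zpow, mul_one]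
  rw [e]
  have e2 := Int.units_mul_self ((-1 : ℤˣ) ^ x)
  generalize (-1 : ℤˣ) ^ x = u at *
  rw [show ∀ a b c : ℤˣ, a * b * u * (c * u) = a * c * b * (u * u) from fun a b c => by ac_rfl, e2,
    mul_one]

end

end SlFoam

namespace SlFoam

noncomputable section

open scoped Classical

variable {N : ℕ} {K : Finset Tri} {c : Facet K → Finset (Fin N)} {i j k : Fin N}
  {sw sw' : Pt → Prop}

/-! ## The contribution of a coloring -/

/-- The inclusion of the polynomials into the rational functions. -/
def toRat (N : ℕ) : MvPolynomial (Fin N) ℤ →+* Rat N :=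
  algebraMap (MvPolynomial (Fin N) ℤ) (Rat N)

theorem toRat_injective : Function.Injective (toRat N) :=
  IsFractionRing.injective (MvPolynomial (Fin N) ℤ) (Rat N)

theorem toRat_ne_zero {f : MvPolynomial (Fin N) ℤ} (h : f ≠ 0) : toRat N f ≠ 0 :=
  (map_ne_zero_iff (toRat N) toRat_injective).2 h

/-- The contribution of a coloring to the evaluation. -/
def term (d : Dots K) (c : Facet K → Finset (Fin N)) : Rat N :=
  (-1) ^ signExp c * toRat N (dotFactor d c) / qFactor c

theorem ratX_sub_ne_zero (h : i ≠ j) : ratX i - ratX j ≠ 0 :=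
  sub_ne_zero.2 fun e => h (MvPolynomial.X_injective (toRat_injective e))

/-- The change of half the Euler characteristics of the bichrome surfaces with a third pigment. -/
def shift (c : Facet K → Finset (Fin N)) (i j : Fin N) (sw : Pt → Prop) (k : Fin N) : ℤ :=
  (sixChi (bipart c j k sw) - sixChi (bipart c i k sw)) / 12

theorem bichrome_comm (c : Facet K → Finset (Fin N)) (i j : Fin N) :
    bichrome c i j = bichrome c j i := by
  rw [bichrome_eq, bichrome_eq]
  simp only [xor_comm]

theorem bichrome_recolor_left (h : Switch K (pig c i) (pig c j) sw) (hi : k ≠ i) (hj : k ≠ j) :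
    sixChi (bichrome (recolor c i j sw) i k) = sixChi (bichrome c i k) +
      (sixChi (bipart c j k sw) - sixChi (bipart c i k sw)) := by
  rw [bichrome_eq, bichrome_eq, pig_recolor_left h, pig_recolor_other h hi hj, bipart, bipart]
  refine Eq.trans ?_ ((sixChi_exch (K := K) (fun t => Xor (pig c i t) (pig c k t))
    (fun t => Xor (pig c j t) (pig c k t)) sw).trans ?_)
  · congr 1
    ext t
    refine Finset.mem_filter.trans (Iff.trans ?_ Finset.mem_filter.symm)
    simp only [exch]
    split_ifs <;> rfl
  · congr!

theorem bichrome_recolor_right (h : Switch K (pig c i) (pig c j) sw) (hi : k ≠ i) (hj : k ≠ j) :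
    sixChi (bichrome (recolor c i j sw) j k) = sixChi (bichrome c j k) +
      (sixChi (bipart c i k sw) - sixChi (bipart c j k sw)) := by
  rw [bichrome_eq, bichrome_eq, pig_recolor_right h, pig_recolor_other h hi hj, bipart, bipart]
  refine Eq.trans ?_ ((sixChi_exch (K := K) (fun t => Xor (pig c j t) (pig c k t))
    (fun t => Xor (pig c i t) (pig c k t)) sw).trans ?_)
  · congr 1
    ext t
    refine Finset.mem_filter.trans (Iff.trans ?_ Finset.mem_filter.symm)
    simp only [exch]
    split_ifs <;> rfl
  · congr!

/-- The division by 12 is exact: six converts the vertex count to Euler characteristics, and both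
bichrome surfaces, before and after the exchange, have even χ. -/
theorem IsColoring.shift_spec (hc : IsColoring N K c) (H : ClosedFoam K)
    (h : Switch K (pig c i) (pig c j) sw) (hi : k ≠ i) (hj : k ≠ j) :
    12 * shift c i j sw k = sixChi (bipart c j k sw) - sixChi (bipart c i k sw) ∧
    chi (bichrome (recolor c i j sw) i k) / 2 = chi (bichrome c i k) / 2 + shift c i j sw k ∧
    chi (bichrome (recolor c i j sw) j k) / 2 = chi (bichrome c j k) / 2 - shift c i j sw k := by
  have hc' := hc.switch H.toEdgeHyp h
  obtain ⟨a1, b1⟩ := hc.six_bichrome H i k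
  obtain ⟨a2, b2⟩ := hc.six_bichrome H j k
  obtain ⟨a3, b3⟩ := hc'.six_bichrome H i k
  obtain ⟨a4, b4⟩ := hc'.six_bichrome H j k
  have e1 := bichrome_recolor_left h hi hj
  have e2 := bichrome_recolor_right h hi hj
  rw [shift]
  omega

theorem bichrome_recolor_self (h : Switch K (pig c i) (pig c j) sw) :
    bichrome (recolor c i j sw) i j = bichrome c i j := by
  ext t
  rw [bichrome_eq, bichrome_eq, Finset.mem_filter, Finset.mem_filter, pig_recolor_xor h]

/-- The quotient of two linear factors that meet at `X_i = X_j`. -/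
def slope (i j k : Fin N) : Rat N := (ratX i - ratX k) / (ratX j - ratX k)

/-- The surface F_ij is unchanged, while F_ik and F_jk trade their parts over `sw`. So an exponent
moves from the factor X_j - X_k to X_i - X_k, with the same order of signs because i and j are
neighbours. -/
theorem IsColoring.qFactor_recolor (hc : IsColoring N K c) (H : ClosedFoam K)
    (hij : i.val + 1 = j.val) (h : Switch K (pig c i) (pig c j) sw) :
    qFactor (recolor c i j sw) = qFactor c *
      ∏ k ∈ (Finset.univ.erase i).erase j, slope i j k ^ shift c i j sw k := by
  have hlt : i < j := by rw [Fin.lt_def]; omega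
  rw [qFactor, qFactor, prod_pairs _ hlt, prod_pairs _ hlt]
  simp only
  rw [bichrome_recolor_self h]
  have e2 : ∀ k ∈ (Finset.univ.erase i).erase j,
      (if i < k then (ratX i - ratX k) ^ (chi (bichrome (recolor c i j sw) i k) / 2)
        else (ratX k - ratX i) ^ (chi (bichrome (recolor c i j sw) k i) / 2)) *
      (if j < k then (ratX j - ratX k) ^ (chi (bichrome (recolor c i j sw) j k) / 2)
        else (ratX k - ratX j) ^ (chi (bichrome (recolor c i j sw) k j) / 2)) =
      ((if i < k then (ratX i - ratX k) ^ (chi (bichrome c i k) / 2)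
        else (ratX k - ratX i) ^ (chi (bichrome c k i) / 2)) *
      (if j < k then (ratX j - ratX k) ^ (chi (bichrome c j k) / 2)
        else (ratX k - ratX j) ^ (chi (bichrome c k j) / 2))) *
      slope i j k ^ shift c i j sw k := by
    intro k hk
    rw [Finset.mem_erase, Finset.mem_erase] at hk
    obtain ⟨-, h1, h2⟩ := hc.shift_spec H h hk.2.1 hk.1
    have n1 : ratX i - ratX k ≠ 0 := ratX_sub_ne_zero hk.2.1.symm
    have n2 : ratX j - ratX k ≠ 0 := ratX_sub_ne_zero hk.1.symm
    have n1' : ratX k - ratX i ≠ 0 := ratX_sub_ne_zero hk.2.1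
    have n2' : ratX k - ratX j ≠ 0 := ratX_sub_ne_zero hk.1
    simp only [← lt_iff_of_adjacent hij hk.2.1 hk.1]
    split_ifs
    · rw [h1, h2, zpow_add₀ n1, zpow_sub₀ n2, slope, div_zpow]
      field_simp
    · rw [bichrome_comm _ k i, bichrome_comm _ k j, bichrome_comm _ k i, bichrome_comm _ k j, h1,
        h2, zpow_add₀ n1', zpow_sub₀ n2', slope, ← neg_sub (ratX k), ← neg_sub (ratX k) (ratX j),
        neg_div_neg_eq, div_zpow]
      field_simp
  have e3 : ∀ a ∈ (Finset.univ.erase i).erase j, ∀ b ∈ (Finset.univ.erase i).erase j,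
      (if a < b then (ratX a - ratX b) ^ (chi (bichrome (recolor c i j sw) a b) / 2) else 1) =
      if a < b then (ratX a - ratX b) ^ (chi (bichrome c a b) / 2) else 1 := by
    intro a ha b hb
    rw [Finset.mem_erase, Finset.mem_erase] at ha hb
    rw [bichrome_eq, bichrome_eq, pig_recolor_other h ha.2.1 ha.1, pig_recolor_other h hb.2.1 hb.1]
  rw [Finset.prod_congr rfl e2, Finset.prod_mul_distrib,
    Finset.prod_congr rfl fun a ha => Finset.prod_congr rfl fun b hb => e3 a ha b hb]
  ac_rfl

theorem qFactor_ne_zero (c : Facet K → Finset (Fin N)) : qFactor c ≠ 0 :=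
  Finset.prod_ne_zero_iff.2 fun _ hp => zpow_ne_zero _
    (ratX_sub_ne_zero (ne_of_lt (Finset.mem_filter.1 hp).2))

/-- The quotient of the contributions of a dot to two colorings. -/
def dotRatio (c c' : Facet K → Finset (Fin N)) (x : Dot K) : Rat N :=
  toRat N (esymmOn (c' x.1) (x.2 + 1)) / toRat N (esymmOn (c x.1) (x.2 + 1))

/-- The quotient of the contributions of two colorings that differ by an exchange. -/
def ratio (d : Dots K) (c : Facet K → Finset (Fin N)) (i j : Fin N) (sw : Pt → Prop) : Rat N :=
  (((-1 : ℤˣ) ^ (chi (bipart c i j sw) / 2) : ℤˣ) : ℤ) *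
    (d.prod fun x n => dotRatio c (recolor c i j sw) x ^ n) *
    ∏ k ∈ (Finset.univ.erase i).erase j, slope i j k ^ (-shift c i j sw k)

/-- Setting all indeterminates to 1 gives a binomial coefficient, which shows that elementary
symmetric polynomials do not vanish, even after indeterminates are identified. -/
theorem eval_one_esymmOn (A : Finset (Fin N)) (w : ℕ) :
    MvPolynomial.eval (fun _ => 1) (esymmOn A w) = (A.card.choose w : ℤ) := by
  rw [esymmOn, map_sum]
  simp [Finset.card_powersetCard]

theorem esymmOn_ne_zero {A : Finset (Fin N)} {w : ℕ} (h : w ≤ A.card) : esymmOn A w ≠ 0 := by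
  intro e
  have := eval_one_esymmOn A w
  rw [e, map_zero] at this
  exact (Nat.choose_pos h).ne' (by exact_mod_cast this.symm)

theorem IsColoring.esymmOn_ne_zero (hc : IsColoring N K c) (x : Dot K) :
    esymmOn (c x.1) (x.2 + 1) ≠ 0 :=
  SlFoam.esymmOn_ne_zero (by rw [hc.card]; exact x.2.2)

theorem neg_one_zpow_cast (n : ℤ) : (-1 : Rat N) ^ n = (((-1 : ℤˣ) ^ n : ℤˣ) : ℤ) := by
  rcases Int.even_or_odd n with h | h
  · rw [h.neg_one_zpow, h.neg_one_zpow]; simp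
  · rw [h.neg_one_zpow, h.neg_one_zpow]; simp

theorem IsColoring.term_recolor (hc : IsColoring N K c) (H : ClosedFoam K)
    (hij : i.val + 1 = j.val) (d : Dots K) (h : Switch K (pig c i) (pig c j) sw) :
    term d (recolor c i j sw) = term d c * ratio d c i j sw := by
  have hd : toRat N (dotFactor d (recolor c i j sw)) = toRat N (dotFactor d c) *
      d.prod fun x n => dotRatio c (recolor c i j sw) x ^ n := by
    rw [dotFactor, dotFactor, Finsupp.prod, Finsupp.prod, Finsupp.prod, map_prod, map_prod,
      ← Finset.prod_mul_distrib]
    refine Finset.prod_congr rfl fun x _ => ?_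
    rw [map_pow, map_pow, ← mul_pow, dotRatio, mul_div_cancel₀ _ (toRat_ne_zero (hc.esymmOn_ne_zero x))]
  rw [term, term, ratio, hd, hc.qFactor_recolor H hij h, neg_one_zpow_cast, neg_one_zpow_cast,
    hc.sign_recolor H hij h]
  simp only [zpow_neg, Finset.prod_inv_distrib, Units.val_mul, Int.cast_mul]
  have := qFactor_ne_zero c
  rw [div_eq_mul_inv, div_eq_mul_inv, mul_inv]
  ring

/-! ### Disjoint exchanges -/

theorem Switch.or {p q : Tri → Prop} (h : Switch K p q sw) (h' : Switch K p q sw') :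
    Switch K p q fun v => sw v ∨ sw' v :=
  ⟨fun t ht hx => or_congr (h.const t ht hx) (h'.const t ht hx), fun v hv =>
    hv.elim (h.sub v) (h'.sub v)⟩

/-- At a given facet at most one of two disjoint exchanges makes a difference. -/
theorem recolor_or (h : Switch K (pig c i) (pig c j) sw) (h' : Switch K (pig c i) (pig c j) sw')
    (hd : ∀ v, sw v → ¬ sw' v) (f : Facet K) :
    (recolor c i j (fun v => sw v ∨ sw' v) f = recolor c i j sw f ∧ recolor c i j sw' f = c f) ∨
    (recolor c i j (fun v => sw v ∨ sw' v) f = recolor c i j sw' f ∧ recolor c i j sw f = c f) := by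
  induction f using Quot.ind with
  | mk t =>
    obtain ⟨t, ht⟩ := t
    change (recolor c i j (fun v => sw v ∨ sw' v) (.of t ht) = recolor c i j sw (.of t ht) ∧
      recolor c i j sw' (.of t ht) = c (.of t ht)) ∨
      (recolor c i j (fun v => sw v ∨ sw' v) (.of t ht) = recolor c i j sw' (.of t ht) ∧
      recolor c i j sw (.of t ht) = c (.of t ht))
    unfold recolor
    simp only [moved_iff h, moved_iff h', moved_iff (h.or h')]
    unfold Moved
    by_cases hx : Xor (pig c i t) (pig c j t)
    · by_cases h1 : sw t.a
      · have h2 := hd _ h1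
        simp [hx, h1, h2]
      · simp [hx, h1]
    · simp [hx]

/-- Each ingredient respects disjoint unions: the Euler characteristics and shifts are sums over
vertices, and each dot is affected by at most one of the exchanges. -/
theorem IsColoring.ratio_or (hc : IsColoring N K c) (H : ClosedFoam K) (d : Dots K)
    (h : Switch K (pig c i) (pig c j) sw) (h' : Switch K (pig c i) (pig c j) sw')
    (hd : ∀ v, sw v → ¬ sw' v) :
    ratio d c i j (fun v => sw v ∨ sw' v) = ratio d c i j sw * ratio d c i j sw' := by
  have ho := h.or h'
  have e1 : chi (bipart c i j fun v => sw v ∨ sw' v) / 2 =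
      chi (bipart c i j sw) / 2 + chi (bipart c i j sw') / 2 := by
    obtain ⟨a1, b1⟩ := hc.six_bipart H h
    obtain ⟨a2, b2⟩ := hc.six_bipart H h'
    obtain ⟨a3, b3⟩ := hc.six_bipart H ho
    have : sixChi (bipart c i j fun v => sw v ∨ sw' v) = _ := sixChi_part_or hd
    change _ = sixChi (bipart c i j sw) + sixChi (bipart c i j sw') at this
    omega
  have e2 : ∀ x, dotRatio c (recolor c i j fun v => sw v ∨ sw' v) x =
      dotRatio c (recolor c i j sw) x * dotRatio c (recolor c i j sw') x := by
    intro x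
    have hn := toRat_ne_zero (hc.esymmOn_ne_zero x)
    rcases recolor_or h h' hd x.1 with ⟨e, e'⟩ | ⟨e, e'⟩
    · rw [dotRatio, dotRatio, dotRatio, e, e', div_self hn, mul_one]
    · rw [dotRatio, dotRatio, dotRatio, e, e', div_self hn, one_mul]
  have e3 : ∀ k ∈ (Finset.univ.erase i).erase j,
      slope i j k ^ (-shift c i j (fun v => sw v ∨ sw' v) k) =
      slope i j k ^ (-shift c i j sw k) * slope i j k ^ (-shift c i j sw' k) := by
    intro k hk
    rw [Finset.mem_erase, Finset.mem_erase] at hk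
    have n1 : ratX i - ratX k ≠ 0 := ratX_sub_ne_zero hk.2.1.symm
    have n2 : ratX j - ratX k ≠ 0 := ratX_sub_ne_zero hk.1.symm
    rw [← zpow_add₀ (show slope i j k ≠ 0 from div_ne_zero n1 n2)]
    have s1 := (hc.shift_spec H h hk.2.1 hk.1).1
    have s2 := (hc.shift_spec H h' hk.2.1 hk.1).1
    have s3 := (hc.shift_spec H ho hk.2.1 hk.1).1
    have t1 : sixChi (bipart c i k fun v => sw v ∨ sw' v) =
      sixChi (bipart c i k sw) + sixChi (bipart c i k sw') := sixChi_part_or hd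
    have t2 : sixChi (bipart c j k fun v => sw v ∨ sw' v) =
      sixChi (bipart c j k sw) + sixChi (bipart c j k sw') := sixChi_part_or hd
    congr 1
    omega
  rw [ratio, ratio, ratio, Finset.prod_congr rfl e3, Finset.prod_mul_distrib, e1, zpow_add,
    Units.val_mul, Int.cast_mul, Finsupp.prod, Finsupp.prod, Finsupp.prod]
  simp only [e2, mul_pow, Finset.prod_mul_distrib]
  ring

end

end SlFoam

namespace SlFoam

noncomputable section

open scoped Classical

variable {N : ℕ} {K : Finset Tri} {c : Facet K → Finset (Fin N)} {i j k : Fin N}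
  {sw sw' : Pt → Prop} {S : Finset Tri}

/-! ## The components of a bichrome surface -/

/-- The connected component of a point in the union of a set of triangles. -/
def piece (S : Finset Tri) (v : Pt) : Quot fun v w => ∃ s ∈ S, s.a = v ∧ s.b = w := Quot.mk _ v

theorem piece_eq {t : Tri} (ht : t ∈ S) : piece S t.a = piece S t.b := Quot.sound ⟨t, ht, rfl, rfl⟩

/-- The vertices in a connected component. -/
def comp (S : Finset Tri) (v : Pt) : Finset Pt :=
  (S.image Tri.a).filter fun w => piece S w = piece S v

/-- The connected components, given by their vertices. -/
def comps (S : Finset Tri) : Finset (Finset Pt) := (S.image Tri.a).image (comp S)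

/-- The points in some of the components. -/
def onSome (T : Finset (Finset Pt)) (v : Pt) : Prop := ∃ κ ∈ T, v ∈ κ

theorem mem_comps {κ : Finset Pt} (h : κ ∈ comps S) : ∃ x ∈ S, κ = comp S x.a := by
  obtain ⟨v, hv, rfl⟩ := Finset.mem_image.1 h
  obtain ⟨x, hx, rfl⟩ := Finset.mem_image.1 hv
  exact ⟨x, hx, rfl⟩

theorem mem_comp {t : Tri} (ht : t ∈ S) {v : Pt} : t.a ∈ comp S v ↔ piece S t.a = piece S v := by
  rw [comp, Finset.mem_filter]
  exact and_iff_right (Finset.mem_image_of_mem _ ht)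

theorem comps_disjoint {κ κ' : Finset Pt} (h : κ ∈ comps S) (h' : κ' ∈ comps S) {v : Pt}
    (hv : v ∈ κ) (hv' : v ∈ κ') : κ = κ' := by
  obtain ⟨x, hx, rfl⟩ := mem_comps h
  obtain ⟨y, hy, rfl⟩ := mem_comps h'
  have h1 := (Finset.mem_filter.1 hv).2
  have h2 := (Finset.mem_filter.1 hv').2
  unfold comp
  rw [← h1, ← h2]

theorem mem_comp_iff (hS : ∀ t ∈ S, t.rot ∈ S) {t : Tri} (ht : t ∈ S) {v : Pt} :
    t.a ∈ comp S v ↔ t.b ∈ comp S v := by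
  rw [mem_comp ht, piece_eq ht]
  exact (mem_comp (hS t ht)).symm

theorem onSome_iff (hS : ∀ t ∈ S, t.rot ∈ S) {T : Finset (Finset Pt)} (hT : T ⊆ comps S) {t : Tri}
    (ht : t ∈ S) : onSome T t.a ↔ onSome T t.b := by
  refine exists_congr fun κ => and_congr_right fun hκ => ?_
  obtain ⟨x, hx, rfl⟩ := mem_comps (hT hκ)
  exact mem_comp_iff hS ht

theorem onSome_insert (κ : Finset Pt) (T : Finset (Finset Pt)) :
    onSome (insert κ T) = fun v => v ∈ κ ∨ onSome T v := by
  funext v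
  simp only [onSome, Finset.mem_insert, exists_eq_or_imp]

theorem onSome_disjoint {κ : Finset Pt} {T : Finset (Finset Pt)} (h : insert κ T ⊆ comps S)
    (hκ : κ ∉ T) (v : Pt) (hv : v ∈ κ) : ¬ onSome T v := by
  rintro ⟨κ', h1, h2⟩
  have := comps_disjoint (h (Finset.mem_insert_self _ _)) (h (Finset.mem_insert_of_mem h1)) hv h2
  exact hκ (this ▸ h1)

theorem onSome_singleton (κ : Finset Pt) : onSome {κ} = fun v => v ∈ κ := by
  funext v
  simp only [onSome, Finset.mem_singleton, exists_eq_left]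

theorem mem_onSome_comps {t : Tri} (ht : t ∈ S) : onSome (comps S) t.a :=
  ⟨comp S t.a, Finset.mem_image_of_mem _ (Finset.mem_image_of_mem _ ht), (mem_comp ht).2 rfl⟩

/-- Triangles of the same component are connected by a chain of triangles. -/
theorem chain_of_comp (hS : ∀ t ∈ S, t.rot ∈ S) {κ : Finset Pt} (h : κ ∈ comps S) {x y : Tri}
    (hx : x ∈ S) (hxκ : x.a ∈ κ) (hy : y ∈ S) (hyκ : y.a ∈ κ) :
    Relation.ReflTransGen (fun s t => (s ∈ S ∧ s.a ∈ κ) ∧ (t ∈ S ∧ t.a ∈ κ) ∧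
      (t = s.rot ∨ s.a = t.a)) x y := by
  obtain ⟨z, hz, rfl⟩ := mem_comps h
  set Q : Pt → Prop := fun v => v ∈ comp S z.a → ∀ y ∈ S, y.a = v →
    Relation.ReflTransGen (fun s t => (s ∈ S ∧ s.a ∈ comp S z.a) ∧ (t ∈ S ∧ t.a ∈ comp S z.a) ∧
      (t = s.rot ∨ s.a = t.a)) x y with hQ
  -- The existence of chains to all triangles at a vertex is invariant along edges, hence depends
  -- only on the class of the vertex in `piece`.
  have resp : ∀ v w, (∃ s ∈ S, s.a = v ∧ s.b = w) → Q v = Q w := by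
    rintro _ _ ⟨s, hs, rfl, rfl⟩
    have h0 := mem_comp_iff hS hs (v := z.a)
    refine propext ⟨fun hq hv y hy e => ?_, fun hq hv y hy e => ?_⟩
    · have h1 := hq (h0.2 hv) s hs rfl
      refine (h1.tail ⟨⟨hs, h0.2 hv⟩, ⟨hS s hs, hv⟩, Or.inl rfl⟩).tail
        ⟨⟨hS s hs, hv⟩, ⟨hy, ?_⟩, Or.inr e.symm⟩
      rw [e]; exact hv
    · have hs1 := hS s hs
      have hs2 := hS _ hs1
      have h1 := hq (h0.1 hv) s.rot hs1 rfl
      have h3 : s.rot.rot.a ∈ comp S z.a := (mem_comp_iff hS hs1).1 (h0.1 hv)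
      refine ((h1.tail ⟨⟨hs1, h0.1 hv⟩, ⟨hs2, h3⟩, Or.inl rfl⟩).tail
        ⟨⟨hs2, h3⟩, ⟨hs, hv⟩, Or.inl rfl⟩).tail ⟨⟨hs, hv⟩, ⟨hy, ?_⟩, Or.inr e.symm⟩
      rw [e]; exact hv
  have h1 : Q x.a := fun _ y hy e =>
    Relation.ReflTransGen.single ⟨⟨hx, hxκ⟩, ⟨hy, e ▸ hxκ⟩, Or.inr e.symm⟩
  have h2 : piece S x.a = piece S y.a := ((mem_comp hx).1 hxκ).trans ((mem_comp hy).1 hyκ).symm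
  have h3 : Q x.a = Q y.a := congrArg (Quot.lift Q resp) h2
  exact (h3 ▸ h1) hyκ y hy rfl

/-! ### Exchanges on components -/

theorem IsColoring.bichrome_rot (hc : IsColoring N K c) (H : EdgeHyp K) :
    ∀ t ∈ bichrome c i j, t.rot ∈ bichrome c i j := by
  intro t ht
  rw [bichrome_eq, Finset.mem_filter] at ht ⊢
  rw [(hc.pigment H i).rot t ht.1, (hc.pigment H j).rot t ht.1]
  exact ⟨H.rot t ht.1, ht.2⟩

theorem IsColoring.switch_onSome (hc : IsColoring N K c) (H : EdgeHyp K) {T : Finset (Finset Pt)}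
    (hT : T ⊆ comps (bichrome c i j)) : Switch K (pig c i) (pig c j) (onSome T) := by
  constructor
  · intro t ht hx
    refine onSome_iff (hc.bichrome_rot H) hT ?_
    rw [bichrome_eq, Finset.mem_filter]
    exact ⟨ht, hx⟩
  · rintro v ⟨κ, h1, h2⟩
    obtain ⟨x, hx, rfl⟩ := mem_comps (hT h1)
    obtain ⟨t, ht, rfl⟩ := Finset.mem_image.1 (Finset.mem_filter.1 h2).1
    rw [bichrome_eq, Finset.mem_filter] at ht
    exact ⟨t, ht.1, rfl, ht.2⟩

theorem IsColoring.switch_comp (hc : IsColoring N K c) (H : EdgeHyp K) {κ : Finset Pt}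
    (hκ : κ ∈ comps (bichrome c i j)) : Switch K (pig c i) (pig c j) (· ∈ κ) := by
  have := hc.switch_onSome H (Finset.singleton_subset_iff.2 hκ)
  rwa [onSome_singleton] at this

theorem mem_bipart {t : Tri} : t ∈ bipart c i j sw ↔ t ∈ bichrome c i j ∧ sw t.a := by
  rw [bipart, mem_part, bichrome_eq, Finset.mem_filter, and_assoc]

theorem IsColoring.chi_comp_le (hc : IsColoring N K c) (H : ClosedFoam K) {κ : Finset Pt}
    (hκ : κ ∈ comps (bichrome c i j)) : chi (bipart c i j (· ∈ κ)) ≤ 2 := by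
  have := (hc.switch_comp H.toEdgeHyp hκ).part_surf (hc.pigment H.toEdgeHyp i)
    (hc.pigment H.toEdgeHyp j) H
  refine this.1.chi_le_two this.2 fun x hx y hy => ?_
  change x ∈ bipart c i j _ at hx
  change y ∈ bipart c i j _ at hy
  rw [mem_bipart] at hx hy
  refine Relation.ReflTransGen.mono ?_ _ _
    (chain_of_comp (hc.bichrome_rot H.toEdgeHyp) hκ hx.1 hx.2 hy.1 hy.2)
  rintro s t ⟨h1, h2, h3⟩
  exact ⟨mem_bipart.2 h1, mem_bipart.2 h2, h3⟩

/-- Additivity of six times the Euler characteristic over disjoint vertex sets; the evenness of each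
part allows division by 2. -/
theorem IsColoring.sum_chi_comps (hc : IsColoring N K c) (H : ClosedFoam K) :
    ∑ κ ∈ comps (bichrome c i j), chi (bipart c i j (· ∈ κ)) / 2 = chi (bichrome c i j) / 2 := by
  have key : ∀ T ⊆ comps (bichrome c i j), ∑ κ ∈ T, chi (bipart c i j (· ∈ κ)) / 2 =
      chi (bipart c i j (onSome T)) / 2 := by
    intro T
    induction T using Finset.induction_on with
    | empty =>
      intro _
      have : bipart c i j (onSome ∅) = ∅ := by
        ext t
        simp [mem_bipart, onSome]
      rw [this]
      simp [chi]
    | insert κ T hκ ih =>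
      intro hT
      have hT' := (Finset.subset_insert κ T).trans hT
      rw [Finset.sum_insert hκ, ih hT', onSome_insert]
      have s1 := hc.switch_comp H.toEdgeHyp (hT (Finset.mem_insert_self _ _))
      have s2 := hc.switch_onSome H.toEdgeHyp hT'
      obtain ⟨a1, b1⟩ := hc.six_bipart H s1
      obtain ⟨a2, b2⟩ := hc.six_bipart H s2
      obtain ⟨a3, b3⟩ := hc.six_bipart H (s1.or s2)
      have : sixChi (bipart c i j fun v => v ∈ κ ∨ onSome T v) = _ :=
        sixChi_part_or (onSome_disjoint hT hκ)
      change _ = sixChi (bipart c i j (· ∈ κ)) + sixChi (bipart c i j (onSome T)) at this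
      omega
  rw [key _ subset_rfl]
  congr 2
  ext t
  rw [mem_bipart]
  exact and_iff_left_of_imp mem_onSome_comps

theorem ratio_false (hc : IsColoring N K c) (d : Dots K) (i j : Fin N) :
    ratio d c i j (fun _ => False) = 1 := by
  have e1 : ∀ i j : Fin N, bipart c i j (fun _ => False) = ∅ := by
    intro i j
    ext t
    simp [mem_bipart]
  have e2 : recolor c i j (fun _ => False) = c := by
    funext f
    simp [recolor, Moved]
  have e3 : ∀ x, dotRatio c c x = 1 := fun x => div_self (toRat_ne_zero (hc.esymmOn_ne_zero x))
  simp [ratio, shift, e1, e2, e3, chi, sixChi]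

theorem IsColoring.ratio_onSome (hc : IsColoring N K c) (H : ClosedFoam K) (d : Dots K)
    (T : Finset (Finset Pt)) (hT : T ⊆ comps (bichrome c i j)) :
    ratio d c i j (onSome T) = ∏ κ ∈ T, ratio d c i j (· ∈ κ) := by
  induction T using Finset.induction_on with
  | empty =>
    have : onSome ∅ = fun _ => False := by funext v; simp [onSome]
    rw [this, ratio_false hc, Finset.prod_empty]
  | insert κ T hκ ih =>
    have hT' := (Finset.subset_insert κ T).trans hT
    rw [Finset.prod_insert hκ, ← ih hT', onSome_insert, hc.ratio_or H d
      (hc.switch_comp H.toEdgeHyp (hT (Finset.mem_insert_self _ _)))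
      (hc.switch_onSome H.toEdgeHyp hT') (onSome_disjoint hT hκ)]

/-! ### The evaluation as a sum onSome orbits of exchanges -/

/-- The colorings. -/
def colorings (N : ℕ) (K : Finset Tri) : Finset (Facet K → Finset (Fin N)) :=
  Finset.univ.filter fun c => IsColoring N K c

theorem mem_colorings : c ∈ colorings N K ↔ IsColoring N K c := by
  rw [colorings, Finset.mem_filter]
  exact and_iff_right (Finset.mem_univ c)

theorem evalRat_eq (d : Dots K) : evalRat N K d = ∑ c ∈ colorings N K, term d c := rfl

/-- The exchanges on subsets of components act on the colorings without changing the bichrome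
surface. Replacing each contribution by its average over the 2^n exchanges avoids choosing orbit
representatives, and expanding the product gives the sum over subsets. -/
theorem evalRat_eq_orbits (H : ClosedFoam K) (hij : i.val + 1 = j.val) (d : Dots K) :
    evalRat N K d = ∑ c ∈ colorings N K, (2 ^ (comps (bichrome c i j)).card : Rat N)⁻¹ *
      (term d c * ∏ κ ∈ comps (bichrome c i j), (1 + ratio d c i j (· ∈ κ))) := by
  have h1 : ∀ c ∈ colorings N K, (2 ^ (comps (bichrome c i j)).card : Rat N)⁻¹ *
      (term d c * ∏ κ ∈ comps (bichrome c i j), (1 + ratio d c i j (· ∈ κ))) =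
      ∑ T ∈ (comps (bichrome c i j)).powerset, (2 ^ (comps (bichrome c i j)).card : Rat N)⁻¹ *
        term d (recolor c i j (onSome T)) := by
    intro c hc
    rw [mem_colorings] at hc
    rw [Finset.prod_one_add, Finset.mul_sum, Finset.mul_sum]
    refine Finset.sum_congr rfl fun T hT => ?_
    rw [Finset.mem_powerset] at hT
    rw [hc.term_recolor H hij d (hc.switch_onSome H.toEdgeHyp hT), hc.ratio_onSome H d T hT]
  rw [Finset.sum_congr rfl h1, Finset.sum_sigma', evalRat_eq]
  -- The pair (coloring, set of components) is sent to (recolored coloring, same set); this is an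
  -- involution because the components stay the same.
  have h2 : ∑ x ∈ (colorings N K).sigma fun c => (comps (bichrome c i j)).powerset,
      (2 ^ (comps (bichrome x.1 i j)).card : Rat N)⁻¹ * term d (recolor x.1 i j (onSome x.2)) =
      ∑ x ∈ (colorings N K).sigma fun c => (comps (bichrome c i j)).powerset,
      (2 ^ (comps (bichrome x.1 i j)).card : Rat N)⁻¹ * term d x.1 := by
    have sw : ∀ x ∈ (colorings N K).sigma fun c => (comps (bichrome c i j)).powerset,
        Switch K (pig x.1 i) (pig x.1 j) (onSome x.2) ∧
        (⟨recolor x.1 i j (onSome x.2), x.2⟩ : Σ _ : Facet K → Finset (Fin N), Finset (Finset Pt)) ∈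
          (colorings N K).sigma fun c => (comps (bichrome c i j)).powerset := by
      rintro ⟨c, T⟩ hx
      rw [Finset.mem_sigma, mem_colorings, Finset.mem_powerset] at hx
      have := hx.1.switch_onSome H.toEdgeHyp hx.2
      refine ⟨this, ?_⟩
      rw [Finset.mem_sigma, mem_colorings, Finset.mem_powerset]
      dsimp only
      rw [bichrome_recolor_self this]
      exact ⟨hx.1.switch H.toEdgeHyp this, hx.2⟩
    refine Finset.sum_nbij' (fun x => ⟨recolor x.1 i j (onSome x.2), x.2⟩)
      (fun x => ⟨recolor x.1 i j (onSome x.2), x.2⟩) (fun x hx => (sw x hx).2) (fun x hx => (sw x hx).2)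
      ?_ ?_ ?_
    · rintro ⟨c, T⟩ hx
      simp only [recolor_recolor (sw _ hx).1]
    · rintro ⟨c, T⟩ hx
      simp only [recolor_recolor (sw _ hx).1]
    · rintro ⟨c, T⟩ hx
      simp only [bichrome_recolor_self (sw _ hx).1]
  rw [h2, Finset.sum_sigma]
  refine Finset.sum_congr rfl fun c _ => ?_
  dsimp only
  rw [Finset.sum_const, Finset.card_powerset, nsmul_eq_mul, ← mul_assoc, Nat.cast_pow,
    Nat.cast_ofNat, mul_inv_cancel₀, one_mul]
  exact pow_ne_zero _ two_ne_zero

end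

end SlFoam

namespace SlFoam

noncomputable section

open scoped Classical

variable {N : ℕ} {K : Finset Tri} {c : Facet K → Finset (Fin N)} {i j k : Fin N}
  {sw sw' : Pt → Prop}

/-! ## Rational functions without a pole along `X_i = X_j` -/

/-- The specialization `X_i ↦ X_j`. -/
def collapse (i j : Fin N) : MvPolynomial (Fin N) ℤ →ₐ[ℤ] MvPolynomial (Fin N) ℤ :=
  MvPolynomial.aeval fun k => if k = i then MvPolynomial.X j else MvPolynomial.X k

theorem dvd_sub_aeval {P : MvPolynomial (Fin N) ℤ} {g : Fin N → MvPolynomial (Fin N) ℤ}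
    (h : ∀ k, P ∣ MvPolynomial.X k - g k) (f : MvPolynomial (Fin N) ℤ) :
    P ∣ f - MvPolynomial.aeval g f := by
  induction f using MvPolynomial.induction_on with
  | C r => simp
  | add p q hp hq =>
    rw [map_add, add_sub_add_comm]
    exact dvd_add hp hq
  | mul_X p n hp =>
    rw [map_mul, MvPolynomial.aeval_X,
      show p * MvPolynomial.X n - MvPolynomial.aeval g p * g n =
        (p - MvPolynomial.aeval g p) * MvPolynomial.X n +
          MvPolynomial.aeval g p * (MvPolynomial.X n - g n) by ring]
    exact dvd_add (hp.mul_right _) ((h n).mul_left _)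

theorem collapse_X (i j k : Fin N) : collapse i j (MvPolynomial.X k) =
    if k = i then MvPolynomial.X j else MvPolynomial.X k := MvPolynomial.aeval_X _ _

theorem collapse_root (i j : Fin N) :
    collapse i j (MvPolynomial.X i - MvPolynomial.X j) = 0 := by
  rw [map_sub, collapse_X, collapse_X, if_pos rfl, ite_self, sub_self]

/-- Modulo X_i - X_j every polynomial agrees with its specialization. -/
theorem root_dvd_iff {f : MvPolynomial (Fin N) ℤ} :
    (MvPolynomial.X i - MvPolynomial.X j) ∣ f ↔ collapse i j f = 0 := by
  constructor
  · rintro ⟨g, rfl⟩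
    rw [map_mul, collapse_root, zero_mul]
  · intro h
    have := dvd_sub_aeval (P := MvPolynomial.X i - MvPolynomial.X j)
      (g := fun k => if k = i then MvPolynomial.X j else MvPolynomial.X k) (fun k => by
        split_ifs with e
        · rw [e]
        · rw [sub_self]; exact dvd_zero _) f
    change _ ∣ f - collapse i j f at this
    rwa [h, sub_zero] at this

theorem collapse_sub_ne_zero {a b : Fin N} (hab : a ≠ b) (h1 : ¬ (a = i ∧ b = j))
    (h2 : ¬ (a = j ∧ b = i)) : collapse i j (MvPolynomial.X a - MvPolynomial.X b) ≠ 0 := by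
  rw [map_sub, collapse_X, collapse_X, sub_ne_zero]
  split_ifs with ha hb hb
  · exact absurd (ha.trans hb.symm) hab
  · intro e
    exact h1 ⟨ha, (MvPolynomial.X_injective e).symm⟩
  · intro e
    exact h2 ⟨MvPolynomial.X_injective e, hb⟩
  · exact fun e => hab (MvPolynomial.X_injective e)

/-- The multiples of X_i - X_j are the kernel of a homomorphism to a domain. -/
theorem root_prime (h : i ≠ j) :
    Prime (MvPolynomial.X i - MvPolynomial.X j : MvPolynomial (Fin N) ℤ) := by
  refine ⟨sub_ne_zero.2 fun e => h (MvPolynomial.X_injective e), fun hu => ?_, fun a b hab => ?_⟩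
  · have := root_dvd_iff.1 (hu.dvd (a := 1))
    rw [map_one] at this
    exact one_ne_zero this
  · rw [root_dvd_iff, map_mul, mul_eq_zero] at hab
    rwa [root_dvd_iff, root_dvd_iff]

/-- A rational function without a pole along `X_i = X_j`. -/
def Regular (i j : Fin N) (x : Rat N) : Prop :=
  ∃ a b, collapse i j b ≠ 0 ∧ x * toRat N b = toRat N a

/-- A rational function which is `1` along `X_i = X_j`. -/
def Near (i j : Fin N) (x : Rat N) : Prop :=
  ∃ a b, collapse i j b ≠ 0 ∧
    x * toRat N b = toRat N (b + (MvPolynomial.X i - MvPolynomial.X j) * a)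

theorem ne_zero_of_collapse {b : MvPolynomial (Fin N) ℤ} (h : collapse i j b ≠ 0) : b ≠ 0 :=
  fun e => h (by rw [e, map_zero])

theorem collapse_mul_ne_zero {a b : MvPolynomial (Fin N) ℤ} (ha : collapse i j a ≠ 0)
    (hb : collapse i j b ≠ 0) : collapse i j (a * b) ≠ 0 := by
  rw [map_mul]; exact mul_ne_zero ha hb

namespace Regular

variable {x y : Rat N}

theorem of_poly (a : MvPolynomial (Fin N) ℤ) : Regular i j (toRat N a) :=
  ⟨a, 1, by rw [map_one]; exact one_ne_zero, by rw [map_one, mul_one]⟩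

theorem inv_poly {b : MvPolynomial (Fin N) ℤ} (h : collapse i j b ≠ 0) :
    Regular i j (toRat N b)⁻¹ :=
  ⟨1, b, h, by rw [inv_mul_cancel₀ (toRat_ne_zero (ne_zero_of_collapse h)), map_one]⟩

theorem mul (hx : Regular i j x) (hy : Regular i j y) : Regular i j (x * y) := by
  obtain ⟨a, b, h1, h2⟩ := hx
  obtain ⟨a', b', h1', h2'⟩ := hy
  exact ⟨a * a', b * b', collapse_mul_ne_zero h1 h1', by rw [map_mul, map_mul, ← h2, ← h2']; ring⟩

theorem add (hx : Regular i j x) (hy : Regular i j y) : Regular i j (x + y) := by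
  obtain ⟨a, b, h1, h2⟩ := hx
  obtain ⟨a', b', h1', h2'⟩ := hy
  refine ⟨a * b' + a' * b, b * b', collapse_mul_ne_zero h1 h1', ?_⟩
  rw [map_add, map_mul, map_mul, map_mul, ← h2, ← h2']
  ring

theorem one : Regular i j (1 : Rat N) := by
  have := of_poly (i := i) (j := j) (1 : MvPolynomial (Fin N) ℤ)
  rwa [map_one] at this

theorem sum {ι : Type*} {s : Finset ι} {f : ι → Rat N} (h : ∀ a ∈ s, Regular i j (f a)) :
    Regular i j (∑ a ∈ s, f a) := by
  have h0 : Regular i j (0 : Rat N) := by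
    have := of_poly (i := i) (j := j) (0 : MvPolynomial (Fin N) ℤ)
    rwa [map_zero] at this
  exact Finset.sum_induction f (Regular i j) (fun _ _ => add) h0 h

theorem prod {ι : Type*} {s : Finset ι} {f : ι → Rat N} (h : ∀ a ∈ s, Regular i j (f a)) :
    Regular i j (∏ a ∈ s, f a) :=
  Finset.prod_induction f (Regular i j) (fun _ _ => mul) one h

theorem pow (h : Regular i j x) (n : ℕ) : Regular i j (x ^ n) := by
  induction n with
  | zero => rw [pow_zero]; exact one
  | succ n ih => rw [pow_succ]; exact ih.mul h

theorem zpow {b : MvPolynomial (Fin N) ℤ} (h : collapse i j b ≠ 0) (n : ℤ) :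
    Regular i j (toRat N b ^ n) := by
  rcases Int.eq_nat_or_neg n with ⟨m, rfl | rfl⟩
  · rw [zpow_natCast]
    exact (of_poly b).pow m
  · rw [zpow_neg, zpow_natCast, ← inv_pow]
    exact (inv_poly h).pow m

theorem intCast (n : ℤ) : Regular i j (n : Rat N) := by
  have := of_poly (i := i) (j := j) (n : MvPolynomial (Fin N) ℤ)
  rwa [map_intCast] at this

end Regular

namespace Near

variable {x y : Rat N}

theorem one : Near i j (1 : Rat N) :=
  ⟨0, 1, by rw [map_one]; exact one_ne_zero, by rw [mul_zero, add_zero, one_mul]⟩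

theorem regular (h : Near i j x) : Regular i j x := by
  obtain ⟨a, b, h1, h2⟩ := h
  exact ⟨_, b, h1, h2⟩

theorem mul (hx : Near i j x) (hy : Near i j y) : Near i j (x * y) := by
  obtain ⟨a, b, h1, h2⟩ := hx
  obtain ⟨a', b', h1', h2'⟩ := hy
  refine ⟨a * b' + b * a' + (MvPolynomial.X i - MvPolynomial.X j) * a * a', b * b',
    collapse_mul_ne_zero h1 h1', ?_⟩
  rw [show b * b' + (MvPolynomial.X i - MvPolynomial.X j) *
      (a * b' + b * a' + (MvPolynomial.X i - MvPolynomial.X j) * a * a') =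
      (b + (MvPolynomial.X i - MvPolynomial.X j) * a) *
        (b' + (MvPolynomial.X i - MvPolynomial.X j) * a') by ring, map_mul, map_mul, ← h2, ← h2']
  ring

theorem inv (h : Near i j x) : Near i j x⁻¹ := by
  obtain ⟨a, b, h1, h2⟩ := h
  have h3 : collapse i j (b + (MvPolynomial.X i - MvPolynomial.X j) * a) ≠ 0 := by
    rwa [map_add, map_mul, collapse_root, zero_mul, add_zero]
  refine ⟨-a, _, h3, ?_⟩
  have hx : x ≠ 0 := by
    rintro rfl
    rw [zero_mul] at h2
    exact toRat_ne_zero (ne_zero_of_collapse h3) h2.symm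
  rw [← h2, ← mul_assoc, inv_mul_cancel₀ hx, one_mul]
  congr 1
  ring

theorem prod {ι : Type*} {s : Finset ι} {f : ι → Rat N} (h : ∀ a ∈ s, Near i j (f a)) :
    Near i j (∏ a ∈ s, f a) :=
  Finset.prod_induction f (Near i j) (fun _ _ => mul) one h

theorem pow (h : Near i j x) (n : ℕ) : Near i j (x ^ n) := by
  induction n with
  | zero => rw [pow_zero]; exact one
  | succ n ih => rw [pow_succ]; exact ih.mul h

theorem zpow (h : Near i j x) (n : ℤ) : Near i j (x ^ n) := by
  rcases Int.eq_nat_or_neg n with ⟨m, rfl | rfl⟩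
  · rw [zpow_natCast]
    exact h.pow m
  · rw [zpow_neg, zpow_natCast]
    exact (h.pow m).inv

/-- The difference 1 - x carries a factor X_i - X_j in its numerator, which cancels the simple pole.
-/
theorem regular_div (h : Near i j x) (hij : i ≠ j) :
    Regular i j ((1 - x) * (ratX i - ratX j)⁻¹) := by
  obtain ⟨a, b, h1, h2⟩ := h
  refine ⟨-a, b, h1, ?_⟩
  have hn := ratX_sub_ne_zero hij
  have e : toRat N (MvPolynomial.X i - MvPolynomial.X j) = ratX i - ratX j := map_sub _ _ _
  rw [map_add, map_mul, e] at h2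
  rw [map_neg, show (1 - x) * (ratX i - ratX j)⁻¹ * toRat N b =
    (toRat N b - x * toRat N b) * (ratX i - ratX j)⁻¹ by ring, h2]
  field_simp
  ring

end Near

/-- Evaluation at all ones does not see the specialization and gives a positive binomial
coefficient. -/
theorem collapse_esymmOn_ne_zero {A : Finset (Fin N)} {w : ℕ} (h : w ≤ A.card) :
    collapse i j (esymmOn A w) ≠ 0 := by
  intro e
  have h1 : ∀ f : MvPolynomial (Fin N) ℤ,
      MvPolynomial.eval (fun _ => (1 : ℤ)) (collapse i j f) = MvPolynomial.eval (fun _ => 1) f := by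
    intro f
    induction f using MvPolynomial.induction_on with
    | C r => simp [collapse]
    | add p q hp hq => rw [map_add, map_add, map_add, hp, hq]
    | mul_X p n hp =>
      rw [map_mul, map_mul, map_mul, hp, collapse_X]
      split_ifs <;> simp
  have h2 := h1 (esymmOn A w)
  rw [e, map_zero, eval_one_esymmOn] at h2
  exact (Nat.choose_pos h).ne' (by exact_mod_cast h2.symm)

theorem esymmOn_map (A : Finset (Fin N)) (w : ℕ) (σ : Equiv.Perm (Fin N)) :
    esymmOn (A.map σ.toEmbedding) w = MvPolynomial.rename σ (esymmOn A w) := by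
  rw [esymmOn, esymmOn, map_sum, Finset.powersetCard_map, Finset.sum_map]
  refine Finset.sum_congr rfl fun s _ => ?_
  rw [map_prod]
  simp [Finset.mapEmbedding_apply, Finset.prod_map]

theorem root_dvd_rename_sub (i j : Fin N) (f : MvPolynomial (Fin N) ℤ) :
    (MvPolynomial.X i - MvPolynomial.X j) ∣ MvPolynomial.rename (Equiv.swap i j) f - f := by
  rw [dvd_sub_comm]
  have e : MvPolynomial.rename (Equiv.swap i j) f =
      MvPolynomial.aeval (fun k => MvPolynomial.X (Equiv.swap i j k)) f :=
    DFunLike.congr_fun (MvPolynomial.algHom_ext (f := MvPolynomial.rename (Equiv.swap i j))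
      fun k => by rw [MvPolynomial.rename_X, MvPolynomial.aeval_X]) f
  rw [e]
  refine dvd_sub_aeval (fun k => ?_) f
  by_cases h1 : k = i
  · rw [h1, Equiv.swap_apply_left]
  by_cases h2 : k = j
  · rw [h2, Equiv.swap_apply_right, dvd_sub_comm]
  rw [Equiv.swap_apply_of_ne_of_ne h1 h2, sub_self]
  exact dvd_zero _

/-- The numerator minus the denominator is X_i - X_j. -/
theorem near_slope (hij : i ≠ j) (hi : k ≠ i) (hj : k ≠ j) : Near i j (slope i j k) := by
  refine ⟨1, MvPolynomial.X j - MvPolynomial.X k,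
    collapse_sub_ne_zero hj.symm (fun h => hij h.1.symm) fun h => hi h.2, ?_⟩
  have hn : ratX j - ratX k ≠ 0 := ratX_sub_ne_zero hj.symm
  rw [mul_one, show (MvPolynomial.X j - MvPolynomial.X k + (MvPolynomial.X i - MvPolynomial.X j) :
    MvPolynomial (Fin N) ℤ) = MvPolynomial.X i - MvPolynomial.X k by ring, map_sub, map_sub, slope]
  exact div_mul_cancel₀ _ hn

theorem IsColoring.near_dotRatio (hc : IsColoring N K c) (x : Dot K) :
    Near i j (dotRatio c (recolor c i j sw) x) := by
  have hn := toRat_ne_zero (hc.esymmOn_ne_zero x)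
  rw [dotRatio, recolor]
  split_ifs
  · obtain ⟨a, ha⟩ := root_dvd_rename_sub i j (esymmOn (c x.1) (x.2 + 1))
    refine ⟨a, esymmOn (c x.1) (x.2 + 1),
      collapse_esymmOn_ne_zero (by rw [hc.card]; exact x.2.2), ?_⟩
    rw [← ha, add_sub_cancel, esymmOn_map, div_mul_cancel₀ _ hn]
  · rw [div_self hn]
    exact Near.one

/-- Up to the sign (-1)^(χ/2) the ratio is a product of slopes and of quotients of dot factors that
differ by the transposition of X_i and X_j; each factor is 1 along X_i = X_j. -/
theorem IsColoring.near_ratio (hc : IsColoring N K c) (hij : i ≠ j) (d : Dots K) :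
    Near i j ((-1 : Rat N) ^ (chi (bipart c i j sw) / 2) * ratio d c i j sw) := by
  rw [ratio, neg_one_zpow_cast, ← mul_assoc, ← mul_assoc, ← Int.cast_mul, ← Units.val_mul,
    Int.units_mul_self, Units.val_one, Int.cast_one, one_mul]
  refine Near.mul (Near.prod fun x _ => (hc.near_dotRatio x).pow _) (Near.prod fun k hk => ?_)
  rw [Finset.mem_erase, Finset.mem_erase] at hk
  exact (near_slope hij hk.2.1 hk.1).zpow _

/-- Here m is half the Euler characteristic of a component. For a sphere m = 1, the ratio is -1
along X_i = X_j, and 1 + x absorbs the simple pole; for m ≤ 0 there is no pole. -/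
theorem regular_one_add {m : ℤ} (hm : m ≤ 1) {x : Rat N} (hij : i ≠ j)
    (h : Near i j ((-1) ^ m * x)) : Regular i j ((ratX i - ratX j) ^ (-m) * (1 + x)) := by
  rcases hm.eq_or_lt with rfl | hlt
  · rw [zpow_one, neg_one_mul] at h
    have := h.regular_div hij
    rwa [sub_neg_eq_add, mul_comm, ← zpow_neg_one] at this
  · have hx : Regular i j x := by
      have h1 := (Regular.intCast (((-1 : ℤˣ) ^ m : ℤˣ) : ℤ)).mul h.regular
      rwa [neg_one_zpow_cast, ← mul_assoc, ← Int.cast_mul, ← Units.val_mul, Int.units_mul_self,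
        Units.val_one, Int.cast_one, one_mul] at h1
    obtain ⟨n, hn⟩ := Int.eq_ofNat_of_zero_le (show 0 ≤ -m by omega)
    have e : toRat N (MvPolynomial.X i - MvPolynomial.X j) = ratX i - ratX j := map_sub _ _ _
    rw [hn, zpow_natCast, ← e]
    exact ((Regular.of_poly _).pow n).mul (Regular.one.add hx)

/-- The exponent of X_i - X_j in 1/Q is distributed over the components of F_ij, so that each
component meets its own factor 1 + ratio. All other factors of Q are invertible along X_i = X_j. -/
theorem IsColoring.regular_orbit (hc : IsColoring N K c) (H : ClosedFoam K)
    (hij : i < j) (d : Dots K) : Regular i j (term d c *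
      ∏ κ ∈ comps (bichrome c i j), (1 + ratio d c i j (· ∈ κ))) := by
  have e : ∀ a b : Fin N, ratX a - ratX b = toRat N (MvPolynomial.X a - MvPolynomial.X b) :=
    fun a b => (map_sub _ _ _).symm
  have hmem : (i, j) ∈ pigmentPairs N := Finset.mem_filter.2 ⟨Finset.mem_univ _, hij⟩
  have hn := ratX_sub_ne_zero hij.ne
  have hq : (qFactor c)⁻¹ = (∏ κ ∈ comps (bichrome c i j),
      (ratX i - ratX j) ^ (-(chi (bipart c i j (· ∈ κ)) / 2))) *
      ∏ p ∈ (pigmentPairs N).erase (i, j),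
        (ratX p.1 - ratX p.2) ^ (-(chi (bichrome c p.1 p.2) / 2)) := by
    have hz : ∀ s : Finset (Finset Pt), ∀ f : Finset Pt → ℤ,
        ∏ κ ∈ s, (ratX i - ratX j) ^ f κ = (ratX i - ratX j) ^ ∑ κ ∈ s, f κ := by
      intro s f
      induction s using Finset.induction_on with
      | empty => simp
      | insert a s ha ih => rw [Finset.prod_insert ha, Finset.sum_insert ha, zpow_add₀ hn, ih]
    rw [qFactor, ← Finset.mul_prod_erase _ _ hmem, hz, Finset.sum_neg_distrib, hc.sum_chi_comps H,
      mul_inv, ← Finset.prod_inv_distrib]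
    simp only [zpow_neg]
  rw [term, div_eq_mul_inv, hq, show ∀ a b c d : Rat N, a * (b * c) * d = a * (c * (b * d)) from
    fun _ _ _ _ => by ring, ← Finset.prod_mul_distrib, neg_one_zpow_cast]
  refine ((Regular.intCast _).mul (Regular.of_poly _)).mul (Regular.mul ?_ ?_)
  · refine Regular.prod fun p hp => ?_
    rw [Finset.mem_erase] at hp
    have hlt := (Finset.mem_filter.1 hp.2).2
    rw [e]
    refine Regular.zpow (collapse_sub_ne_zero hlt.ne (fun h => hp.1 (Prod.ext h.1 h.2)) ?_) _
    rintro ⟨h1, h2⟩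
    rw [h1, h2] at hlt
    exact hlt.asymm hij
  · refine Regular.prod fun κ hκ => regular_one_add ?_ hij.ne (hc.near_ratio hij.ne d)
    have := hc.chi_comp_le H hκ
    omega

/-- The evaluation has no pole along `X_i = X_j` for neighbouring pigments. -/
theorem regular_evalRat_of_adjacent (H : ClosedFoam K) (hij : i.val + 1 = j.val) (d : Dots K) :
    Regular i j (evalRat N K d) := by
  have hlt : i < j := by rw [Fin.lt_def]; omega
  rw [evalRat_eq_orbits H hij]
  refine Regular.sum fun c hc => Regular.mul ?_ ((mem_colorings.1 hc).regular_orbit H hlt d)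
  have : (2 ^ (comps (bichrome c i j)).card : Rat N) =
      toRat N (2 ^ (comps (bichrome c i j)).card) := by
    rw [map_pow, map_ofNat]
  rw [this]
  -- The powers of two from the averaging are harmless: only the pole along X_i = X_j matters here,
  -- and in the end all denominators are known to be products of differences.
  refine Regular.inv_poly ?_
  rw [map_pow, map_ofNat]
  exact pow_ne_zero _ two_ne_zero

end

end SlFoam

namespace SlFoam

noncomputable section

open scoped Classical

variable {N : ℕ} {K : Finset Tri} {c : Facet K → Finset (Fin N)} {i j k : Fin N}

/-! ## The symmetry of the evaluation -/

/-- The permutation of the indeterminates. -/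
def permute (σ : Equiv.Perm (Fin N)) : Rat N →+* Rat N :=
  (IsFractionRing.ringEquivOfRingEquiv (K := Rat N) (L := Rat N)
    (MvPolynomial.renameEquiv ℤ σ).toRingEquiv : Rat N ≃+* Rat N)

theorem permute_toRat (σ : Equiv.Perm (Fin N)) (f : MvPolynomial (Fin N) ℤ) :
    permute σ (toRat N f) = toRat N (MvPolynomial.rename σ f) :=
  IsFractionRing.ringEquivOfRingEquiv_algebraMap _ _

theorem permute_ratX (σ : Equiv.Perm (Fin N)) (k : Fin N) : permute σ (ratX k) = ratX (σ k) := by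
  have := permute_toRat σ (MvPolynomial.X k)
  rwa [MvPolynomial.rename_X] at this

theorem permute_mul (σ τ : Equiv.Perm (Fin N)) (x : Rat N) :
    permute (σ * τ) x = permute σ (permute τ x) := by
  obtain ⟨a, b, -, rfl⟩ := IsFractionRing.div_surjective (A := MvPolynomial (Fin N) ℤ) x
  change permute (σ * τ) (toRat N a / toRat N b) = permute σ (permute τ (toRat N a / toRat N b))
  simp only [map_div₀, permute_toRat, MvPolynomial.rename_rename]
  rfl

theorem permute_one (x : Rat N) : permute 1 x = x := by
  obtain ⟨a, b, -, rfl⟩ := IsFractionRing.div_surjective (A := MvPolynomial (Fin N) ℤ) x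
  change permute 1 (toRat N a / toRat N b) = toRat N a / toRat N b
  simp only [map_div₀, permute_toRat, Equiv.Perm.coe_one, MvPolynomial.rename_id_apply]

/-- The coloring after the exchange of two pigments everywhere. -/
def recolorAll (c : Facet K → Finset (Fin N)) (i j : Fin N) : Facet K → Finset (Fin N) :=
  recolor c i j (onSome (comps (bichrome c i j)))

theorem IsColoring.switch_all (hc : IsColoring N K c) (H : EdgeHyp K) :
    Switch K (pig c i) (pig c j) (onSome (comps (bichrome c i j))) :=
  hc.switch_onSome H subset_rfl

/-- On a facet that is not bichrome the color contains both or neither of i and j, so the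
transposition fixes it. -/
theorem IsColoring.recolorAll_apply (hc : IsColoring N K c) (H : EdgeHyp K) (f : Facet K) :
    recolorAll c i j f = (c f).map (Equiv.swap i j).toEmbedding := by
  induction f using Quot.ind with
  | mk t =>
    obtain ⟨t, ht⟩ := t
    change recolorAll c i j (.of t ht) = (c (.of t ht)).map _
    rw [recolorAll, recolor]
    split_ifs with hm
    · rfl
    · rw [moved_iff (hc.switch_all H), Moved] at hm
      have hx : ¬ Xor (pig c i t) (pig c j t) := fun hx => hm ⟨hx, mem_onSome_comps (by
        rw [bichrome_eq, Finset.mem_filter]; exact ⟨ht, hx⟩)⟩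
      rw [pig_iff ht, pig_iff ht] at hx
      ext k
      rw [mem_swap_map]
      by_cases h1 : k = i
      · rw [h1, Equiv.swap_apply_left]; unfold Xor at hx; tauto
      by_cases h2 : k = j
      · rw [h2, Equiv.swap_apply_right]; unfold Xor at hx; tauto
      rw [Equiv.swap_apply_of_ne_of_ne h1 h2]

theorem IsColoring.bichrome_recolorAll (hc : IsColoring N K c) (H : EdgeHyp K) (a b : Fin N) :
    bichrome (recolorAll c i j) a b = bichrome c (Equiv.swap i j a) (Equiv.swap i j b) := by
  ext t
  rw [bichrome_eq, bichrome_eq, Finset.mem_filter, Finset.mem_filter]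
  refine and_congr_right fun ht => ?_
  rw [pig_iff ht, pig_iff ht, pig_iff ht, pig_iff ht, hc.recolorAll_apply H, mem_swap_map,
    mem_swap_map]

/-- Only the factor of the pair (i, j) is reversed and gives a sign; the factors with a third
pigment are interchanged in pairs. -/
theorem IsColoring.permute_qFactor (hc : IsColoring N K c) (H : EdgeHyp K)
    (hij : i.val + 1 = j.val) : permute (Equiv.swap i j) (qFactor c) =
      (-1) ^ (chi (bichrome c i j) / 2) * qFactor (recolorAll c i j) := by
  have hlt : i < j := by rw [Fin.lt_def]; omega
  rw [qFactor, map_prod, qFactor, prod_pairs _ hlt, prod_pairs _ hlt]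
  simp only [map_zpow₀, map_sub, permute_ratX, hc.bichrome_recolorAll H, Equiv.swap_apply_left,
    Equiv.swap_apply_right]
  have e1 : (ratX j - ratX i) ^ (chi (bichrome c i j) / 2) =
      (-1) ^ (chi (bichrome c i j) / 2) * (ratX i - ratX j) ^ (chi (bichrome c j i) / 2) := by
    rw [bichrome_comm c j i, ← mul_zpow, neg_one_mul, neg_sub]
  have e2 : ∀ k ∈ (Finset.univ.erase i).erase j,
      (if i < k then (ratX j - ratX (Equiv.swap i j k)) ^ (chi (bichrome c i k) / 2)
        else (ratX (Equiv.swap i j k) - ratX j) ^ (chi (bichrome c k i) / 2)) *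
      (if j < k then (ratX i - ratX (Equiv.swap i j k)) ^ (chi (bichrome c j k) / 2)
        else (ratX (Equiv.swap i j k) - ratX i) ^ (chi (bichrome c k j) / 2)) =
      (if i < k then (ratX i - ratX k) ^ (chi (bichrome c j (Equiv.swap i j k)) / 2)
        else (ratX k - ratX i) ^ (chi (bichrome c (Equiv.swap i j k) j) / 2)) *
      (if j < k then (ratX j - ratX k) ^ (chi (bichrome c i (Equiv.swap i j k)) / 2)
        else (ratX k - ratX j) ^ (chi (bichrome c (Equiv.swap i j k) i) / 2)) := by
    intro k hk
    rw [Finset.mem_erase, Finset.mem_erase] at hk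
    rw [Equiv.swap_apply_of_ne_of_ne hk.2.1 hk.1]
    simp only [← lt_iff_of_adjacent hij hk.2.1 hk.1]
    split_ifs <;> rw [mul_comm]
  have e3 : ∀ a ∈ (Finset.univ.erase i).erase j, ∀ b ∈ (Finset.univ.erase i).erase j,
      (if a < b then (ratX (Equiv.swap i j a) - ratX (Equiv.swap i j b)) ^
        (chi (bichrome c a b) / 2) else 1) =
      if a < b then (ratX a - ratX b) ^
        (chi (bichrome c (Equiv.swap i j a) (Equiv.swap i j b)) / 2) else 1 := by
    intro a ha b hb
    rw [Finset.mem_erase, Finset.mem_erase] at ha hb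
    rw [Equiv.swap_apply_of_ne_of_ne ha.2.1 ha.1, Equiv.swap_apply_of_ne_of_ne hb.2.1 hb.1]
  rw [e1, Finset.prod_congr rfl e2,
    Finset.prod_congr rfl fun a ha => Finset.prod_congr rfl fun b hb => e3 a ha b hb]
  ring

/-- The sign from the reversed factor of Q is the sign in `IsColoring.sign_recolor` for the exchange
on all of F_ij. -/
theorem IsColoring.permute_term (hc : IsColoring N K c) (H : ClosedFoam K)
    (hij : i.val + 1 = j.val) (d : Dots K) :
    permute (Equiv.swap i j) (term d c) = term d (recolorAll c i j) := by
  have hs : (-1 : ℤˣ) ^ signExp (recolorAll c i j) = _ :=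
    hc.sign_recolor H hij (hc.switch_all H.toEdgeHyp)
  have hb : bipart c i j (onSome (comps (bichrome c i j))) = bichrome c i j := by
    ext t
    rw [mem_bipart]
    exact and_iff_left_of_imp mem_onSome_comps
  rw [hb] at hs
  have hd : MvPolynomial.rename (Equiv.swap i j) (dotFactor d c) =
      dotFactor d (recolorAll c i j) := by
    rw [dotFactor, dotFactor, Finsupp.prod, Finsupp.prod, map_prod]
    refine Finset.prod_congr rfl fun x _ => ?_
    rw [map_pow, hc.recolorAll_apply H.toEdgeHyp, esymmOn_map]
  rw [term, term, map_div₀, map_mul, map_zpow₀, map_neg, map_one, permute_toRat, hd,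
    hc.permute_qFactor H.toEdgeHyp hij, neg_one_zpow_cast, neg_one_zpow_cast, neg_one_zpow_cast]
  rw [hs]
  have hq := qFactor_ne_zero (recolorAll c i j)
  rcases Int.units_eq_one_or ((-1 : ℤˣ) ^ (chi (bichrome c i j) / 2)) with e | e <;> rw [e]
  · simp
  · simp [div_neg, neg_div]

theorem permute_swap_evalRat (H : ClosedFoam K) (hij : i.val + 1 = j.val) (d : Dots K) :
    permute (Equiv.swap i j) (evalRat N K d) = evalRat N K d := by
  rw [evalRat_eq, map_sum]
  have hm : ∀ c ∈ colorings N K, recolorAll c i j ∈ colorings N K := fun c hc =>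
    mem_colorings.2 ((mem_colorings.1 hc).switch H.toEdgeHyp
      ((mem_colorings.1 hc).switch_all H.toEdgeHyp))
  have hi : ∀ c ∈ colorings N K, recolorAll (recolorAll c i j) i j = c := by
    intro c hc
    funext f
    rw [(mem_colorings.1 (hm c hc)).recolorAll_apply H.toEdgeHyp,
      (mem_colorings.1 hc).recolorAll_apply H.toEdgeHyp]
    ext k
    rw [mem_swap_map, mem_swap_map, Equiv.swap_apply_self]
  exact Finset.sum_nbij' (fun c => recolorAll c i j) (fun c => recolorAll c i j) hm hm hi hi
    fun c hc => (mem_colorings.1 hc).permute_term H hij d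

/-- The evaluation is symmetric. -/
theorem permute_evalRat (H : ClosedFoam K) (d : Dots K) (σ : Equiv.Perm (Fin N)) :
    permute σ (evalRat N K d) = evalRat N K d := by
  cases N with
  | zero => rw [Subsingleton.elim σ 1, permute_one]
  | succ n =>
    -- The transpositions of neighbours generate the symmetric group, so exchanges of neighbouring
    -- pigments suffice.
    have h : σ ∈ Submonoid.closure (Set.range fun i : Fin n => Equiv.swap i.castSucc i.succ) := by
      rw [Equiv.Perm.mclosure_swap_castSucc_succ]; trivial
    induction h using Submonoid.closure_induction with
    | mem x hx =>
      obtain ⟨i, rfl⟩ := hx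
      exact permute_swap_evalRat H (by simp) d
    | one => rw [permute_one]
    | mul x y _ _ hx hy => rw [permute_mul, hy, hx]

/-! ## The integrality of the evaluation -/

theorem Regular.permute {x : Rat N} (h : Regular i j x) (σ : Equiv.Perm (Fin N)) :
    Regular (σ i) (σ j) (permute σ x) := by
  obtain ⟨a, b, h1, h2⟩ := h
  have e : ∀ f : MvPolynomial (Fin N) ℤ, collapse (σ i) (σ j) (MvPolynomial.rename σ f) =
      MvPolynomial.rename σ (collapse i j f) := by
    intro f
    induction f using MvPolynomial.induction_on with
    | C r => simp [collapse]
    | add p q hp hq => simp only [map_add, hp, hq]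
    | mul_X p n hp =>
      rw [map_mul, map_mul, map_mul, map_mul, hp, MvPolynomial.rename_X, collapse_X, collapse_X]
      simp only [EmbeddingLike.apply_eq_iff_eq]
      split_ifs <;> rw [MvPolynomial.rename_X]
  refine ⟨MvPolynomial.rename σ a, MvPolynomial.rename σ b, ?_, ?_⟩
  · rw [e]
    exact (map_ne_zero_iff _ (MvPolynomial.rename_injective σ σ.injective)).2 h1
  · rw [← permute_toRat, ← permute_toRat, ← h2, map_mul]

theorem exists_perm {a b : Fin N} (hij : i ≠ j) (hab : a ≠ b) :
    ∃ σ : Equiv.Perm (Fin N), σ i = a ∧ σ j = b := by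
  -- The first transposition brings i to a, the second moves the image of j to b and leaves a in
  -- place.
  refine ⟨Equiv.swap (Equiv.swap i a j) b * Equiv.swap i a, ?_, ?_⟩
  · rw [Equiv.Perm.mul_apply, Equiv.swap_apply_left, Equiv.swap_apply_of_ne_of_ne _ hab]
    intro h
    have := (Equiv.swap i a).injective ((Equiv.swap_apply_left i a).trans h)
    exact hij this
  · rw [Equiv.Perm.mul_apply, Equiv.swap_apply_left]

/-- A permutation carries the pair of the first two pigments to any other pair, and the evaluation
is invariant under it. -/
theorem regular_evalRat (H : ClosedFoam K) (d : Dots K) (hij : i ≠ j) :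
    Regular i j (evalRat N K d) := by
  have hN : 2 ≤ N := by
    have h1 := i.2
    have h2 := j.2
    have := Fin.val_ne_of_ne hij
    omega
  obtain ⟨σ, rfl, rfl⟩ := exists_perm (i := (⟨0, by omega⟩ : Fin N)) (j := ⟨1, by omega⟩)
    (by simp [Fin.ext_iff]) hij
  rw [← permute_evalRat H d σ]
  exact (regular_evalRat_of_adjacent H rfl d).permute σ

/-- The product of the differences of the indeterminates. -/
def discr (N : ℕ) : MvPolynomial (Fin N) ℤ :=
  ∏ p ∈ pigmentPairs N, (MvPolynomial.X p.1 - MvPolynomial.X p.2)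

/-- A rational function with poles only along the diagonals. -/
def Diagonal (x : Rat N) : Prop := ∃ M A, x * toRat N (discr N ^ M) = toRat N A

namespace Diagonal

variable {x y : Rat N}

theorem of_poly (f : MvPolynomial (Fin N) ℤ) : Diagonal (toRat N f) :=
  ⟨0, f, by rw [pow_zero, map_one, mul_one]⟩

theorem mul (hx : Diagonal x) (hy : Diagonal y) : Diagonal (x * y) := by
  obtain ⟨M, A, h⟩ := hx
  obtain ⟨M', A', h'⟩ := hy
  exact ⟨M + M', A * A', by rw [pow_add, map_mul, map_mul, ← h, ← h']; ring⟩

theorem add (hx : Diagonal x) (hy : Diagonal y) : Diagonal (x + y) := by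
  obtain ⟨M, A, h⟩ := hx
  obtain ⟨M', A', h'⟩ := hy
  refine ⟨M + M', A * discr N ^ M' + A' * discr N ^ M, ?_⟩
  rw [pow_add, map_mul, map_add, map_mul, map_mul, ← h, ← h']
  ring

end Diagonal

/-- A rational function with poles only along the diagonals whose derivative by `∇` vanishes. -/
def Flat (x : Rat N) : Prop :=
  ∃ M A, nablaPoly (Fin N) ℤ A = 0 ∧ x * toRat N (discr N ^ M) = toRat N A

theorem nabla_root (i j : Fin N) :
    nablaPoly (Fin N) ℤ (MvPolynomial.X i - MvPolynomial.X j) = 0 := by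
  rw [map_sub, nablaPoly_X, nablaPoly_X, sub_self]

theorem nabla_mul_eq_zero {a b : MvPolynomial (Fin N) ℤ} (ha : nablaPoly (Fin N) ℤ a = 0)
    (hb : nablaPoly (Fin N) ℤ b = 0) : nablaPoly (Fin N) ℤ (a * b) = 0 := by
  rw [Derivation.leibniz, ha, hb, smul_zero, smul_zero, add_zero]

theorem nabla_prod_roots (s : Finset (Fin N × Fin N)) :
    nablaPoly (Fin N) ℤ (∏ p ∈ s, (MvPolynomial.X p.1 - MvPolynomial.X p.2)) = 0 :=
  Finset.prod_induction _ (fun f => nablaPoly (Fin N) ℤ f = 0) (fun _ _ => nabla_mul_eq_zero)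
    (Derivation.map_one_eq_zero _) fun p _ => nabla_root p.1 p.2

theorem nabla_discr_pow (M : ℕ) : nablaPoly (Fin N) ℤ (discr N ^ M) = 0 := by
  rw [Derivation.leibniz_pow, discr, nabla_prod_roots, smul_zero, smul_zero]

namespace Flat

variable {x y : Rat N}

theorem diagonal (h : Flat x) : Diagonal x := by
  obtain ⟨M, A, -, h⟩ := h
  exact ⟨M, A, h⟩

theorem of_poly {f : MvPolynomial (Fin N) ℤ} (h : nablaPoly (Fin N) ℤ f = 0) : Flat (toRat N f) :=
  ⟨0, f, h, by rw [pow_zero, map_one, mul_one]⟩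

theorem mul (hx : Flat x) (hy : Flat y) : Flat (x * y) := by
  obtain ⟨M, A, h0, h⟩ := hx
  obtain ⟨M', A', h0', h'⟩ := hy
  exact ⟨M + M', A * A', nabla_mul_eq_zero h0 h0',
    by rw [pow_add, map_mul, map_mul, ← h, ← h']; ring⟩

theorem one : Flat (1 : Rat N) := by
  have := of_poly (f := (1 : MvPolynomial (Fin N) ℤ)) (Derivation.map_one_eq_zero _)
  rwa [map_one] at this

theorem pow (h : Flat x) (n : ℕ) : Flat (x ^ n) := by
  induction n with
  | zero => rw [pow_zero]; exact one
  | succ n ih => rw [pow_succ]; exact ih.mul h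

theorem zpow {p : Fin N × Fin N} (hp : p ∈ pigmentPairs N) (n : ℤ) :
    Flat ((ratX p.1 - ratX p.2) ^ n) := by
  have e : toRat N (MvPolynomial.X p.1 - MvPolynomial.X p.2) = ratX p.1 - ratX p.2 := map_sub _ _ _
  rcases Int.eq_nat_or_neg n with ⟨m, rfl | rfl⟩
  · rw [zpow_natCast, ← e]
    exact (of_poly (nabla_root p.1 p.2)).pow m
  · rw [zpow_neg, zpow_natCast, ← inv_pow]
    -- The inverse of one difference is the product of all the others divided by the full product,
    -- and both are killed by ∇.
    refine pow ⟨1, ∏ q ∈ (pigmentPairs N).erase p, (MvPolynomial.X q.1 - MvPolynomial.X q.2),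
      nabla_prod_roots _, ?_⟩ m
    rw [pow_one, discr, ← Finset.mul_prod_erase _ _ hp, map_mul, e, ← mul_assoc,
      inv_mul_cancel₀ (ratX_sub_ne_zero (Finset.mem_filter.1 hp).2.ne), one_mul]

theorem mono {M M' : ℕ} (hM : M ≤ M')
    (h : ∃ A, nablaPoly (Fin N) ℤ A = 0 ∧ x * toRat N (discr N ^ M) = toRat N A) :
    ∃ A, nablaPoly (Fin N) ℤ A = 0 ∧ x * toRat N (discr N ^ M') = toRat N A := by
  obtain ⟨A, h0, h⟩ := h
  refine ⟨A * discr N ^ (M' - M), nabla_mul_eq_zero h0 (nabla_discr_pow _), ?_⟩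
  rw [map_mul, ← h, mul_assoc, ← map_mul, ← pow_add, Nat.add_sub_cancel' hM]

theorem common {ι : Type*} {s : Finset ι} {w : ι → Rat N} (h : ∀ a ∈ s, Flat (w a)) :
    ∃ M, ∀ a ∈ s, ∃ A, nablaPoly (Fin N) ℤ A = 0 ∧ w a * toRat N (discr N ^ M) = toRat N A := by
  induction s using Finset.induction_on with
  | empty => exact ⟨0, fun a ha => absurd ha (Finset.notMem_empty a)⟩
  | insert b s _ ih =>
    obtain ⟨M, hM⟩ := ih fun a ha => h a (Finset.mem_insert_of_mem ha)
    obtain ⟨M', hM'⟩ := h b (Finset.mem_insert_self b s)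
    refine ⟨M + M', fun a ha => ?_⟩
    rcases Finset.mem_insert.1 ha with rfl | ha
    · exact mono (Nat.le_add_left _ _) hM'
    · exact mono (Nat.le_add_right _ _) (hM a ha)

/-- The operator `∇` is linear over the flat rational functions. -/
theorem nabla_sum {ι : Type*} {s : Finset ι} {w : ι → Rat N} (h : ∀ a ∈ s, Flat (w a))
    {f : ι → MvPolynomial (Fin N) ℤ} {F : MvPolynomial (Fin N) ℤ}
    (hF : toRat N F = ∑ a ∈ s, w a * toRat N (f a)) :
    toRat N (nablaPoly (Fin N) ℤ F) = ∑ a ∈ s, w a * toRat N (nablaPoly (Fin N) ℤ (f a)) := by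
  obtain ⟨M, hM⟩ := common h
  choose! A h0 hA using hM
  have hn : toRat N (discr N ^ M) ≠ 0 := toRat_ne_zero (pow_ne_zero _
    (Finset.prod_ne_zero_iff.2 fun p hp => (root_prime (Finset.mem_filter.1 hp).2.ne).ne_zero))
  have key : ∀ g : ι → MvPolynomial (Fin N) ℤ,
      (∑ a ∈ s, w a * toRat N (g a)) * toRat N (discr N ^ M) = toRat N (∑ a ∈ s, A a * g a) := by
    intro g
    rw [Finset.sum_mul, map_sum]
    refine Finset.sum_congr rfl fun a ha => ?_
    rw [map_mul, ← hA a ha]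
    ring
  -- After clearing a common denominator the identity is one of polynomials. Its denominator and its
  -- coefficients are constants for ∇, so differentiating it term by term gives the claim.
  have e : F * discr N ^ M = ∑ a ∈ s, A a * f a := by
    apply toRat_injective
    rw [map_mul, hF, key]
  apply mul_right_cancel₀ hn
  rw [key, ← map_mul]
  have e' := congrArg (nablaPoly (Fin N) ℤ) e
  rw [Derivation.leibniz, nabla_discr_pow, smul_zero, zero_add, smul_eq_mul, map_sum] at e'
  rw [mul_comm, e']
  congr 1
  refine Finset.sum_congr rfl fun a ha => ?_
  rw [Derivation.leibniz, h0 a ha, smul_zero, add_zero, smul_eq_mul]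

end Flat

/-- The coefficient of the dots of a coloring in the evaluation. -/
def weight (c : Facet K → Finset (Fin N)) : Rat N := (-1) ^ signExp c / qFactor c

theorem term_eq (d : Dots K) (c : Facet K → Finset (Fin N)) :
    term d c = weight c * toRat N (dotFactor d c) := by
  rw [term, weight]
  ring

/-- Apart from a sign the weight is a product of powers of differences X_i - X_j, and ∇ is the
derivative along the diagonal translation. -/
theorem flat_weight (c : Facet K → Finset (Fin N)) : Flat (weight c) := by
  have hs : Flat ((-1 : Rat N) ^ signExp c) := by
    have := Flat.of_poly (N := N) (f := (((-1 : ℤˣ) ^ signExp c : ℤˣ) : ℤ))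
      (Derivation.map_intCast _ _)
    rwa [map_intCast, ← neg_one_zpow_cast] at this
  rw [weight, div_eq_mul_inv, qFactor, ← Finset.prod_inv_distrib]
  refine hs.mul (Finset.prod_induction _ Flat (fun _ _ => Flat.mul) Flat.one fun p hp => ?_)
  rw [← zpow_neg]
  exact Flat.zpow hp _

theorem diagonal_evalRat (d : Dots K) : Diagonal (evalRat N K d) := by
  rw [evalRat_eq]
  have h0 : Diagonal (0 : Rat N) := by
    have := Diagonal.of_poly (0 : MvPolynomial (Fin N) ℤ)
    rwa [map_zero] at this
  refine Finset.sum_induction _ Diagonal (fun _ _ => Diagonal.add) h0 fun c _ => ?_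
  rw [term_eq]
  exact (flat_weight c).diagonal.mul (.of_poly _)

/-- Clear denominators by a power of the product of all differences. Regularity along each diagonal
forces the same power of each difference to divide the numerator, and different differences are
coprime primes, so their product divides it. -/
theorem exists_poly {x : Rat N} (hx : Diagonal x) (h : ∀ i j : Fin N, i < j → Regular i j x) :
    ∃ f, toRat N f = x := by
  obtain ⟨M, A, hA⟩ := hx
  have hdvd : ∀ p ∈ pigmentPairs N, (MvPolynomial.X p.1 - MvPolynomial.X p.2) ^ M ∣ A := by
    intro p hp
    have hlt := (Finset.mem_filter.1 hp).2
    obtain ⟨a, b, h1, h2⟩ := h _ _ hlt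
    refine (root_prime hlt.ne).pow_dvd_of_dvd_mul_right M (mt root_dvd_iff.1 h1) (a := A) ?_
    have e : A * b = a * discr N ^ M := by
      apply toRat_injective
      rw [map_mul, map_mul, ← hA, ← h2]
      ring
    rw [e]
    exact (pow_dvd_pow_of_dvd (Finset.dvd_prod_of_mem _ hp) M).mul_left a
  have hall : discr N ^ M ∣ A := by
    rw [discr, ← Finset.prod_pow]
    refine Finset.prod_dvd_of_isRelPrime (fun p hp q hq hpq => ?_) hdvd
    have hp' := (Finset.mem_filter.1 (Finset.mem_coe.1 hp)).2
    have hq' := (Finset.mem_filter.1 (Finset.mem_coe.1 hq)).2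
    refine IsRelPrime.pow ((root_prime hp'.ne).irreducible.isRelPrime_iff_not_dvd.2 ?_)
    rw [root_dvd_iff]
    refine collapse_sub_ne_zero hq'.ne (fun h => hpq (Prod.ext h.1.symm h.2.symm)) fun h => ?_
    rw [h.1, h.2] at hq'
    exact hq'.asymm hp'
  obtain ⟨f, rfl⟩ := hall
  refine ⟨f, ?_⟩
  have hn : toRat N (discr N ^ M) ≠ 0 := toRat_ne_zero (pow_ne_zero _
    (Finset.prod_ne_zero_iff.2 fun p hp => (root_prime (Finset.mem_filter.1 hp).2.ne).ne_zero))
  rw [map_mul, mul_comm] at hA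
  exact (mul_left_cancel₀ hn hA).symm

/-- The evaluation is an integral polynomial. -/
theorem toRat_evalPoly (H : ClosedFoam K) (d : Dots K) :
    toRat N (evalPoly N K d) = evalRat N K d := by
  have h : ∃ P : MvPolynomial (Fin N) ℤ,
      algebraMap (MvPolynomial (Fin N) ℤ) (Rat N) P = evalRat N K d :=
    exists_poly (diagonal_evalRat d) fun i j hij => regular_evalRat H d hij.ne
  rw [evalPoly, dif_pos h]
  exact h.choose_spec

theorem evalPoly_isSymmetric (H : ClosedFoam K) (d : Dots K) :
    (evalPoly N K d).IsSymmetric := fun σ => toRat_injective (by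
  rw [← permute_toRat, toRat_evalPoly H, permute_evalRat H])

end

end SlFoam

/-! ### Derivatives and nilpotency in the evaluation, and the operators on the state space -/

namespace SlFoam

noncomputable section

open scoped Classical

open MvPolynomial (monomial rename esymm)

variable {N : ℕ} {K : Finset Tri} {c : Facet K → Finset (Fin N)}

/-! ## The evaluation of linear combinations of dots -/

/-- The value of a polynomial in the dots at a coloring. -/
def specialize (c : Facet K → Finset (Fin N)) :
    MvPolynomial (Dot K) ℤ →ₐ[ℤ] MvPolynomial (Fin N) ℤ :=
  MvPolynomial.aeval fun x => esymmOn (c x.1) (x.2 + 1)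

theorem specialize_monomial (c : Facet K → Finset (Fin N)) (d : Dots K) :
    specialize c (monomial d 1) = dotFactor d c := by
  rw [specialize, MvPolynomial.aeval_monomial, map_one, one_mul]
  rfl

theorem esymmOn_eq_rename (A : Finset (Fin N)) {n : ℕ} (h : A.card = n) (w : ℕ) :
    esymmOn A w = rename (A.orderEmbOfFin h) (esymm (Fin n) ℤ w) := by
  have hA : A = Finset.univ.map (A.orderEmbOfFin h).toEmbedding := by
    apply Finset.coe_injective
    simp
  conv_lhs => rw [hA]
  rw [esymmOn, esymm, map_sum, Finset.powersetCard_map, Finset.sum_map]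
  refine Finset.sum_congr rfl fun s _ => ?_
  rw [map_prod]
  simp [Finset.mapEmbedding_apply, Finset.prod_map]

theorem nabla_esymmOn (A : Finset (Fin N)) (w : ℕ) : nablaPoly (Fin N) ℤ (esymmOn A (w + 1)) =
    ((A.card - w : ℕ) : MvPolynomial (Fin N) ℤ) * esymmOn A w := by
  rw [esymmOn_eq_rename A rfl, esymmOn_eq_rename A rfl, nablaPoly_rename, nablaPoly_esymm, map_mul,
    map_natCast]

theorem esymmOn_zero (A : Finset (Fin N)) : esymmOn A 0 = 1 := by
  simp [esymmOn]

/-- The rule ∇e_w = (ℓ - w + 1) e_(w-1) survives the substitution of the pigments because a color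
has exactly ℓ elements. -/
theorem IsColoring.specialize_nablaDots (hc : IsColoring N K c) (Q : MvPolynomial (Dot K) ℤ) :
    specialize c (nablaDots K ℤ Q) = nablaPoly (Fin N) ℤ (specialize c Q) := by
  induction Q using MvPolynomial.induction_on with
  | C r => simp [← MvPolynomial.algebraMap_eq]
  | add p q hp hq => simp only [map_add, hp, hq]
  | mul_X p x hp =>
    have hx : specialize c (nablaDots K ℤ (MvPolynomial.X x)) =
        nablaPoly (Fin N) ℤ (specialize c (MvPolynomial.X x)) := by
      obtain ⟨f, w, hw⟩ := x
      rw [nablaDots, MvPolynomial.mkDerivation_X]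
      simp only [specialize, MvPolynomial.aeval_X, nabla_esymmOn, hc.card]
      split_ifs with h0
      · subst h0
        simp [esymmOn_zero]
      · have e : w - 1 + 1 = w := by omega
        simp only [map_mul, map_natCast, MvPolynomial.aeval_X, e]
    simp only [Derivation.leibniz, map_add, map_mul, smul_eq_mul, hp, hx]

/-- The linear extension of the evaluation to polynomials in the dots. -/
def evalForm (N : ℕ) (K : Finset Tri) : MvPolynomial (Dot K) ℤ →ₗ[ℤ] MvPolynomial (Fin N) ℤ :=
  (MvPolynomial.basisMonomials (Dot K) ℤ).constr ℤ (evalPoly N K)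

theorem evalForm_monomial (d : Dots K) : evalForm N K (monomial d 1) = evalPoly N K d := by
  have h := (MvPolynomial.basisMonomials (Dot K) ℤ).constr_basis ℤ (evalPoly N K) d
  rwa [MvPolynomial.coe_basisMonomials] at h

theorem monomial_eq_smul {σ R : Type*} [CommRing R] (d : σ →₀ ℕ) (r : R) :
    (monomial d r : MvPolynomial σ R) = r • monomial d 1 := by
  rw [MvPolynomial.smul_monomial, smul_eq_mul, mul_one]

theorem toRat_evalForm (H : ClosedFoam K) (Q : MvPolynomial (Dot K) ℤ) :
    toRat N (evalForm N K Q) = ∑ c ∈ colorings N K, weight c * toRat N (specialize c Q) := by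
  induction Q using MvPolynomial.induction_on' with
  | add p q hp hq => simp only [map_add, hp, hq, mul_add, Finset.sum_add_distrib]
  | monomial d r =>
    have e : ∀ f : MvPolynomial (Fin N) ℤ, toRat N (r • f) = r * toRat N f := by
      intro f
      rw [map_zsmul, zsmul_eq_mul]
    rw [monomial_eq_smul, map_smul, e, evalForm_monomial, toRat_evalPoly H, evalRat_eq,
      Finset.mul_sum]
    refine Finset.sum_congr rfl fun c _ => ?_
    rw [map_smul, e, specialize_monomial, term_eq]
    ring

/-- The evaluation is a combination of specializations with flat weights; ∇ passes through the
weights and commutes with each specialization. -/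
theorem nabla_evalForm (H : ClosedFoam K) (Q : MvPolynomial (Dot K) ℤ) :
    nablaPoly (Fin N) ℤ (evalForm N K Q) = evalForm N K (nablaDots K ℤ Q) := by
  apply toRat_injective
  rw [toRat_evalForm H, Flat.nabla_sum (fun c _ => flat_weight c) (toRat_evalForm H Q)]
  exact Finset.sum_congr rfl fun c hc => by rw [(mem_colorings.1 hc).specialize_nablaDots]

/-- The constant term of ∇f is the sum of the N linear coefficients of f, which are equal by
symmetry. -/
theorem constantCoeff_nabla {f : MvPolynomial (Fin N) ℤ} (hf : f.IsSymmetric) :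
    (N : ℤ) ∣ MvPolynomial.constantCoeff (nablaPoly (Fin N) ℤ f) := by
  have h0 : ∀ i : Fin N, MvPolynomial.constantCoeff (MvPolynomial.pderiv i f) =
      MvPolynomial.coeff (Finsupp.single i 1) f := by
    intro i
    rw [MvPolynomial.constantCoeff_eq, MvPolynomial.coeff_pderiv]
    simp
  have h1 : MvPolynomial.constantCoeff (nablaPoly (Fin N) ℤ f) =
      ∑ i, MvPolynomial.coeff (Finsupp.single i 1) f := by
    rw [nablaPoly, ← Derivation.coeFnAddMonoidHom_apply, map_sum, Finset.sum_apply, map_sum]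
    exact Finset.sum_congr rfl fun i _ => h0 i
  cases N with
  | zero => rw [h1]; simp
  | succ n =>
    have h2 : ∀ i : Fin (n + 1), MvPolynomial.coeff (Finsupp.single i 1) f =
        MvPolynomial.coeff (Finsupp.single 0 1) f := by
      intro i
      have := MvPolynomial.coeff_rename_mapDomain (Equiv.swap 0 i) (Equiv.injective _) f
        (Finsupp.single 0 1)
      rwa [hf, Finsupp.mapDomain_single, Equiv.swap_apply_left] at this
    rw [h1, Finset.sum_congr rfl fun i _ => h2 i, Finset.sum_const, Finset.card_univ,
      Fintype.card_fin, nsmul_eq_mul]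
    exact dvd_mul_right _ _

/-! ### The evaluation over a ring -/

variable {R : Type*} [CommRing R]

theorem evalR_eq (R : Type*) [CommRing R] (d : Dots K) :
    evalR R N K d = ((MvPolynomial.constantCoeff (evalPoly N K d) : ℤ) : R) := by
  rw [evalR, MvPolynomial.aeval_zero']
  rfl

/-- The linear extension of the evaluation over `R` to polynomials in the dots. -/
def evalFormR (R : Type*) [CommRing R] (N : ℕ) (K : Finset Tri) : MvPolynomial (Dot K) R →ₗ[R] R :=
  (MvPolynomial.basisMonomials (Dot K) R).constr R (evalR R N K)

theorem evalFormR_monomial (d : Dots K) : evalFormR R N K (monomial d 1) = evalR R N K d := by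
  have h := (MvPolynomial.basisMonomials (Dot K) R).constr_basis R (evalR R N K) d
  rwa [MvPolynomial.coe_basisMonomials] at h

theorem evalFormR_map (Q : MvPolynomial (Dot K) ℤ) :
    evalFormR R N K (MvPolynomial.map (Int.castRingHom R) Q) =
      ((MvPolynomial.constantCoeff (evalForm N K Q) : ℤ) : R) := by
  induction Q using MvPolynomial.induction_on' with
  | add p q hp hq => simp only [map_add, hp, hq, Int.cast_add]
  | monomial d r =>
    rw [MvPolynomial.map_monomial, monomial_eq_smul, map_smul, evalFormR_monomial, evalR_eq,
      monomial_eq_smul d r, map_smul, evalForm_monomial, MvPolynomial.constantCoeff_smul,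
      smul_eq_mul, smul_eq_mul, Int.cast_mul]
    rfl

theorem nablaDots_map (Q : MvPolynomial (Dot K) ℤ) :
    nablaDots K R (MvPolynomial.map (Int.castRingHom R) Q) =
      MvPolynomial.map (Int.castRingHom R) (nablaDots K ℤ Q) := by
  induction Q using MvPolynomial.induction_on with
  | C r => simp [← MvPolynomial.algebraMap_eq]
  | add p q hp hq => simp only [map_add, hp, hq]
  | mul_X p x hp =>
    have hx : nablaDots K R (MvPolynomial.X x) =
        MvPolynomial.map (Int.castRingHom R) (nablaDots K ℤ (MvPolynomial.X x)) := by
      rw [nablaDots, MvPolynomial.mkDerivation_X, nablaDots, MvPolynomial.mkDerivation_X]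
      split_ifs <;> simp
    simp only [Derivation.leibniz, map_add, map_mul, smul_eq_mul, hp, hx, MvPolynomial.map_X]

/-- Derivatives evaluate to zero. -/
theorem evalFormR_nablaDots (H : ClosedFoam K) (hR : ringChar R ∣ N) (Q : MvPolynomial (Dot K) R) :
    evalFormR R N K (nablaDots K R Q) = 0 := by
  induction Q using MvPolynomial.induction_on' with
  | add p q hp hq => rw [map_add, map_add, hp, hq, add_zero]
  | monomial d r =>
    -- A monomial with coefficient 1 lifts to the integers, where the evaluation is an honest
    -- symmetric polynomial that can be differentiated before passing to R.
    have e : (monomial d 1 : MvPolynomial (Dot K) R) =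
        MvPolynomial.map (Int.castRingHom R) (monomial d 1) := by
      rw [MvPolynomial.map_monomial, eq_intCast, Int.cast_one]
    rw [monomial_eq_smul, Derivation.map_smul, map_smul, e, nablaDots_map, evalFormR_map,
      ← nabla_evalForm H, evalForm_monomial]
    obtain ⟨a, ha⟩ := constantCoeff_nabla (evalPoly_isSymmetric (N := N) H d)
    have hN : (N : R) = 0 := (ringChar.spec R N).2 hR
    rw [ha, Int.cast_mul, Int.cast_natCast, hN, zero_mul, smul_zero]

/-! ### Dots on facets of label one -/

theorem esymmOn_singleton (m : Fin N) : esymmOn {m} 1 = MvPolynomial.X m := by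
  rw [esymmOn, Finset.powersetCard_one, Finset.map_singleton, Finset.sum_singleton]
  simp

/-- The polynomial with the roots `X_1, …, X_N`. -/
def rootPoly (N : ℕ) : Polynomial (MvPolynomial (Fin N) ℤ) :=
  ∏ l : Fin N, (Polynomial.X - Polynomial.C (MvPolynomial.X l))

theorem rootPoly_monic : (rootPoly N).Monic := Polynomial.monic_prod_X_sub_C _ _

theorem rootPoly_natDegree : (rootPoly N).natDegree = N := by
  rw [rootPoly, Polynomial.natDegree_finsetProd_X_sub_C_eq_card, Finset.card_univ,
    Fintype.card_fin]

theorem rootPoly_eval (m : Fin N) : (rootPoly N).eval (MvPolynomial.X m) = 0 := by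
  rw [rootPoly, Polynomial.eval_prod]
  exact Finset.prod_eq_zero (Finset.mem_univ m) (by simp)

theorem constantCoeff_rootPoly {k : ℕ} (hk : k < N) :
    MvPolynomial.constantCoeff ((rootPoly N).coeff k) = 0 := by
  rw [← Polynomial.coeff_map, rootPoly, Polynomial.map_prod]
  simp [Polynomial.coeff_X_pow, hk.ne]

/-- Adding `N` dots of weight one on a facet of label one kills the evaluation. -/
theorem evalR_add_dots (H : ClosedFoam K) (x : Dot K) (hx : x.1.lab = 1) (d : Dots K) :
    evalR R N K (d + N • Finsupp.single x 1) = 0 := by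
  have hw : x.2.1 = 0 := by have := x.2.2; omega
  -- For each coloring the dot contributes the k-th power of one X_m, a root of `rootPoly`. The
  -- relation is summed with integral evaluations, so after taking constant terms only the leading
  -- coefficient is left.
  have key : ∑ k ∈ Finset.range (N + 1),
      (rootPoly N).coeff k * evalPoly N K (d + k • Finsupp.single x 1) = 0 := by
    apply toRat_injective
    rw [map_sum, map_zero]
    have h1 : ∀ k ∈ Finset.range (N + 1),
        toRat N ((rootPoly N).coeff k * evalPoly N K (d + k • Finsupp.single x 1)) =
        ∑ c ∈ colorings N K, weight c * toRat N (dotFactor d c) *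
          toRat N ((rootPoly N).coeff k * esymmOn (c x.1) (x.2 + 1) ^ k) := by
      intro k _
      rw [map_mul, toRat_evalPoly H, evalRat_eq, Finset.mul_sum]
      refine Finset.sum_congr rfl fun c _ => ?_
      have : dotFactor (d + k • Finsupp.single x 1) c =
          dotFactor d c * esymmOn (c x.1) (x.2 + 1) ^ k := by
        rw [← specialize_monomial, ← specialize_monomial, ← one_mul (1 : ℤ),
          ← MvPolynomial.monomial_mul, one_mul, map_mul, specialize_monomial, specialize_monomial]
        congr 1
        have e := Finsupp.prod_single_index (a := x) (b := k)
          (h := fun x k => esymmOn (c x.1) (x.2 + 1) ^ k) (pow_zero _)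
        rwa [dotFactor, Finsupp.smul_single, smul_eq_mul, mul_one]
      rw [term_eq, this, map_mul, map_mul]
      ring
    rw [Finset.sum_congr rfl h1, Finset.sum_comm]
    refine Finset.sum_eq_zero fun c hc => ?_
    have hcard := (mem_colorings.1 hc).card x.1
    rw [hx, Finset.card_eq_one] at hcard
    obtain ⟨m, hm⟩ := hcard
    rw [← Finset.mul_sum, ← map_sum, hm, hw, zero_add, esymmOn_singleton]
    have := rootPoly_eval m
    rw [Polynomial.eval_eq_sum_range, rootPoly_natDegree] at this
    rw [this, map_zero, mul_zero]
  rw [Finset.sum_range_succ] at key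
  have h2 : (rootPoly N).coeff N = 1 := by
    have := rootPoly_monic (N := N)
    rwa [Polynomial.Monic, Polynomial.leadingCoeff, rootPoly_natDegree] at this
  have h3 := congrArg MvPolynomial.constantCoeff key
  rw [map_add, map_sum, h2, one_mul, map_zero, Finset.sum_eq_zero, zero_add] at h3
  · rw [evalR_eq, h3, Int.cast_zero]
  · intro k hk
    rw [map_mul, constantCoeff_rootPoly (Finset.mem_range.1 hk), zero_mul]

end

end SlFoam

namespace SlFoam

noncomputable section

open scoped Classical

open MvPolynomial (monomial rename)

variable {N : ℕ} {R : Type*} [CommRing R] {Γ : MOYGraph N}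

/-! ## The operator `∇` and the pairing -/

/-- The pairing of a polynomial in the dots on `G` with linear combinations of dotted foams. -/
def pairLin (R : Type*) [CommRing R] (G : Foam Γ) :
    MvPolynomial (Dot G.tri) R →ₗ[R] FoamModule Γ R →ₗ[R] R :=
  (MvPolynomial.basisMonomials (Dot G.tri) R).constr R fun e => pairing R ⟨G, e⟩

theorem pairLin_monomial (G : Foam Γ) (e : Dots G.tri) :
    pairLin R G (monomial e 1) = pairing R ⟨G, e⟩ := by
  have h := (MvPolynomial.basisMonomials (Dot G.tri) R).constr_basis R
    (fun e => pairing (Γ := Γ) R ⟨G, e⟩) e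
  rwa [MvPolynomial.coe_basisMonomials] at h

theorem pairing_single (G F : DottedFoam Γ) (r : R) :
    pairing R G (Finsupp.single F r) = r * evalR R N (glue F.1 G.1) (glueDots F G) := by
  rw [pairing, Finsupp.linearCombination_single, smul_eq_mul]

theorem pairLin_ofDots (F G : Foam Γ) (P : MvPolynomial (Dot F.tri) R)
    (Q : MvPolynomial (Dot G.tri) R) : pairLin R G Q (ofDots R F P) =
      evalFormR R N (glue F G) (rename (dotLeft F G) P * rename (dotRight F G) Q) := by
  induction P using MvPolynomial.induction_on' with
  | add p q hp hq => simp only [map_add, hp, hq, add_mul]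
  | monomial d r =>
    induction Q using MvPolynomial.induction_on' with
    | add p q hp hq => simp only [map_add, LinearMap.add_apply, hp, hq, mul_add]
    | monomial e s =>
      rw [monomial_eq_smul d, monomial_eq_smul e, map_smul, map_smul, LinearMap.smul_apply,
        map_smul, map_smul, map_smul, smul_mul_assoc, mul_smul_comm, map_smul, map_smul,
        pairLin_monomial, ofDots_monomial, MvPolynomial.rename_monomial,
        MvPolynomial.rename_monomial, MvPolynomial.monomial_mul, one_mul, evalFormR_monomial,
        pairing_single, one_mul, smul_comm]
      rfl

theorem nablaDots_rename {K L : Finset Tri} (g : Dot K → Dot L)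
    (h : ∀ x, nablaDots L R (MvPolynomial.X (g x)) = rename g (nablaDots K R (MvPolynomial.X x)))
    (P : MvPolynomial (Dot K) R) :
    nablaDots L R (rename g P) = rename g (nablaDots K R P) := by
  induction P using MvPolynomial.induction_on with
  | C r => simp [← MvPolynomial.algebraMap_eq]
  | add p q hp hq => simp only [map_add, hp, hq]
  | mul_X p x hp =>
    simp only [Derivation.leibniz, map_add, map_mul, smul_eq_mul, hp, h, MvPolynomial.rename_X]

theorem nablaDots_dotLeft (F G : Foam Γ) (P : MvPolynomial (Dot F.tri) R) :
    nablaDots (glue F G) R (rename (dotLeft F G) P) =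
      rename (dotLeft F G) (nablaDots F.tri R P) := by
  refine nablaDots_rename _ (fun x => ?_) P
  rw [nablaDots, nablaDots, MvPolynomial.mkDerivation_X, MvPolynomial.mkDerivation_X]
  have h1 : (dotLeft F G x).1.lab = x.1.lab := inclLeft_lab F G x.1
  have h2 : (dotLeft F G x).2.1 = x.2.1 := rfl
  simp only [h1, h2]
  split_ifs with h0
  · rw [map_natCast]
  · rw [map_mul, map_natCast, MvPolynomial.rename_X]
    rfl

theorem nablaDots_dotRight (F G : Foam Γ) (P : MvPolynomial (Dot G.tri) R) :
    nablaDots (glue F G) R (rename (dotRight F G) P) =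
      rename (dotRight F G) (nablaDots G.tri R P) := by
  refine nablaDots_rename _ (fun x => ?_) P
  rw [nablaDots, nablaDots, MvPolynomial.mkDerivation_X, MvPolynomial.mkDerivation_X]
  have h1 : (dotRight F G x).1.lab = x.1.lab := inclRight_lab F G x.1
  have h2 : (dotRight F G x).2.1 = x.2.1 := rfl
  simp only [h1, h2]
  split_ifs with h0
  · rw [map_natCast]
  · rw [map_mul, map_natCast, MvPolynomial.rename_X]
    rfl

/-- Up to a sign, `∇` is adjoint to itself. -/
theorem pairLin_nabla (hR : ringChar R ∣ N) (G : Foam Γ) (Q : MvPolynomial (Dot G.tri) R)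
    (u : FoamModule Γ R) :
    pairLin R G Q (nabla Γ R u) = -pairLin R G (nablaDots G.tri R Q) u := by
  induction u using Finsupp.induction_linear with
  | zero => simp
  | add u v hu hv => rw [map_add, map_add, map_add, hu, hv, neg_add]
  | single F r =>
    obtain ⟨F, d⟩ := F
    have e : (Finsupp.single ⟨F, d⟩ r : FoamModule Γ R) = ofDots R F (monomial d r) := by
      rw [monomial_eq_smul, map_smul, ofDots_monomial, Finsupp.smul_single, smul_eq_mul, mul_one]
    -- The sum of the two sides is the evaluation of ∇ of the product of the dots on both halves,
    -- and this is zero by `evalFormR_nablaDots`.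
    rw [e, nabla_ofDots, pairLin_ofDots, pairLin_ofDots, eq_neg_iff_add_eq_zero, ← map_add,
      ← nablaDots_dotLeft, ← nablaDots_dotRight,
      ← evalFormR_nablaDots (glue_closedFoam F G) hR
        (rename (dotLeft F G) (monomial d r) * rename (dotRight F G) Q),
      Derivation.leibniz, smul_eq_mul, smul_eq_mul, add_comm,
      mul_comm _ (nablaDots _ R (rename (dotLeft F G) _))]

theorem mem_pairingKer {u : FoamModule Γ R} :
    u ∈ pairingKer Γ R ↔ ∀ G : DottedFoam Γ, pairing R G u = 0 := by
  simp only [pairingKer, Submodule.mem_iInf, LinearMap.mem_ker]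

theorem pairLin_eq_zero {u : FoamModule Γ R} (hu : u ∈ pairingKer Γ R) (G : Foam Γ)
    (Q : MvPolynomial (Dot G.tri) R) : pairLin R G Q u = 0 := by
  induction Q using MvPolynomial.induction_on' with
  | add p q hp hq => rw [map_add, LinearMap.add_apply, hp, hq, add_zero]
  | monomial d r =>
    rw [monomial_eq_smul, map_smul, LinearMap.smul_apply, pairLin_monomial, mem_pairingKer.1 hu,
      smul_zero]

theorem nabla_ker (hR : ringChar R ∣ N) :
    pairingKer Γ R ≤ (pairingKer Γ R).comap (nabla Γ R) := by
  intro u hu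
  rw [Submodule.mem_comap, mem_pairingKer]
  rintro ⟨G, e⟩
  rw [← pairLin_monomial, pairLin_nabla hR, pairLin_eq_zero hu, neg_zero]

/-- The operator `∇` on `F_N(Γ; R)`. -/
def nablaOp (Γ : MOYGraph N) (hR : ringChar R ∣ N) : Module.End R (StateSpace Γ R) :=
  (pairingKer Γ R).mapQ (pairingKer Γ R) (nabla Γ R) (nabla_ker hR)

/-! ## Relations between the operators -/

theorem addDotLin_ofDots (p : Basepoint Γ) (w : Fin p.lab) (F : Foam Γ)
    (P : MvPolynomial (Dot F.tri) R) :
    addDotLin R p w (ofDots R F P) = ofDots R F (MvPolynomial.X (dotAt F p w) * P) := by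
  induction P using MvPolynomial.induction_on' with
  | add p q hp hq => simp only [map_add, hp, hq, mul_add]
  | monomial d r =>
    rw [monomial_eq_smul, map_smul, map_smul, mul_smul_comm, map_smul, ofDots_monomial,
      MvPolynomial.X, MvPolynomial.monomial_mul, one_mul, ofDots_monomial, addDotLin,
      Finsupp.lmapDomain_apply, Finsupp.mapDomain_single, addDot, add_comm]

/-- The Leibniz rule, with ∇e₁ equal to the label of the facet, which is 1. -/
theorem nabla_addDotLin (p : Basepoint Γ) (hp : p.lab = 1) (u : FoamModule Γ R) :
    nabla Γ R (addDotLin R p ⟨0, by omega⟩ u) = addDotLin R p ⟨0, by omega⟩ (nabla Γ R u) + u := by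
  induction u using Finsupp.induction_linear with
  | zero => simp
  | add u v hu hv => rw [map_add, map_add, map_add, map_add, hu, hv]; abel
  | single F r =>
    obtain ⟨F, d⟩ := F
    have e : (Finsupp.single ⟨F, d⟩ r : FoamModule Γ R) = ofDots R F (monomial d r) := by
      rw [monomial_eq_smul, map_smul, ofDots_monomial, Finsupp.smul_single, smul_eq_mul, mul_one]
    have h1 : nablaDots F.tri R (MvPolynomial.X (dotAt F p ⟨0, by omega⟩)) = 1 := by
      rw [nablaDots, MvPolynomial.mkDerivation_X]
      change (if (0 : ℕ) = 0 then (((F.facetAt p).lab : ℕ) : MvPolynomial (Dot F.tri) R) else _) = 1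
      rw [if_pos rfl, F.facetAt_lab, hp, Nat.cast_one]
    rw [e, addDotLin_ofDots, nabla_ofDots, nabla_ofDots, addDotLin_ofDots, ← map_add,
      Derivation.leibniz, h1, smul_eq_mul, smul_eq_mul, mul_one]

theorem addDotLin_comm (p q : Basepoint Γ) (w : Fin p.lab) (w' : Fin q.lab) (u : FoamModule Γ R) :
    addDotLin R p w (addDotLin R q w' u) = addDotLin R q w' (addDotLin R p w u) := by
  rw [addDotLin, addDotLin, Finsupp.lmapDomain_apply, Finsupp.lmapDomain_apply,
    Finsupp.lmapDomain_apply, Finsupp.lmapDomain_apply, ← Finsupp.mapDomain_comp,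
    ← Finsupp.mapDomain_comp]
  congr 1
  funext F
  exact congrArg (Sigma.mk F.1) (add_right_comm _ _ _)

theorem addDotLin_pow (p : Basepoint Γ) (w : Fin p.lab) (n : ℕ) (F : DottedFoam Γ) (r : R) :
    (addDotLin R p w ^ n) (Finsupp.single F r) =
      Finsupp.single ⟨F.1, F.2 + n • Finsupp.single (dotAt F.1 p w) 1⟩ r := by
  induction n with
  | zero => rw [pow_zero, zero_smul, add_zero]; rfl
  | succ n ih =>
    rw [pow_succ', Module.End.mul_apply, ih, addDotLin, Finsupp.lmapDomain_apply,
      Finsupp.mapDomain_single, addDot, succ_nsmul, add_assoc]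

theorem addDotLin_pow_mem (p : Basepoint Γ) (hp : p.lab = 1) (u : FoamModule Γ R) :
    (addDotLin R p ⟨0, by omega⟩ ^ N) u ∈ pairingKer Γ R := by
  rw [mem_pairingKer]
  intro G
  induction u using Finsupp.induction_linear with
  | zero => simp
  | add u v hu hv => rw [map_add, map_add, hu, hv, add_zero]
  | single F r =>
    have h1 : (dotLeft F.1 G.1 (dotAt F.1 p ⟨0, by omega⟩)).1.lab = 1 :=
      ((inclLeft_lab _ _ _).trans (F.1.facetAt_lab p)).trans hp
    have h2 := evalR_add_dots (N := N) (R := R) (glue_closedFoam F.1 G.1) _ h1 (glueDots F G)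
    rw [addDotLin_pow, pairing_single]
    have h3 : glueDots ⟨F.1, F.2 + N • Finsupp.single (dotAt F.1 p ⟨0, by omega⟩) 1⟩ G =
        glueDots F G + N • Finsupp.single (dotLeft F.1 G.1 (dotAt F.1 p ⟨0, by omega⟩)) 1 := by
      simp only [glueDots, Finsupp.mapDomain_add, Finsupp.mapDomain_smul, Finsupp.mapDomain_single]
      exact add_right_comm _ _ _
    rw [h3, h2, mul_zero]

theorem weightOneOp_mk (p : Basepoint Γ) (hp : p.lab = 1) (u : FoamModule Γ R) :
    weightOneOp R p hp (Submodule.Quotient.mk u) =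
      Submodule.Quotient.mk (addDotLin R p ⟨0, by omega⟩ u) := rfl

theorem nablaOp_mk (hR : ringChar R ∣ N) (u : FoamModule Γ R) :
    nablaOp Γ hR (Submodule.Quotient.mk u) = Submodule.Quotient.mk (nabla Γ R u) := rfl

theorem weightOneOp_comm (p q : Basepoint Γ) (hp : p.lab = 1) (hq : q.lab = 1) :
    Commute (weightOneOp R p hp) (weightOneOp R q hq) := by
  refine LinearMap.ext fun u => ?_
  induction u using Submodule.Quotient.induction_on with
  | H u => rw [Module.End.mul_apply, Module.End.mul_apply, weightOneOp_mk, weightOneOp_mk,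
      weightOneOp_mk, weightOneOp_mk, addDotLin_comm]

theorem nablaOp_mul_weightOneOp (hR : ringChar R ∣ N) (p : Basepoint Γ) (hp : p.lab = 1) :
    nablaOp Γ hR * weightOneOp R p hp = weightOneOp R p hp * nablaOp Γ hR + 1 := by
  refine LinearMap.ext fun u => ?_
  induction u using Submodule.Quotient.induction_on with
  | H u => rw [LinearMap.add_apply, Module.End.mul_apply, Module.End.mul_apply, weightOneOp_mk,
      nablaOp_mk, nablaOp_mk, weightOneOp_mk, nabla_addDotLin p hp]; rfl

theorem weightOneOp_pow (p : Basepoint Γ) (hp : p.lab = 1) : weightOneOp R p hp ^ N = 0 := by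
  refine LinearMap.ext fun u => ?_
  induction u using Submodule.Quotient.induction_on with
  | H u =>
    have h : ∀ n, (weightOneOp R p hp ^ n) (Submodule.Quotient.mk u) =
        Submodule.Quotient.mk ((addDotLin R p ⟨0, by omega⟩ ^ n) u) := by
      intro n
      induction n with
      | zero => rfl
      | succ n ih => rw [pow_succ', pow_succ', Module.End.mul_apply, ih]; rfl
    rw [h, LinearMap.zero_apply, Submodule.Quotient.mk_eq_zero]
    exact addDotLin_pow_mem p hp u

/-! ### Consequences of the canonical commutation relation -/

variable {A : Type*} [Ring A] {D X Y Z : A}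

theorem pow_mul_of_commutator (h : D * X = X * D + 1) (n : ℕ) :
    D ^ (n + 1) * X = X * D ^ (n + 1) + (n + 1 : ℕ) * D ^ n := by
  induction n with
  | zero => simp [h]
  | succ n ih =>
    rw [pow_succ' D (n + 1), mul_assoc, ih, mul_add, ← mul_assoc, h, add_mul, one_mul,
      mul_assoc X, ← pow_succ', ← mul_assoc D, ← (Nat.cast_commute (n + 1) D).eq, mul_assoc _ D,
      ← pow_succ', Nat.cast_succ (n + 1), add_mul _ _ (D ^ (n + 1)), one_mul]
    abel

/-- The commutators of D^(n+1) with Y and with Z are the same multiple of D^n. On the image of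
Y^(n+1) the commutator with Y equals -Y D^(n+1), because Y^(n+2) = 0, and it can be substituted in
the identity for Z. -/
theorem intertwine (hY : D * Y = Y * D + 1) (hZ : D * Z = Z * D + 1) (hXY : Commute X Y)
    (hXZ : Commute X Z) (n : ℕ) (hYn : Y ^ (n + 2) = 0) :
    X ^ (n + 1) * D ^ (n + 1) * Z * Y ^ (n + 1) =
      (Z - Y) * (X ^ (n + 1) * D ^ (n + 1)) * Y ^ (n + 1) := by
  have h1 : Y * D ^ (n + 1) * Y ^ (n + 1) = -((n + 1 : ℕ) * D ^ n * Y ^ (n + 1)) := by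
    have := congrArg (· * Y ^ (n + 1)) (pow_mul_of_commutator hY n)
    simp only [add_mul (Y * D ^ (n + 1))] at this
    rw [mul_assoc _ Y, ← pow_succ', hYn, mul_zero] at this
    exact eq_neg_of_add_eq_zero_left this.symm
  have h2 : (Z - Y) * X ^ (n + 1) = X ^ (n + 1) * (Z - Y) :=
    ((hXZ.sub_right hXY).pow_left (n + 1)).eq.symm
  rw [mul_assoc (X ^ (n + 1)), pow_mul_of_commutator hZ, ← mul_assoc, h2, mul_assoc _ _ (Y ^ _),
    mul_assoc _ _ (Y ^ _), mul_assoc (X ^ _), add_mul, sub_mul,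
    ← mul_assoc Y, ← mul_assoc Z, h1, sub_neg_eq_add]

end

end SlFoam

/-! ### The intertwining relation on the state space -/

theorem lemma4p1 (N : ℕ) (hN : 2 ≤ N) (R : Type*) [CommRing R] (hR : ringChar R ∣ N)
    (Γ : SlFoam.MOYGraph N) (x y z : SlFoam.Basepoint Γ)
    (hx : x.lab = 1) (hy : y.lab = 1) (hz : z.lab = 1) :
    -- the operator `∇` descends to an operator `D` on `F_N(Γ; R)`, for which the following holds
    ∃ D : Module.End R (SlFoam.StateSpace Γ R),
      (∀ u : SlFoam.FoamModule Γ R,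
        D (Submodule.Quotient.mk u) = Submodule.Quotient.mk (SlFoam.nabla Γ R u)) ∧
      ∀ X Y Z : Module.End R (SlFoam.StateSpace Γ R),
        X = SlFoam.weightOneOp R x hx → Y = SlFoam.weightOneOp R y hy →
        Z = SlFoam.weightOneOp R z hz →
        -- the two submodules are preserved by the respective operators
        (∀ u ∈ LinearMap.range (Y ^ (N - 1)), Z u ∈ LinearMap.range (Y ^ (N - 1))) ∧
        (∀ u ∈ LinearMap.range (X ^ (N - 1)), (Z - Y) u ∈ LinearMap.range (X ^ (N - 1))) ∧
        (∀ u ∈ LinearMap.range (Y ^ (N - 1)),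
          (X ^ (N - 1) * D ^ (N - 1)) u ∈ LinearMap.range (X ^ (N - 1))) ∧
        -- and the map intertwines `Z` with `Z - Y`
        (∀ u ∈ LinearMap.range (Y ^ (N - 1)),
          (X ^ (N - 1) * D ^ (N - 1)) (Z u) = (Z - Y) ((X ^ (N - 1) * D ^ (N - 1)) u)) ∧
        -- in particular `X` with `-Y`
        (∀ u ∈ LinearMap.range (Y ^ (N - 1)),
          (X ^ (N - 1) * D ^ (N - 1)) (X u) = (-Y) ((X ^ (N - 1) * D ^ (N - 1)) u)) := by
  refine ⟨SlFoam.nablaOp Γ hR, fun u => rfl, ?_⟩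
  -- Then N - 1 = n + 1 and N - 2 = n, the exponents of D in the commutator formula, occur without
  -- subtraction.
  obtain ⟨n, rfl⟩ : ∃ n, N = n + 2 := ⟨N - 2, by omega⟩
  rw [show n + 2 - 1 = n + 1 from rfl]
  rintro X Y Z rfl rfl rfl
  have hXY := SlFoam.weightOneOp_comm (R := R) x y hx hy
  have hXZ := SlFoam.weightOneOp_comm (R := R) x z hx hz
  have hYZ := SlFoam.weightOneOp_comm (R := R) y z hy hz
  have hDX := SlFoam.nablaOp_mul_weightOneOp hR x hx
  have hDY := SlFoam.nablaOp_mul_weightOneOp hR y hy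
  have hDZ := SlFoam.nablaOp_mul_weightOneOp hR z hz
  have hXN := SlFoam.weightOneOp_pow (R := R) x hx
  have hYN := SlFoam.weightOneOp_pow (R := R) y hy
  generalize SlFoam.weightOneOp R x hx = X at *
  generalize SlFoam.weightOneOp R y hy = Y at *
  generalize SlFoam.weightOneOp R z hz = Z at *
  generalize SlFoam.nablaOp Γ hR = D at *
  have pres : ∀ A B : Module.End R (SlFoam.StateSpace Γ R), Commute A B →
      ∀ u ∈ LinearMap.range (A ^ (n + 1)), B u ∈ LinearMap.range (A ^ (n + 1)) := by
    rintro A B hAB _ ⟨v, rfl⟩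
    exact ⟨B v, by rw [← Module.End.mul_apply, (hAB.pow_left _).eq, Module.End.mul_apply]⟩
  refine ⟨pres Y Z hYZ, pres X (Z - Y) (hXZ.sub_right hXY), ?_, ?_, ?_⟩
  · intro u _
    exact ⟨(D ^ (n + 1)) u, rfl⟩
  · rintro _ ⟨v, rfl⟩
    exact LinearMap.congr_fun (SlFoam.intertwine hDY hDZ hXY hXZ n hYN) v
  · rintro _ ⟨v, rfl⟩
    have h := SlFoam.intertwine hDY hDX hXY (Commute.refl X) n hYN
    have h2 : ∀ w, (X ^ (n + 1) * D ^ (n + 1)) (X ((Y ^ (n + 1)) w)) =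
        (X - Y) ((X ^ (n + 1) * D ^ (n + 1)) ((Y ^ (n + 1)) w)) := LinearMap.congr_fun h
    -- In the case Z = X one more factor X completes X^(N-1) to X^N = 0, so only -Y is left of X -
    -- Y.
    have h3 : ∀ w, X ((X ^ (n + 1)) w) = 0 := fun w => by
      rw [← Module.End.mul_apply, ← pow_succ', hXN, LinearMap.zero_apply]
    rw [h2, LinearMap.sub_apply, LinearMap.neg_apply, Module.End.mul_apply (X ^ (n + 1)), h3,
      zero_sub]
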